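/- Let $K/\mathbb{Q}_p$ be a finite extension with ring of integers $\mathcal{O}_K$, residue field $k$, surjective valuation $v\colon K^\times\to\mathbb{Z}$, uniformizer $\varpi$ and ramification degree $e=v(p)$. Let $\lambda\in k^\times$ be the image of $p/\varpi^e$. Let $G$ be an almost-simple, simply connected algebraic group over $K$ with a split maximal torus $T$, root system $\Phi\subset X^*(T)$, and a set $\Phi^+$ of positive roots (i.e. a Borel subgroup $B\supset T$). Let $\mathrm{ht}$ be the height function and $h=\mathrm{ht}(\alpha_{\max})+1$ the Coxeter number. Fix a Chevalley system: root vectors $X_\alpha$ ($\alpha\in\Phi$) which, with $H_\alpha=d\alpha^\vee(1)$, give a Chevalley basis $\{H_\alpha:\alpha\text{ simple}\}\cup\{X_\alpha:\alpha\in\Phi\}$ of $\mathrm{Lie}(G)$, and root homomorphisms $u_\alpha\colon\mathbb{G}_a\to G$ with $du_\alpha(1)=X_\alpha$. Let $T(K)_0$ be the maximal compact subgroup of $T(K)$, and for an integer $n\ge1$ let $T(K)_{n/h}=\{t\in T(K)_0: v(\chi(t)-1)\ge n/h\ \ \forall\chi\in X^*(T)\}$. For $n\ge 0$ let $G_{x,n/h}$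 be the subgroup of $G(K)$ generated by $T(K)_{n/h}$ and all $u_\alpha(c)$ with $\alpha\in\Phi$, $c\in K$, $v(c)+\mathrm{ht}(\alpha)/h\ge n/h$. (This is the Moy–Prasad filtration at the barycenter $x$ of the dominant base alcove.) Let $I=G_{x,0}$ be the Iwahori subgroup and $I_1=G_{x,1/h}$ the pro-$p$ Iwahori subgroup. For $z\in I_1\setminus\{1\}$ let $\omega(z)$ be the largest $t\in(he)^{-1}\mathbb{Z}$ such that $z\in G_{x,et}$, and put $\omega(1)=\infty$. Let $\mathfrak{g}=\mathfrak{n}^-\oplus\mathfrak{t}\oplus\mathfrak{n}$ be the $k$-Lie algebra obtained by reduction from the $\mathbb{Z}$-form of $\mathrm{Lie}(G)$ spanned by the Chevalley basis, and let $$\tilde{\mathfrak g}_e=v\,\mathfrak n^-[v]\oplus v\,\mathfrak t[v]\oplus\mathfrak n[v]\subset\mathfrak g[v]=\mathfrak g\otimes_k k[v]$$ be the preimage of $\mathfrak n$ under $v\mapsto0$, graded by $\deg(X_\alpha\otimes v^i)=\mathrm{ht}(\alpha)/(he)+i/e$ and $\deg(H\otimes v^i)=i/e$ for $H\in\mathfrak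 t$. View it as a $k[\epsilon]$-Lie algebra with $\epsilon$ acting as multiplication by $\lambda v^e$. The group $T(k)$ acts on it by the adjoint action on $\mathfrak g$ and trivially on $k[v]$. **Theorem.** Assume $he<p-1$. Then: 1. $\omega$ is well defined and is a saturated $p$-valuation on $I_1$; it is $I$-invariant, i.e. $gI_1g^{-1}\subseteq I_1$ and $\omega(gzg^{-1})=\omega(z)$ for $g\in I$, $z\in I_1$. 2. The associated graded Lie ring $\mathrm{gr}(I_1)=\bigoplus_i \mathrm{Fil}^i/\mathrm{Fil}^{i+}$, where $\mathrm{Fil}^i=\{\omega\ge i\}$ and $\mathrm{Fil}^{i+}=\{\omega>i\}$, with bracket induced by the commutator $xyx^{-1}y^{-1}$, is naturally a $k[\epsilon]$-Lie algebra. Namely, writing $\mathrm{symb}(z)$ for the class of $z$ in $\mathrm{gr}_{\omega(z)}$, it has a $k[\epsilon]$-Lie algebra structure with $\epsilon\cdot\mathrm{symb}(z)=\mathrm{symb}(z^p)$ for all $z \in I_1$ and, for all $\alpha\in\Phi$ and $a\in\mathcal O_K^\times$ with image $\bar a\in k$, $\bar a\cdot\mathrm{symb}(u_\alpha(c))=\mathrm{symb}(u_\alpha(ac))$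 if $u_\alpha(c)\in I_1$, and $\bar a\cdot\mathrm{symb}(\alpha^\vee(1+c))=\mathrm{symb}(\alpha^\vee(1+ac))$ if $c\in\varpi\mathcal O_K$. 3. For this structure there is an isomorphism $\mathrm{gr}(I_1)\cong\tilde{\mathfrak g}_e$ of graded $k[\epsilon]$-Lie algebras. It intertwines the action of $T(k)\subset I$ on $\mathrm{gr}(I_1)$ by conjugation with the action of $T(k)$ on $\tilde{\mathfrak g}_e$; more precisely, conjugation by $t\in T(K)_0=T(\mathcal O_K)$ on $\mathrm{gr}(I_1)$ corresponds to the action of the reduction $\bar t\in T(k)$. -/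

import Mathlib

section LocalField

variable (p : ℕ) [Fact p.Prime] (K : Type*) [Field K] [Algebra ℚ_[p] K]
  [FiniteDimensional ℚ_[p] K] [Algebra ℤ_[p] K] [IsScalarTower ℤ_[p] ℚ_[p] K]

/-- The ring of integers of a finite extension `K` of `ℚ_p`. -/
abbrev RingInt : Type _ := integralClosure ℤ_[p] K

lemma spectralNorm_le_one_iff_mem (x : K) :
    spectralNorm ℚ_[p] K x ≤ 1 ↔ x ∈ integralClosure ℤ_[p] K := by
  have hx : IsIntegral ℚ_[p] x := Algebra.IsIntegral.isIntegral x
  rw [spectralNorm, spectralValue_le_one_iff (minpoly.monic hx), mem_integralClosure_iff]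
  constructor
  · intro h
    have hl : minpoly ℚ_[p] x ∈ Polynomial.lifts (algebraMap ℤ_[p] ℚ_[p]) := by
      rw [Polynomial.lifts_iff_coeff_lifts]
      exact fun n => ⟨⟨_, h n⟩, rfl⟩
    obtain ⟨q, hq, -, hqm⟩ := Polynomial.lifts_and_natDegree_eq_and_monic hl (minpoly.monic hx)
    refine ⟨q, hqm, ?_⟩
    have := minpoly.aeval ℚ_[p] x
    rw [← hq, Polynomial.aeval_map_algebraMap] at this
    exact this
  · intro h n
    rw [minpoly.isIntegrallyClosed_eq_field_fractions' ℚ_[p] h, Polynomial.coeff_map]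
    exact (((minpoly ℤ_[p] x).coeff n)).2

instance ringInt_isLocalRing : IsLocalRing (RingInt p K) := by
  have hinv : ∀ x : RingInt p K, ¬ spectralNorm ℚ_[p] K (x : K) < 1 → IsUnit x := by
    intro x hx
    have h1 : spectralNorm ℚ_[p] K (x : K) = 1 :=
      le_antisymm ((spectralNorm_le_one_iff_mem p K x).2 x.2) (not_lt.1 hx)
    have h0 : (x : K) ≠ 0 := by
      intro h; rw [h, spectralNorm_zero] at h1; exact zero_ne_one h1
    have h2 : spectralNorm ℚ_[p] K (x : K)⁻¹ = 1 := by
      have := map_mul (spectralMulAlgNorm ℚ_[p] K) (x : K) (x : K)⁻¹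
      rw [mul_inv_cancel₀ h0, map_one, spectralMulAlgNorm_def, spectralMulAlgNorm_def, h1,
        one_mul] at this
      exact this.symm
    refine IsUnit.of_mul_eq_one
      (⟨(x : K)⁻¹, (spectralNorm_le_one_iff_mem p K _).1 h2.le⟩ : RingInt p K) ?_
    exact Subtype.ext (mul_inv_cancel₀ h0)
  refine IsLocalRing.of_isUnit_or_isUnit_one_sub_self fun a => ?_
  by_contra! h
  have ha := not_not.1 (mt (hinv a) h.1)
  have hb := not_not.1 (mt (hinv (1 - a)) h.2)
  have := isNonarchimedean_spectralNorm (K := ℚ_[p]) (L := K) (a : K) ((1 - a : RingInt p K) : K)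
  have e : (a : K) + ((1 - a : RingInt p K) : K) = 1 := by push_cast; ring
  rw [e, spectralNorm_one] at this
  exact absurd this (not_le.2 (max_lt ha hb))

instance ringInt_isFractionRing : IsFractionRing (RingInt p K) K :=
  integralClosure.isFractionRing_of_finite_extension ℚ_[p] K

instance ringInt_isDedekindDomain : IsDedekindDomain (RingInt p K) :=
  IsIntegralClosure.isDedekindDomain ℤ_[p] ℚ_[p] K (RingInt p K)

lemma ringInt_not_isField : ¬ IsField (RingInt p K) := by
  intro h
  have hp : (p : RingInt p K) ≠ 0 := by
    intro h0
    have h1 : ((p : RingInt p K) : K) = 0 := by rw [h0]; rfl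
    have h2 : algebraMap ℚ_[p] K (p : ℚ_[p]) = 0 := by simpa using h1
    rw [map_eq_zero] at h2
    exact (Fact.out : p.Prime).ne_zero (by exact_mod_cast h2)
  obtain ⟨b, hb⟩ := h.mul_inv_cancel hp
  have h1 : spectralNorm ℚ_[p] K ((p : RingInt p K) : K) < 1 := by
    have : ((p : RingInt p K) : K) = algebraMap ℚ_[p] K (p : ℚ_[p]) := by simp
    rw [this, spectralNorm_extends]
    exact Padic.norm_p_lt_one
  have h2 := (spectralNorm_le_one_iff_mem p K b).2 b.2
  have h3 := map_mul (spectralMulAlgNorm ℚ_[p] K) ((p : RingInt p K) : K) (b : K)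
  have e : ((p : RingInt p K) : K) * (b : K) = 1 := congrArg Subtype.val hb
  rw [e, map_one, spectralMulAlgNorm_def, spectralMulAlgNorm_def] at h3
  have := mul_lt_one_of_nonneg_of_lt_one_left (spectralNorm_nonneg _) h1 h2
  exact absurd h3.symm this.ne

instance ringInt_isDiscreteValuationRing : IsDiscreteValuationRing (RingInt p K) :=
  ((IsDiscreteValuationRing.TFAE (RingInt p K) (ringInt_not_isField p K)).out 0 2).2
    (ringInt_isDedekindDomain p K)

/-- The residue field `k` of `K`. -/
abbrev ResK : Type _ := IsLocalRing.ResidueField (RingInt p K)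

open Classical in
/-- The surjective valuation `v : K → ℤ ∪ {∞}`. -/
noncomputable def valK (c : K) : WithTop ℤ :=
  if c = 0 then ⊤ else
    ((-(WithZero.log
      ((IsDiscreteValuationRing.maximalIdeal (RingInt p K)).valuation K c)) : ℤ) : WithTop ℤ)

/-- The ramification degree `e = v(p)` of `K / ℚ_p`. -/
noncomputable def ramDeg : ℕ := (valK p K (p : K)).untopD 0 |>.toNat

end LocalField
open scoped DirectSum

/-- The commutator `x y x⁻¹ y⁻¹` in a group. -/
def gcomm {Γ : Type*} [Group Γ] (x y : Γ) : Γ := x * y * x⁻¹ * y⁻¹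

/-- A `p`-filtration `ω : Γ → (0, ∞]` on a group `Γ`, with `ω x = ∞` only for `x = 1`. -/
structure PFiltration (p : ℕ) (Γ : Type*) [Group Γ] where
  toFun : Γ → WithTop ℝ
  pos : ∀ x, 0 < toFun x
  eq_top_iff : ∀ x, toFun x = ⊤ ↔ x = 1
  le_div : ∀ x y, min (toFun x) (toFun y) ≤ toFun (x * y⁻¹)
  le_comm : ∀ x y, toFun x + toFun y ≤ toFun (gcomm x y)
  le_pow : ∀ x, min (p • toFun x) (toFun x + 1) ≤ toFun (x ^ p)


lemma gcomm_inv {Γ : Type*} [Group Γ] (x y : Γ) : (gcomm x y)⁻¹ = gcomm y x := by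
  unfold gcomm; group

namespace PFiltration

variable {p : ℕ} {Γ : Type*} [Group Γ] (F : PFiltration p Γ)

/-- A `p`-valuation: a `p`-filtration with `ω x > 1 / (p - 1)` and `ω (x ^ p) = ω x + 1`. -/
def IsPValuation : Prop :=
  ∀ x : Γ, x ≠ 1 → ((1 / ((p : ℝ) - 1) : ℝ) : WithTop ℝ) < F.toFun x ∧
    F.toFun (x ^ p) = F.toFun x + 1

/-- The group is complete in the topology of the filtration (it is always separated, by
`eq_top_iff`): Cauchy sequences converge. -/
def IsComplete : Prop :=
  ∀ s : ℕ → Γ,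
    (∀ c : ℝ, ∃ N, ∀ m ≥ N, ∀ n ≥ N, (c : WithTop ℝ) ≤ F.toFun ((s m)⁻¹ * s n)) →
    ∃ y, ∀ c : ℝ, ∃ N, ∀ n ≥ N, (c : WithTop ℝ) ≤ F.toFun (y⁻¹ * s n)

/-- Saturation: complete, and every `x` with `ω x > p / (p - 1)` is a `p`-th power. -/
def IsSaturated : Prop :=
  F.IsComplete ∧
    ∀ x : Γ, (((p : ℝ) / ((p : ℝ) - 1) : ℝ) : WithTop ℝ) < F.toFun x → ∃ y, y ^ p = x

lemma map_one : F.toFun 1 = ⊤ := (F.eq_top_iff 1).2 rfl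

lemma le_one (c : ℝ) : (c : WithTop ℝ) ≤ F.toFun 1 := by simp [F.map_one]

lemma map_inv_ge (x : Γ) : F.toFun x ≤ F.toFun x⁻¹ := by
  simpa [F.map_one] using F.le_div 1 x

lemma map_inv (x : Γ) : F.toFun x⁻¹ = F.toFun x :=
  le_antisymm (by simpa using F.map_inv_ge x⁻¹) (F.map_inv_ge x)

lemma le_mul (x y : Γ) : min (F.toFun x) (F.toFun y) ≤ F.toFun (x * y) := by
  simpa [F.map_inv] using F.le_div x y⁻¹

lemma le_conj (g x : Γ) : F.toFun x ≤ F.toFun (g * x * g⁻¹) := by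
  have h1 : g * x * g⁻¹ = (gcomm g x) * x := by rw [gcomm]; group
  rw [h1]
  refine le_trans (le_min (le_trans ?_ (F.le_comm g x)) le_rfl) (F.le_mul _ _)
  exact le_add_of_nonneg_left (F.pos g).le

/-- `Fil^i = {x | ω x ≥ i}`. -/
def fil (i : ℝ) : Subgroup Γ where
  carrier := {x | (i : WithTop ℝ) ≤ F.toFun x}
  mul_mem' ha hb := le_trans (le_min ha hb) (F.le_mul _ _)
  one_mem' := by simp [F.map_one]
  inv_mem' h := by simpa [F.map_inv] using h

/-- `Fil^{i+} = {x | ω x > i}`. -/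
def filPlus (i : ℝ) : Subgroup Γ where
  carrier := {x | (i : WithTop ℝ) < F.toFun x}
  mul_mem' ha hb := lt_of_lt_of_le (lt_min ha hb) (F.le_mul _ _)
  one_mem' := by simp [F.map_one]
  inv_mem' h := by simpa [F.map_inv] using h

instance filPlus_normal (i : ℝ) : (F.filPlus i).Normal :=
  ⟨fun x hx g => lt_of_lt_of_le hx (F.le_conj g x)⟩

/-- The graded piece `gr_i = Fil^i / Fil^{i+}`, written additively. -/
def GrPiece (i : ℝ) : Type _ :=
  Additive (F.fil i ⧸ (F.filPlus i).subgroupOf (F.fil i))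

/-- The class in `gr_i` of an element of `Fil^i`. -/
def cl (i : ℝ) (x : Γ) (hx : (i : WithTop ℝ) ≤ F.toFun x) : F.GrPiece i :=
  Additive.ofMul (QuotientGroup.mk (⟨x, hx⟩ : F.fil i))

lemma cl_surj {i : ℝ} (a : F.GrPiece i) : ∃ x hx, F.cl i x hx = a := by
  obtain ⟨⟨x, hx⟩, rfl⟩ := QuotientGroup.mk_surjective a.toMul
  exact ⟨x, hx, rfl⟩

lemma cl_eq_iff {i : ℝ} {x y : Γ} {hx : (i : WithTop ℝ) ≤ F.toFun x}
    {hy : (i : WithTop ℝ) ≤ F.toFun y} :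
    F.cl i x hx = F.cl i y hy ↔ (i : WithTop ℝ) < F.toFun (x⁻¹ * y) :=
  QuotientGroup.eq (s := (F.filPlus i).subgroupOf (F.fil i))

lemma lt_comm {i : ℝ} {x y : Γ} (hx : (i : WithTop ℝ) ≤ F.toFun x) :
    (i : WithTop ℝ) < F.toFun (gcomm x y) := by
  refine lt_of_lt_of_le ?_ (F.le_comm x y)
  by_cases h : F.toFun x = ⊤
  · rw [h]; simp
  · refine lt_of_le_of_lt hx ?_
    have := WithTop.add_lt_add_left h (F.pos y)
    simpa using this

instance grPieceAddCommGroup (i : ℝ) : AddCommGroup (F.GrPiece i) :=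
  { (inferInstance :
      AddGroup (Additive (F.fil i ⧸ (F.filPlus i).subgroupOf (F.fil i)))) with
    add_comm := by
      intro a b
      obtain ⟨x, hx, rfl⟩ := F.cl_surj a
      obtain ⟨y, hy, rfl⟩ := F.cl_surj b
      refine (F.cl_eq_iff (hx := (F.fil i).mul_mem hx hy)
        (hy := (F.fil i).mul_mem hy hx)).2 ?_
      have : (x * y)⁻¹ * (y * x) = (gcomm (y⁻¹) (x⁻¹)) := by rw [gcomm]; group
      rw [this]
      exact F.lt_comm (by rwa [F.map_inv]) }

lemma cl_add {i : ℝ} {x y : Γ} (hx : (i : WithTop ℝ) ≤ F.toFun x)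
    (hy : (i : WithTop ℝ) ≤ F.toFun y) :
    F.cl i x hx + F.cl i y hy = F.cl i (x * y) ((F.fil i).mul_mem hx hy) := rfl

lemma cl_neg {i : ℝ} {x : Γ} (hx : (i : WithTop ℝ) ≤ F.toFun x) :
    -F.cl i x hx = F.cl i x⁻¹ ((F.fil i).inv_mem hx) := rfl

lemma cl_eq_zero_iff {i : ℝ} {x : Γ} {hx : (i : WithTop ℝ) ≤ F.toFun x} :
    F.cl i x hx = 0 ↔ (i : WithTop ℝ) < F.toFun x := by
  have h : (0 : F.GrPiece i) = F.cl i 1 (by simp [F.map_one]) := rfl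
  rw [h, F.cl_eq_iff, mul_one, F.map_inv]

lemma cl_conj {i : ℝ} {x : Γ} (g : Γ) (hx : (i : WithTop ℝ) ≤ F.toFun x) :
    F.cl i (g * x * g⁻¹) (hx.trans (F.le_conj g x)) = F.cl i x hx := by
  rw [F.cl_eq_iff]
  have : (g * x * g⁻¹)⁻¹ * x = (gcomm x⁻¹ g)⁻¹ := by unfold gcomm; group
  rw [this, F.map_inv]
  exact F.lt_comm (by rwa [F.map_inv])

lemma le_comm' {i j : ℝ} {x y : Γ} (hx : (i : WithTop ℝ) ≤ F.toFun x)
    (hy : (j : WithTop ℝ) ≤ F.toFun y) : ((i + j : ℝ) : WithTop ℝ) ≤ F.toFun (gcomm x y) := by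
  rw [WithTop.coe_add]
  exact (add_le_add hx hy).trans (F.le_comm x y)

lemma lt_comm_left {i j : ℝ} {x y : Γ} (hx : (i : WithTop ℝ) < F.toFun x)
    (hy : (j : WithTop ℝ) ≤ F.toFun y) : ((i + j : ℝ) : WithTop ℝ) < F.toFun (gcomm x y) := by
  rw [WithTop.coe_add]
  refine lt_of_lt_of_le ?_ (F.le_comm x y)
  exact WithTop.add_lt_add_of_lt_of_le WithTop.coe_ne_top hx hy

lemma cl_comm_mul_left {i j : ℝ} {x x' y : Γ} (hx : (i : WithTop ℝ) ≤ F.toFun x)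
    (hx' : (i : WithTop ℝ) ≤ F.toFun x') (hy : (j : WithTop ℝ) ≤ F.toFun y) :
    F.cl (i + j) (gcomm (x * x') y) (F.le_comm' ((F.fil i).mul_mem hx hx') hy) =
      F.cl (i + j) (gcomm x y) (F.le_comm' hx hy) + F.cl (i + j) (gcomm x' y) (F.le_comm' hx' hy) := by
  have e : (gcomm (x * x') y) = (x * (gcomm x' y) * x⁻¹) * (gcomm x y) := by
    simp only [gcomm]; group
  rw [add_comm (F.cl (i + j) (gcomm x y) _), ← F.cl_conj x (F.le_comm' hx' hy), F.cl_add]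
  congr 1

lemma cl_comm_inv {i j : ℝ} {x y : Γ} (hx : (i : WithTop ℝ) ≤ F.toFun x)
    (hy : (j : WithTop ℝ) ≤ F.toFun y) (h) :
    F.cl (i + j) (gcomm y x) h = - F.cl (i + j) (gcomm x y) (F.le_comm' hx hy) := by
  rw [F.cl_neg]
  congr 1
  exact (gcomm_inv x y).symm

lemma le_comm'' {i j : ℝ} {x y : Γ} (hx : (i : WithTop ℝ) ≤ F.toFun x)
    (hy : (j : WithTop ℝ) ≤ F.toFun y) : ((i + j : ℝ) : WithTop ℝ) ≤ F.toFun (gcomm y x) := by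
  rw [add_comm]; exact F.le_comm' hy hx

lemma cl_comm_mul_right {i j : ℝ} {x y y' : Γ} (hx : (i : WithTop ℝ) ≤ F.toFun x)
    (hy : (j : WithTop ℝ) ≤ F.toFun y) (hy' : (j : WithTop ℝ) ≤ F.toFun y') :
    F.cl (i + j) (gcomm x (y * y')) (F.le_comm' hx ((F.fil j).mul_mem hy hy')) =
      F.cl (i + j) (gcomm x y) (F.le_comm' hx hy) + F.cl (i + j) (gcomm x y') (F.le_comm' hx hy') := by
  have e : (gcomm x (y * y')) = (gcomm x y) * (y * (gcomm x y') * y⁻¹) := by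
    simp only [gcomm]; group
  rw [← F.cl_conj y (F.le_comm' hx hy'), F.cl_add]
  congr 1

/-- The commutator pairing `gr_i × gr_j → gr_{i+j}`, `(x̄, ȳ) ↦` class of `x y x⁻¹ y⁻¹`. -/
def brk (i j : ℝ) (a : F.GrPiece i) (b : F.GrPiece j) : F.GrPiece (i + j) :=
  Quotient.liftOn₂' (s₁ := QuotientGroup.leftRel ((F.filPlus i).subgroupOf (F.fil i)))
    (s₂ := QuotientGroup.leftRel ((F.filPlus j).subgroupOf (F.fil j))) a b
    (fun x y => F.cl (i + j) (gcomm (x : Γ) (y : Γ)) (F.le_comm' x.2 y.2)) (by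
      rintro ⟨x, hx⟩ ⟨y, hy⟩ ⟨x', hx'⟩ ⟨y', hy'⟩ h1 h2
      have h1 : (i : WithTop ℝ) < F.toFun (x⁻¹ * x') := QuotientGroup.leftRel_apply.1 h1
      have h2 : (j : WithTop ℝ) < F.toFun (y⁻¹ * y') := QuotientGroup.leftRel_apply.1 h2
      have e1 := F.cl_comm_mul_left hx h1.le hy
      have e2 := F.cl_comm_mul_right hx' hy h2.le
      rw [F.cl_eq_zero_iff.2 (F.lt_comm_left h1 hy), add_zero] at e1
      have h3 : ((i + j : ℝ) : WithTop ℝ) < F.toFun (gcomm x' (y⁻¹ * y')) := by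
        rw [← gcomm_inv, F.map_inv, add_comm]
        exact F.lt_comm_left h2 hx'
      rw [F.cl_eq_zero_iff.2 h3, add_zero] at e2
      simp only [mul_inv_cancel_left] at e1 e2
      exact e1.symm.trans e2.symm)

lemma brk_cl {i j : ℝ} {x y : Γ} (hx : (i : WithTop ℝ) ≤ F.toFun x)
    (hy : (j : WithTop ℝ) ≤ F.toFun y) :
    F.brk i j (F.cl i x hx) (F.cl j y hy) = F.cl (i + j) (gcomm x y) (F.le_comm' hx hy) := rfl

/-- The commutator pairing as a biadditive map. -/
def brkHom (i j : ℝ) : F.GrPiece i →+ F.GrPiece j →+ F.GrPiece (i + j) :=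
  AddMonoidHom.mk' (fun a => AddMonoidHom.mk' (fun b => F.brk i j a b) (by
    intro b b'
    obtain ⟨x, hx, rfl⟩ := F.cl_surj a
    obtain ⟨y, hy, rfl⟩ := F.cl_surj b
    obtain ⟨y', hy', rfl⟩ := F.cl_surj b'
    exact F.cl_comm_mul_right hx hy hy')) (by
    intro a a'
    ext b
    obtain ⟨x, hx, rfl⟩ := F.cl_surj a
    obtain ⟨y, hy, rfl⟩ := F.cl_surj b
    obtain ⟨x', hx', rfl⟩ := F.cl_surj a'
    exact F.cl_comm_mul_left hx hx' hy)

/-- The associated graded group `gr Γ = ⨁ i, Fil^i / Fil^{i+}`. -/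
abbrev Gr : Type _ := ⨁ i : ℝ, F.GrPiece i

open Classical in
/-- The inclusion of `gr_i` in `gr Γ`. -/
noncomputable def ofPiece (i : ℝ) : F.GrPiece i →+ F.Gr :=
  DirectSum.of (fun i : ℝ => F.GrPiece i) i

open Classical in
/-- The bracket of `gr Γ`, as a biadditive map. -/
noncomputable def grBracket : F.Gr →+ F.Gr →+ F.Gr :=
  DirectSum.toAddMonoid fun i => AddMonoidHom.flip <|
    DirectSum.toAddMonoid fun j => AddMonoidHom.flip <|
      (AddMonoidHom.compHom (F.ofPiece (i + j))).comp (F.brkHom i j)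

/-- The class in `gr Γ` of an element of `Fil^i`. -/
noncomputable def sy (i : ℝ) (x : Γ) (hx : (i : WithTop ℝ) ≤ F.toFun x) : F.Gr :=
  F.ofPiece i (F.cl i x hx)

lemma sy_congr {i j : ℝ} {x y : Γ} (h : i = j) (h' : x = y) (hx : (i : WithTop ℝ) ≤ F.toFun x)
    (hy : (j : WithTop ℝ) ≤ F.toFun y) : F.sy i x hx = F.sy j y hy := by
  subst h; subst h'; rfl

lemma grBracket_sy {i j : ℝ} {x y : Γ} (hx : (i : WithTop ℝ) ≤ F.toFun x)
    (hy : (j : WithTop ℝ) ≤ F.toFun y) :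
    F.grBracket (F.sy i x hx) (F.sy j y hy) = F.sy (i + j) (gcomm x y) (F.le_comm' hx hy) := by
  classical
  simp only [grBracket, sy, ofPiece, DirectSum.toAddMonoid_of, AddMonoidHom.flip_apply]
  rfl

lemma gr_induction {C : F.Gr → Prop} (h0 : C 0) (h1 : ∀ i x hx, C (F.sy i x hx))
    (h2 : ∀ a b, C a → C b → C (a + b)) (a : F.Gr) : C a := by
  classical
  refine DirectSum.induction_on (β := fun i : ℝ => F.GrPiece i) (motive := C) a h0 ?_ h2
  intro i a
  obtain ⟨x, hx, rfl⟩ := F.cl_surj a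
  exact h1 i x hx

lemma sy_neg {i : ℝ} {x : Γ} (hx : (i : WithTop ℝ) ≤ F.toFun x) (hx') :
    F.sy i x⁻¹ hx' = -F.sy i x hx := by
  rw [sy, sy, ← map_neg]; rfl

lemma sy_add {i : ℝ} {x y : Γ} (hx : (i : WithTop ℝ) ≤ F.toFun x)
    (hy : (i : WithTop ℝ) ≤ F.toFun y) (h) :
    F.sy i (x * y) h = F.sy i x hx + F.sy i y hy := by
  rw [sy, sy, sy, ← map_add]; rfl

lemma sy_conj {i : ℝ} {x : Γ} (g : Γ) (hx : (i : WithTop ℝ) ≤ F.toFun x) (h) :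
    F.sy i (g * x * g⁻¹) h = F.sy i x hx := by
  rw [sy, sy, F.cl_conj]

lemma sy_one {i : ℝ} (h) : F.sy i (1 : Γ) h = 0 := by
  rw [sy, F.cl_eq_zero_iff.2 (by simp [F.map_one]), map_zero]

lemma grBracket_skew (a b : F.Gr) : F.grBracket a b = -F.grBracket b a := by
  induction a using F.gr_induction with
  | h0 => simp
  | h2 a a' h h' => simp only [map_add, AddMonoidHom.add_apply, h, h', neg_add]
  | h1 i x hx =>
    induction b using F.gr_induction with
    | h0 => simp
    | h2 b b' h h' => simp only [map_add, AddMonoidHom.add_apply, h, h', neg_add]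
    | h1 j y hy =>
      rw [F.grBracket_sy, F.grBracket_sy, ← F.sy_neg _ (by
        rw [F.map_inv]; exact F.le_comm' hy hx)]
      exact F.sy_congr (add_comm i j) (gcomm_inv y x).symm _ _

lemma grBracket_self (a : F.Gr) : F.grBracket a a = 0 := by
  induction a using F.gr_induction with
  | h0 => simp
  | h1 i x hx =>
    rw [F.grBracket_sy, F.sy_congr rfl (show gcomm x x = 1 by unfold gcomm; group) _
      (F.le_one _), F.sy_one]
  | h2 a b ha hb =>
    simp only [map_add, AddMonoidHom.add_apply, ha, hb, zero_add, add_zero]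
    rw [F.grBracket_skew a b, add_neg_cancel]

lemma hall_witt (x y z : Γ) :
    (y * gcomm (gcomm y⁻¹ x) z * y⁻¹) * (z * gcomm (gcomm z⁻¹ y) x * z⁻¹) *
      (x * gcomm (gcomm x⁻¹ z) y * x⁻¹) = 1 := by
  unfold gcomm; group

lemma grBracket_jacobi_sy {i j k : ℝ} {x y z : Γ} (hx : (i : WithTop ℝ) ≤ F.toFun x)
    (hy : (j : WithTop ℝ) ≤ F.toFun y) (hz : (k : WithTop ℝ) ≤ F.toFun z) :
    F.grBracket (F.grBracket (F.sy j y hy) (F.sy i x hx)) (F.sy k z hz) +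
    F.grBracket (F.grBracket (F.sy k z hz) (F.sy j y hy)) (F.sy i x hx) +
    F.grBracket (F.grBracket (F.sy i x hx) (F.sy k z hz)) (F.sy j y hy) = 0 := by
  have key : ∀ {i j k : ℝ} {x y z : Γ} (hx : (i : WithTop ℝ) ≤ F.toFun x)
      (hy : (j : WithTop ℝ) ≤ F.toFun y) (hz : (k : WithTop ℝ) ≤ F.toFun z) (l : ℝ)
      (_ : l = j + i + k) (h),
      F.grBracket (F.grBracket (F.sy j y hy) (F.sy i x hx)) (F.sy k z hz) =
        -F.sy l (y * gcomm (gcomm y⁻¹ x) z * y⁻¹) h := by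
    intro i j k x y z hx hy hz l hl h
    subst hl
    have hy' : (j : WithTop ℝ) ≤ F.toFun y⁻¹ := by rwa [F.map_inv]
    rw [F.sy_conj y (F.le_comm' (F.le_comm' hy' hx) hz), ← F.grBracket_sy (F.le_comm' hy' hx) hz,
      ← F.grBracket_sy hy' hx, F.sy_neg hy hy']
    simp
  have hy' : (j : WithTop ℝ) ≤ F.toFun y⁻¹ := by rwa [F.map_inv]
  have hz' : (k : WithTop ℝ) ≤ F.toFun z⁻¹ := by rwa [F.map_inv]
  have hx' : (i : WithTop ℝ) ≤ F.toFun x⁻¹ := by rwa [F.map_inv]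
  have e1 : k + j + i = j + i + k := by ring
  have e2 : i + k + j = j + i + k := by ring
  have m1 := (F.le_comm' (F.le_comm' hy' hx) hz).trans (F.le_conj y _)
  have m2 := (F.le_comm' (F.le_comm' hz' hy) hx).trans (F.le_conj z _)
  have m3 := (F.le_comm' (F.le_comm' hx' hz) hy).trans (F.le_conj x _)
  rw [e1] at m2
  rw [e2] at m3
  rw [key hx hy hz _ rfl m1, key hy hz hx _ e1.symm m2, key hz hx hy _ e2.symm m3,
    ← neg_add, ← neg_add, neg_eq_zero]
  have m12 := (le_min m1 m2).trans (F.le_mul _ _)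
  have m123 := (le_min m12 m3).trans (F.le_mul _ _)
  rw [← F.sy_add m1 m2 m12, ← F.sy_add m12 m3 m123,
    F.sy_congr rfl (hall_witt x y z) _ (F.le_one _), F.sy_one]

lemma grBracket_leibniz (a b c : F.Gr) :
    F.grBracket a (F.grBracket b c) =
      F.grBracket (F.grBracket a b) c + F.grBracket b (F.grBracket a c) := by
  suffices h : F.grBracket (F.grBracket a b) c + F.grBracket (F.grBracket c a) b +
      F.grBracket (F.grBracket b c) a = 0 by
    have h1 := F.grBracket_skew a (F.grBracket b c)
    have h2 := F.grBracket_skew b (F.grBracket a c)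
    have h3 := F.grBracket_skew a c
    rw [h3] at h2 ⊢
    simp only [map_neg, AddMonoidHom.neg_apply, neg_neg] at h2 ⊢
    rw [h1, h2, neg_eq_iff_add_eq_zero, ← h]
    abel
  induction a using F.gr_induction with
  | h0 => simp
  | h2 a a' h h' =>
    simp only [map_add, AddMonoidHom.add_apply]
    rw [← add_zero (0 : F.Gr)]
    nth_rewrite 1 [← h]
    rw [← h']
    abel
  | h1 i x hx =>
    induction b using F.gr_induction with
    | h0 => simp
    | h2 a a' h h' =>
      simp only [map_add, AddMonoidHom.add_apply]
      rw [← add_zero (0 : F.Gr)]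
      nth_rewrite 1 [← h]
      rw [← h']
      abel
    | h1 j y hy =>
      induction c using F.gr_induction with
      | h0 => simp
      | h2 a a' h h' =>
        simp only [map_add, AddMonoidHom.add_apply]
        rw [← add_zero (0 : F.Gr)]
        nth_rewrite 1 [← h]
        rw [← h']
        abel
      | h1 k z hz => exact F.grBracket_jacobi_sy hy hx hz

/-- The Lie ring structure of `gr Γ`, induced by the commutator of `Γ`. -/
noncomputable instance : LieRing F.Gr where
  bracket a b := F.grBracket a b
  add_lie a b c := by simp
  lie_add a b c := by simp
  lie_self a := F.grBracket_self a
  leibniz_lie a b c := F.grBracket_leibniz a b c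

/-- The homogeneous component `gr_i` of `gr Γ`. -/
noncomputable def grDeg (i : ℝ) : AddSubgroup F.Gr := (F.ofPiece i).range

/-- The principal symbol of `x` : its class in `gr_{ω x}` (and `0` if `x = 1`). -/
noncomputable def symb (x : Γ) : F.Gr :=
  F.sy ((F.toFun x).untopD 0) x (WithTop.coe_untopD_le _ _)

end PFiltration

open scoped TensorProduct Polynomial

universe u

section LoopAlgebra

variable {k L : Type*} [Field k] [LieRing L] [LieAlgebra k L]

variable (k L) in
/-- The reduction map `L[v] = L ⊗_k k[v] → L`, `v ↦ 0`. -/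
noncomputable def polyRed : k[X] ⊗[k] L →ₗ[k] L :=
  TensorProduct.lid k L ∘ₗ (Polynomial.aeval (R := k) (0 : k)).toLinearMap.rTensor L

lemma polyRed_tmul (q : k[X]) (x : L) : polyRed k L (q ⊗ₜ x) = q.eval 0 • x := by
  simp [polyRed, ← Polynomial.coeff_zero_eq_eval_zero]

lemma polyRed_smul (q : k[X]) (x : k[X] ⊗[k] L) :
    polyRed k L (q • x) = q.eval 0 • polyRed k L x := by
  induction x using TensorProduct.induction_on with
  | zero => simp
  | add x y hx hy => rw [smul_add, map_add, map_add, hx, hy, smul_add]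
  | tmul r x => rw [TensorProduct.smul_tmul', polyRed_tmul, polyRed_tmul, smul_eq_mul,
      Polynomial.eval_mul, mul_smul]

lemma polyRed_lie (x y : k[X] ⊗[k] L) :
    polyRed k L ⁅x, y⁆ = ⁅polyRed k L x, polyRed k L y⁆ := by
  induction x using TensorProduct.induction_on with
  | zero =>
    rw [show ⁅(0 : k[X] ⊗[k] L), y⁆ = 0 from zero_lie y, map_zero, zero_lie]
  | add x x' hx hx' =>
    rw [show ⁅x + x', y⁆ = ⁅x, y⁆ + ⁅x', y⁆ from add_lie x x' y, map_add, map_add, hx, hx', add_lie]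
  | tmul r x =>
    induction y using TensorProduct.induction_on with
    | zero =>
      rw [show ⁅(r ⊗ₜ[k] x : k[X] ⊗[k] L), (0 : k[X] ⊗[k] L)⁆ = 0 from
        lie_zero (r ⊗ₜ[k] x : k[X] ⊗[k] L), map_zero,
        lie_zero]
    | add y y' hy hy' =>
      rw [show ⁅(r ⊗ₜ[k] x : k[X] ⊗[k] L), y + y'⁆ = ⁅(r ⊗ₜ[k] x : k[X] ⊗[k] L), y⁆ +
        ⁅(r ⊗ₜ[k] x : k[X] ⊗[k] L), y'⁆ from
        lie_add (r ⊗ₜ[k] x : k[X] ⊗[k] L) y y', map_add, map_add, hy, hy', lie_add]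
    | tmul s y =>
      rw [LieAlgebra.ExtendScalars.bracket_tmul, polyRed_tmul, polyRed_tmul, polyRed_tmul,
        Polynomial.eval_mul, smul_lie, lie_smul, smul_smul]

/-- The preimage in `L[v]` of a Lie subalgebra of `L` under the reduction map, as a Lie
subalgebra over `k[v]`. -/
noncomputable def polyRedPreimage (N : LieSubalgebra k L) : LieSubalgebra k[X] (k[X] ⊗[k] L) where
  carrier := {x | polyRed k L x ∈ N}
  zero_mem' := by simp
  add_mem' hx hy := by
    simpa using N.add_mem hx hy
  smul_mem' q x hx := by
    simpa [polyRed_smul] using N.smul_mem _ hx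
  lie_mem' hx hy := by
    have h := N.lie_mem hx hy
    rw [← polyRed_lie] at h
    exact h

end LoopAlgebra

section AlgebraicGroup

/-- The `R`-points of the affine group scheme `G = Spec A` over `K`, with the convolution product
(the product of `G(R)`). -/
abbrev Pts (K A R : Type*) [CommRing K] [CommRing A] [HopfAlgebra K A] [CommRing R]
    [Algebra K R] : Type _ := WithConv (A →ₐ[K] R)

/-- The ideal `I` of `A` defines a normal closed subgroup scheme of `G = Spec A`: for every
`K`-algebra `R`, the points of `G(R)` which vanish on `I` form a normal subgroup of `G(R)`. -/
structure IsNormalClosedSubgroup (K A : Type u) [Field K] [CommRing A] [HopfAlgebra K A]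
    (I : Ideal A) : Prop where
  one_mem : ∀ (R : Type u) [CommRing R] [Algebra K R], ∀ a ∈ I, (1 : Pts K A R).ofConv a = 0
  mul_mem : ∀ (R : Type u) [CommRing R] [Algebra K R] (x y : Pts K A R),
    (∀ a ∈ I, x.ofConv a = 0) → (∀ a ∈ I, y.ofConv a = 0) → ∀ a ∈ I, (x * y).ofConv a = 0
  inv_mem : ∀ (R : Type u) [CommRing R] [Algebra K R] (x y : Pts K A R), x * y = 1 →
    (∀ a ∈ I, x.ofConv a = 0) → ∀ a ∈ I, y.ofConv a = 0
  conj_mem : ∀ (R : Type u) [CommRing R] [Algebra K R] (g g' x : Pts K A R), g * g' = 1 →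
    (∀ a ∈ I, x.ofConv a = 0) → ∀ a ∈ I, (g * x * g').ofConv a = 0

/-- An algebraic group `G = Spec A` over a field of characteristic zero is almost-simple: it is
connected, not commutative, and every normal closed subgroup other than `G` is finite. (Such a
group is semisimple, since its solvable radical is then trivial.) -/
structure IsAlmostSimple (K A : Type u) [Field K] [CommRing A] [HopfAlgebra K A] : Prop where
  finiteType : Algebra.FiniteType K A
  connected : ConnectedSpace (PrimeSpectrum A)
  not_comm : ¬ Coalgebra.IsCocomm K A
  finite_of_normal : ∀ I : Ideal A, IsNormalClosedSubgroup K A I → I = ⊥ ∨ Module.Finite K (A ⧸ I)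

variable (K A : Type*) [Field K] [CommRing A] [HopfAlgebra K A]

/-- The Lie algebra of `G = Spec A`: left-invariant derivations of `A`. -/
def LieG : LieSubalgebra K (Derivation K A A) where
  carrier := {D | ∀ a, Coalgebra.comul (R := K) (D a) =
    (D : A →ₗ[K] A).lTensor A (Coalgebra.comul (R := K) a)}
  zero_mem' := by intro a; simp
  add_mem' := by
    intro D E hD hE a
    simp [hD a, hE a, LinearMap.lTensor_add]
  smul_mem' := by
    intro c D hD a
    simp [hD a, LinearMap.lTensor_smul]
  lie_mem' := by
    intro D E hD hE a
    have h1 : ∀ (D E : Derivation K A A) (z : A ⊗[K] A),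
        ((⁅D, E⁆ : Derivation K A A) : A →ₗ[K] A).lTensor A z =
        (D : A →ₗ[K] A).lTensor A ((E : A →ₗ[K] A).lTensor A z) -
        (E : A →ₗ[K] A).lTensor A ((D : A →ₗ[K] A).lTensor A z) := by
      intro D E z
      induction z with
      | zero => simp
      | add x y hx hy => simp only [map_add, hx, hy]; abel
      | tmul x y =>
        have : ((⁅D, E⁆ : Derivation K A A) : A →ₗ[K] A) y = D (E y) - E (D y) :=
          Derivation.commutator_apply y
        rw [LinearMap.lTensor_tmul, this, TensorProduct.tmul_sub]
        rfl
    have h2 : ∀ (D E : Derivation K A A)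
        (_ : ∀ a, Coalgebra.comul (R := K) (D a) =
          (D : A →ₗ[K] A).lTensor A (Coalgebra.comul (R := K) a)) (z : A),
        Coalgebra.comul (R := K) (D (E z)) =
          (D : A →ₗ[K] A).lTensor A (Coalgebra.comul (R := K) (E z)) := fun D E h z => h _
    rw [h1, ← hE a, ← hD a, ← hE, ← hD, Derivation.commutator_apply, map_sub]

variable {K A}

/-- Right translation by `g ∈ G(K)` on functions: `f ↦ (x ↦ f (x g))`. -/
noncomputable def rightTranslate (g : Pts K A K) : A →ₐ[K] A :=
  (Algebra.TensorProduct.rid K K A).toAlgHom.comp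
    ((Algebra.TensorProduct.map (AlgHom.id K A) g.ofConv).comp (Bialgebra.comulAlgHom K A))

variable {X Y : Type*} [AddCommGroup X] [AddCommGroup Y]

/-- The element of `G(K)` given by an element `τ` of `T(K) = Hom(X, Kˣ)`, where the split torus
`T ⊆ G` with character group `X` is given by `π : A → K[X]`. -/
noncomputable def torusPt (π : A →ₐc[K] AddMonoidAlgebra K X) (τ : Multiplicative X →* Kˣ) :
    Pts K A K :=
  WithConv.toConv
    ((AddMonoidAlgebra.lift K K X ((Units.coeHom K).comp τ)).comp (π : A →ₐ[K] _))

/-- `y(c) ∈ T(K) = Hom(X, Kˣ)` for a cocharacter `y` and `c ∈ Kˣ`: it maps `χ` to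
`c ^ ⟨χ, y⟩`. -/
def cocharPt {ι : Type*} (P : RootPairing ι ℤ X Y) (y : Y) (c : Kˣ) : Multiplicative X →* Kˣ where
  toFun χ := c ^ (P.toLinearMap χ.toAdd y)
  map_one' := by simp
  map_mul' a b := by simp [zpow_add]

/-- `D ∈ Lie G` is the derivative `dy(1)` of the cocharacter `y` of `T`. -/
def IsCocharDeriv {ι : Type*} (P : RootPairing ι ℤ X Y) (π : A →ₐc[K] AddMonoidAlgebra K X)
    (y : Y) (D : LieG K A) : Prop :=
  ∀ f : A, Coalgebra.counit (R := K) ((D : Derivation K A A) f) =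
    (π f).coeff.sum fun χ c => c * ((P.toLinearMap χ y : ℤ) : K)

/-- `P` (with base `b`) is the root datum of the algebraic group `G = Spec A` with respect to the
split maximal torus `T` given by `π : A → K[X]`, and we are given a Chevalley system: root vectors
`X_α`, with `H_α = dα^∨(1)`, forming a Chevalley basis of `Lie G`, and the root group
homomorphisms `u_α : 𝔾_a → G` with `du_α(1) = X_α`. -/
structure ChevalleySystem {ι : Type*} [Finite ι] (P : RootPairing ι ℤ X Y) [P.IsReduced]
    (b : P.Base) (π : A →ₐc[K] AddMonoidAlgebra K X) where
  /-- `T → G` is a closed immersion. -/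
  torus_surjective : Function.Surjective π
  /-- The Chevalley basis `{H_α : α simple} ∪ {X_α : α root}`. -/
  basis : Module.Basis (b.support ⊕ ι) K (LieG K A)
  /-- The elements `H_α`, for all roots `α`. -/
  H : ι → LieG K A
  basis_inl : ∀ i : b.support, basis (Sum.inl i) = H i
  H_spec : ∀ i, IsCocharDeriv P π (P.coroot i) (H i)
  /-- `X_α` has weight `α` for the adjoint action of `T`. -/
  weight : ∀ (i : ι) (τ : Multiplicative X →* Kˣ) (f : A),
    rightTranslate (torusPt π τ) ((basis (Sum.inr i) : Derivation K A A) f) =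
      (τ (Multiplicative.ofAdd (P.root i)) : K) •
        (basis (Sum.inr i) : Derivation K A A) (rightTranslate (torusPt π τ) f)
  lie_H_H : ∀ i j, ⁅H i, H j⁆ = 0
  lie_H_X : ∀ i j, ⁅H i, basis (Sum.inr j)⁆ = P.pairing j i • basis (Sum.inr j)
  /-- `[X_α, X_{-α}] = H_α`; `P.reflectionPerm i i` is the index of the root `-α_i`. -/
  lie_X_neg : ∀ i, ⁅basis (Sum.inr i), basis (Sum.inr (P.reflectionPerm i i))⁆ = H i
  /-- `[X_α, X_β] = ± (r + 1) X_{α + β}` if `α + β` is a root, where `r` is the largest integer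
  such that `β - r α` is a root. -/
  lie_X_X : ∀ i j l, P.root l = P.root i + P.root j →
    ∃ N : ℤ, N.natAbs = P.chainBotCoeff i j + 1 ∧
      ⁅basis (Sum.inr i), basis (Sum.inr j)⁆ = N • basis (Sum.inr l)
  lie_X_X_zero : ∀ i j, P.root i + P.root j ≠ 0 → P.root i + P.root j ∉ Set.range P.root →
    ⁅basis (Sum.inr i), basis (Sum.inr j)⁆ = 0
  /-- The root group homomorphisms `𝔾_a → G`, as morphisms of schemes. -/
  u : ι → A →ₐ[K] K[X]
  u_add : ∀ i (c d : K),
    WithConv.toConv ((Polynomial.aeval (c + d)).comp (u i)) =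
      (WithConv.toConv ((Polynomial.aeval c).comp (u i)) : Pts K A K) *
        WithConv.toConv ((Polynomial.aeval d).comp (u i))
  /-- `du_α(1) = X_α`. -/
  u_deriv : ∀ i (f : A), Coalgebra.counit (R := K) ((basis (Sum.inr i) : Derivation K A A) f) =
    (u i f).coeff 1

namespace ChevalleySystem

variable {ι : Type*} [Finite ι] {P : RootPairing ι ℤ X Y} [P.IsReduced] {b : P.Base}
  {π : A →ₐc[K] AddMonoidAlgebra K X} (S : ChevalleySystem P b π)

/-- The root vector `X_α`. -/
noncomputable def rootVec (i : ι) : LieG K A := S.basis (Sum.inr i)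

/-- The element `u_α(c)` of `G(K)`. -/
noncomputable def rootPt (i : ι) (c : K) : Pts K A K :=
  WithConv.toConv ((Polynomial.aeval c).comp (S.u i))

lemma counit_injective (D E : LieG K A)
    (h : ∀ f, Coalgebra.counit (R := K) ((D : Derivation K A A) f) =
      Coalgebra.counit (R := K) ((E : Derivation K A A) f)) : D = E := by
  have key : ∀ (D : LieG K A) (f : A), (D : Derivation K A A) f =
      TensorProduct.rid K A ((Coalgebra.counit (R := K) (A := A) ∘ₗ
        ((D : Derivation K A A) : A →ₗ[K] A)).lTensor A (Coalgebra.comul (R := K) f)) := by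
    intro D f
    rw [LinearMap.lTensor_comp, LinearMap.comp_apply, ← D.2 f, Coalgebra.lTensor_counit_comul]
    simp
  apply Subtype.ext
  apply Derivation.ext
  intro f
  rw [key D f, key E f]
  have : Coalgebra.counit (R := K) (A := A) ∘ₗ ((D : Derivation K A A) : A →ₗ[K] A) =
      Coalgebra.counit (R := K) (A := A) ∘ₗ ((E : Derivation K A A) : A →ₗ[K] A) :=
    LinearMap.ext h
  rw [this]

lemma H_mem_span (i : ι) : S.H i ∈ Submodule.span ℤ (Set.range S.basis) := by
  have hspec : ∀ y ∈ AddSubgroup.closure (P.coroot '' b.support),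
      ∃ D ∈ Submodule.span ℤ (Set.range S.basis), IsCocharDeriv P π y D := by
    intro y hy
    induction hy using AddSubgroup.closure_induction with
    | mem y hy =>
      obtain ⟨i, hi, rfl⟩ := hy
      exact ⟨S.H i, Submodule.subset_span ⟨Sum.inl ⟨i, hi⟩, S.basis_inl ⟨i, hi⟩⟩, S.H_spec i⟩
    | zero => exact ⟨0, Submodule.zero_mem _, fun f => by simp [Finsupp.sum]⟩
    | add y z _ _ hy hz =>
      obtain ⟨D, hD, hD'⟩ := hy
      obtain ⟨E, hE, hE'⟩ := hz
      refine ⟨D + E, Submodule.add_mem _ hD hE, fun f => ?_⟩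
      have h : ((D + E : LieG K A) : Derivation K A A) f =
        (D : Derivation K A A) f + (E : Derivation K A A) f := rfl
      rw [h, map_add, hD' f, hE' f]
      simp [Finsupp.sum, Finset.sum_add_distrib, mul_add]
    | neg y _ hy =>
      obtain ⟨D, hD, hD'⟩ := hy
      refine ⟨-D, Submodule.neg_mem _ hD, fun f => ?_⟩
      have h : ((-D : LieG K A) : Derivation K A A) f = -(D : Derivation K A A) f := rfl
      rw [h, map_neg, hD' f]
      simp [Finsupp.sum]
  have hi : P.coroot i ∈ AddSubgroup.closure (P.coroot '' b.support) := by
    have hle : AddSubmonoid.closure (P.coroot '' b.support) ≤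
        (AddSubgroup.closure (P.coroot '' b.support)).toAddSubmonoid :=
      AddSubmonoid.closure_le.2 AddSubgroup.subset_closure
    rcases b.coroot_mem_or_neg_mem i with h | h
    · exact hle h
    · exact neg_mem_iff.1 (hle h)
  obtain ⟨D, hD, hD'⟩ := hspec _ hi
  rwa [counit_injective (S.H i) D fun f => (S.H_spec i f).trans (hD' f).symm]

lemma basis_lie_mem (s t : b.support ⊕ ι) :
    ⁅S.basis s, S.basis t⁆ ∈ Submodule.span ℤ (Set.range S.basis) := by
  have hX : ∀ t, S.basis t ∈ Submodule.span ℤ (Set.range S.basis) :=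
    fun t => Submodule.subset_span ⟨t, rfl⟩
  rcases s with i | i <;> rcases t with j | j
  · rw [S.basis_inl, S.basis_inl, S.lie_H_H]; exact Submodule.zero_mem _
  · rw [S.basis_inl, S.lie_H_X]; exact Submodule.smul_mem _ _ (hX _)
  · rw [S.basis_inl, ← lie_skew, S.lie_H_X]
    exact Submodule.neg_mem _ (Submodule.smul_mem _ _ (hX _))
  · by_cases h0 : P.root i + P.root j = 0
    · have : j = P.reflectionPerm i i := by
        apply P.root.injective
        rw [P.root_reflectionPerm, P.reflection_apply_self]
        exact (neg_eq_of_add_eq_zero_right h0).symm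
      rw [this, S.lie_X_neg]
      exact S.H_mem_span i
    · by_cases h1 : P.root i + P.root j ∈ Set.range P.root
      · obtain ⟨l, hl⟩ := h1
        obtain ⟨N, -, hN⟩ := S.lie_X_X i j l hl
        rw [hN]; exact Submodule.smul_mem _ _ (hX _)
      · rw [S.lie_X_X_zero i j h0 h1]; exact Submodule.zero_mem _

/-- `𝔤_ℤ`: the `ℤ`-span of the Chevalley basis. -/
noncomputable def gZ : LieSubalgebra ℤ (LieG K A) where
  __ := Submodule.span ℤ (Set.range S.basis)
  lie_mem' := by
    intro x y hx hy
    change x ∈ Submodule.span ℤ (Set.range S.basis) at hx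
    change y ∈ Submodule.span ℤ (Set.range S.basis) at hy
    change ⁅x, y⁆ ∈ Submodule.span ℤ (Set.range S.basis)
    induction hx, hy using Submodule.span_induction₂ with
    | mem_mem x y hx hy =>
      obtain ⟨s, rfl⟩ := hx
      obtain ⟨t, rfl⟩ := hy
      exact S.basis_lie_mem s t
    | zero_left y hy => simp
    | zero_right x hx => simp
    | add_left x y z _ _ _ h1 h2 => rw [add_lie]; exact Submodule.add_mem _ h1 h2
    | add_right x y z _ _ _ h1 h2 => rw [lie_add]; exact Submodule.add_mem _ h1 h2
    | smul_left r x y _ _ h => rw [smul_lie]; exact Submodule.smul_mem _ _ h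
    | smul_right r x y _ _ h => rw [lie_smul]; exact Submodule.smul_mem _ _ h

variable [CharZero K]

/-- The Chevalley basis, as a `ℤ`-basis of `𝔤_ℤ`. -/
noncomputable def basisZ : Module.Basis (b.support ⊕ ι) ℤ S.gZ := S.basis.restrictScalars ℤ

variable (k : Type*) [Field k]

/-- `𝔤_k = 𝔤_ℤ ⊗ k`. -/
def gk : Type _ := k ⊗[ℤ] S.gZ

noncomputable instance : LieRing (S.gk k) := inferInstanceAs (LieRing (k ⊗[ℤ] S.gZ))

noncomputable instance : LieAlgebra k (S.gk k) := inferInstanceAs (LieAlgebra k (k ⊗[ℤ] S.gZ))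

/-- The Chevalley basis of `𝔤_k`. -/
noncomputable def basisk : Module.Basis (b.support ⊕ ι) k (S.gk k) := S.basisZ.baseChange k

lemma basisZ_coe (s : b.support ⊕ ι) : (S.basisZ s : LieG K A) = S.basis s :=
  S.basis.restrictScalars_apply ℤ s

lemma basisk_lie_smul {s t r : b.support ⊕ ι} {N : ℤ}
    (h : ⁅S.basis s, S.basis t⁆ = N • S.basis r) :
    ⁅S.basisk k s, S.basisk k t⁆ = (N : k) • S.basisk k r := by
  have h2 : ⁅S.basisZ s, S.basisZ t⁆ = N • S.basisZ r := by
    apply Subtype.ext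
    rw [LieSubalgebra.coe_bracket, basisZ_coe, basisZ_coe, h, ← basisZ_coe]
    rfl
  have e : ∀ s, S.basisk k s = ((1 : k) ⊗ₜ[ℤ] S.basisZ s : k ⊗[ℤ] S.gZ) :=
    fun s => Module.Basis.baseChange_apply _ _ _
  have h3 : ⁅S.basisk k s, S.basisk k t⁆ = (((1 : k) * 1) ⊗ₜ[ℤ] ⁅S.basisZ s, S.basisZ t⁆ :
      k ⊗[ℤ] S.gZ) := by
    rw [e, e]; rfl
  rw [h3, h2, mul_one, TensorProduct.tmul_smul, e, ← Int.cast_smul_eq_zsmul k]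
  rfl

/-- `𝔫 ⊆ 𝔤_k`, spanned by the `X_α` with `α > 0`. -/
noncomputable def nk : LieSubalgebra k (S.gk k) where
  __ := Submodule.span k {x | ∃ i, b.IsPos i ∧ x = S.basisk k (Sum.inr i)}
  lie_mem' := by
    intro x y hx hy
    set V := Submodule.span k {x | ∃ i, b.IsPos i ∧ x = S.basisk k (Sum.inr i)} with hV
    change x ∈ V at hx
    change y ∈ V at hy
    change ⁅x, y⁆ ∈ V
    have hbas : ∀ i j, b.IsPos i → b.IsPos j →
        ⁅S.basisk k (Sum.inr i), S.basisk k (Sum.inr j)⁆ ∈ V := by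
      intro i j hi hj
      have h0 : P.root i + P.root j ≠ 0 := by
        intro h0
        have hj' : j = P.reflectionPerm i i := by
          apply P.root.injective
          rw [P.root_reflectionPerm, P.reflection_apply_self]
          exact (neg_eq_of_add_eq_zero_right h0).symm
        have h := b.height_reflectionPerm_self i
        have h2 := b.isPos_iff.1 hi
        have h3 := b.isPos_iff.1 hj
        rw [hj'] at h3
        have h4 : b.height (P.reflectionPerm i i) = -b.height i := h
        omega
      by_cases h1 : P.root i + P.root j ∈ Set.range P.root
      · obtain ⟨l, hl⟩ := h1
        obtain ⟨N, -, hN⟩ := S.lie_X_X i j l hl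
        rw [S.basisk_lie_smul k hN]
        exact Submodule.smul_mem _ _ (Submodule.subset_span ⟨l, hi.add hj hl, rfl⟩)
      · have h2 := S.basisk_lie_smul k (s := Sum.inr i) (t := Sum.inr j) (r := Sum.inr i) (N := 0)
          (by rw [S.lie_X_X_zero i j h0 h1, zero_smul])
        rw [h2, Int.cast_zero, zero_smul]
        exact Submodule.zero_mem _
    rw [hV] at hx hy
    induction hx, hy using Submodule.span_induction₂ with
    | mem_mem x y hx hy =>
      obtain ⟨i, hi, rfl⟩ := hx
      obtain ⟨j, hj, rfl⟩ := hy
      exact hbas i j hi hj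
    | zero_left y hy => rw [zero_lie]; exact Submodule.zero_mem _
    | zero_right x hx => rw [lie_zero]; exact Submodule.zero_mem _
    | add_left x y z _ _ _ h1 h2 => rw [add_lie]; exact Submodule.add_mem _ h1 h2
    | add_right x y z _ _ _ h1 h2 => rw [lie_add]; exact Submodule.add_mem _ h1 h2
    | smul_left r x y _ _ h => rw [smul_lie]; exact Submodule.smul_mem _ _ h
    | smul_right r x y _ _ h => rw [lie_smul]; exact Submodule.smul_mem _ _ h

/-- `𝔤̃`: the preimage of `𝔫` under the reduction map `𝔤[v] = 𝔤_k ⊗_k k[v] → 𝔤_k`; that is,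
`v 𝔫⁻[v] ⊕ v 𝔱[v] ⊕ 𝔫[v]`, a Lie algebra over `k[v]`. -/
noncomputable def gTilde : LieSubalgebra k[X] (k[X] ⊗[k] S.gk k) := polyRedPreimage (S.nk k)

/-- The homogeneous component of degree `r` of `𝔤[v]`, for the grading with
`deg (X_α ⊗ v^j) = ht(α)/(he) + j/e` and `deg (H ⊗ v^j) = j/e` for `H ∈ 𝔱`. -/
noncomputable def loopDeg (h e : ℕ) (r : ℝ) : Submodule k (k[X] ⊗[k] S.gk k) :=
  Submodule.span k
    ({x | ∃ (i : ι) (j : ℕ), (b.height i : ℝ) / (h * e) + j / e = r ∧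
        x = (Polynomial.X ^ j : k[X]) ⊗ₜ[k] S.basisk k (Sum.inr i)} ∪
     {x | ∃ (i : b.support) (j : ℕ), (j : ℝ) / e = r ∧
        x = (Polynomial.X ^ j : k[X]) ⊗ₜ[k] S.basisk k (Sum.inl i)})

/-- The adjoint action of `t ∈ T(k) = Hom(X, kˣ)` on `𝔤_k`: it is trivial on `𝔱`, and `X_α` has
weight `α`. -/
noncomputable def adk (t : Multiplicative X →* kˣ) : S.gk k →ₗ[k] S.gk k :=
  (S.basisk k).constr k (Sum.elim (fun i => S.basisk k (Sum.inl i))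
    (fun i => (t (Multiplicative.ofAdd (P.root i)) : k) • S.basisk k (Sum.inr i)))

/-- The action of `t ∈ T(k)` on `𝔤[v] = 𝔤_k ⊗_k k[v]`, trivial on `k[v]`. -/
noncomputable def adkv (t : Multiplicative X →* kˣ) :
    k[X] ⊗[k] S.gk k →ₗ[k[X]] k[X] ⊗[k] S.gk k :=
  (S.adk k t).baseChange k[X]

end ChevalleySystem

end AlgebraicGroup

section MoyPrasad

variable (p : ℕ) [Fact p.Prime] {K : Type*} [Field K] [CharZero K] [Algebra ℚ_[p] K]
  [FiniteDimensional ℚ_[p] K] [Algebra ℤ_[p] K] [IsScalarTower ℤ_[p] ℚ_[p] K]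
  {A : Type*} [CommRing A] [HopfAlgebra K A]
  {X Y : Type*} [AddCommGroup X] [AddCommGroup Y]
  {ι : Type*} [Fintype ι] {P : RootPairing ι ℤ X Y} [P.IsReduced] {b : P.Base}
  {π : A →ₐc[K] AddMonoidAlgebra K X}

/-- The Coxeter number: one more than the height of the highest root. -/
noncomputable def coxeterNum (b : P.Base) : ℕ :=
  Finset.univ.sup (fun i => (b.height i).toNat) + 1

/-- `T(K)_{n/h} ⊆ T(K) = Hom(X, Kˣ)`: for `n = 0` the maximal compact subgroup, i.e. those `τ`
with `v(χ(τ)) = 0` for all `χ`, and for `n > 0` the `τ` in it such that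
`v(χ(τ) - 1) ≥ n/h` for all `χ`. -/
def torusFil (h n : ℕ) : Set (Multiplicative X →* Kˣ) :=
  {τ | (∀ χ, valK p K (τ χ) = 0) ∧
    (0 < n → ∀ χ, (n : WithTop ℤ) ≤ h • valK p K ((τ χ : K) - 1))}

namespace ChevalleySystem

variable (S : ChevalleySystem P b π)

/-- The group `G_{x, n/h}`, where `x` is the barycenter of the dominant base alcove: it is
generated by `T(K)_{n/h}` and by the `u_α(c)` with `v(c) + ht(α)/h ≥ n/h`. -/
noncomputable def mp (n : ℕ) : Subgroup (Pts K A K) :=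
  Subgroup.closure
    ({g | ∃ τ ∈ torusFil p (coxeterNum b) n, g = torusPt π τ} ∪
     {g | ∃ (i : ι) (c : K),
        ((n - b.height i : ℤ) : WithTop ℤ) ≤ coxeterNum b • valK p K c ∧ g = S.rootPt i c})

/-- The Iwahori subgroup `I = G_{x, 0}`. -/
noncomputable def iwahori : Subgroup (Pts K A K) := S.mp p 0

/-- The pro-`p` Iwahori subgroup `I_1 = G_{x, 1/h}`. -/
noncomputable def proPIwahori : Subgroup (Pts K A K) := S.mp p 1

open Classical in
/-- The rescaled Moy–Prasad filtration `ω` on `I_1`: for `z ≠ 1`, `ω z` is the largest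
`n/(he)` such that `z ∈ G_{x, n/h}`. -/
noncomputable def omega (z : S.proPIwahori p) : WithTop ℝ :=
  if z = 1 then ⊤ else
    ((((sSup {n : ℕ | (z : Pts K A K) ∈ S.mp p n} : ℕ) : ℝ) /
      (coxeterNum b * ramDeg p K) : ℝ) : WithTop ℝ)

end ChevalleySystem

end MoyPrasad

/-! Everything is measured in one faithful representation of `G` that has a weight basis on which
the Chevalley basis acts by `𝒪_K`-integral matrices (`ChevalleyRep`). Grading matrices by the
heights of the weights gives lattices `E_n` (`matFil`) with `E_m E_n ⊆ E_{m+n}` and `p E_n =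
E_{n+he}`. For `a ∈ E_m`, `b ∈ E_n` with `m, n ≥ 1` there are first-order formulas: products of `1 +
a` and `1 + b` add, their commutator is `1 + [a, b]`, and `(1 + a)^p` is `1 + pa`, each up to a
deeper error. The last one is where `he < p - 1` enters: it makes the top binomial term `a^p`
negligible against `pa`. The same inequality controls the denominators of the exponential series.

The central fact is `mem_mp_iff`: for `n ≥ 1`, the subgroup `G_{x,n/h}`, defined by generators,
consists of exactly those points `z` whose matrix lies in `1 + E_n`. One inclusion is checked on
generators, since `u_α(c)` is the exponential of `c X_α`. The converse rests on two statements.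
First, `exists_lie_of_mat`: the limit of `p^{-k} (z^{p^k} - 1)` is a point derivation, so it comes
from `Lie G` and approximates `z - 1` to first order. Second, `mem_lieFil_of_lmat_mem`: an element
of `Lie G` whose matrix lies in `E_n` has Chevalley coordinates of the expected valuations.
Successive approximation then writes `z` as a product of torus and root elements of level `n`
(`exists_coordPt`).

After that, `ω` is the `E_n`-level of `z - 1`, and the axioms of a `p`-valuation are the first-order
formulas. Completeness holds because `G(K)` is closed in the matrices over the complete field `K`.
Saturation follows from a Newton iteration for `p`-th roots (`exists_pow_prime_eq`).

For the graded ring, `z` of level `n` is sent to the leading term of an `x ∈ Lie G` with `z ≡ 1 +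
x`: the coordinate of `x` on a basis vector of degree `d` is reduced modulo `ϖ` after division by
`ϖ^{(n-d)/h}`, which is replaced by `v^{(n-d)/h}`. Commutators become brackets. Since `p = λ ϖ^e`,
the `p`-th power becomes multiplication by `λ v^e`. The image is `𝔤̃`, and the `k[ε]`-structure on
`gr` is pulled back along `ε ↦ λ v^e`.

The representation itself (`exists_chevalleyRep`) is a finite-dimensional piece of the regular
representation. The Chevalley basis acts on it by operators that are integral over `𝒪_K` and whose
commutators lie in their `ℤ`-span; a reordering argument of Poincaré–Birkhoff–Witt type then yields
a stable lattice, which splits into weight spaces. Simple connectedness supplies the fundamental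
weights, which detect the torus coordinates. -/

set_option linter.unusedSectionVars false

/-! ### The valuation filtration of `K` and completeness. -/

section OrdK

variable (p : ℕ) [Fact p.Prime] {K : Type*} [Field K] [Algebra ℚ_[p] K]
  [FiniteDimensional ℚ_[p] K] [Algebra ℤ_[p] K] [IsScalarTower ℤ_[p] ℚ_[p] K]

/-- The integer-valued valuation of `K` (with the value `0` at `0`). -/
noncomputable def ordK (c : K) : ℤ :=
  -(WithZero.log ((IsDiscreteValuationRing.maximalIdeal (RingInt p K)).valuation K c))

lemma valK_of_ne_zero {c : K} (hc : c ≠ 0) : valK p K c = ((ordK p c : ℤ) : WithTop ℤ) :=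
  if_neg hc

lemma ordK_mul {c d : K} (hc : c ≠ 0) (hd : d ≠ 0) : ordK p (c * d) = ordK p c + ordK p d := by
  rw [ordK, map_mul, WithZero.log_mul (by simpa using hc) (by simpa using hd), neg_add]; rfl

lemma ordK_one : ordK p (1 : K) = 0 := by simp [ordK]

lemma ordK_inv (c : K) : ordK p c⁻¹ = -ordK p c := by simp [ordK, WithZero.log_inv]

lemma ordK_zpow (c : K) (n : ℤ) : ordK p (c ^ n) = n * ordK p c := by
  simp [ordK, WithZero.log_zpow]

lemma ordK_add {c d : K} (hc : c ≠ 0) (hd : d ≠ 0) (h : c + d ≠ 0) :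
    min (ordK p c) (ordK p d) ≤ ordK p (c + d) := by
  have key : ∀ {c d : K}, c ≠ 0 → d ≠ 0 → ((ordK p c ≤ ordK p d) ↔
      (IsDiscreteValuationRing.maximalIdeal (RingInt p K)).valuation K d ≤
      (IsDiscreteValuationRing.maximalIdeal (RingInt p K)).valuation K c) := by
    intro c d hc hd
    rw [ordK, ordK, neg_le_neg_iff, WithZero.log_le_log (by simpa using hd) (by simpa using hc)]
  rcases Valuation.map_add' ((IsDiscreteValuationRing.maximalIdeal (RingInt p K)).valuation K) c d
    with h1 | h1
  · exact (min_le_left _ _).trans ((key hc h).2 h1)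
  · exact (min_le_right _ _).trans ((key hd h).2 h1)

lemma ordK_neg (c : K) : ordK p (-c) = ordK p c := by simp [ordK]

lemma ordK_nonneg_iff {c : K} (hc : c ≠ 0) : 0 ≤ ordK p c ↔ c ∈ integralClosure ℤ_[p] K := by
  have h0 : 0 ≤ ordK p c ↔
      (IsDiscreteValuationRing.maximalIdeal (RingInt p K)).valuation K c ≤ 1 := by
    rw [ordK, Left.nonneg_neg_iff, WithZero.log_le_iff_le_exp (by simpa using hc)]; rfl
  rw [h0]
  constructor
  · intro h
    obtain ⟨x, rfl⟩ := IsDiscreteValuationRing.exists_lift_of_le_one h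
    exact x.2
  · intro h
    exact IsDedekindDomain.HeightOneSpectrum.valuation_le_one _ (⟨c, h⟩ : RingInt p K)

variable (K) in
/-- The elements of `K` of valuation at least `a`. -/
def ordFil (a : ℚ) : AddSubgroup K where
  carrier := {c | c ≠ 0 → a ≤ ordK p c}
  zero_mem' h := absurd rfl h
  add_mem' {c d} hc hd h := by
    by_cases h1 : c = 0
    · subst h1; rw [zero_add] at h ⊢; exact hd h
    by_cases h2 : d = 0
    · subst h2; rw [add_zero] at h ⊢; exact hc h
    rcases min_le_iff.1 (ordK_add p h1 h2 h) with h3 | h3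
    · exact (hc h1).trans (by exact_mod_cast h3)
    · exact (hd h2).trans (by exact_mod_cast h3)
  neg_mem' {c} hc h := by
    rw [ordK_neg]; exact hc (by simpa using h)

variable {p}

lemma mem_ordFil_of_ne {a : ℚ} {c : K} (hc : c ≠ 0) : c ∈ ordFil p K a ↔ a ≤ ordK p c :=
  ⟨fun h => h hc, fun h _ => h⟩

lemma ordFil_mono {a b : ℚ} (h : a ≤ b) {c : K} (hc : c ∈ ordFil p K b) : c ∈ ordFil p K a :=
  fun h0 => h.trans (hc h0)

lemma ordFil_mul {a b : ℚ} {c d : K} (hc : c ∈ ordFil p K a) (hd : d ∈ ordFil p K b) :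
    c * d ∈ ordFil p K (a + b) := by
  intro h
  rw [ordK_mul p (left_ne_zero_of_mul h) (right_ne_zero_of_mul h)]
  push_cast
  exact add_le_add (hc (left_ne_zero_of_mul h)) (hd (right_ne_zero_of_mul h))

/-- Valuations are integers, so a rational bound can be rounded up. This is what gains the fraction
`1/h` at thresholds `(n - d)/h` that are not integers. -/
lemma ordFil_int {a : ℚ} {n : ℤ} (h : (n : ℚ) - 1 < a) {c : K} (hc : c ∈ ordFil p K a) :
    c ∈ ordFil p K n := by
  intro h0
  have h1 := h.trans_le (hc h0)
  have : n - 1 < ordK p c := by exact_mod_cast h1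
  exact_mod_cast (by omega : n ≤ ordK p c)

lemma mem_ordFil_zero {c : K} : c ∈ ordFil p K 0 ↔ c ∈ integralClosure ℤ_[p] K := by
  by_cases hc : c = 0
  · subst hc; simp [zero_mem]
  · rw [mem_ordFil_of_ne hc, ← ordK_nonneg_iff p hc]; norm_cast

lemma ringInt_mem_ordFil (c : RingInt p K) : (c : K) ∈ ordFil p K 0 := mem_ordFil_zero.2 c.2

lemma one_mem_ordFil : (1 : K) ∈ ordFil p K 0 := mem_ordFil_zero.2 (one_mem _)

lemma intCast_mem_ordFil (n : ℤ) : (n : K) ∈ ordFil p K 0 := mem_ordFil_zero.2 (intCast_mem _ n)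

lemma natCast_mem_ordFil (n : ℕ) : (n : K) ∈ ordFil p K 0 := mem_ordFil_zero.2 (natCast_mem _ n)

lemma ordFil_mul_right {a : ℚ} {c d : K} (hc : c ∈ ordFil p K a) (hd : d ∈ ordFil p K 0) :
    c * d ∈ ordFil p K a := by
  simpa using ordFil_mul hc hd

lemma ordFil_mul_left {a : ℚ} {c d : K} (hc : c ∈ ordFil p K 0) (hd : d ∈ ordFil p K a) :
    c * d ∈ ordFil p K a := by
  simpa using ordFil_mul hc hd

lemma eq_zero_of_forall_ordFil {c : K} (h : ∀ n : ℕ, c ∈ ordFil p K n) : c = 0 := by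
  by_contra hc
  have h1 := (mem_ordFil_of_ne hc).1 (h ((ordK p c).toNat + 1))
  have h2 : (((ordK p c).toNat + 1 : ℕ) : ℤ) ≤ ordK p c := by exact_mod_cast h1
  have := Int.self_le_toNat (ordK p c)
  push_cast at h2
  omega

lemma ordK_unit (u : (RingInt p K)ˣ) : ordK p ((u : RingInt p K) : K) = 0 := by
  have h0 : ∀ u : (RingInt p K)ˣ, ((u : RingInt p K) : K) ≠ 0 := fun u h =>
    u.ne_zero (Subtype.ext h)
  have h1 : ∀ u : (RingInt p K)ˣ, 0 ≤ ordK p ((u : RingInt p K) : K) := fun u =>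
    (ordK_nonneg_iff p (h0 u)).2 (u : RingInt p K).2
  have h2 : ((u : RingInt p K) : K) * ((u⁻¹ : (RingInt p K)ˣ) : RingInt p K) = 1 :=
    congrArg Subtype.val u.mul_inv
  have h3 := ordK_mul p (h0 u) (h0 u⁻¹)
  rw [h2, ordK_one] at h3
  have := h1 u
  have := h1 u⁻¹
  omega

lemma isUnit_of_ordK_eq_zero {c : RingInt p K} (hc : (c : K) ≠ 0) (h : ordK p (c : K) = 0) :
    IsUnit c := by
  have h1 : (c : K)⁻¹ ∈ integralClosure ℤ_[p] K := by
    rw [← ordK_nonneg_iff p (inv_ne_zero hc), ordK_inv, h, neg_zero]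
  exact IsUnit.of_mul_eq_one (⟨_, h1⟩ : RingInt p K) (Subtype.ext (mul_inv_cancel₀ hc))

lemma mem_maximalIdeal_iff {c : RingInt p K} :
    c ∈ IsLocalRing.maximalIdeal (RingInt p K) ↔ (c : K) ∈ ordFil p K 1 := by
  rw [IsLocalRing.mem_maximalIdeal, mem_nonunits_iff]
  by_cases hc : (c : K) = 0
  · have : c = 0 := Subtype.ext hc
    subst this
    simp [zero_mem]
  · rw [mem_ordFil_of_ne hc]
    have h1 := (ordK_nonneg_iff p hc).2 c.2
    constructor
    · intro h
      have h2 : ordK p (c : K) ≠ 0 := fun h2 => h (isUnit_of_ordK_eq_zero hc h2)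
      exact_mod_cast (by omega : 1 ≤ ordK p (c : K))
    · rintro h ⟨u, rfl⟩
      rw [ordK_unit] at h
      norm_num at h

/-- Translates the conditions in the definition of the Moy–Prasad groups, with denominators cleared,
into rational indices of `ordFil`. -/
lemma le_nsmul_valK_iff {h : ℕ} (hh : 0 < h) {n : ℤ} {c : K} :
    ((n : ℤ) : WithTop ℤ) ≤ h • valK p K c ↔ c ∈ ordFil p K ((n : ℚ) / h) := by
  by_cases hc : c = 0
  · subst hc
    have : h • (⊤ : WithTop ℤ) = ⊤ := by
      obtain ⟨m, rfl⟩ := Nat.exists_eq_succ_of_ne_zero hh.ne'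
      rw [succ_nsmul]; exact WithTop.add_top _
    simp [valK, this, zero_mem]
  · rw [valK_of_ne_zero p hc, mem_ordFil_of_ne hc, div_le_iff₀ (by positivity)]
    rw [← WithTop.coe_nsmul, WithTop.coe_le_coe, nsmul_eq_mul, mul_comm]
    exact_mod_cast Iff.rfl

lemma valK_eq_zero_iff {c : K} : valK p K c = 0 ↔ c ≠ 0 ∧ ordK p c = 0 := by
  by_cases hc : c = 0
  · simp [hc, valK]
  · rw [valK_of_ne_zero p hc]; simp [hc]

lemma ordK_uniformizer {ϖ : RingInt p K} (hϖ : Irreducible ϖ) : ordK p (ϖ : K) = 1 := by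
  have h := IsDedekindDomain.HeightOneSpectrum.valuation_of_algebraMap
    (IsDiscreteValuationRing.maximalIdeal (RingInt p K)) (K := K) ϖ
  have h2 : (IsDiscreteValuationRing.maximalIdeal (RingInt p K)).intValuation ϖ =
      WithZero.exp (-1 : ℤ) :=
    IsDedekindDomain.HeightOneSpectrum.intValuation_singleton _ hϖ.ne_zero
      ((IsDiscreteValuationRing.irreducible_iff_uniformizer ϖ).1 hϖ)
  have h3 : ordK p (ϖ : K) = -(WithZero.log (WithZero.exp (-1 : ℤ))) := by
    rw [← h2, ← h]; rfl
  rw [h3, WithZero.log_exp, neg_neg]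

lemma uniformizer_ne_zero {ϖ : RingInt p K} (hϖ : Irreducible ϖ) : (ϖ : K) ≠ 0 :=
  fun h => hϖ.ne_zero (Subtype.ext h)

lemma ordK_uniformizer_zpow {ϖ : RingInt p K} (hϖ : Irreducible ϖ) (n : ℤ) :
    ordK p ((ϖ : K) ^ n) = n := by
  rw [ordK_zpow, ordK_uniformizer hϖ, mul_one]

lemma uniformizer_zpow_mem {ϖ : RingInt p K} (hϖ : Irreducible ϖ) (n : ℤ) :
    (ϖ : K) ^ n ∈ ordFil p K n := fun _ => by rw [ordK_uniformizer_zpow hϖ]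

variable (p) (K) in
lemma prime_ne_zero : (p : K) ≠ 0 := by
  have h2 : algebraMap ℚ_[p] K (p : ℚ_[p]) = (p : K) := by simp
  rw [← h2, Ne, map_eq_zero]
  exact_mod_cast (Fact.out : p.Prime).ne_zero

variable (p) (K) in
lemma one_le_ordK_prime : 1 ≤ ordK p (p : K) := by
  have hp := prime_ne_zero p K
  have h0 : 0 ≤ ordK p (p : K) := (ordK_nonneg_iff p hp).2 (natCast_mem _ p)
  by_contra h
  have h1 : ordK p (p : K) = 0 := by omega
  have h2 : (p : K)⁻¹ ∈ integralClosure ℤ_[p] K := by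
    rw [← ordK_nonneg_iff p (inv_ne_zero hp), ordK_inv, h1, neg_zero]
  rw [← spectralNorm_le_one_iff_mem p K] at h2
  have h3 : (p : K)⁻¹ = algebraMap ℚ_[p] K (p : ℚ_[p])⁻¹ := by simp
  rw [h3, spectralNorm_extends, norm_inv] at h2
  have h4 : ‖(p : ℚ_[p])‖ < 1 := Padic.norm_p_lt_one
  have h5 : 0 < ‖(p : ℚ_[p])‖ := norm_pos_iff.2 (by exact_mod_cast (Fact.out : p.Prime).ne_zero)
  exact absurd h2 (not_le.2 ((one_lt_inv₀ h5).2 h4))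

variable (p) (K) in
lemma ordK_prime : ordK p (p : K) = ramDeg p K := by
  rw [ramDeg, valK_of_ne_zero p (prime_ne_zero p K)]
  have := one_le_ordK_prime p K
  simp only [WithTop.untopD_coe]
  omega

variable (p) (K) in
lemma ramDeg_pos : 0 < ramDeg p K := by
  have := one_le_ordK_prime p K
  rw [ordK_prime] at this
  omega

lemma prime_mem_ordFil : (p : K) ∈ ordFil p K (ramDeg p K) := fun _ => by
  rw [ordK_prime]; norm_cast

/-- From a Bézout relation `a n + b p = 1`: since `v(p) > 0`, a positive valuation of `n` would give
`v(1) > 0`. -/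
lemma ordK_intCast {n : ℤ} (hn : ¬ (p : ℤ) ∣ n) : (n : K) ≠ 0 ∧ ordK p (n : K) = 0 := by
  obtain ⟨a, b, hab⟩ : IsCoprime n (p : ℤ) :=
    ((Nat.prime_iff_prime_int.1 (Fact.out : p.Prime)).coprime_iff_not_dvd.2 hn).symm
  have h1 : ¬ (n : K) ∈ ordFil p K 1 := by
    intro h
    have h2 : (1 : K) ∈ ordFil p K 1 := by
      have e : (1 : K) = (a : K) * n + (b : K) * p := by
        have := congrArg (Int.cast : ℤ → K) hab
        push_cast at this
        exact this.symm
      rw [e]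
      refine add_mem (ordFil_mul_left (intCast_mem_ordFil a) h)
        (ordFil_mul_left (intCast_mem_ordFil b) (ordFil_mono ?_ prime_mem_ordFil))
      exact_mod_cast ramDeg_pos p K
    have := h2 one_ne_zero
    rw [ordK_one] at this
    norm_num at this
  have h0 : (n : K) ≠ 0 := fun h => h1 (h ▸ zero_mem _)
  refine ⟨h0, ?_⟩
  have h2 := (ordK_nonneg_iff p h0).2 (intCast_mem _ n)
  rw [mem_ordFil_of_ne h0] at h1
  have h3 : ¬ 1 ≤ ordK p (n : K) := fun h => h1 (by exact_mod_cast h)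
  omega

lemma div_mem_ordFil {a : ℚ} {c d : K} (hc : c ∈ ordFil p K a) (_ : d ≠ 0) :
    c / d ∈ ordFil p K (a - ordK p d) := by
  rw [div_eq_mul_inv, sub_eq_add_neg]
  refine ordFil_mul hc fun _ => ?_
  rw [ordK_inv]; push_cast; exact le_rfl

lemma div_prime_mem {a : ℚ} {c : K} (hc : c ∈ ordFil p K a) :
    c / p ∈ ordFil p K (a - ramDeg p K) := by
  simpa [ordK_prime] using div_mem_ordFil hc (prime_ne_zero p K)

lemma ordK_factorial [CharZero K] (k : ℕ) :
    ordK p ((k.factorial : ℕ) : K) = ramDeg p K * padicValNat p k.factorial := by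
  obtain ⟨m, hm⟩ := pow_padicValNat_dvd (p := p) (n := k.factorial)
  have hm' : ¬ (p : ℤ) ∣ (m : ℤ) := by
    intro h
    have h : p ∣ m := by exact_mod_cast h
    have h2 : p ^ (padicValNat p k.factorial + 1) ∣ k.factorial := by
      rw [pow_succ]
      calc _ ∣ p ^ padicValNat p k.factorial * m := mul_dvd_mul_left _ h
        _ = k.factorial := hm.symm
    exact pow_succ_padicValNat_not_dvd k.factorial_ne_zero h2
  obtain ⟨h1, h2⟩ := ordK_intCast (K := K) hm'
  have e : ((k.factorial : ℕ) : K) = (p : K) ^ (padicValNat p k.factorial : ℤ) * ((m : ℤ) : K) := by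
    conv_lhs => rw [hm]
    push_cast
    simp
  rw [e, ordK_mul p (zpow_ne_zero _ (prime_ne_zero p K)) h1, h2, ordK_zpow, ordK_prime, add_zero,
    mul_comm]

section Complete

/-- By multiplicativity of the spectral norm, both sides say that `c / ϖ^n` is integral. The lemma
exists to import the completeness of `K` for the spectral norm. -/
lemma mem_ordFil_iff_spectralNorm {ϖ : RingInt p K} (hϖ : Irreducible ϖ) (n : ℕ) (c : K) :
    c ∈ ordFil p K n ↔ spectralNorm ℚ_[p] K c ≤ spectralNorm ℚ_[p] K (ϖ : K) ^ n := by
  have h0 : (ϖ : K) ^ n ≠ 0 := pow_ne_zero _ (uniformizer_ne_zero hϖ)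
  have hm := map_mul (spectralMulAlgNorm ℚ_[p] K) ((ϖ : K) ^ n) (c / (ϖ : K) ^ n)
  rw [mul_div_cancel₀ _ h0, map_pow] at hm
  simp only [spectralMulAlgNorm_def] at hm
  have hpos : 0 < spectralNorm ℚ_[p] K (ϖ : K) ^ n :=
    pow_pos (spectralNorm_zero_lt (uniformizer_ne_zero hϖ) (Algebra.IsAlgebraic.isAlgebraic _)) n
  rw [hm, mul_le_iff_le_one_right hpos, spectralNorm_le_one_iff_mem, ← mem_ordFil_zero]
  have h1 : ordK p ((ϖ : K) ^ n) = n := by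
    simpa using ordK_uniformizer_zpow hϖ (n : ℤ)
  constructor
  · intro h
    have := div_mem_ordFil h h0
    rwa [h1, Int.cast_natCast, sub_self] at this
  · intro h
    have := ordFil_mul h (d := (ϖ : K) ^ n) (b := n) fun _ => by rw [h1]; norm_cast
    rwa [div_mul_cancel₀ _ h0, zero_add] at this

lemma exists_limit_of_step (s : ℕ → K) (hs : ∀ k : ℕ, s (k + 1) - s k ∈ ordFil p K k) :
    ∃ c, ∀ k : ℕ, s k - c ∈ ordFil p K k := by
  obtain ⟨ϖ, hϖ⟩ := IsDiscreteValuationRing.exists_irreducible (RingInt p K)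
  let := spectralNorm.normedField ℚ_[p] K
  have : CompleteSpace K := spectralNorm.completeSpace ℚ_[p] K
  set r := spectralNorm ℚ_[p] K (ϖ : K) with hr
  have hnorm : ∀ (n : ℕ) (c : K), c ∈ ordFil p K n ↔ ‖c‖ ≤ r ^ n := fun n c =>
    mem_ordFil_iff_spectralNorm hϖ n c
  have hr1 : r < 1 := by
    have h1 : r ≤ 1 := (spectralNorm_le_one_iff_mem p K _).2 ϖ.2
    refine lt_of_le_of_ne h1 fun h => ?_
    have h2 : (1 : K) ∈ ordFil p K (1 : ℕ) := by
      rw [mem_ordFil_iff_spectralNorm hϖ, ← hr, h, spectralNorm_one, one_pow]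
    have := h2 one_ne_zero
    rw [ordK_one] at this
    norm_num at this
  have hsub : ∀ k m : ℕ, k ≤ m → s m - s k ∈ ordFil p K k := by
    intro k m hkm
    induction m, hkm using Nat.le_induction with
    | base => simp [zero_mem]
    | succ m hkm ih =>
      have : s (m + 1) - s k = (s (m + 1) - s m) + (s m - s k) := by ring
      rw [this]
      exact add_mem (ordFil_mono (by exact_mod_cast hkm) (hs m)) ih
  have hc : CauchySeq s := by
    refine cauchySeq_of_le_geometric r 1 hr1 fun n => ?_
    rw [dist_comm, dist_eq_norm, one_mul]
    exact (hnorm n _).1 (hs n)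
  obtain ⟨c, hc⟩ := cauchySeq_tendsto_of_complete hc
  refine ⟨c, fun k => ?_⟩
  rw [← neg_mem_iff, neg_sub, hnorm]
  have ht : Filter.Tendsto (fun m => ‖s m - s k‖) Filter.atTop (nhds ‖c - s k‖) :=
    (hc.sub_const (s k)).norm
  exact le_of_tendsto ht (Filter.eventually_atTop.2 ⟨k, fun m hm => (hnorm k _).1 (hsub k m hm)⟩)

variable (p) in
/-- Convergence of sequences in `K`. -/
def OrdTendsto (s : ℕ → K) (c : K) : Prop :=
  ∀ N : ℕ, ∃ k₀, ∀ k ≥ k₀, s k - c ∈ ordFil p K N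

lemma exists_ordTendsto (s : ℕ → K)
    (hs : ∀ N : ℕ, ∃ k₀, ∀ k ≥ k₀, s (k + 1) - s k ∈ ordFil p K N) : ∃ c, OrdTendsto p s c := by
  choose f hf using hs
  have hsub : ∀ N k m : ℕ, f N ≤ k → k ≤ m → s m - s k ∈ ordFil p K N := by
    intro N k m hk hkm
    induction m, hkm using Nat.le_induction with
    | base => simp [zero_mem]
    | succ m hkm ih =>
      have : s (m + 1) - s k = (s (m + 1) - s m) + (s m - s k) := by ring
      rw [this]
      exact add_mem (hf N m (hk.trans hkm)) ih
  -- The thresholds `f N` need not increase with `N`. Replacing them by a bound `g N` for all `f M`,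
  -- `M ≤ N`, gives a subsequence whose `N`-th step lies in `ordFil p K N`.
  have hmono : ∀ N, ∃ g : ℕ, ∀ M ≤ N, f M ≤ g := fun N =>
    ⟨(Finset.range (N + 1)).sup f, fun M hM => Finset.le_sup (by simpa using Nat.lt_succ_of_le hM)⟩
  choose g hg using hmono
  have hmin : ∀ N : ℕ, ∀ k m, f N ≤ k → f N ≤ m → s m - s k ∈ ordFil p K N := by
    intro N k m hk hm
    rcases le_total k m with h | h
    · exact hsub N k m hk h
    · rw [← neg_mem_iff, neg_sub]; exact hsub N m k hm h
  obtain ⟨c, hc⟩ := exists_limit_of_step (p := p) (fun N => s (g N)) fun N =>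
    hmin N _ _ (hg N N le_rfl) (hg (N + 1) N (Nat.le_succ N))
  refine ⟨c, fun N => ⟨g N, fun k hk => ?_⟩⟩
  have : s k - c = (s k - s (g N)) + (s (g N) - c) := by ring
  rw [this]
  exact add_mem (hmin N _ _ (hg N N le_rfl) ((hg N N le_rfl).trans hk)) (hc N)

namespace OrdTendsto

variable {s t : ℕ → K} {c d : K}

lemma eventually (h : OrdTendsto p s c) (a : ℚ) : ∃ k₀, ∀ k ≥ k₀, s k - c ∈ ordFil p K a := by
  obtain ⟨N, hN⟩ := exists_nat_ge a
  obtain ⟨k₀, h⟩ := h N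
  exact ⟨k₀, fun k hk => ordFil_mono hN (h k hk)⟩

lemma unique (h : OrdTendsto p s c) (h' : OrdTendsto p s d) : c = d := by
  rw [← sub_eq_zero]
  refine eq_zero_of_forall_ordFil (p := p) fun N => ?_
  obtain ⟨k₀, h⟩ := h N
  obtain ⟨k₁, h'⟩ := h' N
  have e : c - d = (s (max k₀ k₁) - d) - (s (max k₀ k₁) - c) := by ring
  rw [e]
  exact sub_mem (h' _ (le_max_right _ _)) (h _ (le_max_left _ _))

lemma const (c : K) : OrdTendsto p (fun _ => c) c := fun _ => ⟨0, fun _ _ => by simp [zero_mem]⟩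

lemma add (h : OrdTendsto p s c) (h' : OrdTendsto p t d) :
    OrdTendsto p (fun k => s k + t k) (c + d) := by
  intro N
  obtain ⟨k₀, h⟩ := h N
  obtain ⟨k₁, h'⟩ := h' N
  refine ⟨max k₀ k₁, fun k hk => ?_⟩
  have e : s k + t k - (c + d) = (s k - c) + (t k - d) := by ring
  rw [e]
  exact add_mem (h _ (le_of_max_le_left hk)) (h' _ (le_of_max_le_right hk))

lemma exists_mem (c : K) : ∃ a : ℚ, a ≤ 0 ∧ c ∈ ordFil p K a :=
  ⟨min 0 (ordK p c), min_le_left _ _, fun _ => min_le_right _ _⟩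

lemma mul (h : OrdTendsto p s c) (h' : OrdTendsto p t d) :
    OrdTendsto p (fun k => s k * t k) (c * d) := by
  intro N
  obtain ⟨a, ha, hca⟩ := exists_mem (p := p) c
  obtain ⟨b, hb, hdb⟩ := exists_mem (p := p) d
  obtain ⟨k₀, h⟩ := h.eventually (N - b)
  obtain ⟨k₁, h'⟩ := h'.eventually (N - a)
  refine ⟨max k₀ k₁, fun k hk => ?_⟩
  have h1 := h _ (le_of_max_le_left hk)
  have h2 := h' _ (le_of_max_le_right hk)
  have e : s k * t k - c * d = (s k - c) * (t k - d) + c * (t k - d) + (s k - c) * d := by ring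
  rw [e]
  have hN : (0 : ℚ) ≤ N := Nat.cast_nonneg N
  refine add_mem (add_mem ?_ ?_) ?_
  · exact ordFil_mono (by linarith) (ordFil_mul h1 h2)
  · exact ordFil_mono (by linarith) (ordFil_mul hca h2)
  · exact ordFil_mono (by linarith) (ordFil_mul h1 hdb)

lemma const_mul (c : K) (h' : OrdTendsto p t d) :
    OrdTendsto p (fun k => c * t k) (c * d) := (const c).mul h'

lemma mem {a : ℚ} (h : OrdTendsto p s c) (k₁ : ℕ) (hs : ∀ k ≥ k₁, s k ∈ ordFil p K a) :
    c ∈ ordFil p K a := by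
  obtain ⟨k₀, h⟩ := h.eventually a
  have e : c = s (max k₀ k₁) - (s (max k₀ k₁) - c) := by ring
  rw [e]
  exact sub_mem (hs _ (le_max_right _ _)) (h _ (le_max_left _ _))

end OrdTendsto

end Complete

end OrdK

/-! ### The height filtration on matrices and first-order estimates in it. -/

section MatFil

variable (p : ℕ) [Fact p.Prime] {K : Type*} [Field K] [Algebra ℚ_[p] K]
  [FiniteDimensional ℚ_[p] K] [Algebra ℤ_[p] K] [IsScalarTower ℤ_[p] ℚ_[p] K]
  {J : Type*} [Fintype J] [DecidableEq J]

variable (K) in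
/-- The Moy–Prasad filtration on the matrix algebra, with respect to a basis whose elements have
heights `ℓ`. -/
def matFil (h : ℕ) (ℓ : J → ℚ) (n : ℤ) : AddSubgroup (Matrix J J K) where
  carrier := {M | ∀ i j, M i j ∈ ordFil p K ((n - ℓ i + ℓ j) / h)}
  zero_mem' _ _ := zero_mem _
  add_mem' ha hb i j := add_mem (ha i j) (hb i j)
  neg_mem' ha i j := neg_mem (ha i j)

variable {p} {h : ℕ} {ℓ : J → ℚ}

lemma matFil_mono {m n : ℤ} (hmn : m ≤ n) {M : Matrix J J K} (hM : M ∈ matFil p K h ℓ n) :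
    M ∈ matFil p K h ℓ m := fun i j => ordFil_mono (by gcongr) (hM i j)

/-- In each product of entries the height of the middle index cancels. -/
lemma matFil_mul {m n : ℤ} {M N : Matrix J J K} (hM : M ∈ matFil p K h ℓ m)
    (hN : N ∈ matFil p K h ℓ n) : M * N ∈ matFil p K h ℓ (m + n) := by
  intro i j
  rw [Matrix.mul_apply]
  refine sum_mem fun l _ => ?_
  refine ordFil_mono (le_of_eq ?_) (ordFil_mul (hM i l) (hN l j))
  push_cast
  ring

lemma matFil_mul_of_eq {m n r : ℤ} {M N : Matrix J J K} (hM : M ∈ matFil p K h ℓ m)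
    (hN : N ∈ matFil p K h ℓ n) (hr : r ≤ m + n) : M * N ∈ matFil p K h ℓ r :=
  matFil_mono hr (matFil_mul hM hN)

lemma one_mem_matFil : (1 : Matrix J J K) ∈ matFil p K h ℓ 0 := by
  intro i j
  rw [Matrix.one_apply]
  split_ifs with hij
  · subst hij; simpa using one_mem_ordFil
  · exact zero_mem _

lemma matFil_pow {n : ℤ} {M : Matrix J J K} (hM : M ∈ matFil p K h ℓ n) (k : ℕ) :
    M ^ k ∈ matFil p K h ℓ (k * n) := by
  induction k with
  | zero => simpa using one_mem_matFil
  | succ k ih =>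
    rw [pow_succ]
    exact matFil_mul_of_eq ih hM (by push_cast; linarith)

lemma matFil_smul {n : ℤ} {a : ℚ} {c : K} (hc : c ∈ ordFil p K a) {M : Matrix J J K}
    (hM : M ∈ matFil p K h ℓ n) (hh : 0 < h) {r : ℤ} (hr : (r : ℚ) ≤ n + h * a) :
    c • M ∈ matFil p K h ℓ r := by
  intro i j
  rw [Matrix.smul_apply, smul_eq_mul]
  refine ordFil_mono ?_ (ordFil_mul hc (hM i j))
  have hh' : (0 : ℚ) < h := by exact_mod_cast hh
  rw [div_le_iff₀ hh', add_mul, div_mul_cancel₀ _ hh'.ne']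
  linarith

lemma matFil_zero_smul {n : ℤ} {c : K} (hc : c ∈ ordFil p K 0) {M : Matrix J J K}
    (hM : M ∈ matFil p K h ℓ n) (hh : 0 < h) : c • M ∈ matFil p K h ℓ n :=
  matFil_smul hc hM hh (by simp)

lemma matFil_prime_smul {n : ℤ} {M : Matrix J J K}
    (hM : M ∈ matFil p K h ℓ n) (hh : 0 < h) : (p : K) • M ∈ matFil p K h ℓ (n + h * ramDeg p K) :=
  matFil_smul prime_mem_ordFil hM hh (by simp)

lemma matFil_prime_inv_smul {n : ℤ} {M : Matrix J J K}
    (hM : M ∈ matFil p K h ℓ n) (hh : 0 < h) :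
    (p : K)⁻¹ • M ∈ matFil p K h ℓ (n - h * ramDeg p K) := by
  refine matFil_smul (a := -ramDeg p K) ?_ hM hh (by push_cast; linarith)
  have := div_prime_mem (p := p) (one_mem_ordFil (K := K))
  rwa [one_div, zero_sub] at this

lemma matFil_prime_pow_inv_smul {n : ℤ} {M : Matrix J J K}
    (hM : M ∈ matFil p K h ℓ n) (hh : 0 < h) (k : ℕ) :
    ((p : K) ^ k)⁻¹ • M ∈ matFil p K h ℓ (n - k * (h * ramDeg p K)) := by
  induction k with
  | zero => simpa using hM
  | succ k ih =>
    rw [pow_succ', mul_inv, ← smul_smul]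
    refine matFil_mono (le_of_eq ?_) (matFil_prime_inv_smul ih hh)
    push_cast; ring

lemma eq_zero_of_forall_matFil (hh : 0 < h) {M : Matrix J J K}
    (hM : ∀ n : ℕ, M ∈ matFil p K h ℓ n) :
    M = 0 := by
  ext i j
  refine eq_zero_of_forall_ordFil (p := p) fun n => ?_
  obtain ⟨N, hN⟩ := exists_nat_ge (h * n + ℓ i - ℓ j)
  refine ordFil_mono ?_ (hM N i j)
  have hh' : (0 : ℚ) < h := by exact_mod_cast hh
  rw [le_div_iff₀ hh']
  push_cast
  linarith

lemma exists_mem_matFil (hh : 0 < h) (M : Matrix J J K) : ∃ n : ℤ, M ∈ matFil p K h ℓ n := by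
  have h1 : ∀ i j, ∃ n : ℤ, ∀ m ≤ n, M i j ∈ ordFil p K ((m - ℓ i + ℓ j) / h) := by
    intro i j
    obtain ⟨n, hn⟩ := exists_int_lt (h * ordK p (M i j) + ℓ i - ℓ j : ℚ)
    refine ⟨n, fun m hm _ => ?_⟩
    have hh' : (0 : ℚ) < h := by exact_mod_cast hh
    rw [div_le_iff₀ hh']
    have : (m : ℚ) ≤ n := by exact_mod_cast hm
    linarith
  choose f hf using h1
  obtain ⟨n, hn⟩ : ∃ n : ℤ, ∀ i j, n ≤ f i j := by
    by_cases hJ : Nonempty J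
    · refine ⟨Finset.univ.inf' Finset.univ_nonempty fun ij : J × J => f ij.1 ij.2, fun i j => ?_⟩
      exact Finset.inf'_le (f := fun ij : J × J => f ij.1 ij.2) (Finset.mem_univ (i, j))
    · exact ⟨0, fun i => (hJ ⟨i⟩).elim⟩
  exact ⟨n, fun i j => hf i j n (hn i j)⟩

/-- The inverse of `1 + a` lies in `1 + E_n` if `a` lies in `E_n`, where `n ≥ 1`. -/
lemma inv_sub_one_mem_matFil (hh : 0 < h) {n : ℤ} (hn : 1 ≤ n) {M N : Matrix J J K}
    (hM : M - 1 ∈ matFil p K h ℓ n) (hMN : M * N = 1) : N - 1 ∈ matFil p K h ℓ n := by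
  have e : N - 1 = -((M - 1) * N) := by rw [sub_mul, hMN, one_mul, neg_sub]
  have e' : N = 1 - (M - 1) * N := by rw [sub_mul, hMN, one_mul]; abel
  -- The inverse lies in some `E_m`, possibly with `m < 0`. The identity `N = 1 - (M - 1) N` raises
  -- `m` by one as long as `m < 0`, so level `0` is reached.
  have key : ∀ k : ℕ, ∀ m : ℤ, m + k = 0 → N ∈ matFil p K h ℓ m → N ∈ matFil p K h ℓ 0 := by
    intro k
    induction k with
    | zero =>
      intro m hm h
      obtain rfl : m = 0 := by simpa using hm
      exact h
    | succ k ih =>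
      intro m hm hN
      refine ih (m + 1) (by push_cast at hm; linarith) ?_
      rw [e']
      exact sub_mem (matFil_mono (by push_cast at hm; omega) one_mem_matFil)
        (matFil_mul_of_eq hM hN (by omega))
  have h0 : N ∈ matFil p K h ℓ 0 := by
    obtain ⟨m, hm⟩ := exists_mem_matFil (p := p) (ℓ := ℓ) hh N
    rcases le_total 0 m with h1 | h1
    · exact matFil_mono h1 hm
    · exact key (-m).toNat m (by omega) hm
  rw [e]
  exact neg_mem (matFil_mul_of_eq hM h0 (by omega))

lemma mem_matFil_zero_of_sub_one {n : ℤ} (hn : 0 ≤ n) {M : Matrix J J K}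
    (hM : M - 1 ∈ matFil p K h ℓ n) : M ∈ matFil p K h ℓ 0 := by
  rw [← sub_add_cancel M 1]
  exact add_mem (matFil_mono hn hM) one_mem_matFil

/-- `M N - 1 ≡ (M - 1) + (N - 1)`. -/
lemma mul_sub_one_mem_matFil {m n r : ℤ} {M N : Matrix J J K}
    (hM : M - 1 ∈ matFil p K h ℓ m) (hN : N - 1 ∈ matFil p K h ℓ n) (hr : r ≤ m + n) :
    (M * N - 1) - ((M - 1) + (N - 1)) ∈ matFil p K h ℓ r := by
  have e : (M * N - 1) - ((M - 1) + (N - 1)) = (M - 1) * (N - 1) := by noncomm_ring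
  rw [e]
  exact matFil_mul_of_eq hM hN hr

/-- `M N M⁻¹ N⁻¹ - 1 ≡ [M - 1, N - 1]`. -/
lemma comm_sub_one_mem_matFil (hh : 0 < h) {m n : ℤ} (hm : 1 ≤ m) (hn : 1 ≤ n)
    {M N M' N' : Matrix J J K} (hM : M - 1 ∈ matFil p K h ℓ m) (hN : N - 1 ∈ matFil p K h ℓ n)
    (hM' : M * M' = 1) (hN' : N * N' = 1) :
    (M * N * M' * N' - 1) - ((M - 1) * (N - 1) - (N - 1) * (M - 1)) ∈
      matFil p K h ℓ (m + n + 1) := by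
  -- `M N M⁻¹ N⁻¹ - 1` equals `[M - 1, N - 1]` times `M⁻¹ N⁻¹`, and the last factor is in `1 + E_1`.
  have e : (M * N * M' * N' - 1) - ((M - 1) * (N - 1) - (N - 1) * (M - 1)) =
      ((M - 1) * (N - 1) - (N - 1) * (M - 1)) * (M' * N' - 1) := by
    have h1 : (M - 1) * (N - 1) - (N - 1) * (M - 1) = M * N - N * M := by noncomm_ring
    rw [h1]
    have h2 : N * M * (M' * N') = 1 := by
      rw [mul_assoc, ← mul_assoc M, hM', one_mul, hN']
    rw [mul_sub, sub_mul, h2, mul_one]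
    noncomm_ring
  rw [e]
  have h1 : M' - 1 ∈ matFil p K h ℓ 1 := matFil_mono hm (inv_sub_one_mem_matFil hh hm hM hM')
  have h2 : N' - 1 ∈ matFil p K h ℓ 1 := matFil_mono hn (inv_sub_one_mem_matFil hh hn hN hN')
  have h3 : M' * N' - 1 ∈ matFil p K h ℓ 1 := by
    have := add_mem (mul_sub_one_mem_matFil h1 h2 (r := 1) (by norm_num)) (add_mem h1 h2)
    rwa [sub_add_cancel] at this
  refine matFil_mul_of_eq (sub_mem (matFil_mul hM hN) ?_) h3 le_rfl
  rw [add_comm]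
  exact matFil_mul hN hM

lemma pow_sub_pow_mem_matFil {m q : ℤ} {a b : Matrix J J K} (ha : a ∈ matFil p K h ℓ m)
    (hb : b ∈ matFil p K h ℓ m) (hab : b - a ∈ matFil p K h ℓ q) (k : ℕ) :
    b ^ (k + 1) - a ^ (k + 1) ∈ matFil p K h ℓ (q + k * m) := by
  induction k with
  | zero => simpa using hab
  | succ k ih =>
    have e : b ^ (k + 1 + 1) - a ^ (k + 1 + 1) =
        b ^ (k + 1) * (b - a) + (b ^ (k + 1) - a ^ (k + 1)) * a := by
      rw [pow_succ b (k + 1), pow_succ a (k + 1)]; noncomm_ring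
    rw [e]
    refine add_mem (matFil_mul_of_eq (matFil_pow hb _) hab (by push_cast; linarith))
      (matFil_mul_of_eq ih ha (by push_cast; linarith))

/-- Subtract the binomial expansions of both powers. The terms of degree strictly between `1` and
`p` carry a factor `p`, worth `he`, and an extra factor from `E_m`. The term of degree `p` has no
factor `p`, but lies in `E_{q+(p-1)m}`, and `(p - 1) m ≥ (he + 1) m ≥ he + m`. -/
lemma add_one_pow_prime_sub {m q : ℤ} (hm : 1 ≤ m) (hh : 0 < h)
    (hp : h * ramDeg p K < p - 1) {a b : Matrix J J K}
    (ha : a ∈ matFil p K h ℓ m) (hb : b ∈ matFil p K h ℓ m) (hab : b - a ∈ matFil p K h ℓ q) :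
    ((1 + b) ^ p - (1 + a) ^ p) - (p : K) • (b - a) ∈ matFil p K h ℓ (q + h * ramDeg p K + m) := by
  have hpp : p.Prime := Fact.out
  have hexp : ∀ c : Matrix J J K, (1 + c) ^ p =
      1 + ∑ k ∈ Finset.range p, ((p.choose (k + 1) : ℕ) : K) • c ^ (k + 1) := by
    intro c
    rw [add_comm 1 c, (Commute.one_right c).add_pow, Finset.sum_range_succ']
    simp only [one_pow, mul_one, pow_zero, Nat.choose_zero_right, Nat.cast_one]
    rw [add_comm]
    congr 1
    refine Finset.sum_congr rfl fun k _ => ?_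
    rw [Nat.cast_smul_eq_nsmul, nsmul_eq_mul, (Nat.cast_commute _ _).eq]
  -- Writing `p = t + 1` allows the terms of degree `0` and `1` to be split off the sum; degree `k +
  -- 2` with `k < t` remains.
  obtain ⟨t, ht⟩ : ∃ t, p = t + 1 := ⟨p - 1, by have := hpp.pos; omega⟩
  have e : ((1 + b) ^ p - (1 + a) ^ p) - (p : K) • (b - a) =
      ∑ k ∈ Finset.range t, ((p.choose (k + 2) : ℕ) : K) • (b ^ (k + 2) - a ^ (k + 2)) := by
    rw [hexp, hexp, show Finset.range p = Finset.range (t + 1) by rw [← ht],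
      Finset.sum_range_succ', Finset.sum_range_succ']
    simp only [zero_add, Nat.choose_one_right, pow_one, smul_sub, Finset.sum_sub_distrib]
    abel
  rw [e]
  refine sum_mem fun k hk => ?_
  have hk : k < t := Finset.mem_range.1 hk
  have hd := pow_sub_pow_mem_matFil ha hb hab (k + 1)
  rcases (show k + 2 < p ∨ k + 2 = p by omega) with h1 | h1
  · obtain ⟨c, hc⟩ := hpp.dvd_choose_self (k := k + 2) (by omega) h1
    rw [hc, Nat.cast_mul, mul_comm (p : K), ← smul_smul]
    refine matFil_zero_smul (natCast_mem_ordFil (p := p) (K := K) c) ?_ hh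
    refine matFil_mono ?_ (matFil_prime_smul hd hh)
    have : m ≤ ((k + 1 : ℕ) : ℤ) * m := le_mul_of_one_le_left (by omega) (by push_cast; omega)
    linarith
  · have h2 : p.choose (k + 2) = 1 := by rw [h1, Nat.choose_self]
    rw [h2, Nat.cast_one, one_smul]
    refine matFil_mono ?_ hd
    have h3 : (h : ℤ) * (ramDeg p K : ℤ) + 1 ≤ ((k + 1 : ℕ) : ℤ) := by
      have : h * ramDeg p K + 1 ≤ k + 1 := by omega
      exact_mod_cast this
    have h4 : (0 : ℤ) ≤ (h : ℤ) * (ramDeg p K : ℤ) := by positivity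
    have h5 := mul_le_mul_of_nonneg_right h3 (by omega : (0 : ℤ) ≤ m)
    have h6 := mul_le_mul_of_nonneg_left hm h4
    linarith

lemma pow_prime_sub_one {n : ℤ} (hn : 1 ≤ n) (hh : 0 < h)
    (hp : h * ramDeg p K < p - 1) {M : Matrix J J K} (hM : M - 1 ∈ matFil p K h ℓ n) :
    (M ^ p - 1) - (p : K) • (M - 1) ∈ matFil p K h ℓ (n + h * ramDeg p K + n) := by
  have := add_one_pow_prime_sub hn hh hp (zero_mem _) hM (by simpa using hM)
  simpa using this

/-- The `p`-adic valuation of `k!` is small compared with `k`. -/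
lemma factorial_bound (hp : h * ramDeg p K < p - 1) {n : ℤ} (hn : 1 ≤ n) {k : ℕ} (hk : 2 ≤ k) :
    n + 1 ≤ k * n - h * ramDeg p K * padicValNat p k.factorial := by
  -- Legendre's bound `(p - 1) v_p(k!) < k`, combined with `p - 1 ≥ he + 1`, gives `k ≥ (he + 1)
  -- v_p(k!) + 1`.
  have h1 := sub_one_mul_padicValNat_factorial_lt_of_ne_zero p (n := k) (by omega)
  set v := padicValNat p k.factorial
  have h2 : (h * ramDeg p K + 1) * v ≤ (p - 1) * v := Nat.mul_le_mul_right v (by omega)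
  have h3 : (h * ramDeg p K + 1) * v + 1 ≤ k := by omega
  have h4 : (h : ℤ) * ramDeg p K * v + v + 1 ≤ k := by
    have : ((h * ramDeg p K + 1) * v + 1 : ℕ) ≤ (k : ℤ) := by exact_mod_cast h3
    push_cast at this; linarith
  rcases Nat.eq_zero_or_pos v with hv | hv
  · rw [hv]; push_cast
    have : (2 : ℤ) ≤ k := by exact_mod_cast hk
    nlinarith
  · have hv' : (1 : ℤ) ≤ v := by exact_mod_cast hv
    have : (2 : ℤ) ≤ k := by exact_mod_cast hk
    nlinarith

/-- Truncated exponentials are `1 + M` up to a deeper error: by `factorial_bound` each term `M^k /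
k!` with `k ≥ 2` lies in `E_{n+1}`. The `m + 2` terms ensure that degrees `0` and `1` are present to
be subtracted. -/
lemma exp_sub_mem_matFil [CharZero K] (hh : 0 < h) (hp : h * ramDeg p K < p - 1) {n : ℤ}
    (hn : 1 ≤ n) {M : Matrix J J K} (hM : M ∈ matFil p K h ℓ n) (m : ℕ) :
    (∑ k ∈ Finset.range (m + 2), ((k.factorial : ℕ) : K)⁻¹ • M ^ k) - 1 - M ∈
      matFil p K h ℓ (n + 1) := by
  have e : (∑ k ∈ Finset.range (m + 2), ((k.factorial : ℕ) : K)⁻¹ • M ^ k) - 1 - M =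
      ∑ k ∈ Finset.range m, (((k + 2).factorial : ℕ) : K)⁻¹ • M ^ (k + 2) := by
    rw [Finset.sum_range_succ', Finset.sum_range_succ']
    simp
  rw [e]
  refine sum_mem fun k _ => ?_
  refine matFil_smul (a := -(ordK p (((k + 2).factorial : ℕ) : K))) (fun _ => ?_)
    (matFil_pow hM (k + 2)) hh ?_
  · rw [ordK_inv]; push_cast; exact le_rfl
  · have := factorial_bound (p := p) (K := K) hp hn (k := k + 2) (by omega)
    rw [ordK_factorial]
    have h2 : ((n + 1 : ℤ) : ℚ) ≤ (((k + 2 : ℕ) * n -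
      h * ramDeg p K * padicValNat p (k + 2).factorial : ℤ) : ℚ) := by exact_mod_cast this
    push_cast at h2 ⊢
    linarith

end MatFil

/-! ### Faithful representations adapted to the Chevalley basis. -/

section Corep

variable (p : ℕ) [Fact p.Prime] {K : Type*} [Field K] [CharZero K] [Algebra ℚ_[p] K]
  [FiniteDimensional ℚ_[p] K] [Algebra ℤ_[p] K] [IsScalarTower ℤ_[p] ℚ_[p] K]
  {A : Type*} [CommRing A] [HopfAlgebra K A]
  {X Y : Type*} [AddCommGroup X] [AddCommGroup Y]
  {ι : Type*} [Fintype ι] {P : RootPairing ι ℤ X Y} [P.IsReduced] {b : P.Base}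
  {π : A →ₐc[K] AddMonoidAlgebra K X}

/-- A faithful matrix representation of `G`, on which the torus acts diagonally and the Chevalley
basis acts by integral matrices, and whose weights include the roots and the fundamental weights;
together with a height function on the weights. -/
structure ChevalleyRep (S : ChevalleySystem P b π) (J : Type*) [Fintype J] [DecidableEq J] where
  /-- The matrix coefficients. -/
  g : J → J → A
  comul_g : ∀ i j, Coalgebra.comul (R := K) (g i j) = ∑ k, g i k ⊗ₜ[K] g k j
  counit_g : ∀ i j, Coalgebra.counit (R := K) (g i j) = if i = j then 1 else 0
  adjoin_g : Algebra.adjoin K (Set.range fun ij : J × J => g ij.1 ij.2) = ⊤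
  /-- The weights. -/
  wt : J → X
  torus_g : ∀ i j, π (g i j) = if i = j then AddMonoidAlgebra.single (wt i) 1 else 0
  integral : ∀ s i j,
    Coalgebra.counit (R := K) ((S.basis s : Derivation K A A) (g i j)) ∈ ordFil p K 0
  root_mem : ∀ i, ∃ j, wt j = P.root i
  fund_mem : ∀ i : b.support, ∃ j, P.toLinearMap (wt j) (P.coroot i) = 1 ∧
    ∀ i' : b.support, i' ≠ i → P.toLinearMap (wt j) (P.coroot i') = 0
  /-- The height function. -/
  ht : X →+ ℚ
  ht_root : ∀ i, ht (P.root i) = b.height i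

end Corep

/-- The degree of an element of the Chevalley basis. -/
noncomputable def chevDeg {ι X Y : Type*} [AddCommGroup X] [AddCommGroup Y] {P : RootPairing ι ℤ X Y}
    (b : P.Base) : b.support ⊕ ι → ℤ :=
  Sum.elim (fun _ => 0) b.height

/-! ### Matrices of points of `G` and of elements of `Lie G`. -/

namespace ChevalleyRep

variable {p : ℕ} [Fact p.Prime] {K : Type*} [Field K] [CharZero K] [Algebra ℚ_[p] K]
  [FiniteDimensional ℚ_[p] K] [Algebra ℤ_[p] K] [IsScalarTower ℤ_[p] ℚ_[p] K]
  {A : Type*} [CommRing A] [HopfAlgebra K A]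
  {X Y : Type*} [AddCommGroup X] [AddCommGroup Y]
  {ι : Type*} [Fintype ι] {P : RootPairing ι ℤ X Y} [P.IsReduced] {b : P.Base}
  {π : A →ₐc[K] AddMonoidAlgebra K X} {S : ChevalleySystem P b π}
  {J : Type*} [Fintype J] [DecidableEq J] (R : ChevalleyRep p S J)

/-- The matrix of an element of `G(K)`. -/
def mat : Pts K A K →* Matrix J J K where
  toFun z := Matrix.of fun i j => z.ofConv (R.g i j)
  map_one' := by
    ext i j
    have : (1 : Pts K A K).ofConv (R.g i j) = Coalgebra.counit (R := K) (R.g i j) := rfl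
    rw [Matrix.of_apply, this, R.counit_g, Matrix.one_apply]
  map_mul' z w := by
    ext i j
    have : (z * w).ofConv (R.g i j) = Algebra.TensorProduct.lift z.ofConv w.ofConv
      (fun _ _ => Commute.all _ _) (Coalgebra.comul (R := K) (R.g i j)) :=
      AlgHom.convMul_apply z w _
    rw [Matrix.of_apply, this, R.comul_g, map_sum, Matrix.mul_apply]
    simp

lemma mat_apply (z : Pts K A K) (i j : J) : R.mat z i j = z.ofConv (R.g i j) := rfl

lemma mat_injective : Function.Injective R.mat := by
  intro z w h
  apply WithConv.ofConv_injective
  refine AlgHom.ext_of_adjoin_eq_top R.adjoin_g ?_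
  rintro _ ⟨⟨i, j⟩, rfl⟩
  exact congrFun (congrFun h i) j

lemma mat_mul_inv (z : Pts K A K) : R.mat z * R.mat z⁻¹ = 1 := by
  rw [← map_mul, mul_inv_cancel, map_one]

/-- The matrix of an element of the Lie algebra. -/
noncomputable def lmat : LieG K A →ₗ[K] Matrix J J K where
  toFun D := Matrix.of fun i j => Coalgebra.counit (R := K) ((D : Derivation K A A) (R.g i j))
  map_add' D E := by
    ext i j
    have h : ((D + E : LieG K A) : Derivation K A A) (R.g i j) =
        (D : Derivation K A A) (R.g i j) + (E : Derivation K A A) (R.g i j) := rfl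
    simp
  map_smul' c D := by
    ext i j
    have h : ((c • D : LieG K A) : Derivation K A A) (R.g i j) =
        c • (D : Derivation K A A) (R.g i j) := rfl
    simp

lemma lmat_apply (D : LieG K A) (i j : J) :
    R.lmat D i j = Coalgebra.counit (R := K) ((D : Derivation K A A) (R.g i j)) := rfl

lemma _root_.LieG.apply_eq (D : LieG K A) (f : A) : (D : Derivation K A A) f =
    TensorProduct.rid K A ((Coalgebra.counit (R := K) (A := A) ∘ₗ
        ((D : Derivation K A A) : A →ₗ[K] A)).lTensor A (Coalgebra.comul (R := K) f)) := by
  rw [LinearMap.lTensor_comp, LinearMap.comp_apply, ← D.2 f, Coalgebra.lTensor_counit_comul]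
  simp

lemma deriv_g (D : LieG K A) (i j : J) :
    (D : Derivation K A A) (R.g i j) = ∑ k, R.lmat D k j • R.g i k := by
  rw [LieG.apply_eq, R.comul_g, map_sum, map_sum]
  simp [lmat_apply]

lemma lmat_lie (D E : LieG K A) : R.lmat ⁅D, E⁆ = R.lmat D * R.lmat E - R.lmat E * R.lmat D := by
  have key : ∀ (D E : LieG K A) (i j : J), Coalgebra.counit (R := K)
      ((D : Derivation K A A) ((E : Derivation K A A) (R.g i j))) =
      (R.lmat D * R.lmat E) i j := by
    intro D E i j
    rw [R.deriv_g E, map_sum, map_sum, Matrix.mul_apply]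
    refine Finset.sum_congr rfl fun k _ => ?_
    rw [Derivation.map_smul, map_smul, smul_eq_mul, mul_comm, R.lmat_apply D, R.lmat_apply E]
  ext i j
  have h : ((⁅D, E⁆ : LieG K A) : Derivation K A A) (R.g i j) =
      (D : Derivation K A A) ((E : Derivation K A A) (R.g i j)) -
      (E : Derivation K A A) ((D : Derivation K A A) (R.g i j)) := Derivation.commutator_apply _
  rw [lmat_apply, h, map_sub, key, key, Matrix.sub_apply]

lemma mat_torusPt (τ : Multiplicative X →* Kˣ) :
    R.mat (torusPt π τ) = Matrix.diagonal fun j => (τ (Multiplicative.ofAdd (R.wt j)) : K) := by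
  ext i j
  have : (torusPt π τ).ofConv (R.g i j) =
      AddMonoidAlgebra.lift K K X ((Units.coeHom K).comp τ) (π (R.g i j)) := rfl
  rw [mat_apply, this, R.torus_g, Matrix.diagonal_apply]
  split_ifs with h
  · simp [AddMonoidAlgebra.lift_single]
  · simp

lemma lmat_H (i : ι) : R.lmat (S.H i) =
    Matrix.diagonal fun j => ((P.toLinearMap (R.wt j) (P.coroot i) : ℤ) : K) := by
  ext k j
  rw [lmat_apply, S.H_spec i, R.torus_g, Matrix.diagonal_apply]
  split_ifs with h
  · rw [AddMonoidAlgebra.coeff_single, Finsupp.sum_single_index (by simp), one_mul]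
  · simp

/-- Points of the torus separate characters: choose a functional `λ` on `X` with `λ(x) ≠ 0` and take
`χ ↦ 2^{λ(χ)}`, where `2` has infinite order because the characteristic is zero. -/
lemma _root_.exists_torus_ne_one [Module.Free ℤ X] [Module.Finite ℤ X] {x : X} (hx : x ≠ 0) :
    ∃ τ : Multiplicative X →* Kˣ, τ (Multiplicative.ofAdd x) ≠ 1 := by
  obtain ⟨lam, hlam⟩ : ∃ lam : X →ₗ[ℤ] ℤ, lam x ≠ 0 := by
    by_contra! h
    exact hx ((Module.forall_dual_apply_eq_zero_iff ℤ x).1 h)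
  let two : Kˣ := Units.mk0 2 two_ne_zero
  refine ⟨(zpowersHom Kˣ two).comp (AddMonoidHom.toMultiplicative lam.toAddMonoidHom), ?_⟩
  intro h
  have h1 : (2 : K) ^ (lam x) = 1 := by
    have h2 := congrArg (Units.val) h
    simpa [zpowersHom_apply, two] using h2
  rcases lt_or_gt_of_ne hlam with h2 | h2
  · have h3 : (2 : K) ^ ((-lam x).toNat) = 1 := by
      rw [← zpow_natCast, Int.toNat_of_nonneg (by omega), zpow_neg, h1, inv_one]
    have h4 : (2 : ℕ) ^ ((-lam x).toNat) = 1 := by exact_mod_cast h3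
    rw [Nat.pow_eq_one] at h4
    omega
  · have h3 : (2 : K) ^ ((lam x).toNat) = 1 := by
      rw [← zpow_natCast, Int.toNat_of_nonneg (by omega), h1]
    have h4 : (2 : ℕ) ^ ((lam x).toNat) = 1 := by exact_mod_cast h3
    rw [Nat.pow_eq_one] at h4
    omega

lemma rightTranslate_g (z : Pts K A K) (i j : J) :
    rightTranslate z (R.g i j) = ∑ k, R.mat z k j • R.g i k := by
  have : rightTranslate z (R.g i j) = (Algebra.TensorProduct.rid K K A)
    ((Algebra.TensorProduct.map (AlgHom.id K A) z.ofConv) (Coalgebra.comul (R := K) (R.g i j))) :=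
    rfl
  rw [this, R.comul_g, map_sum, map_sum]
  simp only [Algebra.TensorProduct.map_tmul, AlgHom.id_apply, Algebra.TensorProduct.rid_tmul]
  rfl

lemma rightTranslate_torusPt (τ : Multiplicative X →* Kˣ) (i j : J) :
    rightTranslate (torusPt π τ) (R.g i j) =
      (τ (Multiplicative.ofAdd (R.wt j)) : K) • R.g i j := by
  rw [R.rightTranslate_g, R.mat_torusPt, Finset.sum_eq_single j]
  · rw [Matrix.diagonal_apply_eq]
  · intro k _ hk
    rw [Matrix.diagonal_apply_ne _ hk, zero_smul]
  · simp

/-- Apply the counit to the weight relation for `X_α` on the coefficient `g i j`. The result is `wt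
i (τ) = (α + wt j)(τ)`, times the nonzero entry, for all `τ`; and torus points separate characters.
-/
lemma wt_eq_of_lmat_ne_zero [Module.Free ℤ X] [Module.Finite ℤ X] {α : ι} {i j : J}
    (h : R.lmat (S.basis (Sum.inr α)) i j ≠ 0) : R.wt i = P.root α + R.wt j := by
  by_contra hne
  obtain ⟨τ, hτ⟩ := exists_torus_ne_one (K := K) (sub_ne_zero.2 hne)
  have h1 := congrArg (Coalgebra.counit (R := K)) (S.weight α τ (R.g i j))
  simp only [R.rightTranslate_torusPt, R.deriv_g, map_sum, map_smul, R.counit_g, smul_eq_mul,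
    mul_ite, mul_one, mul_zero, Finset.sum_ite_eq, Finset.mem_univ, if_true] at h1
  rw [Derivation.map_smul, map_smul, ← R.lmat_apply, smul_eq_mul] at h1
  apply hτ
  have h2 : (τ (Multiplicative.ofAdd (R.wt i)) : K) =
      τ (Multiplicative.ofAdd (P.root α)) * τ (Multiplicative.ofAdd (R.wt j)) := by
    apply mul_left_cancel₀ h
    linear_combination h1
  have h3 : τ (Multiplicative.ofAdd (R.wt i)) =
      τ (Multiplicative.ofAdd (P.root α)) * τ (Multiplicative.ofAdd (R.wt j)) := Units.ext h2
  rw [ofAdd_sub, map_div, ofAdd_add, map_mul, h3, div_self']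

end ChevalleyRep

namespace ChevalleyRep

variable {p : ℕ} [Fact p.Prime] {K : Type*} [Field K] [CharZero K] [Algebra ℚ_[p] K]
  [FiniteDimensional ℚ_[p] K] [Algebra ℤ_[p] K] [IsScalarTower ℤ_[p] ℚ_[p] K]
  {A : Type*} [CommRing A] [HopfAlgebra K A]
  {X Y : Type*} [AddCommGroup X] [AddCommGroup Y]
  {ι : Type*} [Fintype ι] {P : RootPairing ι ℤ X Y} [P.IsReduced] {b : P.Base}
  {π : A →ₐc[K] AddMonoidAlgebra K X} {S : ChevalleySystem P b π}
  {J : Type*} [Fintype J] [DecidableEq J] (R : ChevalleyRep p S J)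

/-! ### Root groups as exponentials. -/

section RootPoints

lemma mat_rootPt_apply (α : ι) (c : K) (i j : J) :
    R.mat (S.rootPt α c) i j = (S.u α (R.g i j)).eval c := by
  rw [mat_apply, ← Polynomial.coe_aeval_eq_eval]; rfl

lemma _root_.ChevalleySystem.rootPt_add (α : ι) (c d : K) :
    S.rootPt α (c + d) = S.rootPt α c * S.rootPt α d := S.u_add α c d

lemma _root_.ChevalleySystem.rootPt_zero (α : ι) : S.rootPt α 0 = 1 := by
  have h := S.rootPt_add α 0 0
  rw [add_zero] at h
  exact (mul_eq_left.1 h.symm)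

/-- The differential equation `U' = U X_α` of a one-parameter group: expand `U(c + T) = U(c) U(T)`
and compare coefficients of `T`, the derivative at `0` being `X_α`. An identity of polynomials may
be tested on values since `K` is infinite. -/
lemma derivative_u_g (α : ι) (i j : J) : Polynomial.derivative (S.u α (R.g i j)) =
    ∑ k, Polynomial.C (R.lmat (S.basis (Sum.inr α)) k j) * S.u α (R.g i k) := by
  apply Polynomial.funext
  intro c
  have h1 : Polynomial.taylor c (S.u α (R.g i j)) =
      ∑ k, Polynomial.C ((S.u α (R.g i k)).eval c) * S.u α (R.g k j) := by
    apply Polynomial.funext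
    intro d
    rw [Polynomial.taylor_eval, add_comm, ← R.mat_rootPt_apply, S.rootPt_add, map_mul,
      Matrix.mul_apply, Polynomial.eval_finsetSum]
    refine Finset.sum_congr rfl fun k _ => ?_
    rw [Polynomial.eval_mul, Polynomial.eval_C, R.mat_rootPt_apply, R.mat_rootPt_apply]
  have h2 := congrArg (fun q => Polynomial.coeff q 1) h1
  simp only [Polynomial.taylor_coeff_one, Polynomial.finsetSum_coeff, Polynomial.coeff_C_mul] at h2
  rw [h2, Polynomial.eval_finsetSum]
  refine Finset.sum_congr rfl fun k _ => ?_
  rw [Polynomial.eval_mul, Polynomial.eval_C, lmat_apply, S.u_deriv, mul_comm]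

lemma coeff_u_g (α : ι) (n : ℕ) (i j : J) : (S.u α (R.g i j)).coeff n =
    ((n.factorial : ℕ) : K)⁻¹ * (R.lmat (S.basis (Sum.inr α)) ^ n) i j := by
  induction n generalizing i j with
  | zero =>
    have h := R.mat_rootPt_apply α 0 i j
    rw [S.rootPt_zero, map_one, ← Polynomial.coeff_zero_eq_eval_zero] at h
    simp [← h]
  | succ n ih =>
    have h := congrArg (fun q => Polynomial.coeff q n) (R.derivative_u_g α i j)
    simp only [Polynomial.coeff_derivative, Polynomial.finsetSum_coeff, Polynomial.coeff_C_mul,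
      ih] at h
    have hn : ((n : K) + 1) ≠ 0 := by exact_mod_cast Nat.succ_ne_zero n
    have hf : ((n.factorial : ℕ) : K) ≠ 0 := by exact_mod_cast n.factorial_ne_zero
    rw [Nat.factorial_succ, pow_succ, Matrix.mul_apply, Finset.mul_sum]
    rw [eq_div_of_mul_eq hn h, Finset.sum_div]
    refine Finset.sum_congr rfl fun k _ => ?_
    push_cast
    field_simp

lemma exists_mat_rootPt (α : ι) : ∃ m : ℕ, ∀ c : K, R.mat (S.rootPt α c) =
    ∑ k ∈ Finset.range (m + 2), ((k.factorial : ℕ) : K)⁻¹ •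
      (c • R.lmat (S.basis (Sum.inr α))) ^ k := by
  -- All entries are polynomials, so the exponential series stops at the largest of their degrees,
  -- uniformly in `c`.
  refine ⟨Finset.univ.sup fun ij : J × J => (S.u α (R.g ij.1 ij.2)).natDegree, fun c => ?_⟩
  ext i j
  rw [R.mat_rootPt_apply, Polynomial.eval_eq_sum_range' (n := _ + 2) (Nat.lt_add_right 1
    (Nat.lt_succ_of_le (Finset.le_sup (f := fun ij : J × J => (S.u α (R.g ij.1 ij.2)).natDegree)
      (Finset.mem_univ (i, j))))), Matrix.sum_apply]
  refine Finset.sum_congr rfl fun k _ => ?_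
  rw [R.coeff_u_g, smul_pow, Matrix.smul_apply, Matrix.smul_apply, smul_eq_mul, smul_eq_mul]
  ring

end RootPoints

/-! ### The lattice filtration of `Lie G` and its detection by matrices. -/

section Lattice

variable (p) in
/-- The Moy–Prasad filtration of the Lie algebra. -/
noncomputable def _root_.ChevalleySystem.lieFil (S : ChevalleySystem P b π) (h : ℕ) (n : ℤ) :
    AddSubgroup (LieG K A) where
  carrier := {x | ∀ s, S.basis.repr x s ∈ ordFil p K ((n - chevDeg b s) / h)}
  zero_mem' s := by simp [zero_mem]
  add_mem' ha hb s := by rw [map_add]; exact add_mem (ha s) (hb s)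
  neg_mem' ha s := by rw [map_neg]; exact neg_mem (ha s)

/-- The heights of the weights. -/
def wtHt (j : J) : ℚ := R.ht (R.wt j)

lemma root_ne_zero (α : ι) : P.root α ≠ 0 := P.ne_zero α

lemma _root_.ChevalleySystem.repr_basis_smul (s : b.support ⊕ ι) (c : K) :
    S.basis.repr (c • S.basis s) = Finsupp.single s c := by simp

lemma _root_.ChevalleySystem.smul_basis_mem_lieFil {h : ℕ} {n : ℤ} {s : b.support ⊕ ι} {c : K}
    (hc : c ∈ ordFil p K ((n - chevDeg b s) / h)) : c • S.basis s ∈ S.lieFil p h n := by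
  intro t
  rw [S.repr_basis_smul]
  classical
  rw [Finsupp.single_apply]
  split_ifs with hst
  · subst hst; exact hc
  · exact zero_mem _

variable [Module.Free ℤ X] [Module.Finite ℤ X]

lemma lmat_basis_inl_of_ne (i : b.support) {k j : J} (hkj : k ≠ j) :
    R.lmat (S.basis (Sum.inl i)) k j = 0 := by
  rw [S.basis_inl, R.lmat_H, Matrix.diagonal_apply_ne _ hkj]

lemma lmat_basis_inr_of_ne {α : ι} {k j : J} (hkj : R.wt k ≠ P.root α + R.wt j) :
    R.lmat (S.basis (Sum.inr α)) k j = 0 := by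
  by_contra h
  exact hkj (R.wt_eq_of_lmat_ne_zero h)

lemma wtHt_of_eq {α : ι} {k j : J} (hkj : R.wt k = P.root α + R.wt j) :
    R.wtHt k = b.height α + R.wtHt j := by
  rw [wtHt, hkj, map_add, R.ht_root]; rfl

/-- `X_α` only has entries between weights that differ by `α`, hence whose heights differ by
`ht(α)`, and these entries are integral. The filtration is built so that this gives level exactly
the degree, with threshold valuation `0`. -/
lemma lmat_basis_mem {h : ℕ} (s : b.support ⊕ ι) :
    R.lmat (S.basis s) ∈ matFil p K h R.wtHt (chevDeg b s) := by
  intro k j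
  by_cases h0 : R.lmat (S.basis s) k j = 0
  · rw [h0]; exact zero_mem _
  have h1 : R.wtHt k = chevDeg b s + R.wtHt j := by
    rcases s with i | α
    · have : k = j := by
        by_contra hkj
        exact h0 (R.lmat_basis_inl_of_ne i hkj)
      simp [this, chevDeg]
    · exact R.wtHt_of_eq (R.wt_eq_of_lmat_ne_zero h0)
  have h2 : ((chevDeg b s : ℤ) - R.wtHt k + R.wtHt j) / (h : ℚ) = 0 := by
    rw [h1]; ring
  rw [h2]
  exact R.integral s k j

lemma lmat_eq_sum (x : LieG K A) :
    R.lmat x = ∑ s, S.basis.repr x s • R.lmat (S.basis s) := by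
  conv_lhs => rw [← S.basis.sum_repr x]
  simp only [map_sum, map_smul]

lemma lmat_mem {h : ℕ} (hh : 0 < h) {n : ℤ} {x : LieG K A} (hx : x ∈ S.lieFil p h n) :
    R.lmat x ∈ matFil p K h R.wtHt n := by
  rw [R.lmat_eq_sum]
  refine sum_mem fun s _ => matFil_smul (hx s) (R.lmat_basis_mem s) hh ?_
  have hh' : (h : ℚ) ≠ 0 := by exact_mod_cast hh.ne'
  rw [mul_div_cancel₀ _ hh']
  linarith

/-- An element of `Lie G` which acts with positive valuations lies in the lattice. -/
lemma mem_lieFil_of_lmat_mem {h : ℕ} (hp2 : p ≠ 2) {n : ℤ} {x : LieG K A}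
    (hx : R.lmat x ∈ matFil p K h R.wtHt n) : x ∈ S.lieFil p h n := by
  have hne : ∀ (α : ι) (j : J), R.wt j ≠ P.root α + R.wt j := fun α j hj =>
    root_ne_zero α (by simpa using hj.symm)
  intro s
  rcases s with i | α
  -- On a vector whose weight is the `i`-th fundamental weight, the diagonal entry of `x` is the
  -- coefficient of `H_i` alone.
  · obtain ⟨j, hj1, hj0⟩ := R.fund_mem i
    have h1 := hx j j
    rw [R.lmat_eq_sum, Matrix.sum_apply, Finset.sum_eq_single (Sum.inl i)] at h1
    · rw [Matrix.smul_apply, S.basis_inl, R.lmat_H, Matrix.diagonal_apply_eq, hj1] at h1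
      simpa [chevDeg] using h1
    · rintro (i' | β) - hs
      · rw [Matrix.smul_apply, S.basis_inl, R.lmat_H, Matrix.diagonal_apply_eq,
          hj0 i' (fun h => hs (by rw [h]))]
        simp
      · rw [Matrix.smul_apply, R.lmat_basis_inr_of_ne (hne β j), smul_zero]
    · simp
  · by_contra hα
    -- If the coefficient of `X_α` in `x` had too small a valuation, every nonzero entry of `X_α`
    -- would have to compensate by positive valuation, because no other basis element contributes to
    -- that entry. Then `H_α = [X_α, X_{-α}]` would vanish modulo `ϖ`, although it acts by `2` on a
    -- vector of weight `α`, and `p ≠ 2`.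
    have hV : ∀ k j, R.lmat (S.basis (Sum.inr α)) k j ∈ ordFil p K 1 := by
      intro k j
      by_cases h0 : R.lmat (S.basis (Sum.inr α)) k j = 0
      · rw [h0]; exact zero_mem _
      have hw := R.wt_eq_of_lmat_ne_zero h0
      have h1 := hx k j
      rw [R.lmat_eq_sum, Matrix.sum_apply, Finset.sum_eq_single (Sum.inr α)] at h1
      · rw [Matrix.smul_apply, smul_eq_mul] at h1
        have hx0 : S.basis.repr x (Sum.inr α) ≠ 0 := fun h => hα (h ▸ zero_mem _)
        rw [mem_ordFil_of_ne hx0, not_le] at hα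
        have h2 := h1 (mul_ne_zero hx0 h0)
        rw [R.wtHt_of_eq hw, ordK_mul p hx0 h0] at h2
        rw [mem_ordFil_of_ne h0]
        have e : ((n : ℚ) - (b.height α + R.wtHt j) + R.wtHt j) / h =
          (n - (chevDeg b (Sum.inr α) : ℤ)) / h := by simp [chevDeg]; ring
        rw [e] at h2
        have h3 := hα.trans_le h2
        push_cast at h3
        have h4 : 0 < ordK p (R.lmat (S.basis (Sum.inr α)) k j) := by
          have : (0 : ℚ) < ordK p (R.lmat (S.basis (Sum.inr α)) k j) := by linarith
          exact_mod_cast this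
        exact_mod_cast h4
      · rintro (i' | β) - hs
        · rw [Matrix.smul_apply, R.lmat_basis_inl_of_ne i', smul_zero]
          rintro rfl
          exact hne α k hw
        · rw [Matrix.smul_apply, R.lmat_basis_inr_of_ne, smul_zero]
          intro hw'
          rw [hw] at hw'
          exact hs (by rw [P.root.injective (add_right_cancel hw')])
      · simp
    obtain ⟨j, hj⟩ := R.root_mem α
    have h1 : R.lmat (S.H α) j j ∈ ordFil p K 1 := by
      rw [← S.lie_X_neg α, R.lmat_lie, Matrix.sub_apply, Matrix.mul_apply, Matrix.mul_apply]
      refine sub_mem (sum_mem fun k _ => ?_) (sum_mem fun k _ => ?_)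
      · exact ordFil_mul_right (hV _ _) (R.integral _ _ _)
      · exact ordFil_mul_left (R.integral _ _ _) (hV _ _)
    rw [R.lmat_H, Matrix.diagonal_apply_eq, hj] at h1
    have h2 : P.toLinearMap (P.root α) (P.coroot α) = 2 := P.root_coroot_two α
    rw [h2] at h1
    have h3 : ¬ (p : ℤ) ∣ 2 := by
      intro h
      have h : p ∣ 2 := by exact_mod_cast h
      exact hp2 ((Nat.prime_dvd_prime_iff_eq Fact.out Nat.prime_two).1 h)
    obtain ⟨h4, h5⟩ := ordK_intCast (K := K) h3
    have := h1 h4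
    rw [h5] at this
    norm_num at this

end Lattice

end ChevalleyRep

/-! ### Linear functionals acting on functions, and point derivations. -/

section ActL

variable {K A : Type*} [Field K] [CommRing A] [HopfAlgebra K A]

/-- The left action of a linear functional on functions: `f ↦ f₍₁₎ φ(f₍₂₎)`. -/
noncomputable def actL (φ : A →ₗ[K] K) : A →ₗ[K] A :=
  (TensorProduct.rid K A).toLinearMap ∘ₗ φ.lTensor A ∘ₗ Coalgebra.comul

lemma actL_apply (φ : A →ₗ[K] K) (f : A) :
    actL φ f = TensorProduct.rid K A (φ.lTensor A (Coalgebra.comul (R := K) f)) := rfl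

/-- Coassociativity. For a point derivation `φ` this is the left-invariance that places the
derivation in `LieG`. -/
lemma comul_actL (φ : A →ₗ[K] K) (f : A) :
    Coalgebra.comul (R := K) (actL φ f) = (actL φ).lTensor A (Coalgebra.comul (R := K) f) := by
  have h1 := congrArg ((((TensorProduct.rid K A).toLinearMap ∘ₗ φ.lTensor A)).lTensor A)
    (Coalgebra.coassoc_apply (R := K) f)
  rw [← LinearMap.comp_apply (LinearMap.lTensor A _) (LinearMap.lTensor A _),
    ← LinearMap.lTensor_comp] at h1
  refine Eq.trans ?_ h1
  rw [actL_apply]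
  generalize Coalgebra.comul (R := K) f = t
  induction t with
  | zero => simp
  | add x y hx hy => simp only [map_add, hx, hy]
  | tmul x y =>
    simp only [LinearMap.lTensor_tmul, TensorProduct.rid_tmul, map_smul, LinearMap.rTensor_tmul]
    generalize Coalgebra.comul (R := K) x = t
    induction t with
    | zero => simp
    | add x y hx hy => simp only [smul_add, map_add, TensorProduct.add_tmul, hx, hy]
    | tmul a b => simp [TensorProduct.tmul_smul]

lemma counit_actL (φ : A →ₗ[K] K) (f : A) : Coalgebra.counit (R := K) (actL φ f) = φ f := by
  have h : ∀ t : A ⊗[K] A, Coalgebra.counit (R := K) (TensorProduct.rid K A (φ.lTensor A t)) =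
      φ (TensorProduct.lid K A ((Coalgebra.counit (R := K) (A := A)).rTensor A t)) := by
    intro t
    induction t with
    | zero => simp
    | add x y hx hy => simp only [map_add, hx, hy]
    | tmul x y => simp [mul_comm]
  rw [actL_apply, h, Coalgebra.rTensor_counit_comul]
  simp

lemma actL_counit (f : A) : actL (Coalgebra.counit (R := K)) f = f := by
  rw [actL_apply, Coalgebra.lTensor_counit_comul]
  simp

lemma actL_mul (d : A →ₗ[K] K) (hd : ∀ f g, d (f * g) =
    d f * Coalgebra.counit (R := K) g + Coalgebra.counit (R := K) f * d g) (f g : A) :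
    actL d (f * g) = f * actL d g + g * actL d f := by
  have h : ∀ s t : A ⊗[K] A, TensorProduct.rid K A (d.lTensor A (s * t)) =
      TensorProduct.rid K A ((Coalgebra.counit (R := K) (A := A)).lTensor A s) *
        TensorProduct.rid K A (d.lTensor A t) +
      TensorProduct.rid K A ((Coalgebra.counit (R := K) (A := A)).lTensor A t) *
        TensorProduct.rid K A (d.lTensor A s) := by
    intro s t
    induction s with
    | zero => simp
    | add x y hx hy => simp only [map_add, add_mul, mul_add, hx, hy]; abel
    | tmul x y =>
      induction t with
      | zero => simp
      | add x' y' hx hy => simp only [map_add, add_mul, mul_add, hx, hy]; abel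
      | tmul x' y' =>
        simp only [Algebra.TensorProduct.tmul_mul_tmul, LinearMap.lTensor_tmul,
          TensorProduct.rid_tmul, hd, Algebra.smul_def, map_add, map_mul]
        ring
  have h1 := h (Coalgebra.comul (R := K) f) (Coalgebra.comul (R := K) g)
  rw [Coalgebra.lTensor_counit_comul, Coalgebra.lTensor_counit_comul] at h1
  rw [actL_apply, Bialgebra.comul_mul, h1, ← actL_apply, ← actL_apply]
  simp

/-- The left-invariant derivation of `A` given by a derivation at the identity. -/
noncomputable def LieG.ofPointDerivation (d : A →ₗ[K] K) (hd : ∀ f g, d (f * g) =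
    d f * Coalgebra.counit (R := K) g + Coalgebra.counit (R := K) f * d g) : LieG K A :=
  ⟨Derivation.mk' (actL d) (actL_mul d hd), comul_actL d⟩

lemma LieG.counit_ofPointDerivation (d : A →ₗ[K] K) (hd) (f : A) : Coalgebra.counit (R := K)
    ((LieG.ofPointDerivation d hd : Derivation K A A) f) = d f := counit_actL d f

end ActL

/-! ### Limits of matrices with explicit rate of convergence. -/

section MatLimit

variable {p : ℕ} [Fact p.Prime] {K : Type*} [Field K] [Algebra ℚ_[p] K]
  [FiniteDimensional ℚ_[p] K] [Algebra ℤ_[p] K] [IsScalarTower ℤ_[p] ℚ_[p] K]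
  {J : Type*} {h : ℕ} {ℓ : J → ℚ}

lemma exists_ordTendsto_of_ordFil (hh : 0 < h) (a : ℚ) (s : ℕ → K)
    (hs : ∀ k : ℕ, s (k + 1) - s k ∈ ordFil p K ((k + a) / h)) :
    ∃ c, OrdTendsto p s c ∧ ∀ k : ℕ, s k - c ∈ ordFil p K ((k + a) / h) := by
  have hh' : (0 : ℚ) < h := by exact_mod_cast hh
  obtain ⟨c, hc⟩ := exists_ordTendsto (p := p) s fun N => by
    obtain ⟨k₀, hk₀⟩ := exists_nat_ge (h * N - a)
    refine ⟨k₀, fun k hk => ordFil_mono ?_ (hs k)⟩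
    rw [le_div_iff₀ hh']
    have : (k₀ : ℚ) ≤ k := by exact_mod_cast hk
    linarith
  refine ⟨c, hc, fun k => ?_⟩
  have hsub : ∀ m ≥ k, s k - s m ∈ ordFil p K ((k + a) / h) := by
    intro m hm
    induction m, hm using Nat.le_induction with
    | base => simp [zero_mem]
    | succ m hm ih =>
      have e : s k - s (m + 1) = (s k - s m) - (s (m + 1) - s m) := by ring
      rw [e]
      refine sub_mem ih (ordFil_mono ?_ (hs m))
      have : (k : ℚ) ≤ m := by exact_mod_cast hm
      gcongr
  refine OrdTendsto.mem (s := fun m => s k - s m) ?_ k hsub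
  have := (OrdTendsto.const (p := p) (s k)).add (hc.const_mul (-1))
  simpa [sub_eq_add_neg] using this

lemma exists_matFil_limit [Fintype J] [DecidableEq J] (hh : 0 < h) (a : ℤ) (M : ℕ → Matrix J J K)
    (hM : ∀ k : ℕ, M (k + 1) - M k ∈ matFil p K h ℓ (k + a)) :
    ∃ N, (∀ i j, OrdTendsto p (fun k => M k i j) (N i j)) ∧
      ∀ k : ℕ, M k - N ∈ matFil p K h ℓ (k + a) := by
  have h1 : ∀ i j, ∃ c, OrdTendsto p (fun k => M k i j) c ∧
      ∀ k : ℕ, M k i j - c ∈ ordFil p K ((k + (a - ℓ i + ℓ j)) / h) := fun i j =>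
    exists_ordTendsto_of_ordFil hh (a - ℓ i + ℓ j) (fun k => M k i j) fun k => by
      have := hM k i j
      refine ordFil_mono (le_of_eq ?_) this
      push_cast; ring
  choose N hN using h1
  refine ⟨Matrix.of N, fun i j => (hN i j).1, fun k i j => ?_⟩
  refine ordFil_mono (le_of_eq ?_) ((hN i j).2 k)
  push_cast; ring

end MatLimit

namespace ChevalleyRep

variable {p : ℕ} [Fact p.Prime] {K : Type*} [Field K] [CharZero K] [Algebra ℚ_[p] K]
  [FiniteDimensional ℚ_[p] K] [Algebra ℤ_[p] K] [IsScalarTower ℤ_[p] ℚ_[p] K]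
  {A : Type*} [CommRing A] [HopfAlgebra K A]
  {X Y : Type*} [AddCommGroup X] [AddCommGroup Y]
  {ι : Type*} [Fintype ι] {P : RootPairing ι ℤ X Y} [P.IsReduced] {b : P.Base}
  {π : A →ₐc[K] AddMonoidAlgebra K X} {S : ChevalleySystem P b π}
  {J : Type*} [Fintype J] [DecidableEq J] (R : ChevalleyRep p S J)

/-! ### Closedness of `G(K)` and the logarithm. -/

section Limits

/-- A sequence of points of `G` whose matrices converge has a limit in `G`. -/
lemma exists_pt_limit {h : ℕ} (hh : 0 < h) (a : ℤ) (z : ℕ → Pts K A K)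
    (hz : ∀ k : ℕ, R.mat (z (k + 1)) - R.mat (z k) ∈ matFil p K h R.wtHt (k + a)) :
    ∃ w : Pts K A K, ∀ k : ℕ, R.mat (z k) - R.mat w ∈ matFil p K h R.wtHt (k + a) := by
  obtain ⟨N, hN, hN'⟩ := exists_matFil_limit hh a (fun k => R.mat (z k)) hz
  -- The matrix coefficients generate `A`, so convergence of the matrices gives convergence of
  -- `f(z_k)` for every function `f`. The limits form an algebra homomorphism, that is, a point of
  -- `G`.
  have hlim : ∀ f : A, ∃ c : K, OrdTendsto p (fun k => (z k).ofConv f) c := by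
    intro f
    have hf : f ∈ Algebra.adjoin K (Set.range fun ij : J × J => R.g ij.1 ij.2) := by
      rw [R.adjoin_g]; trivial
    induction hf using Algebra.adjoin_induction with
    | mem f hf =>
      obtain ⟨⟨i, j⟩, rfl⟩ := hf
      exact ⟨_, hN i j⟩
    | algebraMap r => exact ⟨r, by simpa using OrdTendsto.const (p := p) r⟩
    | add f g _ _ hf hg =>
      obtain ⟨c, hc⟩ := hf
      obtain ⟨d, hd⟩ := hg
      exact ⟨c + d, by simpa using hc.add hd⟩
    | mul f g _ _ hf hg =>
      obtain ⟨c, hc⟩ := hf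
      obtain ⟨d, hd⟩ := hg
      exact ⟨c * d, by simpa using hc.mul hd⟩
  choose φ hφ using hlim
  let w : A →ₐ[K] K :=
    { toFun := φ
      map_one' := (hφ 1).unique (by simpa using OrdTendsto.const (p := p) (1 : K))
      map_zero' := (hφ 0).unique (by simpa using OrdTendsto.const (p := p) (0 : K))
      map_mul' := fun f g => (hφ _).unique (by simpa using (hφ f).mul (hφ g))
      map_add' := fun f g => (hφ _).unique (by simpa using (hφ f).add (hφ g))
      commutes' := fun r => (hφ _).unique (by simpa using OrdTendsto.const (p := p) r) }
  refine ⟨WithConv.toConv w, fun k => ?_⟩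
  have : R.mat (WithConv.toConv w) = N := by
    ext i j
    exact (hφ _).unique (hN i j)
  rw [this]
  exact hN' k

variable [Module.Free ℤ X] [Module.Finite ℤ X]

/-- The logarithm: a point of `G` close to `1` is close to `1 + x` for some `x` in `Lie G`. -/
lemma exists_lie_of_mat {h : ℕ} (hh : 0 < h) (hp : h * ramDeg p K < p - 1) {n : ℤ} (hn : 1 ≤ n)
    {z : Pts K A K} (hz : R.mat z - 1 ∈ matFil p K h R.wtHt n) :
    ∃ x ∈ S.lieFil p h n, R.mat z - 1 - R.lmat x ∈ matFil p K h R.wtHt (n + 1) := by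
  have he : 1 ≤ ramDeg p K := ramDeg_pos p K
  have hE : (1 : ℤ) ≤ h * ramDeg p K := by exact_mod_cast Nat.mul_pos hh he
  have hp2 : p ≠ 2 := by
    have := Nat.mul_pos hh he
    omega
  -- Each `p`-th power gains `he` levels, which the later division by `p` loses again.
  have hy : ∀ k : ℕ, R.mat z ^ p ^ k - 1 ∈ matFil p K h R.wtHt (n + k * (h * ramDeg p K)) := by
    intro k
    induction k with
    | zero => simpa using hz
    | succ k ih =>
      have hn' : 1 ≤ n + k * (h * ramDeg p K : ℤ) := by nlinarith
      have h1 := pow_prime_sub_one hn' hh hp ih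
      have h2 := matFil_prime_smul ih hh
      rw [pow_succ, pow_mul, ← sub_add_cancel ((R.mat z ^ p ^ k) ^ p - 1)
        ((p : K) • (R.mat z ^ p ^ k - 1))]
      exact add_mem (matFil_mono (by push_cast; linarith) h1)
        (matFil_mono (by push_cast; linarith) h2)
  set δ : ℕ → Matrix J J K := fun k => ((p : K) ^ k)⁻¹ • (R.mat z ^ p ^ k - 1) with hδ
  have hδn : ∀ k, δ k ∈ matFil p K h R.wtHt n := fun k =>
    matFil_mono (by linarith) (matFil_prime_pow_inv_smul (hy k) hh k)
  -- The error `z^{p^{k+1}} - 1 - p (z^{p^k} - 1)` has level `2(n + k he) + he`. Division by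
  -- `p^{k+1}` leaves `2n + k he ≥ n + 1 + k`, so the sequence converges and its limit agrees with
  -- `z - 1` modulo `E_{n+1}`.
  have hδs : ∀ k : ℕ, δ (k + 1) - δ k ∈ matFil p K h R.wtHt (k + (n + 1)) := by
    intro k
    have hn' : 1 ≤ n + k * (h * ramDeg p K : ℤ) := by nlinarith
    have h1 := matFil_prime_pow_inv_smul (pow_prime_sub_one hn' hh hp (hy k)) hh (k + 1)
    have e : δ (k + 1) - δ k = ((p : K) ^ (k + 1))⁻¹ •
        (((R.mat z ^ p ^ k) ^ p - 1) - (p : K) • (R.mat z ^ p ^ k - 1)) := by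
      have hp0 := prime_ne_zero p K
      rw [hδ]
      simp only
      rw [← pow_mul, ← pow_succ, smul_sub _ _ ((p : K) • _), smul_smul, pow_succ (p : K), mul_inv,
        mul_assoc, inv_mul_cancel₀ hp0, mul_one]
    rw [e]
    refine matFil_mono ?_ h1
    push_cast
    nlinarith
  obtain ⟨N, hN, hN'⟩ := exists_matFil_limit hh (n + 1) δ hδs
  set d : ℕ → A → K := fun k f =>
    ((p : K) ^ k)⁻¹ * ((z ^ p ^ k).ofConv f - Coalgebra.counit (R := K) f) with hd
  -- The functional `d k` is a point derivation up to a quadratic term with factor `p^k`, which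
  -- disappears in the limit. Convergence on the matrix coefficients therefore spreads to all
  -- functions, and the limit is an honest point derivation.
  have hdmul : ∀ k f g, d k (f * g) = d k f * Coalgebra.counit (R := K) g +
      Coalgebra.counit (R := K) f * d k g + (p : K) ^ k * (d k f * d k g) := by
    intro k f g
    have hp0 : (p : K) ^ k ≠ 0 := pow_ne_zero _ (prime_ne_zero p K)
    simp only [hd, map_mul, Bialgebra.counit_mul]
    field_simp
    ring
  have hpk : OrdTendsto p (fun k => (p : K) ^ k) 0 := fun M => ⟨M, fun k hk => by
    rw [sub_zero]
    intro _
    simp only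
    rw [← zpow_natCast, ordK_zpow, ordK_prime]
    have : (M : ℤ) ≤ k * ramDeg p K := by
      have : M ≤ k * ramDeg p K := hk.trans (Nat.le_mul_of_pos_right k he)
      exact_mod_cast this
    exact_mod_cast this⟩
  have hlim : ∀ f : A, ∃ c : K, OrdTendsto p (fun k => d k f) c := by
    intro f
    have hf : f ∈ Algebra.adjoin K (Set.range fun ij : J × J => R.g ij.1 ij.2) := by
      rw [R.adjoin_g]; trivial
    induction hf using Algebra.adjoin_induction with
    | mem f hf =>
      obtain ⟨⟨i, j⟩, rfl⟩ := hf
      refine ⟨N i j, ?_⟩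
      convert hN i j using 2 with k
      simp only [hd, hδ, Matrix.smul_apply, Matrix.sub_apply, smul_eq_mul, ← map_pow, R.counit_g,
        Matrix.one_apply, mat_apply]
    | algebraMap r =>
      exact ⟨0, by simpa [hd, Bialgebra.counit_algebraMap] using OrdTendsto.const (p := p) (0 : K)⟩
    | add f g _ _ hf hg =>
      obtain ⟨c, hc⟩ := hf
      obtain ⟨c', hc'⟩ := hg
      refine ⟨c + c', ?_⟩
      convert hc.add hc' using 2 with k
      simp only [hd, map_add]
      ring
    | mul f g _ _ hf hg =>
      obtain ⟨c, hc⟩ := hf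
      obtain ⟨c', hc'⟩ := hg
      refine ⟨c * Coalgebra.counit (R := K) g + Coalgebra.counit (R := K) f * c' + 0 * (c * c'), ?_⟩
      simp only [hdmul]
      exact ((hc.mul (OrdTendsto.const _)).add ((OrdTendsto.const _).mul hc')).add
        (hpk.mul (hc.mul hc'))
  choose φ hφ using hlim
  let D : A →ₗ[K] K :=
    { toFun := φ
      map_add' := fun f g => (hφ _).unique (by
        convert (hφ f).add (hφ g) using 2 with k
        simp only [hd, map_add]
        ring)
      map_smul' := fun c f => (hφ _).unique (by
        convert (hφ f).const_mul c using 2 with k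
        · simp only [hd, map_smul, smul_eq_mul]
          ring
        · rfl) }
  have hD : ∀ f g, D (f * g) =
      D f * Coalgebra.counit (R := K) g + Coalgebra.counit (R := K) f * D g := by
    intro f g
    refine (hφ _).unique ?_
    simp only [hdmul]
    have := (((hφ f).mul (OrdTendsto.const (Coalgebra.counit (R := K) g))).add
      ((OrdTendsto.const (Coalgebra.counit (R := K) f)).mul (hφ g))).add
        (hpk.mul ((hφ f).mul (hφ g)))
    rwa [zero_mul, add_zero] at this
  have hmat : R.lmat (LieG.ofPointDerivation D hD) = N := by
    ext i j
    rw [lmat_apply, LieG.counit_ofPointDerivation]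
    refine (hφ _).unique ?_
    convert hN i j using 2 with k
    simp only [hd, hδ, Matrix.smul_apply, Matrix.sub_apply, smul_eq_mul, ← map_pow, R.counit_g,
      Matrix.one_apply, mat_apply]
  have h0 : R.mat z - 1 - N ∈ matFil p K h R.wtHt (n + 1) := by
    simpa [hδ] using hN' 0
  refine ⟨LieG.ofPointDerivation D hD, R.mem_lieFil_of_lmat_mem hp2 ?_, ?_⟩
  · rw [hmat, ← sub_sub_cancel (R.mat z - 1) N]
    exact sub_mem hz (matFil_mono (by linarith) h0)
  · rwa [hmat]

end Limits

end ChevalleyRep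

namespace ChevalleyRep

variable {p : ℕ} [Fact p.Prime] {K : Type*} [Field K] [CharZero K] [Algebra ℚ_[p] K]
  [FiniteDimensional ℚ_[p] K] [Algebra ℤ_[p] K] [IsScalarTower ℤ_[p] ℚ_[p] K]
  {A : Type*} [CommRing A] [HopfAlgebra K A]
  {X Y : Type*} [AddCommGroup X] [AddCommGroup Y]
  {ι : Type*} [Fintype ι] {P : RootPairing ι ℤ X Y} [P.IsReduced] {b : P.Base}
  {π : A →ₐc[K] AddMonoidAlgebra K X} {S : ChevalleySystem P b π}
  {J : Type*} [Fintype J] [DecidableEq J] (R : ChevalleyRep p S J)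

/-! ### Products of torus and root elements as coordinates. -/

section Coordinates

lemma _root_.one_add_pow_sub_mem {q : ℚ} (hq : 1 ≤ q) {x : K} (hx : x ∈ ordFil p K q) (m : ℕ) :
    (1 + x) ^ m - 1 - m * x ∈ ordFil p K (q + 1) := by
  have h1 : 1 + x ∈ ordFil p K 0 := add_mem one_mem_ordFil (ordFil_mono (by linarith) hx)
  induction m with
  | zero => simp [zero_mem]
  | succ m ih =>
    have e : (1 + x) ^ (m + 1) - 1 - ((m + 1 : ℕ) : K) * x =
        (1 + x) * ((1 + x) ^ m - 1 - m * x) + m * (x * x) := by push_cast; ring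
    rw [e]
    refine add_mem (ordFil_mul_left h1 ih) (ordFil_mul_left (natCast_mem_ordFil m) ?_)
    exact ordFil_mono (by linarith) (ordFil_mul hx hx)

lemma _root_.one_add_ne_zero {q : ℚ} (hq : 0 < q) {x : K} (hx : x ∈ ordFil p K q) : 1 + x ≠ 0 := by
  intro h
  have h1 : (1 : K) ∈ ordFil p K q := by
    have : (1 : K) = -x := eq_neg_of_add_eq_zero_left h
    rw [this]; exact neg_mem hx
  have := h1 one_ne_zero
  rw [ordK_one] at this
  push_cast at this
  linarith

lemma _root_.ordK_one_add {q : ℚ} (hq : 0 < q) {x : K} (hx : x ∈ ordFil p K q) :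
    ordK p (1 + x) = 0 := by
  have h0 := one_add_ne_zero hq hx
  have h1 : 1 + x ∈ ordFil p K 0 := add_mem one_mem_ordFil (ordFil_mono hq.le hx)
  have h2 : 0 ≤ ordK p (1 + x) := by exact_mod_cast h1 h0
  by_contra hne
  have h3 : 0 < ordK p (1 + x) := lt_of_le_of_ne h2 (Ne.symm hne)
  have h4 : (1 : K) ∈ ordFil p K (min 1 q) := by
    have e : (1 : K) = (1 + x) - x := by ring
    rw [e]
    refine sub_mem (fun _ => (min_le_left _ _).trans ?_) (ordFil_mono (min_le_right _ _) hx)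
    exact_mod_cast h3
  have := h4 one_ne_zero
  rw [ordK_one] at this
  have h5 : 0 < min 1 q := lt_min one_pos hq
  push_cast at this
  linarith

lemma _root_.div_one_add_mem {q r : ℚ} (hr : 0 < r) {x c : K} (hc : c ∈ ordFil p K r)
    (hx : x ∈ ordFil p K q) : x / (1 + c) ∈ ordFil p K q := by
  have := div_mem_ordFil hx (one_add_ne_zero hr hc)
  rwa [ordK_one_add hr hc, Int.cast_zero, sub_zero] at this

lemma _root_.one_add_zpow_sub_mem {q : ℚ} (hq : 1 ≤ q) {x : K} (hx : x ∈ ordFil p K q) (m : ℤ) :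
    (1 + x) ^ m - 1 - m * x ∈ ordFil p K (q + 1) := by
  have hq0 : 0 < q := by linarith
  obtain ⟨m, rfl | rfl⟩ := m.eq_nat_or_neg
  · simpa using one_add_pow_sub_mem hq hx m
  · have h0 := one_add_ne_zero hq0 hx
    have hy : -x / (1 + x) ∈ ordFil p K q := div_one_add_mem hq0 hx (neg_mem hx)
    have e : (1 + x)⁻¹ = 1 + -x / (1 + x) := by field_simp; ring
    have h1 := one_add_pow_sub_mem hq hy m
    rw [← e] at h1
    have e2 : (1 + x) ^ (-(m : ℤ)) - 1 - ((-(m : ℤ) : ℤ) : K) * x =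
        ((1 + x)⁻¹ ^ m - 1 - m * (-x / (1 + x))) + m * (x * (x / (1 + x))) := by
      rw [zpow_neg, zpow_natCast, inv_pow]
      push_cast
      field_simp
      ring
    rw [e2]
    refine add_mem h1 (ordFil_mul_left (natCast_mem_ordFil m) ?_)
    exact ordFil_mono (by linarith) (ordFil_mul hx (div_one_add_mem hq0 hx hx))

/-- Factor `1 + c + x = (1 + c)(1 + y)` with `y = x / (1 + c)`. Then `(1 + y)^m ≡ 1 + m y`, and both
`(1 + c)^m - 1` and `x - y` only contribute at depth `q + 1`. -/
lemma _root_.one_add_add_zpow_sub_mem {q : ℚ} (hq : 1 ≤ q) {c x : K} (hc : c ∈ ordFil p K 1)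
    (hx : x ∈ ordFil p K q) (m : ℤ) :
    (1 + (c + x)) ^ m - (1 + c) ^ m - m * x ∈ ordFil p K (q + 1) := by
  have h0 := one_add_ne_zero one_pos hc
  set y := x / (1 + c) with hy
  have hyq : y ∈ ordFil p K q := div_one_add_mem one_pos hc hx
  have e : 1 + (c + x) = (1 + c) * (1 + y) := by rw [hy]; field_simp; ring
  have hxy : x = y + c * y := by rw [hy]; field_simp
  have h1 := one_add_zpow_sub_mem hq hyq m
  have h2 := one_add_zpow_sub_mem le_rfl hc m
  have h3 : (1 + c) ^ m - 1 ∈ ordFil p K 1 := by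
    have : (1 + c) ^ m - 1 = ((1 + c) ^ m - 1 - m * c) + m * c := by ring
    rw [this]
    exact add_mem (ordFil_mono (by norm_num) h2) (ordFil_mul_left (intCast_mem_ordFil m) hc)
  have h4 : (1 + c) ^ m ∈ ordFil p K 0 := by
    rw [← sub_add_cancel ((1 + c) ^ m) 1]
    exact add_mem (ordFil_mono zero_le_one h3) one_mem_ordFil
  have e2 : (1 + (c + x)) ^ m - (1 + c) ^ m - m * x =
      (1 + c) ^ m * ((1 + y) ^ m - 1 - m * y) + m * (((1 + c) ^ m - 1) * y) - m * (c * y) := by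
    rw [e, mul_zpow]
    linear_combination (-(m : K)) * hxy
  rw [e2]
  refine sub_mem (add_mem (ordFil_mul_left h4 h1) ?_) ?_
  · exact ordFil_mul_left (intCast_mem_ordFil m) (ordFil_mono (by linarith) (ordFil_mul h3 hyq))
  · exact ordFil_mul_left (intCast_mem_ordFil m) (ordFil_mono (by linarith) (ordFil_mul hc hyq))

open Classical in
/-- The unit `1 + c`, if `c ≠ -1`. -/
noncomputable def _root_.oneAddUnit (c : K) : Kˣ := if h : 1 + c ≠ 0 then Units.mk0 (1 + c) h else 1

lemma _root_.coe_oneAddUnit {c : K} (h : 1 + c ≠ 0) : (oneAddUnit c : K) = 1 + c := by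
  rw [oneAddUnit, dif_pos h]; rfl

/-- The point of `G` with a given coordinate with respect to an element of the Chevalley basis. -/
noncomputable def _root_.ChevalleySystem.chevPt (S : ChevalleySystem P b π) (s : b.support ⊕ ι)
    (c : K) : Pts K A K :=
  match s with
  | Sum.inl i => torusPt π (cocharPt P (P.coroot i) (oneAddUnit c))
  | Sum.inr α => S.rootPt α c

lemma _root_.torusPt_one : torusPt π (1 : Multiplicative X →* Kˣ) = (1 : Pts K A K) := by
  apply WithConv.ofConv_injective
  apply AlgHom.ext
  intro f
  have h1 : (torusPt π (1 : Multiplicative X →* Kˣ)).ofConv f =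
      AddMonoidAlgebra.lift K K X ((Units.coeHom K).comp 1) (π f) := rfl
  have h2 : (1 : Pts K A K).ofConv f = Coalgebra.counit (R := K) f := rfl
  have h3 : Coalgebra.counit (R := K) f = Coalgebra.counit (R := K) (π f) :=
    (CoalgHomClass.counit_comp_apply π f).symm
  rw [h1, h2, h3]
  generalize π f = t
  induction t using AddMonoidAlgebra.induction_on with
  | of g => simp
  | add f g hf hg => simp only [map_add, hf, hg]
  | smul r f hf => simp only [map_smul, hf]

lemma _root_.ChevalleySystem.chevPt_zero (s : b.support ⊕ ι) : S.chevPt s 0 = 1 := by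
  rcases s with i | α
  · have h1 : oneAddUnit (0 : K) = 1 := Units.ext (by rw [coe_oneAddUnit] <;> simp)
    have h2 : cocharPt P (P.coroot i) (1 : Kˣ) = 1 := by ext; simp [cocharPt]
    change torusPt π (cocharPt P (P.coroot i) (oneAddUnit 0)) = 1
    rw [h1, h2, torusPt_one]
  · exact S.rootPt_zero α

variable [Module.Free ℤ X] [Module.Finite ℤ X]

lemma mat_rootPt_sub {h : ℕ} (hh : 0 < h) (hp : h * ramDeg p K < p - 1) {n : ℤ} (hn : 1 ≤ n)
    {α : ι} {c : K} (hc : c ∈ ordFil p K ((n - b.height α) / h)) :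
    R.mat (S.rootPt α c) - 1 - c • R.lmat (S.basis (Sum.inr α)) ∈ matFil p K h R.wtHt (n + 1) := by
  obtain ⟨m, hm⟩ := R.exists_mat_rootPt α
  rw [hm c]
  refine exp_sub_mem_matFil hh hp hn ?_ m
  rw [← map_smul]
  exact R.lmat_mem hh (S.smul_basis_mem_lieFil hc)

/-- The first-order effect of moving one coordinate by `x`, at a base point `c` of level `1`.
Allowing `c ≠ 0` is essential for successive approximation; the torus coordinates are not additive,
so this case does not reduce to `c = 0`. -/
lemma chevPt_add_sub {h : ℕ} (hh : 0 < h) (hp : h * ramDeg p K < p - 1) {k : ℤ} (hk : 1 ≤ k)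
    (s : b.support ⊕ ι) {c x : K} (hc : c ∈ ordFil p K ((1 - chevDeg b s) / h))
    (hx : x ∈ ordFil p K ((k - chevDeg b s) / h)) :
    R.mat (S.chevPt s (c + x)) - R.mat (S.chevPt s c) - x • R.lmat (S.basis s) ∈
      matFil p K h R.wtHt (k + 1) := by
  have hh' : (0 : ℚ) < h := by exact_mod_cast hh
  rcases s with i | α
  · simp only [chevDeg, Sum.elim_inl, Int.cast_zero, sub_zero] at hc hx
    have hc1 : c ∈ ordFil p K 1 := by
      have := ordFil_int (n := 1) (by simp; positivity) hc
      simpa using this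
    -- Torus coordinates have integral valuation, so level `k` means `v(x) ≥ ⌈k/h⌉`. The error has
    -- valuation at least `⌈k/h⌉ + 1 ≥ (k + 1)/h`.
    have hq : (1 : ℚ) ≤ ⌈(k : ℚ) / h⌉ := by
      have hk' : (0 : ℚ) < k := by exact_mod_cast hk
      have : 1 ≤ ⌈(k : ℚ) / h⌉ := Int.one_le_ceil_iff.2 (by positivity)
      exact_mod_cast this
    have hxq : x ∈ ordFil p K (⌈(k : ℚ) / h⌉ : ℚ) :=
      ordFil_int (by have := Int.ceil_lt_add_one ((k : ℚ) / h); linarith) hx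
    have hcx : c + x ∈ ordFil p K 1 := add_mem hc1 (ordFil_mono hq hxq)
    change R.mat (torusPt π (cocharPt P (P.coroot i) (oneAddUnit (c + x)))) -
      R.mat (torusPt π (cocharPt P (P.coroot i) (oneAddUnit c))) - _ ∈ _
    rw [S.basis_inl, R.lmat_H, R.mat_torusPt, R.mat_torusPt, Matrix.diagonal_sub,
      ← Matrix.diagonal_smul, Matrix.diagonal_sub]
    intro j j'
    rw [Matrix.diagonal_apply]
    split_ifs with hj
    · subst hj
      simp only [cocharPt, MonoidHom.coe_mk, OneHom.coe_mk, toAdd_ofAdd, Units.val_zpow_eq_zpow_val,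
        Pi.smul_apply, smul_eq_mul]
      rw [coe_oneAddUnit (one_add_ne_zero one_pos hc1), coe_oneAddUnit (one_add_ne_zero one_pos hcx),
        mul_comm x]
      refine ordFil_mono ?_ (one_add_add_zpow_sub_mem hq hc1 hxq _)
      have h1 := Int.le_ceil ((k : ℚ) / h)
      have h2 : ((k + 1 : ℤ) - R.wtHt j + R.wtHt j) / (h : ℚ) = k / h + 1 / h := by
        push_cast; field_simp; ring
      have h3 : 1 / (h : ℚ) ≤ 1 := by
        rw [div_le_one hh']; exact_mod_cast hh
      rw [h2]; linarith
    · exact zero_mem _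
  · change R.mat (S.rootPt α (c + x)) - R.mat (S.rootPt α c) - _ ∈ _
    simp only [chevDeg, Sum.elim_inr] at hc hx
    have h1 := R.mat_rootPt_sub hh hp hk hx
    have h2 := R.mat_rootPt_sub (n := 1) hh hp le_rfl (by simpa using hc)
    have h3 : c • R.lmat (S.basis (Sum.inr α)) ∈ matFil p K h R.wtHt 1 := by
      rw [← map_smul]
      exact R.lmat_mem hh (S.smul_basis_mem_lieFil (by simpa [chevDeg] using hc))
    have h4 : x • R.lmat (S.basis (Sum.inr α)) ∈ matFil p K h R.wtHt k := by
      rw [← map_smul]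
      exact R.lmat_mem hh (S.smul_basis_mem_lieFil (by simpa [chevDeg] using hx))
    have h5 : R.mat (S.rootPt α c) - 1 ∈ matFil p K h R.wtHt 1 := by
      rw [← sub_add_cancel (R.mat (S.rootPt α c) - 1) (c • R.lmat (S.basis (Sum.inr α)))]
      exact add_mem (matFil_mono (by norm_num) h2) h3
    have e : R.mat (S.rootPt α (c + x)) - R.mat (S.rootPt α c) - x • R.lmat (S.basis (Sum.inr α)) =
        R.mat (S.rootPt α c) * (R.mat (S.rootPt α x) - 1 - x • R.lmat (S.basis (Sum.inr α))) +
        (R.mat (S.rootPt α c) - 1) * (x • R.lmat (S.basis (Sum.inr α))) := by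
      rw [S.rootPt_add, map_mul]
      generalize x • R.lmat (S.basis (Sum.inr α)) = L
      noncomm_ring
    rw [e]
    exact add_mem (matFil_mul_of_eq (mem_matFil_zero_of_sub_one zero_le_one h5) h1 (by simp))
      (matFil_mul_of_eq h5 h4 (by linarith))

lemma chevPt_sub_one {h : ℕ} (hh : 0 < h) (hp : h * ramDeg p K < p - 1) {k : ℤ} (hk : 1 ≤ k)
    (s : b.support ⊕ ι) {x : K} (hx : x ∈ ordFil p K ((k - chevDeg b s) / h)) :
    R.mat (S.chevPt s x) - 1 - x • R.lmat (S.basis s) ∈ matFil p K h R.wtHt (k + 1) := by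
  have := R.chevPt_add_sub hh hp hk s (zero_mem _) hx
  rwa [zero_add, S.chevPt_zero, map_one] at this

/-- All factors are in `1 + E_1`, so changing the factors by `δ s ∈ E_k` changes the product by the
sum of the `δ s`; every cross term gains a level. -/
lemma _root_.list_prod_sub_mem {h : ℕ} {ℓ : J → ℚ} {k : ℤ} {σ : Type*}
    (l : List σ) (a a' δ : σ → Matrix J J K)
    (ha : ∀ s, a s - 1 ∈ matFil p K h ℓ 1) (ha' : ∀ s, a' s - 1 ∈ matFil p K h ℓ 1)
    (hδ : ∀ s, δ s ∈ matFil p K h ℓ k)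
    (hd : ∀ s, a' s - a s - δ s ∈ matFil p K h ℓ (k + 1)) :
    (l.map a').prod - 1 ∈ matFil p K h ℓ 1 ∧ (l.map δ).sum ∈ matFil p K h ℓ k ∧
    (l.map a').prod - (l.map a).prod - (l.map δ).sum ∈ matFil p K h ℓ (k + 1) := by
  induction l with
  | nil => simp [zero_mem]
  | cons s l ih =>
    obtain ⟨h1, h2, h3⟩ := ih
    simp only [List.map_cons, List.prod_cons, List.sum_cons]
    refine ⟨?_, add_mem (hδ s) h2, ?_⟩
    · have := add_mem (mul_sub_one_mem_matFil (ha' s) h1 (r := 1) (by norm_num))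
        (add_mem (ha' s) h1)
      rwa [sub_add_cancel] at this
    · have e : a' s * (l.map a').prod - a s * (l.map a).prod - (δ s + (l.map δ).sum) =
          (a' s - a s - δ s) * (l.map a').prod +
          a s * ((l.map a').prod - (l.map a).prod - (l.map δ).sum) +
          δ s * ((l.map a').prod - 1) + (a s - 1) * (l.map δ).sum := by noncomm_ring
      rw [e]
      refine add_mem (add_mem (add_mem ?_ ?_) ?_) ?_
      · exact matFil_mul_of_eq (hd s) (mem_matFil_zero_of_sub_one zero_le_one h1) (by simp)
      · exact matFil_mul_of_eq (mem_matFil_zero_of_sub_one zero_le_one (ha s)) h3 (by simp)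
      · exact matFil_mul_of_eq (hδ s) h1 le_rfl
      · exact matFil_mul_of_eq (ha s) h2 (by linarith)

/-- The point of `G` with given coordinates with respect to the Chevalley basis. -/
noncomputable def _root_.ChevalleySystem.coordPt (S : ChevalleySystem P b π) (x : LieG K A) :
    Pts K A K :=
  ((Finset.univ : Finset (b.support ⊕ ι)).toList.map
    fun s => S.chevPt s (S.basis.repr x s)).prod

lemma coordPt_add_sub {h : ℕ} (hh : 0 < h) (hp : h * ramDeg p K < p - 1) {k : ℤ} (hk : 1 ≤ k)
    {y x : LieG K A} (hy : y ∈ S.lieFil p h 1) (hx : x ∈ S.lieFil p h k) :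
    R.mat (S.coordPt (y + x)) - 1 ∈ matFil p K h R.wtHt 1 ∧
    R.mat (S.coordPt (y + x)) - R.mat (S.coordPt y) - R.lmat x ∈ matFil p K h R.wtHt (k + 1) := by
  have hmat : ∀ x, R.mat (S.coordPt x) = ((Finset.univ : Finset (b.support ⊕ ι)).toList.map
      fun s => R.mat (S.chevPt s (S.basis.repr x s))).prod := by
    intro x
    rw [ChevalleySystem.coordPt, map_list_prod, List.map_map]; rfl
  have hone : ∀ x ∈ S.lieFil p h 1, ∀ s,
      R.mat (S.chevPt s (S.basis.repr x s)) - 1 ∈ matFil p K h R.wtHt 1 := by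
    intro x hx s
    have h1 := R.chevPt_sub_one hh hp le_rfl s (hx s)
    rw [← sub_add_cancel (R.mat (S.chevPt s (S.basis.repr x s)) - 1)
      (S.basis.repr x s • R.lmat (S.basis s))]
    refine add_mem (matFil_mono (by norm_num) h1) ?_
    rw [← map_smul]
    exact R.lmat_mem hh (S.smul_basis_mem_lieFil (hx s))
  have hx1 : x ∈ S.lieFil p h 1 := fun s => ordFil_mono (by gcongr) (hx s)
  have hsum : R.lmat x = ((Finset.univ : Finset (b.support ⊕ ι)).toList.map
      fun s => S.basis.repr x s • R.lmat (S.basis s)).sum := by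
    rw [Finset.sum_map_toList, ← R.lmat_eq_sum]
  have := list_prod_sub_mem (Finset.univ : Finset (b.support ⊕ ι)).toList
    (fun s => R.mat (S.chevPt s (S.basis.repr y s)))
    (fun s => R.mat (S.chevPt s (S.basis.repr (y + x) s)))
    (fun s => S.basis.repr x s • R.lmat (S.basis s)) (hone y hy) (hone _ (add_mem hy hx1))
    (fun s => by rw [← map_smul]; exact R.lmat_mem hh (S.smul_basis_mem_lieFil (hx s)))
    (fun s => by
      rw [map_add, Finsupp.add_apply]
      exact R.chevPt_add_sub hh hp hk s (by simpa using hy s) (hx s))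
  rw [hmat, hmat, hsum]
  exact ⟨this.1, this.2.2⟩

lemma _root_.ChevalleySystem.coordPt_zero : S.coordPt 0 = 1 := by
  rw [ChevalleySystem.coordPt]
  apply List.prod_eq_one
  intro g hg
  obtain ⟨s, -, rfl⟩ := List.mem_map.1 hg
  simp [S.chevPt_zero]

end Coordinates

end ChevalleyRep

namespace ChevalleyRep

variable {p : ℕ} [Fact p.Prime] {K : Type*} [Field K] [CharZero K] [Algebra ℚ_[p] K]
  [FiniteDimensional ℚ_[p] K] [Algebra ℤ_[p] K] [IsScalarTower ℤ_[p] ℚ_[p] K]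
  {A : Type*} [CommRing A] [HopfAlgebra K A]
  {X Y : Type*} [AddCommGroup X] [AddCommGroup Y]
  {ι : Type*} [Fintype ι] {P : RootPairing ι ℤ X Y} [P.IsReduced] {b : P.Base}
  {π : A →ₐc[K] AddMonoidAlgebra K X} {S : ChevalleySystem P b π}
  {J : Type*} [Fintype J] [DecidableEq J] (R : ChevalleyRep p S J)

/-! ### The Moy–Prasad groups as congruence subgroups. -/

section MoyPrasad

lemma _root_.coxeterNum_pos : 0 < coxeterNum b := Nat.succ_pos _

lemma _root_.height_lt_coxeterNum (i : ι) : b.height i < coxeterNum b := by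
  have := Finset.le_sup (f := fun i => (b.height i).toNat) (Finset.mem_univ i)
  have h := Int.self_le_toNat (b.height i)
  rw [coxeterNum]
  push_cast
  have h2 : ((b.height i).toNat : ℤ) ≤
    ((Finset.univ.sup fun i => (b.height i).toNat : ℕ) : ℤ) := by exact_mod_cast this
  omega

lemma _root_.neg_height_lt_coxeterNum (i : ι) : -b.height i < coxeterNum b := by
  have h1 := height_lt_coxeterNum (b := b) (P.reflectionPerm i i)
  have h2 : b.height (P.reflectionPerm i i) = -b.height i := b.height_reflectionPerm_self i
  omega

lemma _root_.exists_seq_of_step {α : Type*} (Q : ℕ → α → Prop) (r : ℕ → α → α → Prop) (a₀ : α)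
    (h0 : Q 0 a₀) (hs : ∀ k a, Q k a → ∃ a', Q (k + 1) a' ∧ r k a a') :
    ∃ s : ℕ → α, s 0 = a₀ ∧ (∀ k, Q k (s k)) ∧ ∀ k, r k (s k) (s (k + 1)) := by
  choose f hf using hs
  let t : ∀ k, {a // Q k a} := fun k =>
    Nat.rec ⟨a₀, h0⟩ (fun k a => ⟨f k a.1 a.2, (hf k a.1 a.2).1⟩) k
  exact ⟨fun k => (t k).1, rfl, fun k => (t k).2, fun k => (hf k _ (t k).2).2⟩

lemma _root_.ChevalleySystem.mp_antitone {m n : ℕ} (hmn : m ≤ n) : S.mp p n ≤ S.mp p m := by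
  refine Subgroup.closure_mono (Set.union_subset_union ?_ ?_)
  · rintro g ⟨τ, hτ, rfl⟩
    refine ⟨τ, ⟨hτ.1, fun hm χ => ?_⟩, rfl⟩
    exact le_trans (by exact_mod_cast hmn) (hτ.2 (hm.trans_le hmn) χ)
  · rintro g ⟨i, c, hc, rfl⟩
    exact ⟨i, c, le_trans (by exact_mod_cast (by omega)) hc, rfl⟩

lemma _root_.ChevalleySystem.rootPt_mem_mp {n : ℕ} {α : ι} {c : K}
    (hc : c ∈ ordFil p K ((n - b.height α) / coxeterNum b)) : S.rootPt α c ∈ S.mp p n := by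
  refine Subgroup.subset_closure (Or.inr ⟨α, c, ?_, rfl⟩)
  rw [le_nsmul_valK_iff coxeterNum_pos]
  push_cast
  exact hc

lemma _root_.ChevalleySystem.chevPt_mem_mp {n : ℕ} (hn : 1 ≤ n) {s : b.support ⊕ ι} {c : K}
    (hc : c ∈ ordFil p K ((n - chevDeg b s) / coxeterNum b)) : S.chevPt s c ∈ S.mp p n := by
  rcases s with i | α
  · have hh' : (0 : ℚ) < coxeterNum b := by exact_mod_cast coxeterNum_pos (b := b)
    have hn' : (0 : ℚ) < n := by exact_mod_cast hn
    have hpos : (0 : ℚ) < (n : ℚ) / coxeterNum b := by positivity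
    have hq : (1 : ℚ) ≤ ⌈(n : ℚ) / coxeterNum b⌉ := by
      have : 1 ≤ ⌈(n : ℚ) / coxeterNum b⌉ := Int.one_le_ceil_iff.2 hpos
      exact_mod_cast this
    have hcq : c ∈ ordFil p K (⌈(n : ℚ) / coxeterNum b⌉ : ℚ) := by
      refine ordFil_int ?_ (by simpa [chevDeg] using hc)
      have := Int.ceil_lt_add_one ((n : ℚ) / coxeterNum b); linarith
    have hq0 : (0 : ℚ) < ⌈(n : ℚ) / coxeterNum b⌉ := by linarith
    have h0 := one_add_ne_zero hq0 hcq
    refine Subgroup.subset_closure (Or.inl ⟨_, ⟨fun χ => ?_, fun _ χ => ?_⟩, rfl⟩)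
    · rw [valK_eq_zero_iff]
      refine ⟨Units.ne_zero _, ?_⟩
      simp only [cocharPt, MonoidHom.coe_mk, OneHom.coe_mk, Units.val_zpow_eq_zpow_val]
      rw [coe_oneAddUnit h0, ordK_zpow, ordK_one_add hq0 hcq, mul_zero]
    · have : ((n : ℕ) : WithTop ℤ) = (((n : ℤ)) : WithTop ℤ) := by norm_cast
      rw [this, le_nsmul_valK_iff coxeterNum_pos]
      simp only [cocharPt, MonoidHom.coe_mk, OneHom.coe_mk, Units.val_zpow_eq_zpow_val]
      rw [coe_oneAddUnit h0]
      have h1 := one_add_zpow_sub_mem hq hcq (P.toLinearMap (Multiplicative.toAdd χ) (P.coroot i))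
      rw [← sub_add_cancel (((1 + c) ^ _ - 1 : K)) _]
      have h2 := Int.le_ceil ((n : ℚ) / coxeterNum b)
      push_cast
      exact add_mem (ordFil_mono (by linarith) h1)
        (ordFil_mono h2 (ordFil_mul_left (intCast_mem_ordFil _) hcq))
  · exact S.rootPt_mem_mp (by simpa [chevDeg] using hc)

lemma _root_.ChevalleySystem.coordPt_mem_mp {n : ℕ} (hn : 1 ≤ n) {x : LieG K A}
    (hx : x ∈ S.lieFil p (coxeterNum b) n) : S.coordPt x ∈ S.mp p n := by
  refine Subgroup.list_prod_mem _ fun g hg => ?_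
  obtain ⟨s, -, rfl⟩ := List.mem_map.1 hg
  exact S.chevPt_mem_mp hn (by simpa using hx s)

lemma _root_.ChevalleySystem.lieFil_mono {h : ℕ} {m n : ℤ} (hmn : m ≤ n) {x : LieG K A}
    (hx : x ∈ S.lieFil p h n) : x ∈ S.lieFil p h m := fun s =>
  ordFil_mono (by gcongr) (hx s)

lemma _root_.ChevalleySystem.prime_inv_smul_mem_lieFil {h : ℕ} (hh : 0 < h) {n : ℤ} {x : LieG K A}
    (hx : x ∈ S.lieFil p h n) : (p : K)⁻¹ • x ∈ S.lieFil p h (n - h * ramDeg p K) := by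
  intro s
  rw [map_smul, Finsupp.smul_apply, smul_eq_mul, mul_comm (p : K)⁻¹, ← div_eq_mul_inv]
  refine ordFil_mono (le_of_eq ?_) (div_prime_mem (hx s))
  have hh' : (0 : ℚ) < h := by exact_mod_cast hh
  push_cast
  field_simp
  ring

variable [Module.Free ℤ X] [Module.Finite ℤ X]

lemma mat_rootPt_sub_one {h : ℕ} (hh : 0 < h) (hp : h * ramDeg p K < p - 1) {n : ℤ} (hn : 1 ≤ n)
    {α : ι} {c : K} (hc : c ∈ ordFil p K ((n - b.height α) / h)) :
    R.mat (S.rootPt α c) - 1 ∈ matFil p K h R.wtHt n := by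
  rw [← sub_add_cancel (R.mat (S.rootPt α c) - 1) (c • R.lmat (S.basis (Sum.inr α)))]
  refine add_mem (matFil_mono (by linarith) (R.mat_rootPt_sub hh hp hn hc)) ?_
  rw [← map_smul]
  exact R.lmat_mem hh (S.smul_basis_mem_lieFil (by simpa [chevDeg] using hc))

/-- The easy inclusion: the generators have level `n`, and matrices in `1 + E_n` are stable under
products and inverses. -/
lemma mat_sub_one_of_mem_mp (hp : coxeterNum b * ramDeg p K < p - 1) {n : ℕ} (hn : 1 ≤ n)
    {z : Pts K A K} (hz : z ∈ S.mp p n) : R.mat z - 1 ∈ matFil p K (coxeterNum b) R.wtHt n := by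
  have hn' : (1 : ℤ) ≤ n := by exact_mod_cast hn
  induction hz using Subgroup.closure_induction with
  | mem z hz =>
    rcases hz with ⟨τ, hτ, rfl⟩ | ⟨α, c, hc, rfl⟩
    · rw [R.mat_torusPt, ← Matrix.diagonal_one, Matrix.diagonal_sub]
      intro i j
      rw [Matrix.diagonal_apply]
      split_ifs with hij
      · subst hij
        have h1 := hτ.2 hn (Multiplicative.ofAdd (R.wt i))
        have : ((n : ℕ) : WithTop ℤ) = (((n : ℤ)) : WithTop ℤ) := by norm_cast
        rw [this, le_nsmul_valK_iff coxeterNum_pos] at h1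
        simpa using h1
      · exact zero_mem _
    · rw [le_nsmul_valK_iff coxeterNum_pos] at hc
      exact R.mat_rootPt_sub_one coxeterNum_pos hp hn' (by push_cast at hc ⊢; exact hc)
  | one => simp [zero_mem]
  | mul x y _ _ hx hy =>
    rw [map_mul]
    have := add_mem (mul_sub_one_mem_matFil hx hy (r := n) (by linarith)) (add_mem hx hy)
    rwa [sub_add_cancel] at this
  | inv x _ hx => exact inv_sub_one_mem_matFil coxeterNum_pos hn' hx (R.mat_mul_inv x)

/-- Says that the Iwahori subgroup and its inverses act in `E_0`, hence that conjugation by it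
preserves all `E_n`. -/
lemma mat_mem_of_mem_iwahori (hp : coxeterNum b * ramDeg p K < p - 1)
    {z : Pts K A K} (hz : z ∈ S.mp p 0) : R.mat z ∈ matFil p K (coxeterNum b) R.wtHt 0 ∧
      R.mat z⁻¹ ∈ matFil p K (coxeterNum b) R.wtHt 0 := by
  have hh : (0 : ℚ) < coxeterNum b := by exact_mod_cast coxeterNum_pos (b := b)
  induction hz using Subgroup.closure_induction with
  | mem z hz =>
    rcases hz with ⟨τ, hτ, rfl⟩ | ⟨α, c, hc, rfl⟩
    · have hdiag : ∀ d : J → K, (∀ j, d j ∈ ordFil p K 0) →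
          Matrix.diagonal d ∈ matFil p K (coxeterNum b) R.wtHt 0 := by
        intro d hd i j
        rw [Matrix.diagonal_apply]
        split_ifs with hij
        · subst hij; simpa using hd i
        · exact zero_mem _
      have hval := fun χ => valK_eq_zero_iff.1 (hτ.1 χ)
      have hinv : R.mat (torusPt π τ)⁻¹ =
          Matrix.diagonal fun j => ((τ (Multiplicative.ofAdd (R.wt j)) : K))⁻¹ := by
        refine left_inv_eq_right_inv (a := R.mat (torusPt π τ)) ?_ ?_
        · rw [← map_mul, inv_mul_cancel, map_one]
        · rw [R.mat_torusPt, Matrix.diagonal_mul_diagonal, ← Matrix.diagonal_one]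
          simp
      rw [hinv, R.mat_torusPt]
      refine ⟨hdiag _ fun j _ => ?_, hdiag _ fun j _ => ?_⟩
      · rw [(hval _).2]; simp
      · rw [ordK_inv, (hval _).2]; simp
    · have h1 : R.mat (S.rootPt α c) - 1 ∈ matFil p K (coxeterNum b) R.wtHt 1 := by
        rw [le_nsmul_valK_iff coxeterNum_pos] at hc
        refine R.mat_rootPt_sub_one coxeterNum_pos hp le_rfl ?_
        have a1 := height_lt_coxeterNum (b := b) α
        have a2 := neg_height_lt_coxeterNum (b := b) α
        -- Since `0 < |ht(α)| < h`, the number `-ht(α)/h` is not an integer. Rounding up shows that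
        -- root elements of level `0` already have level `1`, where the estimates for the
        -- exponential apply.
        rcases lt_or_gt_of_ne (b.height_ne_zero α) with h0 | h0
        · have h0' : (b.height α : ℚ) < 0 := by exact_mod_cast h0
          have a2' : -(b.height α : ℚ) + 1 ≤ coxeterNum b := by exact_mod_cast a2
          refine ordFil_mono ?_ (ordFil_int (n := 1) ?_ hc)
          · rw [div_le_iff₀ hh]; push_cast; linarith
          · push_cast
            rw [sub_self]
            apply div_pos _ hh
            linarith
        · have h0' : (1 : ℚ) ≤ b.height α := by exact_mod_cast h0
          have a1' : (b.height α : ℚ) < coxeterNum b := by exact_mod_cast a1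
          refine ordFil_mono ?_ (ordFil_int (n := 0) ?_ hc)
          · rw [div_le_iff₀ hh]; push_cast; linarith
          · rw [lt_div_iff₀ hh]; push_cast; linarith
      exact ⟨mem_matFil_zero_of_sub_one zero_le_one h1, mem_matFil_zero_of_sub_one zero_le_one
        (inv_sub_one_mem_matFil coxeterNum_pos le_rfl h1 (R.mat_mul_inv _))⟩
  | one => rw [inv_one, map_one]; exact ⟨one_mem_matFil, one_mem_matFil⟩
  | mul x y _ _ hx hy =>
    rw [mul_inv_rev, map_mul, map_mul]
    exact ⟨matFil_mul_of_eq hx.1 hy.1 (by simp), matFil_mul_of_eq hy.2 hx.2 (by simp)⟩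
  | inv x _ hx => rw [inv_inv]; exact hx.symm

lemma mat_inv_mul (z : Pts K A K) : R.mat z⁻¹ * R.mat z = 1 := by
  rw [← map_mul, inv_mul_cancel, map_one]

/-- The points of `G` which are close to `1` have coordinates with respect to the Chevalley
basis. -/
lemma exists_coordPt {h : ℕ} (hh : 0 < h) (hp : h * ramDeg p K < p - 1) {n : ℕ} (hn : 1 ≤ n)
    {z : Pts K A K} (hz : R.mat z - 1 ∈ matFil p K h R.wtHt n) :
    ∃ y ∈ S.lieFil p h n, z = S.coordPt y := by
  have hn' : (1 : ℤ) ≤ n := by exact_mod_cast hn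
  have hone : ∀ {y}, y ∈ S.lieFil p h n → R.mat (S.coordPt y) - 1 ∈ matFil p K h R.wtHt 1 := by
    intro y hy
    have := (R.coordPt_add_sub hh hp hn' (zero_mem _) hy).1
    rwa [zero_add] at this
  -- Successive approximation: the logarithm of `coordPt(y)⁻¹ z`, of level `n + k`, is added to the
  -- coordinates `y`, and the remaining error has level `n + k + 1`.
  obtain ⟨y, hy0, hyk, hys⟩ := exists_seq_of_step
    (fun k y => y ∈ S.lieFil p h n ∧
      R.mat z - R.mat (S.coordPt y) ∈ matFil p K h R.wtHt (n + k : ℕ))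
    (fun k y y' => y' - y ∈ S.lieFil p h (n + k : ℕ)) 0
    ⟨zero_mem _, by simpa [S.coordPt_zero] using hz⟩ (by
      rintro k y ⟨hy, hzy⟩
      have hnk : (1 : ℤ) ≤ (n + k : ℕ) := by push_cast; linarith
      have h1 := hone hy
      have h1' := inv_sub_one_mem_matFil hh le_rfl h1 (R.mat_mul_inv _)
      have h2 : R.mat ((S.coordPt y)⁻¹ * z) - 1 ∈ matFil p K h R.wtHt (n + k : ℕ) := by
        have e : R.mat ((S.coordPt y)⁻¹ * z) - 1 =
            R.mat (S.coordPt y)⁻¹ * (R.mat z - R.mat (S.coordPt y)) := by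
          rw [mul_sub, R.mat_inv_mul, map_mul]
        rw [e]
        exact matFil_mul_of_eq (mem_matFil_zero_of_sub_one zero_le_one h1') hzy (by simp)
      obtain ⟨x, hx, hzx⟩ := R.exists_lie_of_mat hh hp hnk h2
      have hy1 := S.lieFil_mono hn' hy
      have h3 := (R.coordPt_add_sub hh hp hnk hy1 hx).2
      refine ⟨y + x, ⟨add_mem hy (S.lieFil_mono (by push_cast; linarith) hx), ?_⟩, by simpa using hx⟩
      have e : R.mat z - R.mat (S.coordPt (y + x)) =
          R.mat (S.coordPt y) * (R.mat ((S.coordPt y)⁻¹ * z) - 1 - R.lmat x) +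
          (R.mat (S.coordPt y) - 1) * R.lmat x -
          (R.mat (S.coordPt (y + x)) - R.mat (S.coordPt y) - R.lmat x) := by
        rw [map_mul, mul_sub, mul_sub, ← mul_assoc, R.mat_mul_inv]
        noncomm_ring
      rw [e]
      refine matFil_mono (by push_cast; linarith) (sub_mem (add_mem ?_ ?_) h3)
      · exact matFil_mul_of_eq (mem_matFil_zero_of_sub_one zero_le_one h1) hzx (by simp)
      · exact matFil_mul_of_eq h1 (R.lmat_mem hh hx) (by linarith))
  -- The successive corrections tend to zero, so each coordinate converges by completeness of `K`.
  -- The limit reproduces `z` because the representation is faithful and the intersection of the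
  -- `E_k` is zero.
  have hc : ∀ s, ∃ c, ∀ k : ℕ,
      S.basis.repr (y k) s - c ∈ ordFil p K ((k + ((n : ℚ) - chevDeg b s)) / h) := by
    intro s
    obtain ⟨c, -, hc⟩ := exists_ordTendsto_of_ordFil hh ((n : ℚ) - chevDeg b s)
      (fun k => S.basis.repr (y k) s) (fun k => by
        have := hys k s
        rw [map_sub, Finsupp.sub_apply] at this
        refine ordFil_mono (le_of_eq ?_) this
        push_cast; ring)
    exact ⟨c, hc⟩
  choose c hc using hc
  set w : LieG K A := S.basis.equivFun.symm c with hw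
  have hws : ∀ s, S.basis.repr w s = c s := fun s =>
    congrFun (S.basis.equivFun.apply_symm_apply c) s
  have hwk : ∀ k : ℕ, w - y k ∈ S.lieFil p h (n + k : ℕ) := by
    intro k s
    rw [map_sub, Finsupp.sub_apply, hws, ← neg_sub (S.basis.repr (y k) s)]
    refine neg_mem (ordFil_mono (le_of_eq ?_) (hc s k))
    push_cast; ring
  have hwn : w ∈ S.lieFil p h n := by simpa [hy0] using hwk 0
  refine ⟨w, hwn, R.mat_injective (sub_eq_zero.1 (eq_zero_of_forall_matFil (p := p) (ℓ := R.wtHt) hh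
    fun k => ?_))⟩
  have hnk : (1 : ℤ) ≤ (n + k : ℕ) := by push_cast; linarith
  have h3 := (R.coordPt_add_sub hh hp hnk (S.lieFil_mono hn' (hyk k).1) (hwk k)).2
  rw [add_sub_cancel] at h3
  have e : R.mat z - R.mat (S.coordPt w) = (R.mat z - R.mat (S.coordPt (y k))) -
      (R.mat (S.coordPt w) - R.mat (S.coordPt (y k)) - R.lmat (w - y k)) - R.lmat (w - y k) := by
    abel
  rw [e]
  refine matFil_mono (m := k) (n := (n + k : ℕ)) (by push_cast; linarith) (sub_mem (sub_mem (hyk k).2 ?_) ?_)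
  · exact matFil_mono (by linarith) h3
  · exact R.lmat_mem hh (hwk k)

/-- The bridge between generators and congruences; all later properties of `ω` are read off from the
matrix filtration through it. The hard direction factors `z` into generators of level `n` by
`exists_coordPt`. -/
lemma mem_mp_iff (hp : coxeterNum b * ramDeg p K < p - 1) {n : ℕ} (hn : 1 ≤ n) {z : Pts K A K} :
    z ∈ S.mp p n ↔ R.mat z - 1 ∈ matFil p K (coxeterNum b) R.wtHt n := by
  refine ⟨R.mat_sub_one_of_mem_mp hp hn, fun hz => ?_⟩
  obtain ⟨y, hy, rfl⟩ := R.exists_coordPt coxeterNum_pos hp hn hz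
  exact S.coordPt_mem_mp hn hy

lemma coordPt_sub_one {h : ℕ} (hh : 0 < h) (hp : h * ramDeg p K < p - 1) {n : ℤ} (hn : 1 ≤ n)
    {x : LieG K A} (hx : x ∈ S.lieFil p h n) :
    R.mat (S.coordPt x) - 1 - R.lmat x ∈ matFil p K h R.wtHt (n + 1) := by
  have := (R.coordPt_add_sub hh hp hn (zero_mem _) hx).2
  rwa [zero_add, S.coordPt_zero, map_one] at this

lemma conj_mem_mp (R : ChevalleyRep p S J) (hp : coxeterNum b * ramDeg p K < p - 1) {n : ℕ} (hn : 1 ≤ n) {g z : Pts K A K}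
    (hg : g ∈ S.mp p 0) (hz : z ∈ S.mp p n) : g * z * g⁻¹ ∈ S.mp p n := by
  rw [R.mem_mp_iff hp hn] at hz ⊢
  obtain ⟨h1, h2⟩ := R.mat_mem_of_mem_iwahori hp hg
  have e : R.mat (g * z * g⁻¹) - 1 = R.mat g * (R.mat z - 1) * R.mat g⁻¹ := by
    rw [mul_sub, sub_mul, mul_one, R.mat_mul_inv, map_mul, map_mul]
  rw [e]
  exact matFil_mul_of_eq (matFil_mul_of_eq h1 hz (r := n) (by simp)) h2 (by simp)

/-- Points of `G` of large level are `p`-th powers. -/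
lemma exists_pow_prime_eq {h : ℕ} (hh : 0 < h) (hp : h * ramDeg p K < p - 1) {z : Pts K A K}
    (hz : R.mat z - 1 ∈ matFil p K h R.wtHt (h * ramDeg p K + 1)) :
    ∃ y : Pts K A K, R.mat y - 1 ∈ matFil p K h R.wtHt 1 ∧ y ^ p = z := by
  set E : ℤ := h * ramDeg p K with hE
  have hE0 : 0 ≤ E := by positivity
  have hpow : ∀ {y : Pts K A K} {r : ℤ}, 1 ≤ r → R.mat y - 1 ∈ matFil p K h R.wtHt r →
      ∀ m : ℕ, R.mat (y ^ m) - 1 ∈ matFil p K h R.wtHt r := by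
    intro y r hr hy m
    induction m with
    | zero => simp [zero_mem]
    | succ m ih =>
      rw [pow_succ, map_mul]
      have := add_mem (mul_sub_one_mem_matFil ih hy (r := r) (by linarith)) (add_mem ih hy)
      rwa [sub_add_cancel] at this
  obtain ⟨y, hy0, hyk, hys⟩ := exists_seq_of_step
    (fun k y => R.mat y - 1 ∈ matFil p K h R.wtHt 1 ∧
      R.mat z - R.mat (y ^ p) ∈ matFil p K h R.wtHt (E + 1 + k))
    (fun k y y' => R.mat y' - R.mat y ∈ matFil p K h R.wtHt (k + 1)) 1
    ⟨by simp [zero_mem], by simpa using hz⟩ (by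
      rintro k y ⟨hy, hzy⟩
      have hk0 : (0 : ℤ) ≤ k := by positivity
      have h1 := hpow le_rfl hy p
      have h1' := inv_sub_one_mem_matFil hh le_rfl h1 (R.mat_mul_inv _)
      have h2 : R.mat ((y ^ p)⁻¹ * z) - 1 ∈ matFil p K h R.wtHt (E + 1 + k) := by
        have e : R.mat ((y ^ p)⁻¹ * z) - 1 = R.mat (y ^ p)⁻¹ * (R.mat z - R.mat (y ^ p)) := by
          rw [mul_sub, R.mat_inv_mul, map_mul]
        rw [e]
        exact matFil_mul_of_eq (mem_matFil_zero_of_sub_one zero_le_one h1') hzy (by simp)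
      obtain ⟨x, hx, hzx⟩ := R.exists_lie_of_mat hh hp (by linarith) h2
      -- Newton step: the defect `x` of level `he + 1 + k` is divided by `p`, and the point with
      -- coordinates `x/p`, of level `1 + k`, corrects the approximate root.
      have hx' : (p : K)⁻¹ • x ∈ S.lieFil p h (1 + k) :=
        S.lieFil_mono (by linarith) (S.prime_inv_smul_mem_lieFil hh hx)
      set g := S.coordPt ((p : K)⁻¹ • x) with hg
      have hg1 := R.coordPt_sub_one hh hp (by linarith) hx'
      have hg0 : R.mat g - 1 ∈ matFil p K h R.wtHt (1 + k) := by
        rw [← sub_add_cancel (R.mat g - 1) (R.lmat ((p : K)⁻¹ • x))]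
        exact add_mem (matFil_mono (by linarith) hg1) (R.lmat_mem hh hx')
      have hyy : R.mat (y * g) - R.mat y ∈ matFil p K h R.wtHt (1 + k) := by
        have e : R.mat (y * g) - R.mat y = R.mat y * (R.mat g - 1) := by
          rw [map_mul, mul_sub, mul_one]
        rw [e]
        exact matFil_mul_of_eq (mem_matFil_zero_of_sub_one zero_le_one hy) hg0 (by simp)
      have hyg : R.mat (y * g) - 1 ∈ matFil p K h R.wtHt 1 := by
        rw [← sub_add_sub_cancel (R.mat (y * g)) (R.mat y) 1]
        exact add_mem (matFil_mono (by linarith) hyy) hy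
      refine ⟨y * g, ⟨hyg, ?_⟩, by rwa [add_comm] at hyy⟩
      have h3 := add_one_pow_prime_sub le_rfl hh hp hy hyg (q := 1 + k)
        (by rwa [sub_sub_sub_cancel_right])
      rw [add_sub_cancel, add_sub_cancel, sub_sub_sub_cancel_right, ← map_pow, ← map_pow] at h3
      -- The new defect is split so that every summand visibly has level `he + 2 + k`: the
      -- first-order errors of the logarithm, of the `p`-th power map and of `coordPt`, and products
      -- of `x` with something in `E_1`.
      have e : R.mat z - R.mat ((y * g) ^ p) =
          (R.mat (y ^ p) * (R.mat ((y ^ p)⁻¹ * z) - 1 - R.lmat x) +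
            (R.mat (y ^ p) - 1) * R.lmat x) -
          (R.mat ((y * g) ^ p) - R.mat (y ^ p) - (p : K) • (R.mat (y * g) - R.mat y)) -
          (p : K) • (R.mat y * (R.mat g - 1 - R.lmat ((p : K)⁻¹ • x))) -
          (R.mat y - 1) * R.lmat x := by
        have e1 : R.mat (y ^ p) * R.mat ((y ^ p)⁻¹ * z) = R.mat z := by
          rw [← map_mul, mul_inv_cancel_left]
        have e2 : (p : K) • (R.mat y * R.lmat ((p : K)⁻¹ • x)) = R.mat y * R.lmat x := by
          rw [map_smul, Matrix.mul_smul, smul_smul, mul_inv_cancel₀ (prime_ne_zero p K), one_smul]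
        rw [mul_sub, mul_sub, e1, mul_sub (R.mat y), mul_sub (R.mat y), smul_sub, smul_sub,
          smul_sub, e2, ← map_mul R.mat y g]
        noncomm_ring
      rw [e]
      have hx0 := R.lmat_mem hh hx
      refine sub_mem (sub_mem (sub_mem (add_mem ?_ ?_) ?_) ?_) ?_
      · exact matFil_mul_of_eq (mem_matFil_zero_of_sub_one zero_le_one h1) hzx
          (by push_cast; linarith)
      · exact matFil_mul_of_eq h1 hx0 (by push_cast; linarith)
      · exact matFil_mono (by push_cast; linarith) h3
      · have := matFil_mul_of_eq (mem_matFil_zero_of_sub_one zero_le_one hy) hg1 le_rfl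
        exact matFil_mono (by push_cast; linarith) (matFil_prime_smul this hh)
      · exact matFil_mul_of_eq hy hx0 (by push_cast; linarith))
  obtain ⟨w, hw⟩ := R.exists_pt_limit hh 1 y hys
  have hw1 : R.mat w - 1 ∈ matFil p K h R.wtHt 1 := by
    have := hw 0
    rw [hy0, map_one] at this
    rw [← neg_sub]
    exact neg_mem (by simpa using this)
  refine ⟨w, hw1, R.mat_injective (sub_eq_zero.1 (eq_zero_of_forall_matFil (p := p) (ℓ := R.wtHt) hh
    fun k => ?_))⟩
  have h1 := pow_sub_pow_mem_matFil (mem_matFil_zero_of_sub_one zero_le_one hw1)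
    (mem_matFil_zero_of_sub_one zero_le_one (hyk k).1) (hw k) (p - 1)
  rw [Nat.sub_add_cancel (Fact.out : p.Prime).one_le, ← map_pow, ← map_pow] at h1
  have e : R.mat (w ^ p) - R.mat z = -(R.mat z - R.mat (y k ^ p)) -
    (R.mat (y k ^ p) - R.mat (w ^ p)) := by abel
  rw [e]
  refine sub_mem (neg_mem (matFil_mono (by linarith) (hyk k).2)) (matFil_mono (by simp) h1)

end MoyPrasad

end ChevalleyRep

namespace ChevalleyRep

variable {p : ℕ} [Fact p.Prime] {K : Type*} [Field K] [CharZero K] [Algebra ℚ_[p] K]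
  [FiniteDimensional ℚ_[p] K] [Algebra ℤ_[p] K] [IsScalarTower ℤ_[p] ℚ_[p] K]
  {A : Type*} [CommRing A] [HopfAlgebra K A]
  {X Y : Type*} [AddCommGroup X] [AddCommGroup Y]
  {ι : Type*} [Fintype ι] {P : RootPairing ι ℤ X Y} [P.IsReduced] {b : P.Base}
  {π : A →ₐc[K] AddMonoidAlgebra K X} {S : ChevalleySystem P b π}
  {J : Type*} [Fintype J] [DecidableEq J] (R : ChevalleyRep p S J)

/-! ### The saturated `p`-valuation `ω`. -/

section Filtration

variable [Module.Free ℤ X] [Module.Finite ℤ X]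

/-- Every `z ≠ 1` in the pro-`p` Iwahori has a well-defined level. -/
lemma exists_level (R : ChevalleyRep p S J) (hp : coxeterNum b * ramDeg p K < p - 1)
    {z : S.proPIwahori p} (hz : z ≠ 1) :
    ∃ n : ℕ, 1 ≤ n ∧ ∀ m, (z : Pts K A K) ∈ S.mp p m ↔ m ≤ n := by
  classical
  -- A point in every group of the filtration has matrix `1`, hence is trivial by faithfulness.
  -- Without this the supremum in `omega` could take its junk value.
  have hex : ∃ m, (z : Pts K A K) ∉ S.mp p m := by
    by_contra! h
    refine hz (Subtype.ext (R.mat_injective (sub_eq_zero.1 (eq_zero_of_forall_matFil (p := p)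
      (ℓ := R.wtHt) (coxeterNum_pos (b := b)) fun n => ?_))))
    have := R.mat_sub_one_of_mem_mp hp (Nat.succ_pos n) (h (n + 1))
    rw [OneMemClass.coe_one, map_one]
    exact matFil_mono (by push_cast; linarith) this
  have h1 : (z : Pts K A K) ∈ S.mp p 1 := z.2
  have h2 : ∀ m, (z : Pts K A K) ∈ S.mp p m ↔ m < Nat.find hex := by
    intro m
    refine ⟨fun hm => ?_, fun hm => not_not.1 (Nat.find_min hex hm)⟩
    by_contra! hlt
    exact Nat.find_spec hex (S.mp_antitone hlt hm)
  have h3 := (h2 1).1 h1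
  refine ⟨Nat.find hex - 1, by omega, fun m => (h2 m).trans (by omega)⟩

lemma exists_isGreatest (R : ChevalleyRep p S J) (hp : coxeterNum b * ramDeg p K < p - 1)
    {z : S.proPIwahori p} (hz : z ≠ 1) :
    ∃ n : ℕ, IsGreatest {n : ℕ | (z : Pts K A K) ∈ S.mp p n} n := by
  obtain ⟨n, -, hn⟩ := R.exists_level hp hz
  exact ⟨n, (hn n).2 le_rfl, fun m hm => (hn m).1 hm⟩

variable (p) in
/-- The real number `n / (h e)`. -/
noncomputable def _root_.levelReal (K : Type*) [Field K] [CharZero K] [Algebra ℚ_[p] K]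
    [FiniteDimensional ℚ_[p] K] [Algebra ℤ_[p] K] [IsScalarTower ℤ_[p] ℚ_[p] K]
    (b : P.Base) (n : ℕ) : ℝ := (n : ℝ) / (coxeterNum b * ramDeg p K)

lemma _root_.levelReal_denom_pos : (0 : ℝ) < coxeterNum b * ramDeg p K := by
  have h1 := coxeterNum_pos (b := b)
  have h2 := ramDeg_pos p K
  positivity

lemma _root_.levelReal_le_iff {m n : ℕ} : levelReal p K b m ≤ levelReal p K b n ↔ m ≤ n := by
  rw [levelReal, levelReal, div_le_div_iff_of_pos_right levelReal_denom_pos]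
  exact Nat.cast_le

lemma _root_.levelReal_injective : Function.Injective (levelReal p K b) := fun _ _ h =>
  le_antisymm (levelReal_le_iff.1 h.le) (levelReal_le_iff.1 h.ge)

lemma _root_.levelReal_add (m n : ℕ) :
    levelReal p K b (m + n) = levelReal p K b m + levelReal p K b n := by
  rw [levelReal, levelReal, levelReal, ← add_div]; push_cast; rfl

lemma _root_.levelReal_add_one (n : ℕ) :
    levelReal p K b (n + coxeterNum b * ramDeg p K) = levelReal p K b n + 1 := by
  rw [levelReal_add, add_right_inj, levelReal]
  push_cast
  exact div_self levelReal_denom_pos.ne'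

lemma _root_.levelReal_pos {n : ℕ} (hn : 1 ≤ n) : 0 < levelReal p K b n := by
  have : (0 : ℝ) < n := by exact_mod_cast hn
  exact div_pos this levelReal_denom_pos

lemma _root_.exists_le_levelReal (c : ℝ) : ∃ n, c ≤ levelReal p K b n := by
  obtain ⟨n, hn⟩ := exists_nat_ge (c * (coxeterNum b * ramDeg p K))
  exact ⟨n, (le_div_iff₀ levelReal_denom_pos).2 hn⟩

lemma _root_.ChevalleySystem.omega_one : S.omega p 1 = ⊤ := if_pos rfl

lemma exists_omega_eq (R : ChevalleyRep p S J) (hp : coxeterNum b * ramDeg p K < p - 1)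
    {z : S.proPIwahori p} (hz : z ≠ 1) :
    ∃ n : ℕ, 1 ≤ n ∧ S.omega p z = (levelReal p K b n : ℝ) ∧
      ∀ m, (z : Pts K A K) ∈ S.mp p m ↔ m ≤ n := by
  obtain ⟨n, hn1, hn⟩ := R.exists_level hp hz
  refine ⟨n, hn1, ?_, hn⟩
  have : sSup {n : ℕ | (z : Pts K A K) ∈ S.mp p n} = n :=
    IsGreatest.csSup_eq ⟨(hn n).2 le_rfl, fun m hm => (hn m).1 hm⟩
  rw [ChevalleySystem.omega, if_neg hz, this]
  rfl

lemma le_omega_iff (R : ChevalleyRep p S J) (hp : coxeterNum b * ramDeg p K < p - 1)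
    {z : S.proPIwahori p} {m : ℕ} :
    ((levelReal p K b m : ℝ) : WithTop ℝ) ≤ S.omega p z ↔ (z : Pts K A K) ∈ S.mp p m := by
  by_cases hz : z = 1
  · subst hz
    simp [S.omega_one, one_mem]
  · obtain ⟨n, -, hn, hm⟩ := R.exists_omega_eq hp hz
    rw [hn, hm, WithTop.coe_le_coe, levelReal_le_iff]

/-- Values of `ω` other than `∞` are of the form `n/(he)`, so strictly exceeding one level means
reaching the next. -/
lemma lt_omega_iff (R : ChevalleyRep p S J) (hp : coxeterNum b * ramDeg p K < p - 1)
    {z : S.proPIwahori p} {m : ℕ} :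
    ((levelReal p K b m : ℝ) : WithTop ℝ) < S.omega p z ↔ (z : Pts K A K) ∈ S.mp p (m + 1) := by
  by_cases hz : z = 1
  · subst hz
    simp [S.omega_one, one_mem]
  · obtain ⟨n, -, hn, hm⟩ := R.exists_omega_eq hp hz
    rw [hn, hm, WithTop.coe_lt_coe, lt_iff_not_ge, levelReal_le_iff]
    omega

/-- Because `z^p - 1 ≡ p (z - 1)` with an error strictly deeper than `p (z - 1)`, taking `p`-th
powers shifts levels by exactly `he`. -/
lemma mem_mp_pow_iff (R : ChevalleyRep p S J) (hp : coxeterNum b * ramDeg p K < p - 1)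
    {z : Pts K A K} {n : ℕ} (hn : 1 ≤ n) (hz : z ∈ S.mp p 1) :
    z ^ p ∈ S.mp p (n + coxeterNum b * ramDeg p K) ↔ z ∈ S.mp p n := by
  have hh := coxeterNum_pos (b := b)
  have hE : (0 : ℤ) ≤ coxeterNum b * ramDeg p K := by positivity
  have key : ∀ m : ℕ, 1 ≤ m → z ∈ S.mp p m →
      (z ^ p ∈ S.mp p (m + coxeterNum b * ramDeg p K)) ∧
      (z ^ p ∈ S.mp p (m + 1 + coxeterNum b * ramDeg p K) → z ∈ S.mp p (m + 1)) := by
    intro m hm h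
    have hm' : (1 : ℤ) ≤ m := by exact_mod_cast hm
    have h0 := (R.mem_mp_iff hp hm).1 h
    have h1 := pow_prime_sub_one hm' hh hp h0
    rw [← map_pow] at h1
    refine ⟨(R.mem_mp_iff hp (by omega)).2 ?_, fun h2 => ?_⟩
    · rw [← sub_add_cancel (R.mat (z ^ p) - 1) ((p : K) • (R.mat z - 1))]
      push_cast
      exact add_mem (matFil_mono (by linarith) h1) (matFil_prime_smul h0 hh)
    · have h3 := (R.mem_mp_iff hp (by omega)).1 h2
      rw [R.mem_mp_iff hp (by omega)]
      have h4 : (p : K) • (R.mat z - 1) ∈ matFil p K (coxeterNum b) R.wtHt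
          (m + 1 + coxeterNum b * ramDeg p K) := by
        rw [← sub_sub_cancel (R.mat (z ^ p) - 1) ((p : K) • (R.mat z - 1))]
        exact sub_mem (by push_cast at h3; exact h3) (matFil_mono (by linarith) h1)
      have h5 := matFil_prime_inv_smul h4 hh
      rw [smul_smul, inv_mul_cancel₀ (prime_ne_zero p K), one_smul] at h5
      push_cast
      exact matFil_mono (by linarith) h5
  refine ⟨fun h => ?_, fun h => (key n hn h).1⟩
  -- The estimate for `z^p` depends on the level already known for `z`, so the level of `z` is
  -- raised one step at a time.
  have : ∀ m, 1 ≤ m → m ≤ n → z ∈ S.mp p m := by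
    intro m hm
    induction m, hm using Nat.le_induction with
    | base => exact fun _ => hz
    | succ m hm ih =>
      intro hmn
      exact (key m hm (ih (by omega))).2 (S.mp_antitone (by omega) h)
  exact this n hn le_rfl

lemma gcomm_mem_mp (R : ChevalleyRep p S J) (hp : coxeterNum b * ramDeg p K < p - 1) {m n : ℕ}
    (hm : 1 ≤ m) (hn : 1 ≤ n) {x y : Pts K A K} (hx : x ∈ S.mp p m) (hy : y ∈ S.mp p n) :
    gcomm x y ∈ S.mp p (m + n) := by
  have hx' := (R.mem_mp_iff hp hm).1 hx
  have hy' := (R.mem_mp_iff hp hn).1 hy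
  have h := comm_sub_one_mem_matFil coxeterNum_pos (by exact_mod_cast hm) (by exact_mod_cast hn)
    hx' hy' (R.mat_mul_inv x) (R.mat_mul_inv y)
  rw [R.mem_mp_iff hp (by omega), gcomm, map_mul, map_mul, map_mul,
    ← sub_add_cancel (R.mat x * R.mat y * R.mat x⁻¹ * R.mat y⁻¹ - 1)
      ((R.mat x - 1) * (R.mat y - 1) - (R.mat y - 1) * (R.mat x - 1))]
  push_cast
  exact add_mem (matFil_mono (by linarith) h)
    (sub_mem (matFil_mul hx' hy') (matFil_mul_of_eq hy' hx' (by linarith)))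

/-- The filtration of the pro-`p` Iwahori by `ω`. -/
noncomputable def filtration (R : ChevalleyRep p S J) (hp : coxeterNum b * ramDeg p K < p - 1) :
    PFiltration p (S.proPIwahori p) where
  toFun := S.omega p
  pos z := by
    by_cases hz : z = 1
    · rw [hz, S.omega_one]; exact WithTop.coe_lt_top 0
    · obtain ⟨n, h1, hn, -⟩ := R.exists_omega_eq hp hz
      rw [hn]
      exact_mod_cast levelReal_pos h1
  eq_top_iff z := by
    refine ⟨fun h => ?_, fun h => by rw [h, S.omega_one]⟩
    by_contra hz
    obtain ⟨n, h1, hn, -⟩ := R.exists_omega_eq hp hz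
    rw [hn] at h
    exact WithTop.coe_ne_top h
  le_div x y := by
    by_cases hx : x = 1
    · by_cases hy : y = 1
      · rw [hx, hy, one_mul, inv_one, S.omega_one]; exact le_top
      · obtain ⟨n, -, hn, hn'⟩ := R.exists_omega_eq hp hy
        refine (min_le_right _ _).trans ?_
        rw [hx, one_mul, hn, R.le_omega_iff hp]
        exact inv_mem ((hn' n).2 le_rfl)
    · obtain ⟨n, -, hn, hn'⟩ := R.exists_omega_eq hp hx
      rcases le_total (S.omega p x) (S.omega p y) with h | h
      · rw [min_eq_left h, hn, R.le_omega_iff hp]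
        rw [hn, R.le_omega_iff hp] at h
        exact mul_mem ((hn' n).2 le_rfl) (inv_mem h)
      · rw [min_eq_right h]
        by_cases hy : y = 1
        · rw [hy, S.omega_one, top_le_iff] at h
          rw [h] at hn
          exact absurd hn.symm WithTop.coe_ne_top
        · obtain ⟨m, -, hm, hm'⟩ := R.exists_omega_eq hp hy
          rw [hm, R.le_omega_iff hp] at h ⊢
          exact mul_mem h (inv_mem ((hm' m).2 le_rfl))
  le_comm x y := by
    by_cases hx : x = 1
    · have : gcomm x y = 1 := by rw [hx]; simp [gcomm]
      rw [this, S.omega_one]; exact le_top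
    by_cases hy : y = 1
    · have : gcomm x y = 1 := by rw [hy]; simp [gcomm]
      rw [this, S.omega_one]; exact le_top
    obtain ⟨n, h1, hn, hn'⟩ := R.exists_omega_eq hp hx
    obtain ⟨m, h2, hm, hm'⟩ := R.exists_omega_eq hp hy
    rw [hn, hm, ← WithTop.coe_add, ← levelReal_add, R.le_omega_iff hp]
    exact R.gcomm_mem_mp hp h1 h2 ((hn' n).2 le_rfl) ((hm' m).2 le_rfl)
  le_pow x := by
    refine (min_le_right _ _).trans ?_
    by_cases hx : x = 1
    · rw [hx, one_pow, S.omega_one]; exact le_top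
    obtain ⟨n, h1, hn, hn'⟩ := R.exists_omega_eq hp hx
    have : ((levelReal p K b n : ℝ) : WithTop ℝ) + 1 =
      ((levelReal p K b (n + coxeterNum b * ramDeg p K) : ℝ) : WithTop ℝ) := by
      rw [levelReal_add_one]; rfl
    rw [hn, this, R.le_omega_iff hp]
    exact (R.mem_mp_pow_iff hp h1 x.2).2 ((hn' n).2 le_rfl)

/-- The smallest value of `ω` is at least `1/(he)`, which exceeds `1/(p - 1)` precisely because `he
< p - 1`; the `p`-th power rule is the exact shift by `he`, one unit of `ω`. -/
lemma filtration_isPValuation (R : ChevalleyRep p S J)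
    (hp : coxeterNum b * ramDeg p K < p - 1) : (R.filtration hp).IsPValuation := by
  intro x hx
  obtain ⟨n, h1, hn, hn'⟩ := R.exists_omega_eq hp hx
  change _ < S.omega p x ∧ S.omega p (x ^ p) = S.omega p x + 1
  have hlt : (coxeterNum b * ramDeg p K : ℝ) < p - 1 := by
    have : ((coxeterNum b * ramDeg p K : ℕ) : ℝ) < ((p - 1 : ℕ) : ℝ) := by exact_mod_cast hp
    rw [Nat.cast_sub (Fact.out : p.Prime).one_le] at this
    push_cast at this
    exact this
  constructor
  · rw [hn, WithTop.coe_lt_coe, levelReal]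
    have h1' : (1 : ℝ) ≤ n := by exact_mod_cast h1
    exact (one_div_lt_one_div_of_lt levelReal_denom_pos hlt).trans_le
      (div_le_div_of_nonneg_right h1' levelReal_denom_pos.le)
  · have h2 : S.omega p x + 1 =
        ((levelReal p K b (n + coxeterNum b * ramDeg p K) : ℝ) : WithTop ℝ) := by
      rw [hn, levelReal_add_one]; rfl
    rw [h2]
    refine le_antisymm (le_of_not_gt fun h => ?_) ?_
    · rw [R.lt_omega_iff hp, add_right_comm] at h
      have := (R.mem_mp_pow_iff hp (by omega) x.2).1 h
      rw [hn'] at this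
      omega
    · rw [R.le_omega_iff hp]
      exact (R.mem_mp_pow_iff hp h1 x.2).2 ((hn' n).2 le_rfl)

lemma filtration_isComplete (R : ChevalleyRep p S J)
    (hp : coxeterNum b * ramDeg p K < p - 1) : (R.filtration hp).IsComplete := by
  intro s hs
  have hh := coxeterNum_pos (b := b)
  have h1 : ∀ k : ℕ, ∃ N, ∀ m ≥ N, ∀ n ≥ N, R.mat (s n : Pts K A K) - R.mat (s m : Pts K A K) ∈
      matFil p K (coxeterNum b) R.wtHt (k + 1) := by
    intro k
    obtain ⟨N, hN⟩ := hs (levelReal p K b (k + 1))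
    refine ⟨N, fun m hm n hn => ?_⟩
    have h2 := R.mat_sub_one_of_mem_mp hp (by omega) ((R.le_omega_iff hp).1 (hN m hm n hn))
    have h3 := mem_matFil_zero_of_sub_one zero_le_one
      (R.mat_sub_one_of_mem_mp hp le_rfl (s m).2)
    have e : R.mat (s n : Pts K A K) - R.mat (s m : Pts K A K) = R.mat (s m : Pts K A K) *
        (R.mat (((s m)⁻¹ * s n : S.proPIwahori p) : Pts K A K) - 1) := by
      rw [Subgroup.coe_mul, Subgroup.coe_inv, mul_sub, ← map_mul, mul_inv_cancel_left, mul_one]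
    rw [e]
    exact matFil_mul_of_eq h3 h2 (by push_cast; linarith)
  choose N hN using h1
  -- The running maximum gives a subsequence along which the `k`-th step already has level `k + 1`.
  set M : ℕ → ℕ := fun k => (Finset.range (k + 1)).sup N with hM
  have hNM : ∀ k l, k ≤ l → N k ≤ M l := fun k l hkl =>
    Finset.le_sup (f := N) (Finset.mem_range.2 (by omega))
  obtain ⟨w, hw⟩ := R.exists_pt_limit hh 1 (fun k => (s (M k) : Pts K A K)) fun k =>
    hN k _ (hNM k k le_rfl) _ (hNM k (k + 1) (by omega))
  have hw1 : R.mat w - 1 ∈ matFil p K (coxeterNum b) R.wtHt 1 := by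
    rw [← sub_sub_sub_cancel_left _ _ (R.mat (s (M 0) : Pts K A K)), ← neg_sub, ← neg_sub,]
    have h2 := R.mat_sub_one_of_mem_mp hp le_rfl (s (M 0)).2
    have h3 := hw 0
    rw [neg_neg]
    exact sub_mem (by simpa using h2) (by simpa using h3)
  have hwm : w ∈ S.mp p 1 := (R.mem_mp_iff hp le_rfl).2 (by simpa using hw1)
  refine ⟨⟨w, hwm⟩, fun c => ?_⟩
  obtain ⟨k, hk⟩ := exists_le_levelReal (p := p) (K := K) (b := b) c
  refine ⟨M k, fun n hn => ?_⟩
  refine le_trans (WithTop.coe_le_coe.2 (hk.trans (levelReal_le_iff.2 (Nat.le_succ k))))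
    ((R.le_omega_iff hp).2 ((R.mem_mp_iff hp (by omega)).2 ?_))
  have h2 : R.mat (s n : Pts K A K) - R.mat w ∈ matFil p K (coxeterNum b) R.wtHt (k + 1) := by
    rw [← sub_add_sub_cancel _ (R.mat (s (M k) : Pts K A K))]
    exact add_mem (hN k _ (hNM k k le_rfl) _ ((hNM k k le_rfl).trans hn)) (hw k)
  have h3 := inv_sub_one_mem_matFil hh le_rfl hw1 (R.mat_mul_inv w)
  have e : R.mat (((⟨w, hwm⟩ : S.proPIwahori p)⁻¹ * s n : S.proPIwahori p) : Pts K A K) - 1 =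
      R.mat w⁻¹ * (R.mat (s n : Pts K A K) - R.mat w) := by
    rw [Subgroup.coe_mul, Subgroup.coe_inv, mul_sub, R.mat_inv_mul, map_mul]
  rw [e]
  exact matFil_mul_of_eq (mem_matFil_zero_of_sub_one zero_le_one h3) h2 (by push_cast; linarith)

lemma filtration_isSaturated (R : ChevalleyRep p S J)
    (hp : coxeterNum b * ramDeg p K < p - 1) : (R.filtration hp).IsSaturated := by
  refine ⟨R.filtration_isComplete hp, fun x hx => ?_⟩
  -- Only `ω(x) > 1` is used, which is weaker than `ω(x) > p/(p - 1)`: it means level at least `he +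
  -- 1`, the range of `exists_pow_prime_eq`.
  have h1 : ((levelReal p K b (coxeterNum b * ramDeg p K) : ℝ) : WithTop ℝ) < S.omega p x := by
    refine lt_of_le_of_lt ?_ hx
    have h2 : levelReal p K b (coxeterNum b * ramDeg p K) = 1 := by
      have := levelReal_add_one (p := p) (K := K) (b := b) 0
      rw [zero_add] at this
      rw [this, levelReal]; simp
    rw [h2, WithTop.coe_le_coe]
    have h3 : (1 : ℝ) < p := by exact_mod_cast (Fact.out : p.Prime).one_lt
    rw [le_div_iff₀ (by linarith)]
    linarith
  rw [R.lt_omega_iff hp, R.mem_mp_iff hp (by omega)] at h1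
  obtain ⟨y, hy, hyx⟩ := R.exists_pow_prime_eq coxeterNum_pos hp (by push_cast at h1; exact h1)
  exact ⟨⟨y, (R.mem_mp_iff hp le_rfl).2 (by simpa using hy)⟩, Subtype.ext hyx⟩

lemma filtration_conj (R : ChevalleyRep p S J) (hp : coxeterNum b * ramDeg p K < p - 1)
    {g : Pts K A K} (hg : g ∈ S.iwahori p) (z : S.proPIwahori p) :
    ∃ z' : S.proPIwahori p, (z' : Pts K A K) = g * z * g⁻¹ ∧
      S.omega p z' = S.omega p z := by
  have hz' : g * z * g⁻¹ ∈ S.mp p 1 := R.conj_mem_mp hp le_rfl hg z.2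
  refine ⟨⟨_, hz'⟩, rfl, ?_⟩
  have key : ∀ {g : Pts K A K} (_ : g ∈ S.iwahori p) (z z' : S.proPIwahori p)
      (_ : (z' : Pts K A K) = g * z * g⁻¹), S.omega p z ≤ S.omega p z' := by
    intro g hg z z' h
    by_cases hz : z = 1
    · have : z' = 1 := by
        apply Subtype.ext
        rw [h, hz]; simp
      rw [this, S.omega_one]; exact le_top
    · obtain ⟨n, h1, hn, hn'⟩ := R.exists_omega_eq hp hz
      rw [hn, R.le_omega_iff hp, h]
      exact R.conj_mem_mp hp h1 hg ((hn' n).2 le_rfl)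
  refine le_antisymm (key (inv_mem hg) _ _ ?_) (key hg _ _ rfl)
  simp only [inv_inv]
  group

end Filtration

end ChevalleyRep

/-! ### A finiteness criterion of Poincaré–Birkhoff–Witt type. -/

section FiniteAlgebra

variable {O E : Type*} [CommRing O] [Ring E] [Algebra O E] {σ : Type*} (x : σ → E)

variable (O) in
/-- The span of the words of length less than `n` in the family `x`. -/
def wordSpan (n : ℕ) : Submodule O E :=
  Submodule.span O {y | ∃ l : List σ, l.length < n ∧ (l.map x).prod = y}

lemma word_mem_wordSpan {n : ℕ} {l : List σ} (hl : l.length < n) :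
    (l.map x).prod ∈ wordSpan O x n := Submodule.subset_span ⟨l, hl, rfl⟩

lemma mul_mem_wordSpan (s : σ) {n : ℕ} {y : E} (hy : y ∈ wordSpan O x n) :
    x s * y ∈ wordSpan O x (n + 1) := by
  induction hy using Submodule.span_induction with
  | mem y hy =>
    obtain ⟨l, hl, rfl⟩ := hy
    exact word_mem_wordSpan x (l := s :: l) (by simpa using hl)
  | zero => rw [mul_zero]; exact zero_mem _
  | add a b _ _ ha hb => rw [mul_add]; exact add_mem ha hb
  | smul c a _ ha => rw [mul_smul_comm]; exact Submodule.smul_mem _ _ ha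

variable {x}

/-- Swapping two adjacent letters costs a commutator, which is a combination of single letters, so
words may be reordered modulo shorter words. -/
lemma prod_sub_prod_mem_wordSpan
    (hcomm : ∀ s t, x s * x t - x t * x s ∈ Submodule.span O (Set.range x)) {l l' : List σ}
    (h : l.Perm l') : (l.map x).prod - (l'.map x).prod ∈ wordSpan O x l.length := by
  induction h with
  | nil => simp [zero_mem]
  | cons a _ ih =>
    simp only [List.map_cons, List.prod_cons, ← mul_sub, List.length_cons]
    exact mul_mem_wordSpan x a ih
  | swap a c l =>
    have e : ((c :: a :: l).map x).prod - ((a :: c :: l).map x).prod =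
        (x c * x a - x a * x c) * (l.map x).prod := by
      simp only [List.map_cons, List.prod_cons]
      noncomm_ring
    rw [e]
    have h := hcomm c a
    generalize x c * x a - x a * x c = y at h
    induction h using Submodule.span_induction with
    | mem y hy =>
      obtain ⟨s, rfl⟩ := hy
      exact word_mem_wordSpan x (l := s :: l) (by simp)
    | zero => rw [zero_mul]; exact zero_mem _
    | add a b _ _ ha hb => rw [add_mul]; exact add_mem ha hb
    | smul c a _ ha => rw [smul_mul_assoc]; exact Submodule.smul_mem _ _ ha
  | trans h _ ih1 ih2 =>
    rw [← sub_add_sub_cancel]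
    exact add_mem ih1 (by rwa [← h.length_eq] at ih2)

lemma exists_pow_mem_span {y : E} (hy : IsIntegral O y) : ∃ d : ℕ,
    y ^ d ∈ Submodule.span O {z | ∃ i < d, y ^ i = z} := by
  obtain ⟨q, hq, hqy⟩ := hy
  refine ⟨q.natDegree, ?_⟩
  have h : Polynomial.aeval y q = 0 := hqy
  rw [Polynomial.aeval_eq_sum_range, Finset.sum_range_succ, hq.coeff_natDegree, one_smul] at h
  rw [eq_neg_of_add_eq_zero_right h]
  exact neg_mem (sum_mem fun i hi => Submodule.smul_mem _ _
    (Submodule.subset_span ⟨i, Finset.mem_range.1 hi, rfl⟩))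

/-- An algebra generated by finitely many integral elements whose commutators lie in their span is
contained in a finite module. -/
lemma exists_fg_of_commutator_mem [Finite σ] (hint : ∀ s, IsIntegral O (x s))
    (hcomm : ∀ s t, x s * x t - x t * x s ∈ Submodule.span O (Set.range x)) :
    ∃ M : Submodule O E, M.FG ∧ 1 ∈ M ∧ ∀ s, ∀ m ∈ M, x s * m ∈ M := by
  classical
  have := Fintype.ofFinite σ
  choose d hd using fun s => exists_pow_mem_span (hint s)
  -- In a word of length greater than `∑ d s` some letter `s` occurs at least `d s` times. After
  -- collecting these at the front, integrality replaces `x s ^ d s` by lower powers, so words of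
  -- length `n` are combinations of shorter ones. The `+ 1` puts the empty word in the span even
  -- when there are no letters.
  set n := ∑ s, d s + 1 with hn
  have key : ∀ l : List σ, l.length = n → (l.map x).prod ∈ wordSpan O x l.length := by
    intro l hl
    obtain ⟨s, hs⟩ : ∃ s, d s ≤ l.count s := by
      by_contra! h
      have h1 : ∑ s, (l : Multiset σ).count s = l.length := by
        rw [Multiset.sum_count_eq_card fun a _ => Finset.mem_univ a]; rfl
      have h2 := Finset.sum_le_sum fun s (_ : s ∈ Finset.univ) => (h s).le
      simp only [Multiset.coe_count] at h1
      omega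
    obtain ⟨l', hl'⟩ := (List.replicate_sublist_iff.2 hs).exists_perm_append
    rw [← sub_add_cancel (l.map x).prod ((List.replicate (d s) s ++ l').map x).prod]
    refine add_mem (prod_sub_prod_mem_wordSpan hcomm hl') ?_
    have hlen : l.length = d s + l'.length := by simpa using hl'.length_eq
    rw [List.map_append, List.prod_append, List.map_replicate, List.prod_replicate]
    have h := hd s
    generalize x s ^ d s = y at h
    induction h using Submodule.span_induction with
    | mem y hy =>
      obtain ⟨i, hi, rfl⟩ := hy
      have := word_mem_wordSpan (O := O) x (n := l.length) (l := List.replicate i s ++ l')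
        (by rw [List.length_append, List.length_replicate]; omega)
      rwa [List.map_append, List.prod_append, List.map_replicate, List.prod_replicate] at this
    | zero => rw [zero_mul]; exact zero_mem _
    | add a b _ _ ha hb => rw [add_mul]; exact add_mem ha hb
    | smul c a _ ha => rw [smul_mul_assoc]; exact Submodule.smul_mem _ _ ha
  refine ⟨wordSpan O x n, ?_, word_mem_wordSpan x (l := []) (by simp [hn]), fun s m hm => ?_⟩
  · refine Submodule.fg_span (Set.Finite.subset
      ((List.finite_length_lt σ n).image fun l => (l.map x).prod) ?_)
    rintro y ⟨l, hl, rfl⟩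
    exact ⟨l, hl, rfl⟩
  · have h1 := mul_mem_wordSpan x s hm
    refine (Submodule.span_le.2 ?_ : wordSpan O x (n + 1) ≤ wordSpan O x n) h1
    rintro y ⟨l, hl, rfl⟩
    rcases (Nat.lt_succ_iff.1 hl).lt_or_eq with h | h
    · exact word_mem_wordSpan x h
    · have := key l h
      rwa [h] at this

end FiniteAlgebra

/-! ### Heights of weights and fundamental weights. -/

section RootData

variable {X Y ι : Type*} [AddCommGroup X] [AddCommGroup Y] {P : RootPairing ι ℤ X Y}
  (b : P.Base)

/-- The height function extends to the weights. -/
lemma exists_heightHom : ∃ ht : X →+ ℚ, ∀ i, ht (P.root i) = b.height i := by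
  have hli : LinearIndependent ℤ fun i : b.support => P.root i := b.linearIndepOn_root
  set Q := Submodule.span ℤ (Set.range fun i : b.support => P.root i)
  let g : Q →ₗ[ℤ] ℚ := (Finsupp.linearCombination ℤ fun _ : b.support => (1 : ℚ)) ∘ₗ hli.repr
  -- The height is defined on the root lattice by independence of the simple roots, and extends to
  -- all weights because `ℚ` is divisible. This is why weights get rational heights.
  obtain ⟨ht, hht⟩ := (Module.Baer.of_divisible ℚ).extension_property_addMonoidHom
    Q.subtype.toAddMonoidHom Subtype.val_injective g.toAddMonoidHom
  have h1 : ∀ i ∈ b.support, ht (P.root i) = 1 := by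
    intro i hi
    have h2 := DFunLike.congr_fun hht ⟨P.root i, Submodule.subset_span ⟨⟨i, hi⟩, rfl⟩⟩
    change ht (P.root i) = Finsupp.linearCombination ℤ _ (hli.repr _) at h2
    rw [h2, hli.repr_eq_single ⟨i, hi⟩ _ rfl]
    simp
  refine ⟨ht, fun i => ?_⟩
  obtain ⟨f, hf⟩ : ∃ f : ι → ℤ, P.root i = ∑ j ∈ b.support, f j • P.root j :=
    ⟨_, (b.exists_root_eq_sum_int i).choose_spec.2.2⟩
  rw [b.height_eq_sum hf, hf, map_sum, Int.cast_sum]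
  refine Finset.sum_congr rfl fun j hj => ?_
  rw [map_zsmul, h1 j hj]
  simp

/-- Fundamental weights exist if the coroots span. -/
lemma exists_fundamentalWeight (hsc : Submodule.span ℤ (Set.range P.coroot) = ⊤)
    (i : b.support) : ∃ ϖ : X, P.toLinearMap ϖ (P.coroot i) = 1 ∧
      ∀ j : b.support, j ≠ i → P.toLinearMap ϖ (P.coroot j) = 0 := by
  classical
  have hli : LinearIndependent ℤ fun i : b.support => P.coroot i := b.linearIndepOn_coroot
  -- Simple connectedness: the simple coroots form a basis of `Y`, whose dual basis lies in `X` by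
  -- perfectness of the pairing.
  have hsp : ⊤ ≤ Submodule.span ℤ (Set.range fun i : b.support => P.coroot i) := by
    rw [← hsc, ← b.span_int_coroot_support, Set.image_eq_range]
    exact le_rfl
  set B := Module.Basis.mk hli hsp
  obtain ⟨ϖ, hϖ⟩ := (LinearMap.IsPerfPair.bijective_left P.toLinearMap).2 (B.coord i)
  have h : ∀ j : b.support, P.toLinearMap ϖ (P.coroot j) = if i = j then 1 else 0 := by
    intro j
    have : P.coroot j = B j := by rw [Module.Basis.mk_apply]
    rw [hϖ, this, B.coord_apply, B.repr_self, Finsupp.single_apply]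
    simp [eq_comm]
  exact ⟨ϖ, by simp [h], fun j hj => by rw [h, if_neg hj.symm]⟩

end RootData

/-! ### Weight decomposition of functions under the torus. -/

section WeightProjections

variable {K A : Type*} [Field K] [CommRing A] [HopfAlgebra K A]

lemma actL_actL (φ ψ : A →ₗ[K] K) (f : A) : actL φ (actL ψ f) = actL (φ ∘ₗ actL ψ) f := by
  rw [actL_apply φ, comul_actL, ← LinearMap.comp_apply (φ.lTensor A), ← LinearMap.lTensor_comp,
    ← actL_apply]

lemma actL_smul (c : K) (φ : A →ₗ[K] K) (f : A) : actL (c • φ) f = c • actL φ f := by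
  rw [actL_apply, actL_apply, LinearMap.lTensor_smul, LinearMap.smul_apply, map_smul]

/-- `actL φ f` depends on finitely many values of `φ`. -/
lemma exists_actL_eq_sum (f : A) : ∃ s : Finset (A × A), ∀ φ : A →ₗ[K] K,
    actL φ f = ∑ t ∈ s, φ t.2 • t.1 := by
  obtain ⟨s, hs⟩ := TensorProduct.exists_finset (R := K) (Coalgebra.comul (R := K) f)
  refine ⟨s, fun φ => ?_⟩
  rw [actL_apply, hs, map_sum, map_sum]
  simp

lemma LieG.eq_actL [CharZero K] (D : LieG K A) (f : A) : (D : Derivation K A A) f =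
    actL (Coalgebra.counit (R := K) ∘ₗ ((D : Derivation K A A) : A →ₗ[K] A)) f :=
  LieG.apply_eq D f

lemma rightTranslate_eq_actL (z : Pts K A K) (f : A) :
    rightTranslate z f = actL z.ofConv.toLinearMap f := rfl

variable {X Y : Type*} [AddCommGroup X] [AddCommGroup Y] (π : A →ₐc[K] AddMonoidAlgebra K X)

/-- The coefficient of the character `χ` in the restriction of a function to the torus. -/
noncomputable def torusCoeff (χ : X) : A →ₗ[K] K :=
  Finsupp.lapply χ ∘ₗ (AddMonoidAlgebra.coeffLinearEquiv K).toLinearMap ∘ₗ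
    (π : A →ₐ[K] AddMonoidAlgebra K X).toLinearMap

lemma torusCoeff_apply (χ : X) (f : A) : torusCoeff π χ f = (π f).coeff χ := rfl

/-- The projection to the functions of weight `χ` for right translation by the torus. -/
noncomputable def wproj (χ : X) : A →ₗ[K] A := actL (torusCoeff π χ)

/-- `π` is compatible with comultiplication and characters are group-like in `K[X]`, so on the torus
the projection just extracts one character. The idempotency and orthogonality of the projections
follow. -/
lemma map_wproj (χ : X) (f : A) :
    π (wproj π χ f) = AddMonoidAlgebra.single χ ((π f).coeff χ) := by
  set γ : AddMonoidAlgebra K X →ₗ[K] K :=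
    Finsupp.lapply χ ∘ₗ (AddMonoidAlgebra.coeffLinearEquiv K).toLinearMap with hγ
  have hπ : ∀ t : A ⊗[K] A, π (TensorProduct.rid K A ((torusCoeff π χ).lTensor A t)) =
      TensorProduct.rid K _ (γ.lTensor _ (TensorProduct.map
        ((π : A →ₗc[K] AddMonoidAlgebra K X) : A →ₗ[K] AddMonoidAlgebra K X)
        ((π : A →ₗc[K] AddMonoidAlgebra K X) : A →ₗ[K] AddMonoidAlgebra K X) t)) := by
    intro t
    induction t with
    | zero => simp
    | add x y hx hy => simp only [map_add, hx, hy]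
    | tmul x y =>
      simp only [LinearMap.lTensor_tmul, TensorProduct.rid_tmul, map_smul, TensorProduct.map_tmul]
      rfl
  have hΔ : TensorProduct.map
        ((π : A →ₗc[K] AddMonoidAlgebra K X) : A →ₗ[K] AddMonoidAlgebra K X)
        ((π : A →ₗc[K] AddMonoidAlgebra K X) : A →ₗ[K] AddMonoidAlgebra K X)
        (Coalgebra.comul (R := K) f) = Coalgebra.comul (R := K) (π f) :=
    CoalgHomClass.map_comp_comul_apply π f
  rw [wproj, actL_apply, hπ, hΔ]
  generalize π f = t
  classical
  induction t using AddMonoidAlgebra.induction_linear with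
  | zero => simp
  | add x y hx hy => simp only [map_add, hx, hy, AddMonoidAlgebra.coeff_add, Finsupp.add_apply,
      AddMonoidAlgebra.single_add]
  | single θ c =>
    rw [AddMonoidAlgebra.comul_single]
    rw [CommSemiring.comul_apply, TensorProduct.map_tmul, LinearMap.lTensor_tmul, TensorProduct.rid_tmul,
      AddMonoidAlgebra.coeff_single, Finsupp.single_apply]
    have h2 : γ (AddMonoidAlgebra.lsingle (R := K) θ c) = if θ = χ then c else 0 := by
      rw [← Finsupp.single_apply]; rfl
    rw [h2]
    split_ifs with h
    · subst h
      rw [AddMonoidAlgebra.lsingle_apply, AddMonoidAlgebra.smul_single, smul_eq_mul, mul_one]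
    · simp

lemma wproj_wproj_self (χ : X) (f : A) : wproj π χ (wproj π χ f) = wproj π χ f := by
  conv_lhs => rw [wproj, actL_actL]
  refine congrArg (fun φ => actL φ f) (LinearMap.ext fun g => ?_)
  rw [LinearMap.comp_apply, torusCoeff_apply]
  change (π (wproj π χ g)).coeff χ = _
  rw [map_wproj, AddMonoidAlgebra.coeff_single, Finsupp.single_eq_same]; rfl

lemma wproj_wproj_of_ne {χ ψ : X} (h : χ ≠ ψ) (f : A) : wproj π χ (wproj π ψ f) = 0 := by
  have : torusCoeff π χ ∘ₗ actL (torusCoeff π ψ) = 0 := by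
    ext g
    rw [LinearMap.comp_apply, torusCoeff_apply]
    change (π (wproj π ψ g)).coeff χ = _
    rw [map_wproj, AddMonoidAlgebra.coeff_single, Finsupp.single_eq_of_ne h]; rfl
  conv_lhs => rw [wproj, wproj, actL_actL, this]
  simp [actL_apply]

/-- The counit on `K[X]` is the sum of all coefficients, so the projections sum to the action of the
counit, which is the identity. Only the characters that occur in the finitely many tensor factors of
the comultiplication of `f` matter. -/
lemma exists_sum_wproj (f : A) : ∃ F : Finset X, ∑ χ ∈ F, wproj π χ f = f := by
  classical
  obtain ⟨s, hs⟩ := exists_actL_eq_sum (K := K) f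
  refine ⟨s.biUnion fun t => (π t.2).coeff.support, ?_⟩
  simp only [wproj, hs]
  rw [Finset.sum_comm]
  conv_rhs => rw [← actL_counit (K := K) f, hs]
  refine Finset.sum_congr rfl fun t ht => ?_
  rw [← Finset.sum_smul]
  congr 1
  have h3 : Coalgebra.counit (R := K) t.2 = Coalgebra.counit (R := K) (π t.2) :=
    (CoalgHomClass.counit_comp_apply π t.2).symm
  have h4 : ∀ q : AddMonoidAlgebra K X, Coalgebra.counit (R := K) q = q.coeff.sum fun _ c => c := by
    intro q
    induction q using AddMonoidAlgebra.induction_linear with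
    | zero => simp
    | add x y hx hy =>
      rw [map_add, hx, hy, AddMonoidAlgebra.coeff_add,
        Finsupp.sum_add_index (by simp) (by simp)]
    | single θ c =>
      rw [AddMonoidAlgebra.counit_single, AddMonoidAlgebra.coeff_single,
        Finsupp.sum_single_index rfl]
      rfl
  rw [h3, h4, Finsupp.sum]
  simp only [torusCoeff_apply]
  refine (Finset.sum_subset (Finset.subset_biUnion_of_mem (fun t : A × A => (π t.2).coeff.support) ht)
    fun χ _ hχ => ?_).symm
  exact Finsupp.notMem_support_iff.1 hχ

lemma rightTranslate_wproj (τ : Multiplicative X →* Kˣ) (χ : X) (f : A) :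
    rightTranslate (torusPt π τ) (wproj π χ f) =
      (τ (Multiplicative.ofAdd χ) : K) • wproj π χ f := by
  rw [rightTranslate_eq_actL, wproj, actL_actL, ← actL_smul]
  refine congrArg (fun φ => actL φ f) (LinearMap.ext fun g => ?_)
  rw [LinearMap.comp_apply, LinearMap.smul_apply, torusCoeff_apply]
  change AddMonoidAlgebra.lift K K X ((Units.coeHom K).comp τ) (π (wproj π χ g)) = _
  rw [map_wproj, AddMonoidAlgebra.lift_single]
  simp [mul_comm]

lemma wproj_rightTranslate (τ : Multiplicative X →* Kˣ) (χ : X) (f : A) :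
    wproj π χ (rightTranslate (torusPt π τ) f) =
      (τ (Multiplicative.ofAdd χ) : K) • wproj π χ f := by
  obtain ⟨F, hF⟩ := exists_sum_wproj π f
  conv_lhs => rw [← hF, map_sum, map_sum]
  conv_rhs => rw [← hF, map_sum, Finset.smul_sum]
  refine Finset.sum_congr rfl fun θ _ => ?_
  rw [rightTranslate_wproj, map_smul]
  by_cases h : χ = θ
  · rw [h]
  · rw [wproj_wproj_of_ne π h, smul_zero, smul_zero]

/-- A function which is an eigenvector of the torus is a weight vector. -/
lemma wproj_eq_self [CharZero K] [Module.Free ℤ X] [Module.Finite ℤ X] {χ : X} {f : A}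
    (h : ∀ τ : Multiplicative X →* Kˣ, rightTranslate (torusPt π τ) f =
      (τ (Multiplicative.ofAdd χ) : K) • f) : wproj π χ f = f := by
  have h0 : ∀ θ, θ ≠ χ → wproj π θ f = 0 := by
    intro θ hθ
    obtain ⟨τ, hτ⟩ := exists_torus_ne_one (K := K) (sub_ne_zero.2 hθ)
    have h1 := wproj_rightTranslate π τ θ f
    rw [h τ, map_smul, ← sub_eq_zero, ← sub_smul, smul_eq_zero] at h1
    refine h1.resolve_left fun h2 => hτ ?_
    rw [ofAdd_sub, map_div, Units.ext (sub_eq_zero.1 h2), div_self']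
  obtain ⟨F, hF⟩ := exists_sum_wproj π f
  conv_rhs => rw [← hF]
  by_cases hχ : χ ∈ F
  · rw [Finset.sum_eq_single_of_mem χ hχ fun θ _ hθ => h0 θ hθ]
  · have h3 : f = 0 := by
      rw [← hF]
      exact Finset.sum_eq_zero fun θ hθ => h0 θ (fun h => hχ (h ▸ hθ))
    rw [hF, h3, map_zero]

variable {π} {ι : Type*} [Fintype ι] {P : RootPairing ι ℤ X Y} [P.IsReduced] {b : P.Base}
  (S : ChevalleySystem P b π)

lemma ChevalleySystem.wproj_rootVec [CharZero K] [Module.Free ℤ X] [Module.Finite ℤ X] (α : ι)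
    {χ : X} {f : A} (hf : wproj π χ f = f) :
    wproj π (P.root α + χ) ((S.basis (Sum.inr α) : Derivation K A A) f) =
      (S.basis (Sum.inr α) : Derivation K A A) f := by
  refine wproj_eq_self π fun τ => ?_
  rw [S.weight, ← hf, rightTranslate_wproj, hf, Derivation.map_smul, smul_smul, ofAdd_add, map_mul,
    Units.val_mul]

lemma ChevalleySystem.H_apply_of_wproj [CharZero K] (i : ι) {χ : X} {f : A} (hf : wproj π χ f = f) :
    (S.H i : Derivation K A A) f = ((P.toLinearMap χ (P.coroot i) : ℤ) : K) • f := by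
  conv_lhs => rw [← hf, LieG.eq_actL, wproj, actL_actL]
  conv_rhs => rw [← hf, wproj, ← actL_smul]
  refine congrArg (fun φ => actL φ f) (LinearMap.ext fun g => ?_)
  simp only [LinearMap.comp_apply, LinearMap.smul_apply, torusCoeff_apply]
  have h := S.H_spec i (wproj π χ g)
  rw [map_wproj, AddMonoidAlgebra.coeff_single, Finsupp.sum_single_index (by simp)] at h
  rw [smul_eq_mul, mul_comm]
  exact h

end WeightProjections

/-! ### Local finiteness of the regular representation. -/

section StableSubspace

variable {K A : Type*} [Field K] [CommRing A] [HopfAlgebra K A]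

/-- Functions lie in finite-dimensional subspaces which are stable under the group. -/
lemma exists_stable_subspace [hft : Algebra.FiniteType K A] {T : Set A} (hT : T.Finite) :
    ∃ W : Submodule K A, FiniteDimensional K W ∧ (∀ φ : A →ₗ[K] K, ∀ f ∈ W, actL φ f ∈ W) ∧
      Algebra.adjoin K (W : Set A) = ⊤ ∧ T ⊆ W := by
  classical
  obtain ⟨G, hG⟩ := hft.out
  set U : Set A := T ∪ G with hU
  -- Finite-dimensional because all `actL φ t`, for fixed `t`, lie in the span of the finitely many
  -- left tensor factors of the comultiplication of `t`. Including algebra generators in `U` makes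
  -- the representation faithful.
  set W := Submodule.span K {f : A | ∃ t ∈ U, ∃ φ : A →ₗ[K] K, f = actL φ t} with hW
  have hUW : U ⊆ W := fun t ht =>
    Submodule.subset_span ⟨t, ht, Coalgebra.counit, (actL_counit t).symm⟩
  choose s hs using fun f : A => exists_actL_eq_sum (K := K) f
  have hfin : (⋃ t ∈ U, Prod.fst '' (s t : Set (A × A))).Finite :=
    (hT.union G.finite_toSet).biUnion fun t _ => (s t).finite_toSet.image _
  have hle : W ≤ Submodule.span K (⋃ t ∈ U, Prod.fst '' (s t : Set (A × A))) := by
    refine Submodule.span_le.2 ?_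
    rintro f ⟨t, ht, φ, rfl⟩
    rw [SetLike.mem_coe, hs]
    exact sum_mem fun q hq => Submodule.smul_mem _ _
      (Submodule.subset_span (Set.mem_biUnion ht ⟨q, hq, rfl⟩))
  have := FiniteDimensional.span_of_finite K hfin
  refine ⟨W, Submodule.finiteDimensional_of_le hle, fun φ f hf => ?_, ?_,
    Set.subset_union_left.trans hUW⟩
  · induction hf using Submodule.span_induction with
    | mem f hf =>
      obtain ⟨t, ht, ψ, rfl⟩ := hf
      exact Submodule.subset_span ⟨t, ht, _, actL_actL φ ψ t⟩
    | zero => rw [map_zero]; exact zero_mem _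
    | add f g _ _ hf hg => rw [map_add]; exact add_mem hf hg
    | smul c f _ hf => rw [map_smul]; exact Submodule.smul_mem _ _ hf
  · rw [eq_top_iff, ← hG]
    exact Algebra.adjoin_mono (Set.subset_union_right.trans hUW)

end StableSubspace

/-! ### Matrix coefficients of a stable subspace. -/

section MatrixCoefficients

variable {K A : Type*} [Field K] [CommRing A] [HopfAlgebra K A] {J : Type*} [Fintype J]

lemma exists_dual_family {w : J → A} (hli : LinearIndependent K w) :
    ∃ d : J → A →ₗ[K] K, (∀ j, d j (w j) = 1) ∧ (∀ i j, i ≠ j → d i (w j) = 0) ∧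
      ∀ v ∈ Submodule.span K (Set.range w), v = ∑ i, d i v • w i := by
  classical
  obtain ⟨g, hg⟩ := (Finsupp.linearCombination K w).exists_leftInverse_of_injective
    (LinearMap.ker_eq_bot.2 hli)
  have hgw : ∀ j, g (w j) = Finsupp.single j 1 := by
    intro j
    have := LinearMap.congr_fun hg (Finsupp.single j 1)
    simpa using this
  have h1 : ∀ i j, (Finsupp.lapply i ∘ₗ g) (w j) = if j = i then 1 else 0 := by
    intro i j
    rw [LinearMap.comp_apply, hgw, Finsupp.lapply_apply, Finsupp.single_apply]
  refine ⟨fun i => Finsupp.lapply i ∘ₗ g, fun j => by simp [h1],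
    fun i j hij => by rw [h1, if_neg hij.symm], fun v hv => ?_⟩
  induction hv using Submodule.span_induction with
  | mem v hv =>
    obtain ⟨j, rfl⟩ := hv
    simp [h1]
  | zero => simp
  | add f g _ _ hf hg =>
    conv_lhs => rw [hf, hg]
    simp only [map_add, add_smul, Finset.sum_add_distrib]
  | smul c f _ hf =>
    conv_lhs => rw [hf]
    simp only [map_smul, smul_eq_mul, mul_smul, Finset.smul_sum]

/-- The function `d(f₍₁₎) f₍₂₎`. -/
noncomputable def actR (d : A →ₗ[K] K) : A →ₗ[K] A :=
  (TensorProduct.lid K A).toLinearMap ∘ₗ d.rTensor A ∘ₗ Coalgebra.comul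

lemma actR_apply (d : A →ₗ[K] K) (f : A) :
    actR d f = TensorProduct.lid K A (d.rTensor A (Coalgebra.comul (R := K) f)) := rfl

lemma map_actR (φ d : A →ₗ[K] K) (f : A) : φ (actR d f) = d (actL φ f) := by
  rw [actR_apply, actL_apply]
  generalize Coalgebra.comul (R := K) f = t
  induction t with
  | zero => simp
  | add x y hx hy => simp only [map_add, hx, hy]
  | tmul x y => simp [mul_comm]

/-- Functionals on the right factor separate tensors, as a basis of that factor shows. It allows the
comultiplication on a stable subspace to be computed one functional at a time. -/
lemma tensor_ext_right {t t' : A ⊗[K] A} (h : ∀ φ : A →ₗ[K] K,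
    TensorProduct.rid K A (φ.lTensor A t) = TensorProduct.rid K A (φ.lTensor A t')) : t = t' := by
  classical
  set C := Module.Basis.ofVectorSpace K A
  have key : ∀ (t : A ⊗[K] A) (i), TensorProduct.equivFinsuppOfBasisRight C t i =
      TensorProduct.rid K A ((C.coord i).lTensor A t) := by
    intro t i
    induction t with
    | zero => simp
    | add x y hx hy => simp only [map_add, Finsupp.add_apply, hx, hy]
    | tmul x y =>
      rw [TensorProduct.equivFinsuppOfBasisRight_apply_tmul_apply]
      simp
  apply (TensorProduct.equivFinsuppOfBasisRight (M := A) C).injective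
  ext i
  rw [key, key, h]

variable {w : J → A} {d : J → A →ₗ[K] K}

lemma comul_eq_sum_tmul_actR
    (hd : ∀ v ∈ Submodule.span K (Set.range w), v = ∑ i, d i v • w i)
    (hst : ∀ (φ : A →ₗ[K] K) (j : J), actL φ (w j) ∈ Submodule.span K (Set.range w))
    (j : J) :
    Coalgebra.comul (R := K) (w j) = ∑ i, w i ⊗ₜ[K] actR (d i) (w j) := by
  refine tensor_ext_right fun φ => ?_
  rw [← actL_apply, hd _ (hst φ j)]
  simp [map_actR]

lemma comul_actR
    (hd : ∀ v ∈ Submodule.span K (Set.range w), v = ∑ i, d i v • w i)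
    (hst : ∀ (φ : A →ₗ[K] K) (j : J), actL φ (w j) ∈ Submodule.span K (Set.range w))
    (i j : J) : Coalgebra.comul (R := K) (actR (d i) (w j)) =
    ∑ k, actR (d i) (w k) ⊗ₜ[K] actR (d k) (w j) := by
  have h1 : ∀ t : A ⊗[K] A, Coalgebra.comul (R := K) (TensorProduct.lid K A ((d i).rTensor A t)) =
      TensorProduct.lid K (A ⊗[K] A) ((d i).rTensor (A ⊗[K] A)
        ((Coalgebra.comul (R := K) (A := A)).lTensor A t)) := by
    intro t
    induction t with
    | zero => simp
    | add x y hx hy => simp only [map_add, hx, hy]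
    | tmul x y => simp
  have h2 : ∀ (t : A ⊗[K] A) (g : A), TensorProduct.lid K (A ⊗[K] A) ((d i).rTensor (A ⊗[K] A)
      (TensorProduct.assoc K A A A (t ⊗ₜ g))) =
      TensorProduct.lid K A ((d i).rTensor A t) ⊗ₜ[K] g := by
    intro t g
    induction t with
    | zero => simp
    | add x y hx hy => simp only [map_add, TensorProduct.add_tmul, hx, hy]
    | tmul x y => simp [TensorProduct.smul_tmul']
  rw [actR_apply, h1, ← Coalgebra.coassoc_apply, comul_eq_sum_tmul_actR hd hst j]
  simp only [map_sum, LinearMap.rTensor_tmul, h2]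
  rfl

/-- Contracting the formula for the comultiplication with the counit gives `w_j = ∑ ε(w_i) g_{ij}`.
Hence the matrix coefficients generate `A` whenever the stable subspace does. -/
lemma mem_span_actR
    (hd : ∀ v ∈ Submodule.span K (Set.range w), v = ∑ i, d i v • w i)
    (hst : ∀ (φ : A →ₗ[K] K) (j : J), actL φ (w j) ∈ Submodule.span K (Set.range w))
    (j : J) :
    w j ∈ Submodule.span K (Set.range fun ij : J × J => actR (d ij.1) (w ij.2)) := by
  have h := Coalgebra.rTensor_counit_comul (R := K) (w j)
  rw [comul_eq_sum_tmul_actR hd hst j] at h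
  have h2 := congrArg (TensorProduct.lid K A) h
  simp only [map_sum, LinearMap.rTensor_tmul, TensorProduct.lid_tmul, one_smul] at h2
  rw [← h2]
  exact sum_mem fun i _ => Submodule.smul_mem _ _ (Submodule.subset_span ⟨(i, j), rfl⟩)

end MatrixCoefficients

/-! ### Integrality of the Chevalley basis on a stable subspace. -/

section WeightLattice

variable {p : ℕ} [Fact p.Prime] {K : Type*} [Field K] [CharZero K] [Algebra ℚ_[p] K]
  [FiniteDimensional ℚ_[p] K] [Algebra ℤ_[p] K] [IsScalarTower ℤ_[p] ℚ_[p] K]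
  {A : Type*} [CommRing A] [HopfAlgebra K A]
  {X Y : Type*} [AddCommGroup X] [AddCommGroup Y] [Module.Free ℤ X] [Module.Finite ℤ X]
  {ι : Type*} [Fintype ι] {P : RootPairing ι ℤ X Y} [P.IsReduced] {b : P.Base}
  {π : A →ₐc[K] AddMonoidAlgebra K X} (S : ChevalleySystem P b π)

lemma exists_weights {W : Submodule K A} [FiniteDimensional K W] :
    ∃ F : Finset X, ∀ f ∈ W, ∑ χ ∈ F, wproj π χ f = f := by
  classical
  choose F hF using exists_sum_wproj π
  obtain ⟨B, hB⟩ : W.FG := Module.Finite.iff_fg.1 inferInstance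
  refine ⟨B.biUnion F, fun f hf => ?_⟩
  rw [← hB] at hf
  induction hf using Submodule.span_induction with
  | mem f hf =>
    conv_rhs => rw [← hF f]
    refine (Finset.sum_subset (Finset.subset_biUnion_of_mem F hf) fun χ _ hχ => ?_).symm
    rw [← hF f, map_sum]
    exact Finset.sum_eq_zero fun θ hθ => wproj_wproj_of_ne π (fun h : χ = θ => hχ (h ▸ hθ)) _
  | zero => simp
  | add f g _ _ hf hg => simp only [map_add, Finset.sum_add_distrib, hf, hg]
  | smul c f _ hf => simp only [map_smul, ← Finset.smul_sum, hf]

lemma ChevalleySystem.wproj_rootVec_comm (α : ι) (χ : X) (f : A) :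
    wproj π (P.root α + χ) ((S.basis (Sum.inr α) : Derivation K A A) f) =
      (S.basis (Sum.inr α) : Derivation K A A) (wproj π χ f) := by
  classical
  obtain ⟨F, hF⟩ := exists_sum_wproj π f
  have h : ∀ θ, wproj π (P.root α + χ) ((S.basis (Sum.inr α) : Derivation K A A) (wproj π θ f)) =
      (S.basis (Sum.inr α) : Derivation K A A) (wproj π χ (wproj π θ f)) := by
    intro θ
    rw [← S.wproj_rootVec α (wproj_wproj_self π θ f)]
    by_cases hθ : χ = θ
    · rw [hθ, wproj_wproj_self, wproj_wproj_self, S.wproj_rootVec α (wproj_wproj_self π θ f)]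
    · rw [wproj_wproj_of_ne π (fun h => hθ (add_left_cancel h)), wproj_wproj_of_ne π hθ, map_zero]
  rw [← hF]
  simp only [map_sum, h]

variable {W : Submodule K A} (hst : ∀ φ : A →ₗ[K] K, ∀ f ∈ W, actL φ f ∈ W)

/-- The action of the Lie algebra on a stable subspace. -/
noncomputable def LieG.restr (hst : ∀ φ : A →ₗ[K] K, ∀ f ∈ W, actL φ f ∈ W) (D : LieG K A) :
    Module.End K W :=
  ((D : Derivation K A A) : A →ₗ[K] A).restrict fun f hf => by
    have := hst (Coalgebra.counit (R := K) ∘ₗ ((D : Derivation K A A) : A →ₗ[K] A)) f hf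
    rwa [← LieG.eq_actL] at this

lemma LieG.coe_restr (D : LieG K A) (f : W) :
    (LieG.restr hst D f : A) = (D : Derivation K A A) f := rfl

lemma LieG.coe_restr_pow (D : LieG K A) (n : ℕ) (f : W) :
    ((LieG.restr hst D ^ n) f : A) = (⇑(D : Derivation K A A))^[n] f := by
  induction n generalizing f with
  | zero => rfl
  | succ n ih => rw [pow_succ, Module.End.mul_apply, ih, Function.iterate_succ_apply]; rfl

lemma wproj_eq_zero_of_notMem {F : Finset X} (hF : ∀ f ∈ W, ∑ χ ∈ F, wproj π χ f = f) {χ : X}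
    (hχ : χ ∉ F) {f : A} (hf : f ∈ W) : wproj π χ f = 0 := by
  rw [← hF f hf, map_sum]
  exact Finset.sum_eq_zero fun θ hθ => wproj_wproj_of_ne π (fun h : χ = θ => hχ (h ▸ hθ)) _

variable [FiniteDimensional K W]

/-- `H_i` is diagonalizable with integer eigenvalues `⟨χ, α_i^∨⟩`, so the product of the
corresponding linear factors kills it. `X_α` shifts weights by `α` and there are finitely many
weights, so it is nilpotent. -/
lemma ChevalleySystem.isIntegral_restr (s : b.support ⊕ ι) :
    IsIntegral (RingInt p K) (LieG.restr hst (S.basis s)) := by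
  classical
  obtain ⟨F, hF⟩ := exists_weights (π := π) (W := W)
  rcases s with i | α
  · set n : X → RingInt p K := fun χ => ((P.toLinearMap χ (P.coroot i) : ℤ) : RingInt p K) with hn
    set q : (RingInt p K)[X] := ∏ χ ∈ F, (Polynomial.X - Polynomial.C (n χ)) with hq
    refine ⟨q, Polynomial.monic_prod_of_monic _ _ fun χ _ => Polynomial.monic_X_sub_C _, ?_⟩
    change Polynomial.aeval _ q = 0
    have key : ∀ χ ∈ F, ∀ f : W, wproj π χ f = f →
        Polynomial.aeval (LieG.restr hst (S.basis (Sum.inl i))) q f = 0 := by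
      intro χ hχ f hf
      rw [hq, ← Finset.prod_erase_mul _ _ hχ, map_mul, Module.End.mul_apply]
      have h0 : Polynomial.aeval (LieG.restr hst (S.basis (Sum.inl i)))
          (Polynomial.X - Polynomial.C (n χ)) f = 0 := by
        apply Subtype.ext
        rw [map_sub, Polynomial.aeval_X, Polynomial.aeval_C, LinearMap.sub_apply,
          Submodule.coe_sub, LieG.coe_restr, S.basis_inl, S.H_apply_of_wproj _ hf,
          hn, map_intCast, Module.End.intCast_apply, Int.cast_smul_eq_zsmul]
        exact sub_self _
      rw [h0, map_zero]
    ext f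
    have hf : f = ∑ χ ∈ F, (⟨wproj π χ f, hst _ _ f.2⟩ : W) := by
      apply Subtype.ext
      rw [Submodule.coe_sum]
      exact (hF f f.2).symm
    rw [hf, map_sum, Finset.sum_eq_zero fun χ hχ => key χ hχ _ (wproj_wproj_self π χ _)]
    rfl
  · refine ⟨Polynomial.X ^ F.card, Polynomial.monic_X_pow _, ?_⟩
    change Polynomial.aeval _ (Polynomial.X ^ F.card) = 0
    rw [map_pow, Polynomial.aeval_X]
    have hwt : ∀ (χ : X) (f : A), wproj π χ f = f → ∀ n : ℕ, wproj π (n • P.root α + χ)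
        ((⇑(S.basis (Sum.inr α) : Derivation K A A))^[n] f) =
        (⇑(S.basis (Sum.inr α) : Derivation K A A))^[n] f := by
      intro χ f hf n
      induction n with
      | zero => simpa using hf
      | succ n ih =>
        rw [Function.iterate_succ_apply', succ_nsmul', add_assoc]
        exact S.wproj_rootVec α ih
    have key : ∀ χ : X, ∀ f : W, wproj π χ f = f →
        (LieG.restr hst (S.basis (Sum.inr α)) ^ F.card) f = 0 := by
      intro χ f hf
      by_contra hne
      -- If the power `#F` did not kill `f`, then `χ, χ + α, …, χ + #F α` would be `#F + 1` weights
      -- in `F`, so two of them would coincide although `α` is nonzero in the torsion-free group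
      -- `X`.
      have hmem : ∀ n ∈ Finset.range (F.card + 1), n • P.root α + χ ∈ F := by
        intro n hn
        by_contra hnF
        have h1 := hwt χ f hf n
        rw [← LieG.coe_restr_pow hst, wproj_eq_zero_of_notMem hF hnF (Subtype.prop _)] at h1
        apply hne
        have hle : n ≤ F.card := by simpa [Nat.lt_succ_iff] using hn
        have h2 : (LieG.restr hst (S.basis (Sum.inr α)) ^ n) f = 0 := Subtype.ext h1.symm
        rw [← Nat.sub_add_cancel hle, pow_add, Module.End.mul_apply, h2, map_zero]
      obtain ⟨m, -, n, -, hmn, h2⟩ := Finset.exists_ne_map_eq_of_card_lt_of_maps_to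
        (by simp) hmem
      have h3 : (m : ℤ) • P.root α = (n : ℤ) • P.root α := by
        simpa using add_right_cancel h2
      exact hmn (by exact_mod_cast smul_left_injective ℤ (P.ne_zero α) h3)
    ext f
    have hf : f = ∑ χ ∈ F, (⟨wproj π χ f, hst _ _ f.2⟩ : W) := by
      apply Subtype.ext
      rw [Submodule.coe_sum]
      exact (hF f f.2).symm
    rw [hf, map_sum, Finset.sum_eq_zero fun χ _ => key χ _ (wproj_wproj_self π χ _)]
    rfl

/-- The structure constants of the Chevalley basis are integers; this is the commutator hypothesis
of `exists_fg_of_commutator_mem`. -/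
lemma ChevalleySystem.restr_commutator_mem (s t : b.support ⊕ ι) :
    LieG.restr hst (S.basis s) * LieG.restr hst (S.basis t) -
      LieG.restr hst (S.basis t) * LieG.restr hst (S.basis s) ∈
      Submodule.span (RingInt p K) (Set.range fun s => LieG.restr hst (S.basis s)) := by
  have h1 : LieG.restr hst (S.basis s) * LieG.restr hst (S.basis t) -
      LieG.restr hst (S.basis t) * LieG.restr hst (S.basis s) =
      LieG.restr hst ⁅S.basis s, S.basis t⁆ := by
    ext f
    exact (Derivation.commutator_apply _).symm
  rw [h1]
  have h2 := S.basis_lie_mem s t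
  generalize ⁅S.basis s, S.basis t⁆ = D at h2
  induction h2 using Submodule.span_induction with
  | mem D hD =>
    obtain ⟨s, rfl⟩ := hD
    exact Submodule.subset_span ⟨s, rfl⟩
  | zero =>
    have e : LieG.restr hst (0 : LieG K A) = 0 := rfl
    rw [e]; exact zero_mem _
  | add D E _ _ hD hE =>
    have e : LieG.restr hst (D + E) = LieG.restr hst D + LieG.restr hst E := rfl
    rw [e]; exact add_mem hD hE
  | smul c D _ hD =>
    have e : LieG.restr hst (c • D) = (c : RingInt p K) • LieG.restr hst D := by
      ext f
      exact (Int.cast_smul_eq_zsmul (RingInt p K) c ((D : Derivation K A A) f)).symm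
    rw [e]; exact Submodule.smul_mem _ _ hD

end WeightLattice

universe v

/-! ### Construction of the integral representation. -/

section WeightBasis

variable {p : ℕ} [Fact p.Prime] {K : Type*} [Field K] [CharZero K] [Algebra ℚ_[p] K]
  [FiniteDimensional ℚ_[p] K] [Algebra ℤ_[p] K] [IsScalarTower ℤ_[p] ℚ_[p] K]
  {A : Type*} [CommRing A] [HopfAlgebra K A]
  {X : Type v} {Y : Type*} [AddCommGroup X] [AddCommGroup Y] [Module.Free ℤ X] [Module.Finite ℤ X]
  {ι : Type*} [Fintype ι] {P : RootPairing ι ℤ X Y} [P.IsReduced] {b : P.Base}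
  {π : A →ₐc[K] AddMonoidAlgebra K X} (S : ChevalleySystem P b π)

/-- A stable subspace has a basis of weight vectors, whose span over the ring of integers is stable
under the Chevalley basis. -/
lemma ChevalleySystem.exists_integral_weight_basis {W : Submodule K A}
    (hst : ∀ φ : A →ₗ[K] K, ∀ f ∈ W, actL φ f ∈ W) [FiniteDimensional K W] :
    ∃ (J : Type v) (_ : Fintype J) (w : J → A) (wt : J → X), LinearIndependent K w ∧
      Submodule.span K (Set.range w) = W ∧ (∀ j, wproj π (wt j) (w j) = w j) ∧
      ∀ s j, (S.basis s : Derivation K A A) (w j) ∈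
        Submodule.span (RingInt p K) (Set.range w) := by
  classical
  obtain ⟨F, hF⟩ := exists_weights (π := π) (W := W)
  obtain ⟨M, hMfg, hM1, hMs⟩ := exists_fg_of_commutator_mem (O := RingInt p K)
    (S.isIntegral_restr hst) (S.restr_commutator_mem (p := p) hst)
  set B := Module.finBasis K W
  let ev : X → Fin (Module.finrank K W) → Module.End K W →ₗ[RingInt p K] A := fun χ i =>
    { toFun := fun m => wproj π χ (m (B i))
      map_add' := fun m n => by simp
      map_smul' := fun c m => by
        rw [LinearMap.smul_apply, RingHom.id_apply, ← algebraMap_smul K c (m (B i)),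
          Submodule.coe_smul, map_smul, algebraMap_smul] }
  have hev : ∀ χ i m, ev χ i m = wproj π χ (m (B i)) := fun _ _ _ => rfl
  -- The lattice generated by a `K`-basis under the finite module `M` of operators need not
  -- obviously be a sum of weight spaces, so its weight projections are taken instead. They remain
  -- stable, as `X_α` intertwines the projection to `χ` with the one to `α + χ`, and each is finite
  -- torsion-free, hence free, over `𝒪_K`.
  set L : X → Submodule (RingInt p K) A := fun χ => ⨆ i, M.map (ev χ i) with hL
  have hLmem : ∀ χ i, ∀ m ∈ M, wproj π χ (m (B i)) ∈ L χ := fun χ i m hm =>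
    (le_iSup (fun i => M.map (ev χ i)) i) ⟨m, hm, rfl⟩
  have hLind : ∀ (χ : X) (N : Submodule (RingInt p K) A),
      (∀ i, ∀ m ∈ M, wproj π χ (m (B i)) ∈ N) → L χ ≤ N := by
    intro χ N h
    refine iSup_le fun i => Submodule.map_le_iff_le_comap.2 fun m hm => h i m hm
  have hLw : ∀ χ, ∀ f ∈ L χ, wproj π χ f = f := by
    intro χ f hf
    refine hLind χ (LinearMap.eqLocus ((wproj π χ).restrictScalars (RingInt p K)) LinearMap.id)
      (fun i m _ => wproj_wproj_self π χ _) hf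
  have hLW : ∀ χ, ∀ f ∈ L χ, f ∈ W := fun χ f hf =>
    hLind χ (W.restrictScalars (RingInt p K)) (fun i m _ => hst _ _ (m (B i)).2) hf
  have hLF : ∀ χ, χ ∉ F → ∀ f ∈ L χ, f = 0 := fun χ hχ f hf => by
    rw [← hLw χ f hf, wproj_eq_zero_of_notMem hF hχ (hLW χ f hf)]
  have hfg : ∀ χ, (L χ).FG := fun χ => Submodule.fg_iSup _ fun i => hMfg.map _
  have hfin : ∀ χ, Module.Finite (RingInt p K) (L χ) := fun χ => Module.Finite.iff_fg.2 (hfg χ)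
  have htf : ∀ χ, Module.IsTorsionFree (RingInt p K) (L χ) := fun χ =>
    Module.IsTorsionFree.of_smul_eq_zero fun c f h => by
      have h1 : (c : K) • (f : A) = 0 := congrArg Subtype.val h
      rcases smul_eq_zero.1 h1 with h | h
      · exact Or.inl (Subtype.ext h)
      · exact Or.inr (Subtype.ext h)
  have hfree : ∀ χ, Module.Free (RingInt p K) (L χ) := fun χ =>
    Module.free_of_finite_type_torsion_free'
  let J := Σ χ : F, Fin (Module.finrank (RingInt p K) (L χ))
  let w : J → A := fun j => (Module.finBasis (RingInt p K) (L j.1) j.2 : A)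
  let wt : J → X := fun j => j.1
  have hw : ∀ j : J, wproj π (wt j) (w j) = w j := fun j => hLw (wt j) (w j) (SetLike.coe_mem _)
  have hspanL : ∀ χ, ∀ f ∈ L χ, f ∈ Submodule.span (RingInt p K) (Set.range w) := by
    intro χ f hf
    by_cases hχ : χ ∈ F
    · have h1 := (Module.finBasis (RingInt p K) (L χ)).sum_repr ⟨f, hf⟩
      have h2 := congrArg Subtype.val h1
      rw [Submodule.coe_sum] at h2
      rw [← show _ = f from h2]
      exact sum_mem fun i _ => Submodule.smul_mem _ _ (Submodule.subset_span ⟨⟨⟨χ, hχ⟩, i⟩, rfl⟩)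
    · rw [hLF χ hχ f hf]; exact zero_mem _
  have hOK : ∀ f ∈ Submodule.span (RingInt p K) (Set.range w),
      f ∈ Submodule.span K (Set.range w) := fun f hf =>
    Submodule.span_le_restrictScalars (RingInt p K) K _ hf
  refine ⟨J, inferInstance, w, wt, ?_, ?_, hw, ?_⟩
  · rw [Fintype.linearIndependent_iff]
    rintro g hg ⟨χ, i⟩
    have h1 : ∑ i, g ⟨χ, i⟩ • w ⟨χ, i⟩ = 0 := by
      have h2 := congrArg (wproj π (χ : X)) hg
      rw [map_zero, map_sum, Fintype.sum_sigma, Finset.sum_eq_single χ] at h2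
      · rw [← h2]
        refine Finset.sum_congr rfl fun i _ => ?_
        rw [map_smul, hw ⟨χ, i⟩]
      · intro θ _ hθ
        refine Finset.sum_eq_zero fun i _ => ?_
        rw [map_smul, ← hw ⟨θ, i⟩,
          wproj_wproj_of_ne π (fun h : (χ : X) = θ => hθ (Subtype.ext h.symm)), smul_zero]
      · simp
    have h3 : LinearIndependent K fun i => w ⟨χ, i⟩ := by
      rw [← LinearIndependent.iff_fractionRing (R := RingInt p K)]
      exact (Module.finBasis (RingInt p K) (L χ)).linearIndependent.map' (L χ).subtype
        (Submodule.ker_subtype _)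
    exact Fintype.linearIndependent_iff.1 h3 _ h1 i
  · refine le_antisymm (Submodule.span_le.2 ?_) fun f hf => ?_
    · rintro _ ⟨j, rfl⟩
      exact hLW _ _ (Subtype.prop _)
    · have h1 := congrArg Subtype.val (B.sum_repr ⟨f, hf⟩)
      rw [Submodule.coe_sum] at h1
      rw [← show _ = f from h1]
      refine sum_mem fun i _ => Submodule.smul_mem _ _ ?_
      rw [← hF _ (B i).2]
      exact sum_mem fun χ _ => hOK _ (hspanL χ _ (hLmem χ i 1 hM1))
  · intro s j
    have hj : w j ∈ L (wt j) := Subtype.prop _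
    rcases s with i | α
    · rw [S.basis_inl, S.H_apply_of_wproj i (hw j), Int.cast_smul_eq_zsmul]
      exact zsmul_mem (hspanL _ _ hj) _
    · refine hspanL (P.root α + wt j) _ ?_
      refine hLind (wt j) ((L (P.root α + wt j)).comap
        (((S.basis (Sum.inr α) : Derivation K A A) : A →ₗ[K] A).restrictScalars (RingInt p K)))
        (fun i m hm => ?_) hj
      change (S.basis (Sum.inr α) : Derivation K A A) (wproj π (wt j) (m (B i))) ∈
        L (P.root α + wt j)
      rw [← S.wproj_rootVec_comm]
      exact hLmem _ i _ (hMs (Sum.inr α) m hm)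

/-- The group `G` has a faithful representation with an integral weight basis. -/
lemma ChevalleySystem.exists_chevalleyRep [Algebra.FiniteType K A]
    (hsc : Submodule.span ℤ (Set.range P.coroot) = ⊤) :
    ∃ (J : Type v) (_ : Fintype J) (_ : DecidableEq J), Nonempty (ChevalleyRep p S J) := by
  classical
  choose om hom1 hom0 using exists_fundamentalWeight b hsc
  -- Functions on `G` restricting to given characters of the torus. Putting those for the roots and
  -- the fundamental weights into the stable subspace forces these characters to be weights.
  choose e he using fun χ : X => S.torus_surjective (AddMonoidAlgebra.single χ 1)
  obtain ⟨W, hWfin, hst, hadj, hTW⟩ := exists_stable_subspace (K := K)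
    (T := Set.range (fun i => e (P.root i)) ∪ Set.range (fun i => e (om i)))
    ((Set.finite_range _).union (Set.finite_range _))
  obtain ⟨J, hJ, w, wt, hli, hspan, hw, hint⟩ :=
    S.exists_integral_weight_basis (p := p) hst
  obtain ⟨d, hd1, hd0, hd⟩ := exists_dual_family hli
  obtain ⟨ht, hht⟩ := exists_heightHom b
  have hstw : ∀ (φ : A →ₗ[K] K) (j : J), actL φ (w j) ∈ Submodule.span K (Set.range w) := by
    intro φ j
    rw [hspan]
    exact hst φ _ (hspan ▸ Submodule.subset_span ⟨j, rfl⟩)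
  -- If `χ` were not a weight, the projection of `e χ` to `χ` would vanish, but its restriction to
  -- the torus is `χ` itself.
  have hexw : ∀ χ, e χ ∈ W → ∃ j, wt j = χ := by
    intro χ hχ
    by_contra! h
    have h1 : ∀ f ∈ W, wproj π χ f = 0 := by
      intro f hf
      rw [← hspan] at hf
      induction hf using Submodule.span_induction with
      | mem f hf =>
        obtain ⟨j, rfl⟩ := hf
        rw [← hw j, wproj_wproj_of_ne π (h j).symm]
      | zero => rw [map_zero]
      | add f g _ _ hf hg => rw [map_add, hf, hg, add_zero]
      | smul c f _ hf => rw [map_smul, hf, smul_zero]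
    have h2 := map_wproj π χ (e χ)
    rw [h1 _ hχ, map_zero, he, AddMonoidAlgebra.coeff_single, Finsupp.single_eq_same] at h2
    have h3 := congrArg (fun q : AddMonoidAlgebra K X => q.coeff χ) h2
    simp at h3
  refine ⟨J, hJ, inferInstance, ⟨{
    g := fun i j => actR (d i) (w j)
    comul_g := comul_actR hd hstw
    counit_g := fun i j => ?_
    adjoin_g := ?_
    wt := wt
    torus_g := fun i j => ?_
    integral := fun s i j => ?_
    root_mem := fun i => hexw _ (hTW (Or.inl ⟨i, rfl⟩))
    fund_mem := fun i => ?_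
    ht := ht
    ht_root := hht }⟩⟩
  · rw [map_actR, actL_counit]
    split_ifs with h
    · rw [h, hd1]
    · exact hd0 i j h
  · rw [eq_top_iff, ← hadj]
    refine Algebra.adjoin_le fun f hf => ?_
    rw [SetLike.mem_coe, ← hspan] at hf
    have h1 : Submodule.span K (Set.range w) ≤ Subalgebra.toSubmodule
        (Algebra.adjoin K (Set.range fun ij : J × J => actR (d ij.1) (w ij.2))) := by
      refine Submodule.span_le.2 ?_
      rintro _ ⟨j, rfl⟩
      exact Algebra.span_le_adjoin K _ (mem_span_actR hd hstw j)
    exact h1 hf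
  · apply AddMonoidAlgebra.coeff_injective
    ext χ
    have h1 : (π (actR (d i) (w j))).coeff χ = d i (wproj π χ (w j)) := by
      rw [← torusCoeff_apply, map_actR]; rfl
    rw [h1]
    by_cases hχ : χ = wt j
    · rw [hχ, hw j]
      split_ifs with h
      · rw [h, hd1]; simp
      · rw [hd0 i j h]; simp
    · rw [← hw j, wproj_wproj_of_ne π hχ, map_zero]
      split_ifs with h
      · rw [h, AddMonoidAlgebra.coeff_single, Finsupp.single_eq_of_ne hχ]
      · simp
  · have h1 := map_actR (Coalgebra.counit (R := K) ∘ₗ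
      ((S.basis s : Derivation K A A) : A →ₗ[K] A)) (d i) (w j)
    rw [← LieG.eq_actL] at h1
    change Coalgebra.counit (R := K) ((S.basis s : Derivation K A A) (actR (d i) (w j))) = _ at h1
    rw [h1]
    have h2 := hint s j
    generalize (S.basis s : Derivation K A A) (w j) = v at h2
    induction h2 using Submodule.span_induction with
    | mem f hf =>
      obtain ⟨k, rfl⟩ := hf
      by_cases hik : i = k
      · rw [hik, hd1]; exact one_mem_ordFil
      · rw [hd0 i k hik]; exact zero_mem _
    | zero => rw [map_zero]; exact zero_mem _
    | add f g _ _ hf hg => rw [map_add]; exact add_mem hf hg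
    | smul c f _ hf =>
      rw [← algebraMap_smul K c f, map_smul]
      exact ordFil_mul_left (ringInt_mem_ordFil c) hf
  · obtain ⟨j, hj⟩ := hexw (om i) (hTW (Or.inr ⟨i, rfl⟩))
    exact ⟨j, by rw [hj]; exact hom1 i, fun i' hi' => by rw [hj]; exact hom0 i i' hi'⟩

end WeightBasis

/-! ### Reduction to the residue field. -/

section ResidueMap

variable {p : ℕ} [Fact p.Prime] {K : Type*} [Field K] [Algebra ℚ_[p] K]
  [FiniteDimensional ℚ_[p] K] [Algebra ℤ_[p] K] [IsScalarTower ℤ_[p] ℚ_[p] K]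

open Classical in
variable (p) in
/-- The residue class of an integral element (and `0` for other elements). -/
noncomputable def resK (c : K) : ResK p K :=
  if h : c ∈ integralClosure ℤ_[p] K then IsLocalRing.residue (RingInt p K) ⟨c, h⟩ else 0

lemma resK_coe (c : RingInt p K) : resK p (c : K) = IsLocalRing.residue (RingInt p K) c :=
  dif_pos c.2

lemma exists_ringInt_eq {c : K} (hc : c ∈ ordFil p K 0) : ∃ d : RingInt p K, (d : K) = c :=
  ⟨⟨c, mem_ordFil_zero.1 hc⟩, rfl⟩

lemma resK_add {c d : K} (hc : c ∈ ordFil p K 0) (hd : d ∈ ordFil p K 0) :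
    resK p (c + d) = resK p c + resK p d := by
  obtain ⟨c, rfl⟩ := exists_ringInt_eq hc
  obtain ⟨d, rfl⟩ := exists_ringInt_eq hd
  rw [← Subalgebra.coe_add, resK_coe, resK_coe, resK_coe, map_add]

lemma resK_mul {c d : K} (hc : c ∈ ordFil p K 0) (hd : d ∈ ordFil p K 0) :
    resK p (c * d) = resK p c * resK p d := by
  obtain ⟨c, rfl⟩ := exists_ringInt_eq hc
  obtain ⟨d, rfl⟩ := exists_ringInt_eq hd
  rw [← Subalgebra.coe_mul, resK_coe, resK_coe, resK_coe, map_mul]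

lemma resK_intCast (n : ℤ) : resK p (n : K) = n := by
  have : (n : K) = ((n : RingInt p K) : K) := by simp
  rw [this, resK_coe, map_intCast]

lemma resK_eq_zero_iff {c : K} (hc : c ∈ ordFil p K 0) : resK p c = 0 ↔ c ∈ ordFil p K 1 := by
  obtain ⟨c, rfl⟩ := exists_ringInt_eq hc
  rw [resK_coe, IsLocalRing.residue_eq_zero_iff, mem_maximalIdeal_iff]

end ResidueMap

/-! ### Leading terms of elements of `Lie G`. -/

section Lead

variable {p : ℕ} [Fact p.Prime] {K : Type*} [Field K] [CharZero K] [Algebra ℚ_[p] K]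
  [FiniteDimensional ℚ_[p] K] [Algebra ℤ_[p] K] [IsScalarTower ℤ_[p] ℚ_[p] K]
  {A : Type*} [CommRing A] [HopfAlgebra K A]
  {X Y : Type*} [AddCommGroup X] [AddCommGroup Y]
  {ι : Type*} [Fintype ι] {P : RootPairing ι ℤ X Y} [P.IsReduced] {b : P.Base}
  {π : A →ₐc[K] AddMonoidAlgebra K X} (S : ChevalleySystem P b π)

namespace ChevalleySystem

/-- The Chevalley basis of `𝔤[v]`. -/
noncomputable def loopBasis (k : Type*) [Field k] :
    Module.Basis (b.support ⊕ ι) k[X] (k[X] ⊗[k] S.gk k) := (S.basisk k).baseChange k[X]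

lemma loopBasis_apply (k : Type*) [Field k] (s : b.support ⊕ ι) :
    S.loopBasis k s = (1 : k[X]) ⊗ₜ[k] S.basisk k s := Module.Basis.baseChange_apply _ _ _

lemma monomial_smul_loopBasis (k : Type*) [Field k] (s : b.support ⊕ ι) (j : ℕ) (c : k) :
    Polynomial.monomial j c • S.loopBasis k s =
      c • ((Polynomial.X ^ j : k[X]) ⊗ₜ[k] S.basisk k s) := by
  rw [loopBasis_apply, TensorProduct.smul_tmul', TensorProduct.smul_tmul', smul_eq_mul, mul_one,
    ← Polynomial.C_mul_X_pow_eq_monomial, Polynomial.smul_eq_C_mul]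

end ChevalleySystem

variable (b) in
/-- The power of the uniformizer in degree `n`. -/
noncomputable def leadExp (n : ℤ) (s : b.support ⊕ ι) : ℤ := (n - chevDeg b s) / coxeterNum b

open Classical in
variable (b) in
/-- The coefficient of the leading term in degree `n`. -/
noncomputable def leadCoef (ϖ : RingInt p K) (n : ℤ) (s : b.support ⊕ ι) (c : K) : ResK p K :=
  if (coxeterNum b : ℤ) ∣ n - chevDeg b s then resK p (c * (ϖ : K) ^ (-leadExp b n s)) else 0

lemma leadExp_cast {n : ℤ} {s : b.support ⊕ ι} (h : (coxeterNum b : ℤ) ∣ n - chevDeg b s) :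
    ((n : ℚ) - chevDeg b s) / coxeterNum b = leadExp b n s := by
  have hh : (coxeterNum b : ℚ) ≠ 0 := by exact_mod_cast (coxeterNum_pos (b := b)).ne'
  rw [div_eq_iff hh, leadExp]
  exact_mod_cast (Int.ediv_mul_cancel h).symm

variable {ϖ : RingInt p K} (hϖ : Irreducible ϖ)

lemma ordFil_zero_of_lead {q : ℤ} {c : K} (hϖ : Irreducible ϖ) (hc : c ∈ ordFil p K q) :
    c * (ϖ : K) ^ (-q) ∈ ordFil p K 0 := by
  have := ordFil_mul hc (uniformizer_zpow_mem hϖ (-q))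
  push_cast at this
  rwa [add_neg_cancel] at this

lemma leadCoef_add {n : ℤ} {s : b.support ⊕ ι} {c d : K} (hϖ : Irreducible ϖ)
    (hc : c ∈ ordFil p K ((n - chevDeg b s) / coxeterNum b))
    (hd : d ∈ ordFil p K ((n - chevDeg b s) / coxeterNum b)) :
    leadCoef b ϖ n s (c + d) = leadCoef b ϖ n s c + leadCoef b ϖ n s d := by
  rw [leadCoef, leadCoef, leadCoef]
  split_ifs with h
  · rw [leadExp_cast h] at hc hd
    rw [add_mul, resK_add (ordFil_zero_of_lead hϖ hc) (ordFil_zero_of_lead hϖ hd)]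
  · rw [add_zero]

lemma leadCoef_zero {n : ℤ} {s : b.support ⊕ ι} : leadCoef b ϖ n s 0 = 0 := by
  rw [leadCoef]
  split_ifs
  · rw [zero_mul]
    have := resK_coe (0 : RingInt p K)
    rwa [map_zero] at this
  · rfl

lemma leadCoef_mul {n : ℤ} {s : b.support ⊕ ι} {a c : K} (hϖ : Irreducible ϖ)
    (ha : a ∈ ordFil p K 0) (hc : c ∈ ordFil p K ((n - chevDeg b s) / coxeterNum b)) :
    leadCoef b ϖ n s (a * c) = resK p a * leadCoef b ϖ n s c := by
  rw [leadCoef, leadCoef]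
  split_ifs with h
  · rw [leadExp_cast h] at hc
    rw [mul_assoc, resK_mul ha (ordFil_zero_of_lead hϖ hc)]
  · rw [mul_zero]

/-- The coordinate lattice changes between levels `n` and `n + 1` only if `h` divides `n - deg s`.
In that case the quotient is the residue field; otherwise integrality of valuations makes the two
conditions equivalent, matching the value `0` of `leadCoef`. -/
lemma leadCoef_eq_zero_iff {n : ℤ} {s : b.support ⊕ ι} {c : K} (hϖ : Irreducible ϖ)
    (hc : c ∈ ordFil p K ((n - chevDeg b s) / coxeterNum b)) :
    leadCoef b ϖ n s c = 0 ↔ c ∈ ordFil p K (((n + 1 : ℤ) - chevDeg b s) / coxeterNum b) := by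
  have hh : (0 : ℚ) < coxeterNum b := by exact_mod_cast coxeterNum_pos (b := b)
  have hh1 : (1 : ℚ) ≤ coxeterNum b := by exact_mod_cast coxeterNum_pos (b := b)
  rw [leadCoef]
  split_ifs with h
  · have hq := leadExp_cast h
    rw [hq] at hc
    rw [resK_eq_zero_iff (ordFil_zero_of_lead hϖ hc)]
    set q := leadExp b n s
    have hq' : ((n + 1 : ℤ) - chevDeg b s : ℚ) / coxeterNum b = q + 1 / coxeterNum b := by
      rw [← hq]; push_cast; ring
    rw [hq']
    have hpos : 0 < 1 / (coxeterNum b : ℚ) := by positivity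
    have hle : 1 / (coxeterNum b : ℚ) ≤ 1 := by rw [div_le_one hh]; exact hh1
    constructor
    · intro h1
      have h2 := ordFil_mul h1 (uniformizer_zpow_mem hϖ q)
      rw [mul_assoc, ← zpow_add₀ (uniformizer_ne_zero hϖ), neg_add_cancel, zpow_zero, mul_one] at h2
      exact ordFil_mono (by linarith) h2
    · intro h1
      have h2 : c ∈ ordFil p K ((q + 1 : ℤ) : ℚ) :=
        ordFil_int (by push_cast; linarith) h1
      have h3 := ordFil_mul h2 (uniformizer_zpow_mem hϖ (-q))
      push_cast at h3
      exact ordFil_mono (by linarith) h3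
  · refine ⟨fun _ => ?_, fun _ => rfl⟩
    set q := (n - chevDeg b s) / (coxeterNum b : ℤ) with hq
    have hz : (0 : ℤ) < coxeterNum b := by exact_mod_cast coxeterNum_pos (b := b)
    have h1 := Int.emod_add_mul_ediv (n - chevDeg b s) (coxeterNum b)
    have h2 := Int.emod_lt_of_pos (n - chevDeg b s) hz
    have h3 := Int.emod_nonneg (n - chevDeg b s) hz.ne'
    have h4 : (n - chevDeg b s) % (coxeterNum b : ℤ) ≠ 0 := fun h0 =>
      h (Int.dvd_of_emod_eq_zero h0)
    rw [← hq] at h1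
    have h5 : (coxeterNum b : ℤ) * q + 1 ≤ n - chevDeg b s := by omega
    have h6 : (n + 1 : ℤ) - chevDeg b s ≤ coxeterNum b * (q + 1) := by
      rw [mul_add, mul_one]; omega
    have h5' : (coxeterNum b : ℚ) * q + 1 ≤ n - chevDeg b s := by exact_mod_cast h5
    have h6' : ((n + 1 : ℤ) : ℚ) - chevDeg b s ≤ coxeterNum b * (q + 1) := by exact_mod_cast h6
    have h7 : c ∈ ordFil p K ((q + 1 : ℤ) : ℚ) := by
      refine ordFil_int ?_ hc
      rw [lt_div_iff₀ hh]; push_cast; linarith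
    refine ordFil_mono ?_ h7
    rw [div_le_iff₀ hh]; push_cast at h6' ⊢; linarith

namespace ChevalleySystem

/-- The leading term in degree `n` of an element of the Lie algebra. -/
noncomputable def lead (ϖ : RingInt p K) (n : ℤ) (x : LieG K A) :
    (ResK p K)[X] ⊗[ResK p K] S.gk (ResK p K) :=
  ∑ s, Polynomial.monomial (leadExp b n s).toNat (leadCoef b ϖ n s (S.basis.repr x s)) •
    S.loopBasis (ResK p K) s

lemma repr_lead (n : ℤ) (x : LieG K A) (s : b.support ⊕ ι) :
    (S.loopBasis (ResK p K)).repr (S.lead ϖ n x) s =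
      Polynomial.monomial (leadExp b n s).toNat (leadCoef b ϖ n s (S.basis.repr x s)) := by
  rw [lead, Module.Basis.repr_sum_self]

lemma lead_add (hϖ : Irreducible ϖ) {n : ℤ} {x y : LieG K A}
    (hx : x ∈ S.lieFil p (coxeterNum b) n) (hy : y ∈ S.lieFil p (coxeterNum b) n) :
    S.lead ϖ n (x + y) = S.lead ϖ n x + S.lead ϖ n y := by
  rw [lead, lead, lead, ← Finset.sum_add_distrib]
  refine Finset.sum_congr rfl fun s _ => ?_
  rw [map_add, Finsupp.add_apply, leadCoef_add hϖ (hx s) (hy s), map_add, add_smul]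

lemma lead_zero (n : ℤ) : S.lead ϖ n 0 = 0 := by
  rw [lead]
  refine Finset.sum_eq_zero fun s _ => ?_
  rw [map_zero, Finsupp.zero_apply, leadCoef_zero, map_zero, zero_smul]

lemma lead_sum (hϖ : Irreducible ϖ) {n : ℤ} {σ : Type*} (t : Finset σ) (x : σ → LieG K A)
    (hx : ∀ i ∈ t, x i ∈ S.lieFil p (coxeterNum b) n) :
    S.lead ϖ n (∑ i ∈ t, x i) = ∑ i ∈ t, S.lead ϖ n (x i) := by
  classical
  induction t using Finset.induction_on with
  | empty => simp [lead_zero]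
  | insert a t ha ih =>
    rw [Finset.sum_insert ha, Finset.sum_insert ha, S.lead_add hϖ (hx a (Finset.mem_insert_self a t))
      (sum_mem fun i hi => hx i (Finset.mem_insert_of_mem hi)),
      ih fun i hi => hx i (Finset.mem_insert_of_mem hi)]

lemma lead_smul (hϖ : Irreducible ϖ) {n : ℤ} {a : K} (ha : a ∈ ordFil p K 0) {x : LieG K A}
    (hx : x ∈ S.lieFil p (coxeterNum b) n) :
    S.lead ϖ n (a • x) = (Polynomial.C (resK p a) : (ResK p K)[X]) • S.lead ϖ n x := by
  rw [lead, lead, Finset.smul_sum]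
  refine Finset.sum_congr rfl fun s _ => ?_
  rw [map_smul, Finsupp.smul_apply, smul_eq_mul, leadCoef_mul hϖ ha (hx s), smul_smul,
    Polynomial.C_mul_monomial]

lemma lead_eq_zero_iff (hϖ : Irreducible ϖ) {n : ℤ} {x : LieG K A}
    (hx : x ∈ S.lieFil p (coxeterNum b) n) :
    S.lead ϖ n x = 0 ↔ x ∈ S.lieFil p (coxeterNum b) (n + 1) := by
  rw [← (S.loopBasis (ResK p K)).repr.map_eq_zero_iff, Finsupp.ext_iff]
  refine forall_congr' fun s => ?_
  rw [repr_lead, Finsupp.zero_apply, Polynomial.monomial_eq_zero_iff,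
    leadCoef_eq_zero_iff hϖ (hx s)]

lemma lead_smul_basis (n : ℤ) (s : b.support ⊕ ι) (c : K) : S.lead ϖ n (c • S.basis s) =
    Polynomial.monomial (leadExp b n s).toNat (leadCoef b ϖ n s c) • S.loopBasis (ResK p K) s := by
  rw [lead, Finset.sum_eq_single s]
  · rw [S.repr_basis_smul, Finsupp.single_eq_same]
  · intro t _ ht
    rw [S.repr_basis_smul, Finsupp.single_eq_of_ne ht, leadCoef_zero, map_zero, zero_smul]
  · simp

end ChevalleySystem

end Lead

/-! ### Multiplicativity of leading terms and structure constants. -/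

section LeadAlgebra

variable {p : ℕ} [Fact p.Prime] {K : Type*} [Field K] [CharZero K] [Algebra ℚ_[p] K]
  [FiniteDimensional ℚ_[p] K] [Algebra ℤ_[p] K] [IsScalarTower ℤ_[p] ℚ_[p] K]
  {A : Type*} [CommRing A] [HopfAlgebra K A]
  {X Y : Type*} [AddCommGroup X] [AddCommGroup Y]
  {ι : Type*} [Fintype ι] {P : RootPairing ι ℤ X Y} [P.IsReduced] {b : P.Base}
  {π : A →ₐc[K] AddMonoidAlgebra K X} (S : ChevalleySystem P b π)

/-- Because `deg s < h`, a multiple of `h` of the form `n - deg s` with `n ≥ 1` exceeds `-h`. Hence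
the truncation `toNat` in the exponents loses nothing in positive levels. -/
lemma leadExp_nonneg {n : ℤ} (hn : 1 ≤ n) {s : b.support ⊕ ι}
    (h : (coxeterNum b : ℤ) ∣ n - chevDeg b s) : 0 ≤ leadExp b n s := by
  have hz : (0 : ℤ) < coxeterNum b := by exact_mod_cast coxeterNum_pos (b := b)
  have hd : chevDeg b s < coxeterNum b := by
    rcases s with i | i
    · exact hz
    · exact height_lt_coxeterNum i
  have h1 := Int.ediv_mul_cancel h
  rw [leadExp]
  by_contra! h2
  nlinarith

lemma leadCoef_of_not_dvd {ϖ : RingInt p K} {n : ℤ} {s : b.support ⊕ ι} {c : K}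
    (h : ¬ (coxeterNum b : ℤ) ∣ n - chevDeg b s) : leadCoef b ϖ n s c = 0 := if_neg h

lemma leadCoef_mul_mul {ϖ : RingInt p K} (hϖ : Irreducible ϖ) {m n : ℤ} {r s t : b.support ⊕ ι}
    {c d : K} (hc : c ∈ ordFil p K ((m - chevDeg b s) / coxeterNum b))
    (hd : d ∈ ordFil p K ((n - chevDeg b t) / coxeterNum b))
    (hr : chevDeg b r = chevDeg b s + chevDeg b t) :
    leadCoef b ϖ (m + n) r (c * d) = leadCoef b ϖ m s c * leadCoef b ϖ n t d := by
  have hcd : c * d ∈ ordFil p K (((m + n : ℤ) - chevDeg b r) / coxeterNum b) :=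
    ordFil_mono (by rw [hr]; push_cast; exact le_of_eq (by ring)) (ordFil_mul hc hd)
  by_cases hs : (coxeterNum b : ℤ) ∣ m - chevDeg b s
  · by_cases ht : (coxeterNum b : ℤ) ∣ n - chevDeg b t
    · have e : m + n - chevDeg b r = (m - chevDeg b s) + (n - chevDeg b t) := by rw [hr]; ring
      have hst : (coxeterNum b : ℤ) ∣ m + n - chevDeg b r := e ▸ dvd_add hs ht
      have hexp : leadExp b (m + n) r = leadExp b m s + leadExp b n t := by
        rw [leadExp, e, Int.add_ediv_of_dvd_left hs]; rfl
      rw [leadExp_cast hs] at hc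
      rw [leadExp_cast ht] at hd
      rw [leadCoef, leadCoef, leadCoef, if_pos hs, if_pos ht, if_pos hst,
        ← resK_mul (ordFil_zero_of_lead hϖ hc) (ordFil_zero_of_lead hϖ hd), hexp, neg_add,
        zpow_add₀ (uniformizer_ne_zero hϖ)]
      congr 1
      ring
    · rw [leadCoef_of_not_dvd ht, mul_zero, leadCoef_eq_zero_iff hϖ hcd]
      have hd' := (leadCoef_eq_zero_iff hϖ hd).1 (leadCoef_of_not_dvd ht)
      exact ordFil_mono (by rw [hr]; push_cast; exact le_of_eq (by ring)) (ordFil_mul hc hd')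
  · rw [leadCoef_of_not_dvd hs, zero_mul, leadCoef_eq_zero_iff hϖ hcd]
    have hc' := (leadCoef_eq_zero_iff hϖ hc).1 (leadCoef_of_not_dvd hs)
    exact ordFil_mono (by rw [hr]; push_cast; exact le_of_eq (by ring)) (ordFil_mul hc' hd)

variable (b) in
/-- The coordinate of the leading term in degree `n`. -/
noncomputable def leadMon (ϖ : RingInt p K) (n : ℤ) (s : b.support ⊕ ι) (c : K) : (ResK p K)[X] :=
  Polynomial.monomial (leadExp b n s).toNat (leadCoef b ϖ n s c)

lemma leadMon_mul_mul {ϖ : RingInt p K} (hϖ : Irreducible ϖ) {m n : ℤ} (hm : 1 ≤ m) (hn : 1 ≤ n)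
    {r s t : b.support ⊕ ι}
    {c d : K} (hc : c ∈ ordFil p K ((m - chevDeg b s) / coxeterNum b))
    (hd : d ∈ ordFil p K ((n - chevDeg b t) / coxeterNum b))
    (hr : chevDeg b r = chevDeg b s + chevDeg b t) :
    leadMon b ϖ (m + n) r (c * d) = leadMon b ϖ m s c * leadMon b ϖ n t d := by
  rw [leadMon, leadMon, leadMon, Polynomial.monomial_mul_monomial, leadCoef_mul_mul hϖ hc hd hr]
  by_cases hs : (coxeterNum b : ℤ) ∣ m - chevDeg b s
  · by_cases ht : (coxeterNum b : ℤ) ∣ n - chevDeg b t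
    · have e : m + n - chevDeg b r = (m - chevDeg b s) + (n - chevDeg b t) := by rw [hr]; ring
      have hexp : leadExp b (m + n) r = leadExp b m s + leadExp b n t := by
        rw [leadExp, e, Int.add_ediv_of_dvd_left hs]; rfl
      rw [hexp, Int.toNat_add (leadExp_nonneg hm hs) (leadExp_nonneg hn ht)]
    · rw [leadCoef_of_not_dvd ht, mul_zero, map_zero, map_zero]
  · rw [leadCoef_of_not_dvd hs, zero_mul, map_zero, map_zero]

lemma leadMon_zero {ϖ : RingInt p K} {n : ℤ} {s : b.support ⊕ ι} : leadMon b ϖ n s 0 = 0 := by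
  rw [leadMon, leadCoef_zero, map_zero]

lemma leadMon_mul {ϖ : RingInt p K} (hϖ : Irreducible ϖ) {n : ℤ} {s : b.support ⊕ ι} {a c : K}
    (ha : a ∈ ordFil p K 0) (hc : c ∈ ordFil p K ((n - chevDeg b s) / coxeterNum b)) :
    leadMon b ϖ n s (a * c) = Polynomial.C (resK p a) * leadMon b ϖ n s c := by
  rw [leadMon, leadMon, leadCoef_mul hϖ ha hc, Polynomial.C_mul_monomial]

/-- Multiplication by `p` shifts the leading terms. -/
lemma leadMon_prime_mul {ϖ lam : RingInt p K} (hϖ : Irreducible ϖ)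
    (hlam : (p : RingInt p K) = lam * ϖ ^ ramDeg p K) {n : ℤ} (hn : 1 ≤ n) {s : b.support ⊕ ι}
    {c : K} (hc : c ∈ ordFil p K ((n - chevDeg b s) / coxeterNum b)) :
    leadMon b ϖ (n + coxeterNum b * ramDeg p K) s ((p : K) * c) =
      (Polynomial.C (IsLocalRing.residue (RingInt p K) lam) * Polynomial.X ^ ramDeg p K) *
        leadMon b ϖ n s c := by
  have hz : (coxeterNum b : ℤ) ≠ 0 := by exact_mod_cast (coxeterNum_pos (b := b)).ne'
  have e : n + coxeterNum b * ramDeg p K - chevDeg b s =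
    (n - chevDeg b s) + coxeterNum b * ramDeg p K := by ring
  have hp : (p : K) = lam * (ϖ : K) ^ ramDeg p K := by
    have := congrArg (fun x : RingInt p K => (x : K)) hlam
    simpa using this
  by_cases hs : (coxeterNum b : ℤ) ∣ n - chevDeg b s
  · have hs' : (coxeterNum b : ℤ) ∣ n + coxeterNum b * ramDeg p K - chevDeg b s :=
      e ▸ dvd_add hs (dvd_mul_right _ _)
    have hexp : leadExp b (n + coxeterNum b * ramDeg p K) s = leadExp b n s + ramDeg p K := by
      rw [leadExp, e, Int.add_ediv_of_dvd_left hs, Int.mul_ediv_cancel_left _ hz]; rfl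
    have h1 : (p : K) * c * (ϖ : K) ^ (-(leadExp b n s + ramDeg p K)) =
        lam * (c * (ϖ : K) ^ (-leadExp b n s)) := by
      have h0 := uniformizer_ne_zero hϖ
      rw [hp, neg_add, zpow_add₀ h0, zpow_neg (ϖ : K) (ramDeg p K : ℤ), zpow_natCast]
      field_simp
    rw [leadExp_cast hs] at hc
    rw [leadMon, leadMon, hexp, Int.toNat_add (leadExp_nonneg hn hs) (by positivity),
      Int.toNat_natCast, leadCoef, leadCoef, if_pos hs, if_pos hs', hexp, h1,
      resK_mul (ringInt_mem_ordFil _) (ordFil_zero_of_lead hϖ hc), resK_coe,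
      ← Polynomial.C_mul_X_pow_eq_monomial, ← Polynomial.C_mul_X_pow_eq_monomial, map_mul, pow_add]
    ring
  · have hs' : ¬ (coxeterNum b : ℤ) ∣ n + coxeterNum b * ramDeg p K - chevDeg b s := by
      rw [e, Int.dvd_add_left (dvd_mul_right _ _)]
      exact hs
    rw [leadMon, leadMon, leadCoef_of_not_dvd hs, leadCoef_of_not_dvd hs', map_zero, map_zero,
      mul_zero]

namespace ChevalleySystem

lemma lead_eq_sum (ϖ : RingInt p K) (n : ℤ) (x : LieG K A) : S.lead ϖ n x =
    ∑ s, leadMon b ϖ n s (S.basis.repr x s) • S.loopBasis (ResK p K) s := rfl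

lemma lead_smul_basis' (ϖ : RingInt p K) (n : ℤ) (s : b.support ⊕ ι) (c : K) :
    S.lead ϖ n (c • S.basis s) = leadMon b ϖ n s c • S.loopBasis (ResK p K) s :=
  S.lead_smul_basis n s c

lemma lead_prime_smul {ϖ lam : RingInt p K} (hϖ : Irreducible ϖ)
    (hlam : (p : RingInt p K) = lam * ϖ ^ ramDeg p K) {n : ℤ} (hn : 1 ≤ n)
    {x : LieG K A} (hx : x ∈ S.lieFil p (coxeterNum b) n) :
    S.lead ϖ (n + coxeterNum b * ramDeg p K) ((p : K) • x) =
      (Polynomial.C (IsLocalRing.residue (RingInt p K) lam) * Polynomial.X ^ ramDeg p K) •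
        S.lead ϖ n x := by
  rw [lead_eq_sum, lead_eq_sum, Finset.smul_sum]
  refine Finset.sum_congr rfl fun s _ => ?_
  rw [map_smul, Finsupp.smul_apply, smul_eq_mul, leadMon_prime_mul hϖ hlam hn (hx s), mul_smul]

/-- Bracketing with `H_α` multiplies the `X_α`-coordinate by `2`, whereas `[H_α, H_i] = 0`. -/
lemma repr_H_inr (i α : ι) : S.basis.repr (S.H i) (Sum.inr α) = 0 := by
  have h1 : S.basis.repr ⁅S.H α, S.H i⁆ (Sum.inr α) =
      2 * S.basis.repr (S.H i) (Sum.inr α) := by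
    conv_lhs => rw [← S.basis.sum_repr (S.H i)]
    rw [lie_sum, map_sum, Finsupp.finsetSum_apply, Finset.sum_eq_single (Sum.inr α)]
    · rw [lie_smul, S.lie_H_X, P.pairing_same, map_smul, map_zsmul]
      simp [mul_comm]
    · rintro (j | j) _ hj
      · rw [lie_smul, S.basis_inl, S.lie_H_H]; simp
      · rw [lie_smul, S.lie_H_X, map_smul, map_zsmul]
        have : j ≠ α := fun h => hj (by rw [h])
        simp [this]
    · simp
  rw [S.lie_H_H, map_zero, Finsupp.zero_apply] at h1
  have h2 : (2 : K) ≠ 0 := two_ne_zero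
  exact (mul_eq_zero.1 h1.symm).resolve_left h2

/-- The bracket respects the heights. -/
lemma chevDeg_of_repr_lie_ne_zero {r s t : b.support ⊕ ι}
    (h : S.basis.repr ⁅S.basis s, S.basis t⁆ r ≠ 0) :
    chevDeg b r = chevDeg b s + chevDeg b t := by
  classical
  rcases s with i | i <;> rcases t with j | j
  · rw [S.basis_inl, S.basis_inl, S.lie_H_H] at h
    simp at h
  · rw [S.basis_inl, S.lie_H_X, map_zsmul, S.basis.repr_self, Finsupp.smul_apply,
      Finsupp.single_apply] at h
    split_ifs at h with hr
    · subst hr; simp [chevDeg]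
    · simp at h
  · rw [S.basis_inl, ← lie_skew, S.lie_H_X, map_neg, map_zsmul, S.basis.repr_self,
      Finsupp.neg_apply, Finsupp.smul_apply, Finsupp.single_apply] at h
    split_ifs at h with hr
    · subst hr; simp [chevDeg]
    · simp at h
  · by_cases h0 : P.root i + P.root j = 0
    · have hj : j = P.reflectionPerm i i := by
        apply P.root.injective
        rw [P.root_reflectionPerm, P.reflection_apply_self]
        exact (neg_eq_of_add_eq_zero_right h0).symm
      rw [hj, S.lie_X_neg] at h
      rcases r with r | r
      · have h4 : b.height (P.reflectionPerm i i) = -b.height i := b.height_reflectionPerm_self i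
        rw [hj]
        simp [chevDeg, h4]
      · exact absurd (S.repr_H_inr i r) h
    · by_cases h1 : P.root i + P.root j ∈ Set.range P.root
      · obtain ⟨l, hl⟩ := h1
        obtain ⟨N, -, hN⟩ := S.lie_X_X i j l hl
        rw [hN, map_zsmul, S.basis.repr_self, Finsupp.smul_apply, Finsupp.single_apply] at h
        split_ifs at h with hr
        · subst hr
          exact b.height_add hl
        · simp at h
      · rw [S.lie_X_X_zero i j h0 h1] at h
        simp at h

/-- The structure constants of the Chevalley basis. -/
lemma exists_structure_const (s t : b.support ⊕ ι) : ∃ N : b.support ⊕ ι → ℤ,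
    ⁅S.basis s, S.basis t⁆ = ∑ r, (N r : K) • S.basis r ∧
    (∀ (k : Type _) [Field k],
      ⁅S.basisk k s, S.basisk k t⁆ = ∑ r, (N r : k) • S.basisk k r) ∧
    ∀ r, N r ≠ 0 → chevDeg b r = chevDeg b s + chevDeg b t := by
  -- Taking the constants in the `ℤ`-form makes the same integers valid over `K` and over every
  -- residue field.
  have hN := S.basisZ.sum_repr ⁅S.basisZ s, S.basisZ t⁆
  set N := fun r => S.basisZ.repr ⁅S.basisZ s, S.basisZ t⁆ r
  have h1 : ⁅S.basis s, S.basis t⁆ = ∑ r, (N r : K) • S.basis r := by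
    have := congrArg (fun x : S.gZ => (x : LieG K A)) hN
    simp only [LieSubalgebra.coe_bracket, basisZ_coe] at this
    rw [← this, AddSubmonoidClass.coe_finsetSum]
    refine Finset.sum_congr rfl fun r _ => ?_
    rw [Int.cast_smul_eq_zsmul, ← basisZ_coe]
    rfl
  refine ⟨N, h1, fun k _ => ?_, fun r hr => S.chevDeg_of_repr_lie_ne_zero ?_⟩
  · have e : ∀ s, S.basisk k s = ((1 : k) ⊗ₜ[ℤ] S.basisZ s : k ⊗[ℤ] S.gZ) :=
      fun s => Module.Basis.baseChange_apply _ _ _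
    have h3 : ⁅S.basisk k s, S.basisk k t⁆ = (((1 : k) * 1) ⊗ₜ[ℤ] ⁅S.basisZ s, S.basisZ t⁆ :
        k ⊗[ℤ] S.gZ) := by
      rw [e, e]; rfl
    rw [h3, ← hN, mul_one, TensorProduct.tmul_sum]
    refine Finset.sum_congr rfl fun r _ => ?_
    rw [TensorProduct.tmul_smul, e, ← Int.cast_smul_eq_zsmul k]
    rfl
  · rw [h1, S.basis.repr_sum_self]
    exact_mod_cast hr

end ChevalleySystem

end LeadAlgebra

lemma lie_sum_smul_sum_smul {R L σ : Type*} [CommRing R] [LieRing L] [LieAlgebra R L] [Fintype σ]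
    (a c : σ → R) (v : σ → L) :
    ⁅∑ s, a s • v s, ∑ t, c t • v t⁆ = ∑ s, ∑ t, (a s * c t) • ⁅v s, v t⁆ := by
  rw [sum_lie]
  refine Finset.sum_congr rfl fun s _ => ?_
  rw [lie_sum]
  exact Finset.sum_congr rfl fun t _ => by rw [smul_lie, lie_smul, smul_smul]

/-! ### Brackets of leading terms and the image `𝔤̃`. -/

section LeadStructure

variable {p : ℕ} [Fact p.Prime] {K : Type*} [Field K] [CharZero K] [Algebra ℚ_[p] K]
  [FiniteDimensional ℚ_[p] K] [Algebra ℤ_[p] K] [IsScalarTower ℤ_[p] ℚ_[p] K]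
  {A : Type*} [CommRing A] [HopfAlgebra K A]
  {X Y : Type*} [AddCommGroup X] [AddCommGroup Y]
  {ι : Type*} [Fintype ι] {P : RootPairing ι ℤ X Y} [P.IsReduced] {b : P.Base}
  {π : A →ₐc[K] AddMonoidAlgebra K X} (S : ChevalleySystem P b π)

namespace ChevalleySystem

lemma loopBasis_lie (k : Type*) [Field k] {s t : b.support ⊕ ι} {N : b.support ⊕ ι → ℤ}
    (h : ⁅S.basisk k s, S.basisk k t⁆ = ∑ r, (N r : k) • S.basisk k r) :
    ⁅S.loopBasis k s, S.loopBasis k t⁆ =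
      ∑ r, (Polynomial.C (N r : k) : k[X]) • S.loopBasis k r := by
  rw [loopBasis_apply, loopBasis_apply, LieAlgebra.ExtendScalars.bracket_tmul, h, one_mul,
    TensorProduct.tmul_sum]
  refine Finset.sum_congr rfl fun r _ => ?_
  rw [loopBasis_apply, TensorProduct.tmul_smul, TensorProduct.smul_tmul', TensorProduct.smul_tmul',
    Polynomial.smul_eq_C_mul, smul_eq_mul]

/-- The leading term of a bracket is the bracket of the leading terms. -/
lemma lead_lie {ϖ : RingInt p K} (hϖ : Irreducible ϖ) {m n : ℤ} (hm : 1 ≤ m) (hn : 1 ≤ n)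
    {x y : LieG K A} (hx : x ∈ S.lieFil p (coxeterNum b) m)
    (hy : y ∈ S.lieFil p (coxeterNum b) n) :
    ⁅x, y⁆ ∈ S.lieFil p (coxeterNum b) (m + n) ∧
      S.lead ϖ (m + n) ⁅x, y⁆ = ⁅S.lead ϖ m x, S.lead ϖ n y⁆ := by
  choose N hN hNk hNd using fun s t => S.exists_structure_const s t
  have hxy : ⁅x, y⁆ = ∑ s, ∑ t, ∑ r,
      ((N s t r : K) * (S.basis.repr x s * S.basis.repr y t)) • S.basis r := by
    conv_lhs => rw [← S.basis.sum_repr x, ← S.basis.sum_repr y]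
    rw [sum_lie]
    refine Finset.sum_congr rfl fun s _ => ?_
    rw [lie_sum]
    refine Finset.sum_congr rfl fun t _ => ?_
    rw [smul_lie, lie_smul, hN, smul_smul, Finset.smul_sum]
    refine Finset.sum_congr rfl fun r _ => ?_
    rw [smul_smul]
    congr 1
    ring
  have hmul : ∀ s t r, N s t r ≠ 0 → S.basis.repr x s * S.basis.repr y t ∈
      ordFil p K (((m + n : ℤ) - chevDeg b r) / coxeterNum b) := fun s t r h =>
    ordFil_mono (by rw [hNd s t r h]; push_cast; exact le_of_eq (by ring)) (ordFil_mul (hx s) (hy t))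
  have hint : ∀ z : ℤ, (z : K) ∈ ordFil p K 0 := fun z => intCast_mem_ordFil z
  have hmem : ∀ s t r, ((N s t r : K) * (S.basis.repr x s * S.basis.repr y t)) • S.basis r ∈
      S.lieFil p (coxeterNum b) (m + n) := by
    intro s t r
    by_cases h : N s t r = 0
    · rw [h, Int.cast_zero, zero_mul, zero_smul]; exact zero_mem _
    · exact smul_basis_mem_lieFil (by simpa using ordFil_mul (hint (N s t r)) (hmul s t r h))
  refine ⟨by
    rw [hxy]
    exact sum_mem fun s _ => sum_mem fun t _ => sum_mem fun r _ => hmem s t r, ?_⟩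
  rw [hxy, S.lead_sum hϖ _ _ fun s _ => sum_mem fun t _ => sum_mem fun r _ => hmem s t r,
    lead_eq_sum, lead_eq_sum]
  refine Eq.trans ?_ (lie_sum_smul_sum_smul _ _ _).symm
  refine Finset.sum_congr rfl fun s _ => ?_
  rw [S.lead_sum hϖ _ _ fun t _ => sum_mem fun r _ => hmem s t r]
  refine Finset.sum_congr rfl fun t _ => ?_
  rw [S.lead_sum hϖ _ _ fun r _ => hmem s t r]
  refine Eq.trans ?_ (congrArg _ (S.loopBasis_lie _ (hNk s t (ResK p K))).symm)
  rw [Finset.smul_sum]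
  refine Finset.sum_congr rfl fun r _ => ?_
  rw [lead_smul_basis', smul_smul]
  by_cases h : N s t r = 0
  · rw [h]; simp [leadMon_zero]
  · rw [leadMon_mul hϖ (hint _) (hmul s t r h), leadMon_mul_mul hϖ hm hn (hx s) (hy t)
      (hNd s t r h), resK_intCast, mul_comm]

lemma polyRed_eq_sum (k : Type*) [Field k] (v : k[X] ⊗[k] S.gk k) : polyRed k (S.gk k) v =
    ∑ s, ((S.loopBasis k).repr v s).coeff 0 • S.basisk k s := by
  conv_lhs => rw [← (S.loopBasis k).sum_repr v]
  rw [map_sum]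
  refine Finset.sum_congr rfl fun s _ => ?_
  rw [polyRed_smul, loopBasis_apply, polyRed_tmul, Polynomial.eval_one, one_smul,
    Polynomial.coeff_zero_eq_eval_zero]

lemma mem_gTilde_iff (k : Type*) [Field k] (v : k[X] ⊗[k] S.gk k) : v ∈ S.gTilde k ↔
    ∀ s, ((S.loopBasis k).repr v s).coeff 0 ≠ 0 → ∃ i, b.IsPos i ∧ s = Sum.inr i := by
  have h1 : {x | ∃ i, b.IsPos i ∧ x = S.basisk k (Sum.inr i)} =
      S.basisk k '' {s | ∃ i, b.IsPos i ∧ s = Sum.inr i} := by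
    ext x
    constructor
    · rintro ⟨i, hi, rfl⟩; exact ⟨_, ⟨i, hi, rfl⟩, rfl⟩
    · rintro ⟨_, ⟨i, hi, rfl⟩, rfl⟩; exact ⟨i, hi, rfl⟩
  have h2 : v ∈ S.gTilde k ↔ polyRed k (S.gk k) v ∈ Submodule.span k
      {x | ∃ i, b.IsPos i ∧ x = S.basisk k (Sum.inr i)} := Iff.rfl
  rw [h2, h1, (S.basisk k).mem_span_image, polyRed_eq_sum]
  constructor
  · intro h s hs
    exact h (by
      rw [Finset.mem_coe, Finsupp.mem_support_iff, (S.basisk k).repr_sum_self]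
      exact hs)
  · intro h s hs
    rw [Finset.mem_coe, Finsupp.mem_support_iff, (S.basisk k).repr_sum_self] at hs
    exact h s hs

lemma mem_loopDeg_iff (k : Type*) [Field k] (h e : ℕ) (r : ℝ) (v : k[X] ⊗[k] S.gk k) :
    v ∈ S.loopDeg k h e r ↔ ∀ s j, ((S.loopBasis k).repr v s).coeff j ≠ 0 →
      (chevDeg b s : ℝ) / (h * e) + j / e = r := by
  classical
  have hX : ∀ (j : ℕ) (s t : b.support ⊕ ι) (i : ℕ),
      ((S.loopBasis k).repr ((Polynomial.X ^ j : k[X]) ⊗ₜ[k] S.basisk k s) t).coeff i =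
        if s = t ∧ i = j then 1 else 0 := by
    intro j s t i
    have : ((Polynomial.X ^ j : k[X]) ⊗ₜ[k] S.basisk k s) =
        (Polynomial.X ^ j : k[X]) • S.loopBasis k s := by
      rw [loopBasis_apply, TensorProduct.smul_tmul', smul_eq_mul, mul_one]
    rw [this, map_smul, Module.Basis.repr_self, Finsupp.smul_apply, Finsupp.single_apply, smul_eq_mul]
    by_cases hst : s = t
    · simp [hst, Polynomial.coeff_X_pow]
    · simp [hst]
  constructor
  · intro hv
    rw [loopDeg] at hv
    induction hv using Submodule.span_induction with
    | mem x hx =>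
      intro s j hs
      rcases hx with ⟨i, j', hr, rfl⟩ | ⟨i, j', hr, rfl⟩ <;> rw [hX] at hs <;> split_ifs at hs with h1
      · rw [← h1.1, h1.2]; exact hr
      · exact absurd rfl hs
      · rw [← h1.1, h1.2]; simpa [chevDeg] using hr
      · exact absurd rfl hs
    | zero => intro s j hs; simp at hs
    | add x y _ _ hx hy =>
      intro s j hs
      by_cases h1 : ((S.loopBasis k).repr x s).coeff j = 0
      · refine hy s j fun h2 => hs ?_
        simp [h1, h2]
      · exact hx s j h1
    | smul a x _ hx =>
      intro s j hs
      refine hx s j fun h1 => hs ?_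
      rw [← algebraMap_smul k[X] a x, map_smul, Finsupp.smul_apply, smul_eq_mul,
        Polynomial.algebraMap_apply, Algebra.algebraMap_self, RingHom.id_apply,
        Polynomial.coeff_C_mul, h1, mul_zero]
  · intro hv
    rw [← (S.loopBasis k).sum_repr v]
    refine sum_mem fun s _ => ?_
    rw [((S.loopBasis k).repr v s).as_sum_support, Finset.sum_smul]
    refine sum_mem fun j hj => ?_
    rw [monomial_smul_loopBasis]
    refine Submodule.smul_mem _ _ (Submodule.subset_span ?_)
    have := hv s j (Polynomial.mem_support_iff.1 hj)
    rcases s with i | i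
    · exact Or.inr ⟨i, j, by simpa [chevDeg] using this, rfl⟩
    · exact Or.inl ⟨i, j, this, rfl⟩

/-- Leading terms of level `n` involve only `v^j` times basis vectors of degree `d` with `n = hj +
d`. Both homogeneity and membership in `𝔤̃` follow: for `j = 0` and `n ≥ 1` the degree `d` is
positive. -/
lemma coeff_repr_lead {ϖ : RingInt p K} {n : ℤ} (hn : 1 ≤ n) {x : LieG K A} {s : b.support ⊕ ι}
    {j : ℕ} (h : ((S.loopBasis (ResK p K)).repr (S.lead ϖ n x) s).coeff j ≠ 0) :
    n = coxeterNum b * j + chevDeg b s := by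
  rw [repr_lead, Polynomial.coeff_monomial] at h
  by_cases hs : (coxeterNum b : ℤ) ∣ n - chevDeg b s
  · split_ifs at h with hj
    · have h1 : leadExp b n s = j := by
        rw [← hj, Int.toNat_of_nonneg (leadExp_nonneg hn hs)]
      have h2 := Int.mul_ediv_cancel' hs
      rw [leadExp] at h1
      rw [h1] at h2
      omega
    · exact absurd rfl h
  · rw [leadCoef_of_not_dvd hs] at h
    simp at h

lemma lead_mem_gTilde (ϖ : RingInt p K) {n : ℤ} (hn : 1 ≤ n) (x : LieG K A) :
    S.lead ϖ n x ∈ S.gTilde (ResK p K) := by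
  rw [mem_gTilde_iff]
  intro s hs
  have h := S.coeff_repr_lead hn hs
  rcases s with i | i
  · simp [chevDeg] at h; omega
  · refine ⟨i, ?_, rfl⟩
    rw [b.isPos_iff]
    have : n = b.height i := by simpa [chevDeg] using h
    omega

lemma lead_mem_loopDeg (ϖ : RingInt p K) {n : ℕ} (hn : 1 ≤ n) (x : LieG K A) :
    S.lead ϖ n x ∈ S.loopDeg (ResK p K) (coxeterNum b) (ramDeg p K) (levelReal p K b n) := by
  rw [mem_loopDeg_iff]
  intro s j hs
  have hns : (n : ℝ) = coxeterNum b * j + chevDeg b s := by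
    exact_mod_cast S.coeff_repr_lead (by exact_mod_cast hn) hs
  rw [levelReal, hns]
  have h1 : (coxeterNum b : ℝ) ≠ 0 := by exact_mod_cast (coxeterNum_pos (b := b)).ne'
  have h2 : (ramDeg p K : ℝ) ≠ 0 := by exact_mod_cast (ramDeg_pos p K).ne'
  field_simp
  ring

/-- The leading terms span `𝔤̃`. -/
lemma gTilde_le_closure_lead {ϖ : RingInt p K} (hϖ : Irreducible ϖ)
    {v : (ResK p K)[X] ⊗[ResK p K] S.gk (ResK p K)} (hv : v ∈ S.gTilde (ResK p K)) :
    v ∈ AddSubgroup.closure {w | ∃ n : ℤ, 1 ≤ n ∧ ∃ x ∈ S.lieFil p (coxeterNum b) n,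
      w = S.lead ϖ n x} := by
  rw [mem_gTilde_iff] at hv
  rw [← (S.loopBasis _).sum_repr v]
  refine sum_mem fun s _ => ?_
  rw [((S.loopBasis _).repr v s).as_sum_support, Finset.sum_smul]
  refine sum_mem fun j hj => AddSubgroup.subset_closure ?_
  rw [Polynomial.mem_support_iff] at hj
  set c := ((S.loopBasis _).repr v s).coeff j
  obtain ⟨d, hd⟩ := IsLocalRing.residue_surjective c
  have hh := coxeterNum_pos (b := b)
  have hdvd : (coxeterNum b : ℤ) ∣ coxeterNum b * j + chevDeg b s - chevDeg b s := by simp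
  have hexp : leadExp b (coxeterNum b * j + chevDeg b s) s = j := by
    rw [leadExp, add_sub_cancel_right, Int.mul_ediv_cancel_left _ (by exact_mod_cast hh.ne')]
  have hmem : (d : K) * (ϖ : K) ^ (j : ℤ) ∈ ordFil p K
      (((coxeterNum b * j + chevDeg b s : ℤ) - chevDeg b s : ℚ) / coxeterNum b) := by
    have := ordFil_mul (ringInt_mem_ordFil d) (uniformizer_zpow_mem hϖ (j : ℤ))
    rw [leadExp_cast hdvd, hexp]
    simpa using this
  -- A monomial `c v^j` on basis vector `s` is the leading term of `d ϖ^j` times that vector, with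
  -- `d` lifting `c`. The level `hj + deg s` is at least `1`: for `j = 0` membership in `𝔤̃` makes
  -- `s` a positive root, and for `j ≥ 1` heights are greater than `-h`.
  refine ⟨coxeterNum b * j + chevDeg b s, ?_, ((d : K) * (ϖ : K) ^ (j : ℤ)) • S.basis s,
    smul_basis_mem_lieFil hmem, ?_⟩
  · rcases Nat.eq_zero_or_pos j with rfl | hj0
    · obtain ⟨i, hi, rfl⟩ := hv s hj
      rw [b.isPos_iff] at hi
      simpa [chevDeg, Int.lt_iff_add_one_le] using hi
    · have h1 : (coxeterNum b : ℤ) ≤ coxeterNum b * j :=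
        le_mul_of_one_le_right (by positivity) (by exact_mod_cast hj0)
      rcases s with i | i
      · simp only [chevDeg, Sum.elim_inl]; omega
      · have := neg_height_lt_coxeterNum (b := b) i
        simp only [chevDeg, Sum.elim_inr]; omega
  · rw [lead_smul_basis', leadMon, leadCoef, if_pos hdvd, hexp, mul_assoc,
      ← zpow_add₀ (uniformizer_ne_zero hϖ), add_neg_cancel, zpow_zero, mul_one, resK_coe, hd,
      Int.toNat_natCast]

end ChevalleySystem

end LeadStructure

/-! ### Leading terms of group elements. -/

namespace ChevalleyRep

variable {p : ℕ} [Fact p.Prime] {K : Type*} [Field K] [CharZero K] [Algebra ℚ_[p] K]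
  [FiniteDimensional ℚ_[p] K] [Algebra ℤ_[p] K] [IsScalarTower ℤ_[p] ℚ_[p] K]
  {A : Type*} [CommRing A] [HopfAlgebra K A]
  {X Y : Type*} [AddCommGroup X] [AddCommGroup Y]
  {ι : Type*} [Fintype ι] {P : RootPairing ι ℤ X Y} [P.IsReduced] {b : P.Base}
  {π : A →ₐc[K] AddMonoidAlgebra K X} {S : ChevalleySystem P b π}
  {J : Type*} [Fintype J] [DecidableEq J] (R : ChevalleyRep p S J)

variable [Module.Free ℤ X] [Module.Finite ℤ X]

open Classical in
/-- The leading term in degree `n` of an element of `G(K)`. -/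
noncomputable def symv (ϖ : RingInt p K) (n : ℤ) (z : Pts K A K) :
    (ResK p K)[X] ⊗[ResK p K] S.gk (ResK p K) :=
  if h : ∃ x ∈ S.lieFil p (coxeterNum b) n,
    R.mat z - 1 - R.lmat x ∈ matFil p K (coxeterNum b) R.wtHt (n + 1) then S.lead ϖ n h.choose
  else 0

lemma prime_ne_two (hp : coxeterNum b * ramDeg p K < p - 1) : p ≠ 2 := by
  have := Nat.mul_pos (coxeterNum_pos (b := b)) (ramDeg_pos p K)
  omega

variable {ϖ : RingInt p K}

/-- Independence of the chosen first-order approximation: two of them differ by an element of `Lie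
G` whose matrix is in `E_{n+1}`, hence by one of level `n + 1` in the Lie lattice, which has no
leading term in degree `n`. -/
lemma symv_eq (hp : coxeterNum b * ramDeg p K < p - 1) (hϖ : Irreducible ϖ) {n : ℤ}
    {z : Pts K A K} {x : LieG K A} (hx : x ∈ S.lieFil p (coxeterNum b) n)
    (hzx : R.mat z - 1 - R.lmat x ∈ matFil p K (coxeterNum b) R.wtHt (n + 1)) :
    R.symv ϖ n z = S.lead ϖ n x := by
  have h : ∃ x ∈ S.lieFil p (coxeterNum b) n,
    R.mat z - 1 - R.lmat x ∈ matFil p K (coxeterNum b) R.wtHt (n + 1) := ⟨x, hx, hzx⟩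
  rw [symv, dif_pos h]
  obtain ⟨hy, hzy⟩ := h.choose_spec
  have h1 : h.choose - x ∈ S.lieFil p (coxeterNum b) (n + 1) := by
    apply R.mem_lieFil_of_lmat_mem (prime_ne_two hp)
    rw [map_sub]
    have := sub_mem hzx hzy
    rwa [sub_sub_sub_cancel_left] at this
  have h2 := S.lead_add hϖ (sub_mem hy hx) hx
  rwa [sub_add_cancel, (S.lead_eq_zero_iff hϖ (sub_mem hy hx)).2 h1, zero_add] at h2

lemma exists_lie_of_mem_mp (hp : coxeterNum b * ramDeg p K < p - 1) {n : ℕ} (hn : 1 ≤ n)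
    {z : Pts K A K} (hz : z ∈ S.mp p n) : ∃ x ∈ S.lieFil p (coxeterNum b) n,
    R.mat z - 1 - R.lmat x ∈ matFil p K (coxeterNum b) R.wtHt (n + 1) :=
  R.exists_lie_of_mat coxeterNum_pos hp (by exact_mod_cast hn) ((R.mem_mp_iff hp hn).1 hz)

lemma symv_coordPt (hp : coxeterNum b * ramDeg p K < p - 1) (hϖ : Irreducible ϖ) {n : ℤ}
    (hn : 1 ≤ n) {x : LieG K A} (hx : x ∈ S.lieFil p (coxeterNum b) n) :
    R.symv ϖ n (S.coordPt x) = S.lead ϖ n x :=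
  R.symv_eq hp hϖ hx (R.coordPt_sub_one coxeterNum_pos hp hn hx)

lemma symv_mem_gTilde {n : ℤ} (hn : 1 ≤ n) (z : Pts K A K) :
    R.symv ϖ n z ∈ S.gTilde (ResK p K) := by
  rw [symv]
  split_ifs
  · exact S.lead_mem_gTilde ϖ hn _
  · exact zero_mem _

lemma symv_mem_loopDeg {n : ℕ} (hn : 1 ≤ n) (z : Pts K A K) : R.symv ϖ n z ∈
    S.loopDeg (ResK p K) (coxeterNum b) (ramDeg p K) (levelReal p K b n) := by
  rw [symv]
  split_ifs
  · exact S.lead_mem_loopDeg ϖ hn _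
  · exact zero_mem _

lemma symv_eq_zero_iff (hp : coxeterNum b * ramDeg p K < p - 1) (hϖ : Irreducible ϖ) {n : ℕ}
    (hn : 1 ≤ n) {z : Pts K A K} (hz : z ∈ S.mp p n) :
    R.symv ϖ n z = 0 ↔ z ∈ S.mp p (n + 1) := by
  obtain ⟨x, hx, hzx⟩ := R.exists_lie_of_mem_mp hp hn hz
  rw [R.symv_eq hp hϖ hx hzx, S.lead_eq_zero_iff hϖ hx, R.mem_mp_iff hp (by omega)]
  push_cast
  constructor
  · intro h
    rw [← sub_add_cancel (R.mat z - 1) (R.lmat x)]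
    exact add_mem hzx (R.lmat_mem coxeterNum_pos h)
  · intro h
    apply R.mem_lieFil_of_lmat_mem (prime_ne_two hp)
    rw [← sub_sub_cancel (R.mat z - 1) (R.lmat x)]
    exact sub_mem h hzx

lemma symv_mul (hp : coxeterNum b * ramDeg p K < p - 1) (hϖ : Irreducible ϖ) {n : ℕ}
    (hn : 1 ≤ n) {z w : Pts K A K} (hz : z ∈ S.mp p n) (hw : w ∈ S.mp p n) :
    R.symv ϖ n (z * w) = R.symv ϖ n z + R.symv ϖ n w := by
  obtain ⟨x, hx, hzx⟩ := R.exists_lie_of_mem_mp hp hn hz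
  obtain ⟨y, hy, hwy⟩ := R.exists_lie_of_mem_mp hp hn hw
  have h1 := mul_sub_one_mem_matFil (r := n + 1) ((R.mem_mp_iff hp hn).1 hz)
    ((R.mem_mp_iff hp hn).1 hw) (by omega)
  rw [R.symv_eq hp hϖ hx hzx, R.symv_eq hp hϖ hy hwy, ← S.lead_add hϖ hx hy]
  refine R.symv_eq hp hϖ (add_mem hx hy) ?_
  have h2 := add_mem h1 (add_mem hzx hwy)
  rw [map_mul, map_add]
  convert h2 using 1
  abel

/-- The group commutator is `1 + [z - 1, w - 1]` to first order, and there `z - 1`, `w - 1` may be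
replaced by `x`, `y` in `Lie G`. -/
lemma symv_gcomm (hp : coxeterNum b * ramDeg p K < p - 1) (hϖ : Irreducible ϖ) {m n : ℕ}
    (hm : 1 ≤ m) (hn : 1 ≤ n) {z w : Pts K A K} (hz : z ∈ S.mp p m) (hw : w ∈ S.mp p n) :
    R.symv ϖ (m + n : ℕ) (gcomm z w) = ⁅R.symv ϖ m z, R.symv ϖ n w⁆ := by
  have hm' : (1 : ℤ) ≤ m := by exact_mod_cast hm
  have hn' : (1 : ℤ) ≤ n := by exact_mod_cast hn
  obtain ⟨x, hx, hzx⟩ := R.exists_lie_of_mem_mp hp hm hz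
  obtain ⟨y, hy, hwy⟩ := R.exists_lie_of_mem_mp hp hn hw
  have hz' := (R.mem_mp_iff hp hm).1 hz
  have hw' := (R.mem_mp_iff hp hn).1 hw
  have h1 := comm_sub_one_mem_matFil coxeterNum_pos hm' hn' hz' hw' (R.mat_mul_inv z)
    (R.mat_mul_inv w)
  obtain ⟨hxy, hlead⟩ := S.lead_lie hϖ hm' hn' hx hy
  rw [R.symv_eq hp hϖ hx hzx, R.symv_eq hp hϖ hy hwy, ← hlead]
  push_cast
  refine R.symv_eq hp hϖ hxy ?_
  have hlx := R.lmat_mem coxeterNum_pos hx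
  have hly := R.lmat_mem coxeterNum_pos hy
  have key : ∀ {a a' c c' : Matrix J J K} {m n : ℤ},
      a - a' ∈ matFil p K (coxeterNum b) R.wtHt (m + 1) →
      c - c' ∈ matFil p K (coxeterNum b) R.wtHt (n + 1) →
      a ∈ matFil p K (coxeterNum b) R.wtHt m → c' ∈ matFil p K (coxeterNum b) R.wtHt n →
      a * c - a' * c' ∈ matFil p K (coxeterNum b) R.wtHt (m + n + 1) := by
    intro a a' c c' m n h1 h2 h3 h4
    have e : a * c - a' * c' = a * (c - c') + (a - a') * c' := by noncomm_ring
    rw [e]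
    exact add_mem (matFil_mul_of_eq h3 h2 (by omega)) (matFil_mul_of_eq h1 h4 (by omega))
  have h2 := key hzx hwy hz' hly
  have h3 := matFil_mono (m := m + n + 1) (by omega) (key hwy hzx hw' hlx)
  have h4 := add_mem h1 (sub_mem h2 h3)
  rw [gcomm, map_mul, map_mul, map_mul, R.lmat_lie]
  convert h4 using 1
  abel

lemma symv_pow_prime (hp : coxeterNum b * ramDeg p K < p - 1) (hϖ : Irreducible ϖ)
    {lam : RingInt p K} (hlam : (p : RingInt p K) = lam * ϖ ^ ramDeg p K) {n : ℕ} (hn : 1 ≤ n)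
    {z : Pts K A K} (hz : z ∈ S.mp p n) :
    R.symv ϖ (n + coxeterNum b * ramDeg p K : ℕ) (z ^ p) =
      (Polynomial.C (IsLocalRing.residue (RingInt p K) lam) * Polynomial.X ^ ramDeg p K) •
        R.symv ϖ n z := by
  have hh := coxeterNum_pos (b := b)
  have hn' : (1 : ℤ) ≤ n := by exact_mod_cast hn
  obtain ⟨x, hx, hzx⟩ := R.exists_lie_of_mem_mp hp hn hz
  rw [R.symv_eq hp hϖ hx hzx, ← S.lead_prime_smul hϖ hlam hn' hx]
  push_cast
  have h1 := pow_prime_sub_one hn' hh hp ((R.mem_mp_iff hp hn).1 hz)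
  have h2 := matFil_prime_smul hzx hh
  have h3 := add_mem (matFil_mono (m := n + coxeterNum b * ramDeg p K + 1) (by omega) h1)
    (matFil_mono (m := n + coxeterNum b * ramDeg p K + 1) (by omega) h2)
  refine R.symv_eq hp hϖ ?_ ?_
  · apply R.mem_lieFil_of_lmat_mem (prime_ne_two hp)
    rw [map_smul]
    exact matFil_prime_smul (R.lmat_mem hh hx) hh
  · rw [map_pow, map_smul]
    rwa [smul_sub _ (R.mat z - 1), sub_add_sub_cancel] at h3

lemma leadMon_ne_zero {n : ℤ} {s : b.support ⊕ ι} {c : K} (hϖ : Irreducible ϖ) (hc : c ≠ 0)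
    (hn : n = coxeterNum b * ordK p c + chevDeg b s) : leadMon b ϖ n s c ≠ 0 := by
  have hh : (0 : ℚ) < coxeterNum b := by exact_mod_cast coxeterNum_pos (b := b)
  have e : ((n : ℚ) - chevDeg b s) / coxeterNum b = ordK p c := by
    rw [hn, div_eq_iff hh.ne']; push_cast; ring
  have hmem : c ∈ ordFil p K ((n - chevDeg b s) / coxeterNum b) := by
    rw [e]; exact fun _ => le_rfl
  rw [leadMon, Ne, Polynomial.monomial_eq_zero_iff, leadCoef_eq_zero_iff hϖ hmem,
    mem_ordFil_of_ne hc]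
  push_cast
  rw [add_sub_right_comm, add_div, e]
  have : 0 < 1 / (coxeterNum b : ℚ) := by positivity
  linarith

lemma symv_rootPt (hp : coxeterNum b * ramDeg p K < p - 1) (hϖ : Irreducible ϖ) {n : ℤ}
    (hn : 1 ≤ n) {α : ι} {c : K} (hc : c ∈ ordFil p K ((n - b.height α) / coxeterNum b)) :
    R.symv ϖ n (S.rootPt α c) =
      leadMon b ϖ n (Sum.inr α) c • S.loopBasis (ResK p K) (Sum.inr α) := by
  rw [← S.lead_smul_basis']
  refine R.symv_eq hp hϖ (S.smul_basis_mem_lieFil hc) ?_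
  rw [map_smul]
  exact R.mat_rootPt_sub coxeterNum_pos hp hn hc

/-- Determines the exact level `h v(c) + ht(α)` of `u_α(c)` when it is at least `1`, since the
leading term there is nonzero. -/
lemma rootPt_not_mem_mp (R : ChevalleyRep p S J) (hp : coxeterNum b * ramDeg p K < p - 1) {n : ℕ}
    (hn : 1 ≤ n) {α : ι} {c : K} (hc : c ≠ 0) (h : (n : ℤ) = coxeterNum b * ordK p c + b.height α) :
    S.rootPt α c ∈ S.mp p n ∧ S.rootPt α c ∉ S.mp p (n + 1) := by
  obtain ⟨ϖ, hϖ⟩ := IsDiscreteValuationRing.exists_irreducible (RingInt p K)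
  have hh : (0 : ℚ) < coxeterNum b := by exact_mod_cast coxeterNum_pos (b := b)
  have hmem : c ∈ ordFil p K (((n : ℤ) - b.height α) / coxeterNum b) := by
    intro _
    rw [div_le_iff₀ hh, h]; push_cast; linarith
  have hz : S.rootPt α c ∈ S.mp p n := S.rootPt_mem_mp (by exact_mod_cast hmem)
  refine ⟨hz, fun h' => ?_⟩
  rw [← R.symv_eq_zero_iff hp hϖ hn hz, R.symv_rootPt hp hϖ (by exact_mod_cast hn) hmem] at h'
  have h2 := congrArg (fun v => (S.loopBasis (ResK p K)).repr v (Sum.inr α)) h'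
  simp only [map_smul, Module.Basis.repr_self, Finsupp.smul_single, Finsupp.single_eq_same,
    map_zero, Finsupp.zero_apply, smul_eq_mul, mul_one] at h2
  exact leadMon_ne_zero hϖ hc h h2

lemma _root_.ChevalleySystem.rootPt_pow (α : ι) (c : K) (m : ℕ) :
    S.rootPt α c ^ m = S.rootPt α (m * c) := by
  induction m with
  | zero => rw [pow_zero, Nat.cast_zero, zero_mul, S.rootPt_zero]
  | succ m ih => rw [pow_succ, ih, ← S.rootPt_add]; congr 1; push_cast; ring

/-- The root group elements of `I_1`. -/
lemma rootPt_level (R : ChevalleyRep p S J) (hp : coxeterNum b * ramDeg p K < p - 1) {α : ι} {c : K} (hc : c ≠ 0)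
    (hz : S.rootPt α c ∈ S.mp p 1) : 1 ≤ coxeterNum b * ordK p c + b.height α := by
  set m := coxeterNum b * ordK p c + b.height α with hm
  by_contra! hlt
  set E := coxeterNum b * ramDeg p K with hE
  have hE0 : 1 ≤ E := Nat.mul_pos (coxeterNum_pos (b := b)) (ramDeg_pos p K)
  -- The exact level of `u_α(c)` is not accessible when `m < 1`. The power `u_α(c)^{p^k} = u_α(p^k
  -- c)` moves into the range where it is: for large `k` its level is `m + k he`, whereas membership
  -- of `u_α(c)` in `I_1` forces at least `1 + k he`.
  have hpow : ∀ k : ℕ, S.rootPt α ((p : K) ^ k * c) ∈ S.mp p (1 + k * E) := by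
    intro k
    induction k with
    | zero => simpa using hz
    | succ k ih =>
      have h1 := (R.mem_mp_pow_iff hp (by omega) (S.mp_antitone (by omega) ih)).2 ih
      rw [S.rootPt_pow, ← mul_assoc (p : K), ← pow_succ', ← hE] at h1
      rwa [Nat.succ_mul, ← add_assoc]
  obtain ⟨k, hk⟩ : ∃ k : ℕ, 1 ≤ m + k := ⟨(1 - m).toNat, by omega⟩
  have hkE : (k : ℤ) ≤ k * E := le_mul_of_one_le_right (by positivity) (by exact_mod_cast hE0)
  obtain ⟨M, hM⟩ := Int.eq_ofNat_of_zero_le (a := m + k * E) (by omega)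
  have hpk : (p : K) ^ k ≠ 0 := pow_ne_zero _ (prime_ne_zero p K)
  have hord : ordK p ((p : K) ^ k * c) = k * ramDeg p K + ordK p c := by
    rw [ordK_mul p hpk hc, ← zpow_natCast, ordK_zpow, ordK_prime]
  have h2 := (R.rootPt_not_mem_mp hp (n := M) (by omega) (mul_ne_zero hpk hc) (by
    rw [hord, ← hM, hm, hE]; push_cast; ring)).2
  refine h2 (S.mp_antitone ?_ (hpow k))
  zify
  omega

lemma _root_.diagonal_mem_matFil {h : ℕ} {ℓ : J → ℚ} {n : ℤ} {d : J → K}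
    (hd : ∀ j, d j ∈ ordFil p K ((n : ℚ) / h)) : Matrix.diagonal d ∈ matFil p K h ℓ n := by
  intro i j
  rw [Matrix.diagonal_apply]
  split_ifs with hij
  · subst hij; simpa using hd i
  · exact zero_mem _

lemma smul_H_mem_lieFil (R : ChevalleyRep p S J) (hp : coxeterNum b * ramDeg p K < p - 1) {n : ℤ} {α : ι} {c : K}
    (hc : c ∈ ordFil p K ((n : ℚ) / coxeterNum b)) :
    c • S.H α ∈ S.lieFil p (coxeterNum b) n := by
  apply R.mem_lieFil_of_lmat_mem (prime_ne_two hp)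
  rw [map_smul, R.lmat_H, ← Matrix.diagonal_smul]
  exact diagonal_mem_matFil fun j => ordFil_mul_right hc (intCast_mem_ordFil _)

/-- On each weight `χ` the element acts by `(1 + c)^m ≡ 1 + m c` with `m = ⟨χ, α^∨⟩`, which is `1 +
c H_α` to first order. -/
lemma symv_corootPt (hp : coxeterNum b * ramDeg p K < p - 1) (hϖ : Irreducible ϖ) {q : ℕ}
    (hq : 1 ≤ q) {α : ι} {c : K} {w : Kˣ} (hw : (w : K) = 1 + c) (hc : c ∈ ordFil p K q) :
    torusPt π (cocharPt P (P.coroot α) w) ∈ S.mp p (coxeterNum b * q) ∧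
    R.symv ϖ (coxeterNum b * q : ℕ) (torusPt π (cocharPt P (P.coroot α) w)) =
      S.lead ϖ (coxeterNum b * q : ℕ) (c • S.H α) := by
  have hh := coxeterNum_pos (b := b)
  have hh' : (0 : ℚ) < coxeterNum b := by exact_mod_cast hh
  have hq' : (1 : ℚ) ≤ q := by exact_mod_cast hq
  have e1 : (((coxeterNum b * q : ℕ) : ℤ) : ℚ) / coxeterNum b = q := by
    push_cast
    field_simp
  have hmem := R.smul_H_mem_lieFil hp (n := (coxeterNum b * q : ℕ)) (α := α) (c := c)
    (by rwa [e1])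
  have h1 : R.mat (torusPt π (cocharPt P (P.coroot α) w)) - 1 - R.lmat (c • S.H α) ∈
      matFil p K (coxeterNum b) R.wtHt ((coxeterNum b * q : ℕ) + 1) := by
    rw [R.mat_torusPt, ← Matrix.diagonal_one, Matrix.diagonal_sub, map_smul, R.lmat_H,
      ← Matrix.diagonal_smul, Matrix.diagonal_sub]
    refine diagonal_mem_matFil fun j => ?_
    have h2 := one_add_zpow_sub_mem hq' hc (P.toLinearMap (R.wt j) (P.coroot α))
    rw [← hw] at h2
    refine ordFil_mono ?_ (b := (q : ℚ) + 1) ?_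
    · have h3 : (1 : ℚ) / coxeterNum b ≤ 1 := by
        rw [div_le_one hh']; exact_mod_cast hh
      rw [Int.cast_add, add_div, e1]
      push_cast
      linarith
    · convert h2 using 1
      simp [cocharPt, mul_comm]
  refine ⟨?_, R.symv_eq hp hϖ hmem h1⟩
  rw [R.mem_mp_iff hp (Nat.mul_pos hh hq), ← sub_add_cancel (R.mat _ - 1) (R.lmat (c • S.H α))]
  exact add_mem (matFil_mono (by omega) h1) (R.lmat_mem hh hmem)

/-- On a vector of weight `α` the leading part `c H_α` acts by `2c`, and `2` is a unit, so the level
is no deeper than `h v(c)`. -/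
lemma corootPt_not_mem_mp (R : ChevalleyRep p S J) (hp : coxeterNum b * ramDeg p K < p - 1) {q : ℕ}
    (hq : 1 ≤ q) {α : ι} {c : K} {w : Kˣ} (hw : (w : K) = 1 + c) (hc : c ≠ 0)
    (hcq : ordK p c = q) :
    torusPt π (cocharPt P (P.coroot α) w) ∉ S.mp p (coxeterNum b * q + 1) := by
  obtain ⟨ϖ, hϖ⟩ := IsDiscreteValuationRing.exists_irreducible (RingInt p K)
  have hh := coxeterNum_pos (b := b)
  have hh' : (0 : ℚ) < coxeterNum b := by exact_mod_cast hh
  have hcm : c ∈ ordFil p K q := fun _ => by rw [hcq]; norm_cast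
  have e1 : (((coxeterNum b * q : ℕ) : ℤ) : ℚ) / coxeterNum b = q := by
    push_cast
    field_simp
  have hmem := R.smul_H_mem_lieFil hp (n := (coxeterNum b * q : ℕ)) (α := α) (c := c)
    (by rwa [e1])
  obtain ⟨h1, h2⟩ := R.symv_corootPt hp hϖ hq hw hcm (α := α)
  rw [← R.symv_eq_zero_iff hp hϖ (Nat.mul_pos hh hq) h1, h2, S.lead_eq_zero_iff hϖ hmem]
  intro h3
  have h4 := R.lmat_mem hh h3
  obtain ⟨j, hj⟩ := R.root_mem α
  have h5 := h4 j j
  have h6 : (2 : K) ≠ 0 := two_ne_zero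
  have h7 : ordK p (2 : K) = 0 := by
    have hpr : p.Prime := Fact.out
    have h8 : ¬ (p : ℤ) ∣ 2 := by
      intro h
      have h9 : p ∣ 2 := by exact_mod_cast h
      exact prime_ne_two hp ((Nat.prime_dvd_prime_iff_eq hpr Nat.prime_two).1 h9)
    exact_mod_cast (ordK_intCast (K := K) h8).2
  have h8 : P.toLinearMap (R.wt j) (P.coroot α) = 2 := by
    rw [hj]; exact P.pairing_same α
  rw [map_smul, R.lmat_H, Matrix.smul_apply, Matrix.diagonal_apply_eq, h8, smul_eq_mul,
    Int.cast_ofNat, sub_add_cancel] at h5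
  have h9 := h5 (mul_ne_zero hc h6)
  rw [ordK_mul p hc h6, h7, add_zero, hcq, Int.cast_add, add_div, e1] at h9
  push_cast at h9
  have : 0 < 1 / (coxeterNum b : ℚ) := by positivity
  linarith

end ChevalleyRep

/-! ### The map from `gr(I_1)` to `𝔤[v]`: injectivity, grading, image, bracket. -/

namespace ChevalleyRep

variable {p : ℕ} [Fact p.Prime] {K : Type*} [Field K] [CharZero K] [Algebra ℚ_[p] K]
  [FiniteDimensional ℚ_[p] K] [Algebra ℤ_[p] K] [IsScalarTower ℤ_[p] ℚ_[p] K]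
  {A : Type*} [CommRing A] [HopfAlgebra K A]
  {X Y : Type*} [AddCommGroup X] [AddCommGroup Y]
  {ι : Type*} [Fintype ι] {P : RootPairing ι ℤ X Y} [P.IsReduced] {b : P.Base}
  {π : A →ₐc[K] AddMonoidAlgebra K X} {S : ChevalleySystem P b π}
  {J : Type*} [Fintype J] [DecidableEq J] (R : ChevalleyRep p S J)

variable [Module.Free ℤ X] [Module.Finite ℤ X]

/-- The grading is indexed by all real numbers; at values that are not positive levels the graded
piece is zero. -/
lemma lt_omega_of_ne (R : ChevalleyRep p S J) (hp : coxeterNum b * ramDeg p K < p - 1) {i : ℝ}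
    (hi : ∀ n : ℕ, 1 ≤ n → levelReal p K b n ≠ i) {z : S.proPIwahori p}
    (hz : (i : WithTop ℝ) ≤ S.omega p z) : (i : WithTop ℝ) < S.omega p z := by
  by_cases h1 : z = 1
  · rw [h1, S.omega_one]; exact WithTop.coe_lt_top i
  · obtain ⟨n, hn, hz', -⟩ := R.exists_omega_eq hp h1
    rw [hz', WithTop.coe_le_coe] at hz
    rw [hz', WithTop.coe_lt_coe]
    exact lt_of_le_of_ne hz (hi n hn).symm

open Classical in
/-- The leading term of degree `i` of an element of `G(K)`, for a real degree `i`. -/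
noncomputable def symR (ϖ : RingInt p K) (i : ℝ) (z : Pts K A K) :
    (ResK p K)[X] ⊗[ResK p K] S.gk (ResK p K) :=
  if h : ∃ n : ℕ, 1 ≤ n ∧ levelReal p K b n = i then R.symv ϖ h.choose z else 0

variable {ϖ : RingInt p K}

lemma symR_levelReal {n : ℕ} (hn : 1 ≤ n) (z : Pts K A K) :
    R.symR ϖ (levelReal p K b n) z = R.symv ϖ n z := by
  have h : ∃ m : ℕ, 1 ≤ m ∧ levelReal p K b m = levelReal p K b n := ⟨n, hn, rfl⟩
  rw [symR, dif_pos h, levelReal_injective h.choose_spec.2]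

lemma symR_of_ne {i : ℝ} (hi : ∀ n : ℕ, 1 ≤ n → levelReal p K b n ≠ i) (z : Pts K A K) :
    R.symR ϖ i z = 0 := dif_neg fun ⟨n, hn, h⟩ => hi n hn h

lemma levelReal_cases (b : P.Base) (i : ℝ) : (∃ n : ℕ, 1 ≤ n ∧ levelReal p K b n = i) ∨
    ∀ n : ℕ, 1 ≤ n → levelReal p K b n ≠ i := by
  by_contra! h
  obtain ⟨h1, n, hn, h2⟩ := h
  exact h1 n hn h2

lemma symR_mul (hp : coxeterNum b * ramDeg p K < p - 1) (hϖ : Irreducible ϖ) {i : ℝ}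
    {z w : S.proPIwahori p} (hz : (i : WithTop ℝ) ≤ S.omega p z)
    (hw : (i : WithTop ℝ) ≤ S.omega p w) :
    R.symR ϖ i (z * w : Pts K A K) = R.symR ϖ i z + R.symR ϖ i w := by
  obtain ⟨n, hn, rfl⟩ | hi := levelReal_cases (p := p) (K := K) b i
  · rw [R.symR_levelReal hn, R.symR_levelReal hn, R.symR_levelReal hn,
      R.symv_mul hp hϖ hn ((R.le_omega_iff hp).1 hz) ((R.le_omega_iff hp).1 hw)]
  · rw [R.symR_of_ne hi, R.symR_of_ne hi, R.symR_of_ne hi, add_zero]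

lemma symR_eq_zero_iff (hp : coxeterNum b * ramDeg p K < p - 1) (hϖ : Irreducible ϖ) {i : ℝ}
    {z : S.proPIwahori p} (hz : (i : WithTop ℝ) ≤ S.omega p z) :
    R.symR ϖ i (z : Pts K A K) = 0 ↔ (i : WithTop ℝ) < S.omega p z := by
  obtain ⟨n, hn, rfl⟩ | hi := levelReal_cases (p := p) (K := K) b i
  · rw [R.symR_levelReal hn, R.symv_eq_zero_iff hp hϖ hn ((R.le_omega_iff hp).1 hz),
      R.lt_omega_iff hp]
  · exact ⟨fun _ => R.lt_omega_of_ne hp hi hz, fun _ => R.symR_of_ne hi _⟩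

lemma symR_mem_loopDeg (i : ℝ) (z : Pts K A K) :
    R.symR ϖ i z ∈ S.loopDeg (ResK p K) (coxeterNum b) (ramDeg p K) i := by
  obtain ⟨n, hn, rfl⟩ | hi := levelReal_cases (p := p) (K := K) b i
  · rw [R.symR_levelReal hn]; exact R.symv_mem_loopDeg hn z
  · rw [R.symR_of_ne hi]; exact zero_mem _

lemma symR_mem_gTilde (i : ℝ) (z : Pts K A K) : R.symR ϖ i z ∈ S.gTilde (ResK p K) := by
  obtain ⟨n, hn, rfl⟩ | hi := levelReal_cases (p := p) (K := K) b i
  · rw [R.symR_levelReal hn]; exact R.symv_mem_gTilde (by exact_mod_cast hn) z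
  · rw [R.symR_of_ne hi]; exact zero_mem _

variable (hp : coxeterNum b * ramDeg p K < p - 1)

/-- The leading terms, on a graded piece of `I_1`. -/
noncomputable def grPieceHom (hϖ : Irreducible ϖ) (i : ℝ) : (R.filtration hp).GrPiece i →+
    (ResK p K)[X] ⊗[ResK p K] S.gk (ResK p K) :=
  MonoidHom.toAdditiveLeft (QuotientGroup.lift _
    (MonoidHom.mk' (fun z : (R.filtration hp).fil i =>
      Multiplicative.ofAdd (R.symR ϖ i ((z : S.proPIwahori p) : Pts K A K)))
      fun z w => R.symR_mul hp hϖ z.2 w.2)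
    fun z hz => (R.symR_eq_zero_iff hp hϖ z.2).2 hz)

lemma grPieceHom_cl (hϖ : Irreducible ϖ) {i : ℝ} (z : S.proPIwahori p)
    (hz : (i : WithTop ℝ) ≤ (R.filtration hp).toFun z) :
    R.grPieceHom hp hϖ i ((R.filtration hp).cl i z hz) = R.symR ϖ i (z : Pts K A K) := rfl

lemma grPieceHom_injective (hϖ : Irreducible ϖ) (i : ℝ) :
    Function.Injective (R.grPieceHom hp hϖ i) := by
  rw [injective_iff_map_eq_zero]
  intro a ha
  obtain ⟨z, hz, rfl⟩ := (R.filtration hp).cl_surj a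
  rw [grPieceHom_cl, R.symR_eq_zero_iff hp hϖ hz] at ha
  exact (R.filtration hp).cl_eq_zero_iff.2 ha

lemma grPieceHom_mem_loopDeg (hϖ : Irreducible ϖ) (i : ℝ) (a : (R.filtration hp).GrPiece i) :
    R.grPieceHom hp hϖ i a ∈ S.loopDeg (ResK p K) (coxeterNum b) (ramDeg p K) i := by
  obtain ⟨z, hz, rfl⟩ := (R.filtration hp).cl_surj a
  exact R.symR_mem_loopDeg i _

open Classical in
/-- The leading terms, on the graded Lie ring of `I_1`. -/
noncomputable def grHom (hϖ : Irreducible ϖ) : (R.filtration hp).Gr →+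
    (ResK p K)[X] ⊗[ResK p K] S.gk (ResK p K) :=
  DirectSum.toAddMonoid (R.grPieceHom hp hϖ)

lemma grHom_ofPiece (hϖ : Irreducible ϖ) (i : ℝ) (a : (R.filtration hp).GrPiece i) :
    R.grHom hp hϖ ((R.filtration hp).ofPiece i a) = R.grPieceHom hp hϖ i a :=
  DirectSum.toAddMonoid_of _ _ _

lemma grHom_sy (hϖ : Irreducible ϖ) {i : ℝ} (z : S.proPIwahori p)
    (hz : (i : WithTop ℝ) ≤ (R.filtration hp).toFun z) :
    R.grHom hp hϖ ((R.filtration hp).sy i z hz) = R.symR ϖ i (z : Pts K A K) := by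
  rw [PFiltration.sy, grHom_ofPiece, grPieceHom_cl]

/-- The coefficients of the image of an element of the graded Lie ring only depend on one of its
components. -/
lemma coeff_grHom (hϖ : Irreducible ϖ) (a : (R.filtration hp).Gr) (s : b.support ⊕ ι) (j : ℕ) :
    ((S.loopBasis (ResK p K)).repr (R.grHom hp hϖ a) s).coeff j =
      ((S.loopBasis (ResK p K)).repr (R.grPieceHom hp hϖ
        ((chevDeg b s : ℝ) / (coxeterNum b * ramDeg p K) + j / ramDeg p K)
        (a
          ((chevDeg b s : ℝ) / (coxeterNum b * ramDeg p K) + j / ramDeg p K))) s).coeff j := by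
  classical
  set r := (chevDeg b s : ℝ) / (coxeterNum b * ramDeg p K) + j / ramDeg p K with hr
  refine DirectSum.induction_on (β := fun i : ℝ => (R.filtration hp).GrPiece i)
    (motive := fun a => ((S.loopBasis (ResK p K)).repr (R.grHom hp hϖ a) s).coeff j =
      ((S.loopBasis (ResK p K)).repr (R.grPieceHom hp hϖ r (a r)) s).coeff j) a ?_ ?_ ?_
  · rw [map_zero, DirectSum.zero_apply, map_zero, map_zero, map_zero]
  · intro i a
    by_cases hi : i = r
    · subst hi
      rw [DirectSum.of_eq_same]
      exact congrArg (fun v => ((S.loopBasis (ResK p K)).repr v s).coeff j)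
        (R.grHom_ofPiece hp hϖ _ a)
    · rw [DirectSum.of_eq_of_ne _ _ _ (Ne.symm hi), map_zero, map_zero, Finsupp.zero_apply,
        Polynomial.coeff_zero]
      refine Eq.trans (congrArg (fun v => ((S.loopBasis (ResK p K)).repr v s).coeff j)
        (R.grHom_ofPiece hp hϖ _ a)) ?_
      by_contra h
      exact hi (((S.mem_loopDeg_iff _ _ _ _ _).1 (R.grPieceHom_mem_loopDeg hp hϖ i a) s j h).symm)
  · intro a c ha hc
    simp only [map_add, DirectSum.add_apply, Finsupp.add_apply, Polynomial.coeff_add] at ha hc ⊢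
    rw [ha, hc]

lemma component_eq_zero (hϖ : Irreducible ϖ) (a : (R.filtration hp).Gr) (r : ℝ)
    (h : ∀ (s : b.support ⊕ ι) (j : ℕ), (chevDeg b s : ℝ) / (coxeterNum b * ramDeg p K) + j / ramDeg p K = r →
      ((S.loopBasis (ResK p K)).repr (R.grHom hp hϖ a) s).coeff j = 0) :
    a r = 0 := by
  apply R.grPieceHom_injective hp hϖ r
  rw [map_zero, ← (S.loopBasis (ResK p K)).repr.map_eq_zero_iff]
  ext s j
  by_contra h1
  have h2 := (S.mem_loopDeg_iff _ _ _ _ _).1 (R.grPieceHom_mem_loopDeg hp hϖ r _) s j h1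
  have h3 := R.coeff_grHom hp hϖ a s j
  rw [h s j h2, h2] at h3
  exact h1 h3.symm

/-- Each graded piece embeds into its own homogeneous component of `𝔤[v]`, and distinct components
share no monomials, so nothing cancels between pieces. -/
lemma grHom_injective (hϖ : Irreducible ϖ) : Function.Injective (R.grHom hp hϖ) := by
  rw [injective_iff_map_eq_zero]
  intro a ha
  refine DirectSum.ext fun r => ?_
  exact R.component_eq_zero hp hϖ a r fun s j _ => by
    rw [ha, map_zero, Finsupp.zero_apply, Polynomial.coeff_zero]

lemma mem_grDeg_iff (hϖ : Irreducible ϖ) (r : ℝ) (a : (R.filtration hp).Gr) :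
    a ∈ (R.filtration hp).grDeg r ↔
      R.grHom hp hϖ a ∈ S.loopDeg (ResK p K) (coxeterNum b) (ramDeg p K) r := by
  classical
  constructor
  · rintro ⟨a, rfl⟩
    rw [grHom_ofPiece]
    exact R.grPieceHom_mem_loopDeg hp hϖ r a
  · intro h
    refine ⟨a r, ?_⟩
    refine DirectSum.ext fun i => ?_
    change DirectSum.of (fun i : ℝ => (R.filtration hp).GrPiece i) r (a r) i = a i
    by_cases hi : i = r
    · subst hi; exact DirectSum.of_eq_same _ _
    · refine (DirectSum.of_eq_of_ne _ _ _ hi).trans (R.component_eq_zero hp hϖ a i ?_).symm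
      intro s j hs
      by_contra h1
      exact hi (hs.symm.trans ((S.mem_loopDeg_iff _ _ _ _ _).1 h s j h1))

lemma range_grHom (hϖ : Irreducible ϖ) (v : (ResK p K)[X] ⊗[ResK p K] S.gk (ResK p K)) :
    v ∈ S.gTilde (ResK p K) ↔ ∃ a, R.grHom hp hϖ a = v := by
  constructor
  · intro hv
    change v ∈ (R.grHom hp hϖ).range
    refine (AddSubgroup.closure_le _).2 ?_ (S.gTilde_le_closure_lead hϖ hv)
    rintro _ ⟨n, hn, x, hx, rfl⟩
    obtain ⟨n, rfl⟩ := Int.eq_ofNat_of_zero_le (by omega : 0 ≤ n)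
    have hn' : 1 ≤ n := by omega
    have hz := S.coordPt_mem_mp hn' hx
    set z : S.proPIwahori p := ⟨S.coordPt x, S.mp_antitone hn' hz⟩ with hz'
    have h : ((levelReal p K b n : ℝ) : WithTop ℝ) ≤ (R.filtration hp).toFun z :=
      (R.le_omega_iff hp).2 hz
    refine ⟨(R.filtration hp).sy _ z h, ?_⟩
    rw [grHom_sy, R.symR_levelReal hn', R.symv_coordPt hp hϖ hn hx]
  · rintro ⟨a, rfl⟩
    induction a using (R.filtration hp).gr_induction with
    | h0 => rw [map_zero]; exact zero_mem _
    | h1 i x hx => rw [grHom_sy]; exact R.symR_mem_gTilde i _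
    | h2 a c ha hc => rw [map_add]; exact add_mem ha hc

lemma grHom_symb (hϖ : Irreducible ϖ) {z : S.proPIwahori p} {n : ℕ} (hn : 1 ≤ n)
    (hz : S.omega p z = (levelReal p K b n : ℝ)) :
    R.grHom hp hϖ ((R.filtration hp).symb z) = R.symv ϖ n (z : Pts K A K) := by
  have h1 : ((R.filtration hp).toFun z).untopD 0 = levelReal p K b n := by
    change (S.omega p z).untopD 0 = _
    rw [hz]; rfl
  rw [PFiltration.symb, grHom_sy, h1, R.symR_levelReal hn]

lemma symb_one : (R.filtration hp).symb 1 = 0 := PFiltration.sy_one _ _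

lemma omega_eq_of_not_mem (R : ChevalleyRep p S J)
    (hp : coxeterNum b * ramDeg p K < p - 1) {z : S.proPIwahori p} {n : ℕ}
    (h1 : (z : Pts K A K) ∈ S.mp p n) (h2 : (z : Pts K A K) ∉ S.mp p (n + 1)) :
    S.omega p z = (levelReal p K b n : ℝ) :=
  le_antisymm (not_lt.1 fun h => h2 ((R.lt_omega_iff hp).1 h)) ((R.le_omega_iff hp).2 h1)

lemma grHom_lie (hϖ : Irreducible ϖ) (x y : (R.filtration hp).Gr) :
    R.grHom hp hϖ ⁅x, y⁆ = ⁅R.grHom hp hϖ x, R.grHom hp hϖ y⁆ := by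
  have hV : ∀ u v w : (ResK p K)[X] ⊗[ResK p K] S.gk (ResK p K), ⁅u + v, w⁆ = ⁅u, w⁆ + ⁅v, w⁆ :=
    fun u v w => add_lie u v w
  have hV' : ∀ u v w : (ResK p K)[X] ⊗[ResK p K] S.gk (ResK p K), ⁅u, v + w⁆ = ⁅u, v⁆ + ⁅u, w⁆ :=
    fun u v w => lie_add u v w
  have hV0 : ∀ u : (ResK p K)[X] ⊗[ResK p K] S.gk (ResK p K), ⁅u, (0 : (ResK p K)[X] ⊗[ResK p K] S.gk (ResK p K))⁆ = 0 :=
    fun u => lie_zero u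
  have hV0' : ∀ u : (ResK p K)[X] ⊗[ResK p K] S.gk (ResK p K), ⁅(0 : (ResK p K)[X] ⊗[ResK p K] S.gk (ResK p K)), u⁆ = 0 :=
    fun u => zero_lie u
  induction x using (R.filtration hp).gr_induction with
  | h0 => rw [zero_lie, map_zero, hV0']
  | h2 x x' h h' => rw [add_lie, map_add, map_add, h, h', hV]
  | h1 i x hx =>
    induction y using (R.filtration hp).gr_induction with
    | h0 => rw [lie_zero, map_zero, hV0]
    | h2 y y' h h' => rw [lie_add, map_add, map_add, h, h', hV']
    | h1 j y hy =>
      have e : ⁅(R.filtration hp).sy i x hx, (R.filtration hp).sy j y hy⁆ =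
        (R.filtration hp).sy (i + j) (gcomm x y) ((R.filtration hp).le_comm' hx hy) :=
          (R.filtration hp).grBracket_sy hx hy
      have hzero : ∀ {i j : ℝ} {x y : S.proPIwahori p}
          (hx : (i : WithTop ℝ) < (R.filtration hp).toFun x)
          (hy : (j : WithTop ℝ) ≤ (R.filtration hp).toFun y),
          R.symR ϖ (i + j) ((gcomm x y : S.proPIwahori p) : Pts K A K) = 0 := fun hx hy =>
        (R.symR_eq_zero_iff hp hϖ ((R.filtration hp).le_comm' hx.le hy)).2
          ((R.filtration hp).lt_comm_left hx hy)
      rw [e, grHom_sy, grHom_sy, grHom_sy]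
      -- If one of the degrees is not a level, its class is zero and the commutator lies strictly
      -- deeper, so both sides vanish; otherwise the bracket formula for leading terms applies.
      obtain ⟨m, hm, rfl⟩ | hi := levelReal_cases (p := p) (K := K) b i
      · obtain ⟨n, hn, rfl⟩ | hj := levelReal_cases (p := p) (K := K) b j
        · rw [← levelReal_add, R.symR_levelReal hm, R.symR_levelReal hn,
            R.symR_levelReal (by omega)]
          exact R.symv_gcomm hp hϖ hm hn ((R.le_omega_iff hp).1 hx) ((R.le_omega_iff hp).1 hy)
        · have h2 := (R.filtration hp).lt_comm_left (R.lt_omega_of_ne hp hj hy) hx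
          rw [R.symR_of_ne hj, hV0]
          refine (R.symR_eq_zero_iff hp hϖ ((R.filtration hp).le_comm' hx hy)).2 ?_
          change _ < (R.filtration hp).toFun (gcomm x y)
          rw [← (R.filtration hp).map_inv, gcomm_inv, add_comm]
          exact h2
      · rw [R.symR_of_ne hi, hV0', hzero (R.lt_omega_of_ne hp hi hx) hy]

end ChevalleyRep

/-! ### Conjugation by the integral torus. -/

namespace ChevalleyRep

variable {p : ℕ} [Fact p.Prime] {K : Type*} [Field K] [CharZero K] [Algebra ℚ_[p] K]
  [FiniteDimensional ℚ_[p] K] [Algebra ℤ_[p] K] [IsScalarTower ℤ_[p] ℚ_[p] K]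
  {A : Type*} [CommRing A] [HopfAlgebra K A]
  {X Y : Type*} [AddCommGroup X] [AddCommGroup Y]
  {ι : Type*} [Fintype ι] {P : RootPairing ι ℤ X Y} [P.IsReduced] {b : P.Base}
  {π : A →ₐc[K] AddMonoidAlgebra K X} {S : ChevalleySystem P b π}
  {J : Type*} [Fintype J] [DecidableEq J] (R : ChevalleyRep p S J)

variable [Module.Free ℤ X] [Module.Finite ℤ X] {ϖ : RingInt p K}

/-- The character of `T` on an element of the Chevalley basis. -/
def chevChar {k : Type*} [Monoid k] (b : P.Base) (τ : Multiplicative X →* kˣ) :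
    b.support ⊕ ι → kˣ :=
  Sum.elim (fun _ => 1) fun i => τ (Multiplicative.ofAdd (P.root i))

lemma adkv_loopBasis {k : Type*} [Field k] (τ : Multiplicative X →* kˣ) (s : b.support ⊕ ι) :
    S.adkv k τ (S.loopBasis k s) =
      (Polynomial.C (chevChar b τ s : k) : k[X]) • S.loopBasis k s := by
  rw [ChevalleySystem.loopBasis_apply, ChevalleySystem.adkv, LinearMap.baseChange_tmul,
    ChevalleySystem.adk, Module.Basis.constr_basis, TensorProduct.smul_tmul', smul_eq_mul, mul_one]
  rcases s with i | i
  · simp [chevChar]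
  · simp only [chevChar, Sum.elim_inr, TensorProduct.tmul_smul, TensorProduct.smul_tmul']
    rw [Polynomial.smul_eq_C_mul, mul_one]

/-- Conjugation by `T` on the matrices of the Chevalley basis. -/
lemma conj_lmat_basis (τ : Multiplicative X →* Kˣ) (s : b.support ⊕ ι) :
    R.mat (torusPt π τ) * R.lmat (S.basis s) * R.mat (torusPt π τ)⁻¹ =
      (chevChar b τ s : K) • R.lmat (S.basis s) := by
  have h1 : R.mat (torusPt π τ) * R.lmat (S.basis s) =
      ((chevChar b τ s : K) • R.lmat (S.basis s)) * R.mat (torusPt π τ) := by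
    rw [R.mat_torusPt]
    ext k j
    rw [Matrix.diagonal_mul, Matrix.mul_diagonal, Matrix.smul_apply, smul_eq_mul]
    rcases s with i | α
    · by_cases hkj : k = j
      · subst hkj
        simp [chevChar, mul_comm]
      · rw [R.lmat_basis_inl_of_ne i hkj]; simp
    · by_cases hkj : R.wt k = P.root α + R.wt j
      · rw [hkj, ofAdd_add, map_mul, Units.val_mul]
        simp only [chevChar, Sum.elim_inr]
        ring
      · rw [R.lmat_basis_inr_of_ne hkj]; simp
  rw [h1, mul_assoc, R.mat_mul_inv, mul_one]

lemma _root_.ChevalleySystem.torusPt_mem_iwahori (S : ChevalleySystem P b π)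
    (τ : Multiplicative X →* (RingInt p K)ˣ) :
    torusPt π ((Units.map (algebraMap (RingInt p K) K).toMonoidHom).comp τ) ∈ S.iwahori p := by
  refine Subgroup.subset_closure (Or.inl ⟨_, ⟨fun χ => ?_, fun h => absurd h (lt_irrefl 0)⟩, rfl⟩)
  rw [valK_eq_zero_iff]
  exact ⟨Units.ne_zero _, ordK_unit (τ χ)⟩

/-- The leading terms of conjugates by elements of `T(O)`. -/
lemma symv_conj (hp : coxeterNum b * ramDeg p K < p - 1) (hϖ : Irreducible ϖ) {n : ℕ}
    (hn : 1 ≤ n) {z : Pts K A K} (hz : z ∈ S.mp p n)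
    (τ : Multiplicative X →* (RingInt p K)ˣ) :
    R.symv ϖ n (torusPt π ((Units.map (algebraMap (RingInt p K) K).toMonoidHom).comp τ) * z *
        (torusPt π ((Units.map (algebraMap (RingInt p K) K).toMonoidHom).comp τ))⁻¹) =
      S.adkv (ResK p K) ((Units.map (IsLocalRing.residue (RingInt p K)).toMonoidHom).comp τ)
        (R.symv ϖ n z) := by
  obtain ⟨x, hx, hzx⟩ := R.exists_lie_of_mem_mp hp hn hz
  set σ : Multiplicative X →* Kˣ :=
    (Units.map (algebraMap (RingInt p K) K).toMonoidHom).comp τ with hσ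
  have hτ : ∀ s, (chevChar b σ s : K) = ((chevChar b τ s : RingInt p K) : K) := by
    rintro (i | i)
    · simp [chevChar]
    · rfl
  have hτ' : ∀ s, (chevChar b ((Units.map (IsLocalRing.residue (RingInt p K)).toMonoidHom).comp τ) s :
      ResK p K) = resK p (chevChar b σ s : K) := by
    intro s
    rw [hτ, resK_coe]
    rcases s with i | i
    · simp [chevChar]
    · rfl
  have hmem : ∀ s, (chevChar b σ s : K) ∈ ordFil p K 0 := fun s => by
    rw [hτ]; exact ringInt_mem_ordFil _
  have hsum : R.mat (torusPt π σ) * R.lmat x * R.mat (torusPt π σ)⁻¹ =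
      R.lmat (∑ s, ((chevChar b σ s : K) * S.basis.repr x s) • S.basis s) := by
    rw [R.lmat_eq_sum x, Finset.mul_sum, Finset.sum_mul, map_sum]
    refine Finset.sum_congr rfl fun s _ => ?_
    rw [Matrix.mul_smul, Matrix.smul_mul, R.conj_lmat_basis, smul_smul, map_smul, mul_comm]
  have hxs : ∀ s, ((chevChar b σ s : K) * S.basis.repr x s) • S.basis s ∈
      S.lieFil p (coxeterNum b) n :=
    fun s => S.smul_basis_mem_lieFil (ordFil_mul_left (hmem s) (hx s))
  rw [R.symv_eq hp hϖ hx hzx, R.symv_eq hp hϖ (sum_mem fun s _ => hxs s),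
    S.lead_sum hϖ _ _ fun s _ => hxs s, S.lead_eq_sum, map_sum]
  · refine Finset.sum_congr rfl fun s _ => ?_
    rw [S.lead_smul_basis', leadMon_mul hϖ (hmem s) (hx s), map_smul, adkv_loopBasis, smul_smul,
      hτ', mul_comm]
  · rw [← hsum]
    obtain ⟨h1, h2⟩ := R.mat_mem_of_mem_iwahori hp (S.torusPt_mem_iwahori (p := p) τ)
    have h3 := matFil_mul_of_eq (matFil_mul_of_eq h1 hzx (zero_add _).ge) h2 (add_zero _).ge
    convert h3 using 1
    rw [map_mul, map_mul, mul_sub, mul_sub, sub_mul, sub_mul, mul_one, R.mat_mul_inv]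

end ChevalleyRep

/-! ### The `k[ε]`-structure and the main theorem. -/

namespace ChevalleyRep

variable {p : ℕ} [Fact p.Prime] {K : Type*} [Field K] [CharZero K] [Algebra ℚ_[p] K]
  [FiniteDimensional ℚ_[p] K] [Algebra ℤ_[p] K] [IsScalarTower ℤ_[p] ℚ_[p] K]
  {A : Type*} [CommRing A] [HopfAlgebra K A]
  {X Y : Type*} [AddCommGroup X] [AddCommGroup Y]
  {ι : Type*} [Fintype ι] {P : RootPairing ι ℤ X Y} [P.IsReduced] {b : P.Base}
  {π : A →ₐc[K] AddMonoidAlgebra K X} {S : ChevalleySystem P b π}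
  {J : Type*} [Fintype J] [DecidableEq J] (R : ChevalleyRep p S J)

/-- Transport of a Lie algebra structure along an isomorphism of Lie rings, with a change of
scalars. -/
lemma _root_.exists_lieAlgebra_of_addEquiv {B L M : Type*} [CommRing B] [LieRing L] [LieRing M]
    [LieAlgebra B M] (θ : B →+* B) (f : L ≃+ M) (hf : ∀ x y, f ⁅x, y⁆ = ⁅f x, f y⁆) :
    ∃ _ : LieAlgebra B L, ∀ (q : B) (x : L), f (q • x) = θ q • f x := by
  refine ⟨{
    smul := fun q x => f.symm (θ q • f x)
    mul_smul := ?_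
    one_smul := ?_
    smul_zero := ?_
    smul_add := ?_
    add_smul := ?_
    zero_smul := ?_
    lie_smul := ?_ }, fun q x => f.apply_symm_apply _⟩
  · intro q r x
    change f.symm (θ (q * r) • f x) = f.symm (θ q • f (f.symm (θ r • f x)))
    rw [f.apply_symm_apply, map_mul, mul_smul]
  · intro x
    change f.symm (θ 1 • f x) = x
    rw [map_one, one_smul, f.symm_apply_apply]
  · intro q
    change f.symm (θ q • f 0) = 0
    rw [map_zero, smul_zero, map_zero]
  · intro q x y
    change f.symm (θ q • f (x + y)) = f.symm (θ q • f x) + f.symm (θ q • f y)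
    rw [map_add, smul_add, map_add]
  · intro q r x
    change f.symm (θ (q + r) • f x) = f.symm (θ q • f x) + f.symm (θ r • f x)
    rw [map_add, add_smul, map_add]
  · intro x
    change f.symm (θ 0 • f x) = 0
    rw [map_zero, zero_smul, map_zero]
  · intro q x y
    change ⁅x, f.symm (θ q • f y)⁆ = f.symm (θ q • f ⁅x, y⁆)
    rw [f.eq_symm_apply, hf, f.apply_symm_apply, lie_smul, hf]

variable [Module.Free ℤ X] [Module.Finite ℤ X] {ϖ : RingInt p K}

/-- The graded Lie ring of `I_1` is isomorphic to `𝔤̃`. -/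
noncomputable def grEquiv (hp : coxeterNum b * ramDeg p K < p - 1) (hϖ : Irreducible ϖ) :
    (R.filtration hp).Gr ≃+ S.gTilde (ResK p K) :=
  AddEquiv.ofBijective
    ((R.grHom hp hϖ).codRestrict (S.gTilde (ResK p K)).toSubmodule.toAddSubgroup
      fun a => (R.range_grHom hp hϖ _).2 ⟨a, rfl⟩)
    ⟨fun _ _ h => R.grHom_injective hp hϖ (congrArg Subtype.val h), fun v => by
      obtain ⟨a, ha⟩ := (R.range_grHom hp hϖ _).1 v.2
      exact ⟨a, Subtype.ext ha⟩⟩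

lemma grHom_symb_pow (hp : coxeterNum b * ramDeg p K < p - 1) (hϖ : Irreducible ϖ)
    {lam : RingInt p K} (hlam : (p : RingInt p K) = lam * ϖ ^ ramDeg p K) (z : S.proPIwahori p) :
    R.grHom hp hϖ ((R.filtration hp).symb (z ^ p)) =
      (Polynomial.C (IsLocalRing.residue (RingInt p K) lam) * Polynomial.X ^ ramDeg p K) •
        R.grHom hp hϖ ((R.filtration hp).symb z) := by
  by_cases hz : z = 1
  · rw [hz, one_pow, R.symb_one hp, map_zero, smul_zero]
  · obtain ⟨n, hn, hzn, hm⟩ := R.exists_omega_eq hp hz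
    have h1 : S.omega p (z ^ p) = (levelReal p K b (n + coxeterNum b * ramDeg p K) : ℝ) := by
      have h2 : S.omega p (z ^ p) = S.omega p z + 1 := (R.filtration_isPValuation hp z hz).2
      rw [h2, hzn, levelReal_add_one, WithTop.coe_add, WithTop.coe_one]
    rw [R.grHom_symb hp hϖ hn hzn, R.grHom_symb hp hϖ (by omega) h1,
      ← R.symv_pow_prime hp hϖ hlam hn ((hm n).2 le_rfl)]
    rfl

lemma grHom_symb_rootPt (hp : coxeterNum b * ramDeg p K < p - 1) (hϖ : Irreducible ϖ)
    (a : (RingInt p K)ˣ) {i : ι} {c : K} {z z' : S.proPIwahori p}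
    (hz : (z : Pts K A K) = S.rootPt i c)
    (hz' : (z' : Pts K A K) = S.rootPt i ((a : RingInt p K) * c)) :
    R.grHom hp hϖ ((R.filtration hp).symb z') =
      (Polynomial.C (IsLocalRing.residue (RingInt p K) a) : (ResK p K)[X]) •
        R.grHom hp hϖ ((R.filtration hp).symb z) := by
  by_cases hc : c = 0
  · rw [hc, S.rootPt_zero] at hz
    rw [hc, mul_zero, S.rootPt_zero] at hz'
    have e : z = 1 := Subtype.ext hz
    have e' : z' = 1 := Subtype.ext hz'
    rw [e, e', R.symb_one hp, map_zero, smul_zero]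
  have hz1 : (z : Pts K A K) ∈ S.mp p 1 := z.2
  rw [hz] at hz1
  have hlev := R.rootPt_level hp hc hz1
  -- Scaling by a unit preserves the valuation, so `u_α(c)` and `u_α(ac)` have the same level and
  -- their symbols can be compared in one graded piece.
  obtain ⟨n, hn⟩ := Int.eq_ofNat_of_zero_le
    (by omega : 0 ≤ coxeterNum b * ordK p c + b.height i)
  have hn1 : 1 ≤ n := by omega
  have hn' : (n : ℚ) = coxeterNum b * ordK p c + b.height i := by exact_mod_cast hn.symm
  have ha : ((a : RingInt p K) : K) ≠ 0 := fun h => a.ne_zero (Subtype.ext h)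
  have hac : ((a : RingInt p K) : K) * c ≠ 0 := mul_ne_zero ha hc
  have hord : ordK p (((a : RingInt p K) : K) * c) = ordK p c := by
    rw [ordK_mul p ha hc, ordK_unit, zero_add]
  have hh : (0 : ℚ) < coxeterNum b := by exact_mod_cast coxeterNum_pos (b := b)
  have hmem : c ∈ ordFil p K (((n : ℤ) - b.height i) / coxeterNum b) := by
    intro _
    rw [div_le_iff₀ hh, Int.cast_natCast, hn']
    linarith
  have hmem' := ordFil_mul_left (ringInt_mem_ordFil (a : RingInt p K)) hmem
  obtain ⟨h1, h2⟩ := R.rootPt_not_mem_mp hp hn1 hc hn.symm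
  obtain ⟨h1', h2'⟩ := R.rootPt_not_mem_mp (α := i) hp hn1 hac (by rw [hord]; exact hn.symm)
  rw [← hz] at h1 h2
  rw [← hz'] at h1' h2'
  have hn1' : (1 : ℤ) ≤ n := by exact_mod_cast hn1
  rw [R.grHom_symb hp hϖ hn1 (R.omega_eq_of_not_mem hp h1 h2),
    R.grHom_symb hp hϖ hn1 (R.omega_eq_of_not_mem hp h1' h2'), hz, hz',
    R.symv_rootPt hp hϖ hn1' hmem, R.symv_rootPt hp hϖ hn1' hmem',
    leadMon_mul (s := Sum.inr i) hϖ (ringInt_mem_ordFil _) hmem, resK_coe]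
  exact mul_smul _ _ _

lemma grHom_symb_corootPt (hp : coxeterNum b * ramDeg p K < p - 1) (hϖ : Irreducible ϖ)
    (a : (RingInt p K)ˣ) {i : ι} {c : RingInt p K} {w w' : Kˣ} {z z' : S.proPIwahori p}
    (hcm : c ∈ IsLocalRing.maximalIdeal (RingInt p K))
    (hw : (w : K) = 1 + c) (hw' : (w' : K) = 1 + (a : RingInt p K) * c)
    (hz : (z : Pts K A K) = torusPt π (cocharPt P (P.coroot i) w))
    (hz' : (z' : Pts K A K) = torusPt π (cocharPt P (P.coroot i) w')) :
    R.grHom hp hϖ ((R.filtration hp).symb z') =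
      (Polynomial.C (IsLocalRing.residue (RingInt p K) a) : (ResK p K)[X]) •
        R.grHom hp hϖ ((R.filtration hp).symb z) := by
  by_cases hc : (c : K) = 0
  · have h1 : cocharPt P (P.coroot i) (1 : Kˣ) = 1 := by ext; simp [cocharPt]
    rw [hc, add_zero] at hw
    rw [hc, mul_zero, add_zero] at hw'
    rw [Units.ext (hw.trans Units.val_one.symm), h1, torusPt_one] at hz
    rw [Units.ext (hw'.trans Units.val_one.symm), h1, torusPt_one] at hz'
    have e : z = 1 := Subtype.ext hz
    have e' : z' = 1 := Subtype.ext hz'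
    rw [e, e', R.symb_one hp, map_zero, smul_zero]
  have h0 : 1 ≤ ordK p (c : K) := by
    exact_mod_cast (mem_ordFil_of_ne hc).1 (mem_maximalIdeal_iff.1 hcm)
  obtain ⟨q, hq⟩ := Int.eq_ofNat_of_zero_le (by omega : 0 ≤ ordK p (c : K))
  have hq1 : 1 ≤ q := by omega
  have ha : ((a : RingInt p K) : K) ≠ 0 := fun h => a.ne_zero (Subtype.ext h)
  have hord : ordK p (((a : RingInt p K) : K) * c) = q := by
    rw [ordK_mul p ha hc, ordK_unit, zero_add, hq]
  have hcq : (c : K) ∈ ordFil p K q := fun _ => by rw [hq]; rfl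
  have hcq' := ordFil_mul_left (ringInt_mem_ordFil (a : RingInt p K)) hcq
  obtain ⟨h1, h3⟩ := R.symv_corootPt hp hϖ hq1 hw hcq (α := i)
  obtain ⟨h1', h3'⟩ := R.symv_corootPt hp hϖ hq1 hw' hcq' (α := i)
  have h2 := R.corootPt_not_mem_mp hp hq1 hw hc hq (α := i)
  have h2' := R.corootPt_not_mem_mp hp hq1 hw' (mul_ne_zero ha hc) hord (α := i)
  rw [← hz] at h1 h2 h3
  rw [← hz'] at h1' h2' h3'
  have hn1 : 1 ≤ coxeterNum b * q := Nat.mul_pos coxeterNum_pos hq1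
  have hh : (coxeterNum b : ℚ) ≠ 0 := by exact_mod_cast (coxeterNum_pos (b := b)).ne'
  have hH := R.smul_H_mem_lieFil hp (n := (coxeterNum b * q : ℕ)) (α := i) (c := (c : K))
    (by convert hcq using 1; push_cast; field_simp)
  rw [R.grHom_symb hp hϖ hn1 (R.omega_eq_of_not_mem hp h1 h2),
    R.grHom_symb hp hϖ hn1 (R.omega_eq_of_not_mem hp h1' h2'), h3, h3', ← smul_smul,
    S.lead_smul hϖ (ringInt_mem_ordFil _) hH, resK_coe]

lemma grHom_symb_conj (hp : coxeterNum b * ramDeg p K < p - 1) (hϖ : Irreducible ϖ)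
    (τ : Multiplicative X →* (RingInt p K)ˣ) {z z' : S.proPIwahori p}
    (hz' : (z' : Pts K A K) =
      torusPt π ((Units.map (algebraMap (RingInt p K) K).toMonoidHom).comp τ) * z *
      (torusPt π ((Units.map (algebraMap (RingInt p K) K).toMonoidHom).comp τ))⁻¹) :
    R.grHom hp hϖ ((R.filtration hp).symb z') =
      S.adkv (ResK p K) ((Units.map (IsLocalRing.residue (RingInt p K)).toMonoidHom).comp τ)
        (R.grHom hp hϖ ((R.filtration hp).symb z)) := by
  by_cases hz : z = 1
  · rw [hz, OneMemClass.coe_one, mul_one, mul_inv_cancel] at hz'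
    have e : z' = 1 := Subtype.ext hz'
    rw [hz, e, R.symb_one hp, map_zero, map_zero]
  · obtain ⟨n, hn, hzn, hm⟩ := R.exists_omega_eq hp hz
    obtain ⟨z'', h1, h2⟩ := R.filtration_conj hp (S.torusPt_mem_iwahori (p := p) τ) z
    have e : z' = z'' := Subtype.ext (hz'.trans h1.symm)
    rw [← e, hzn] at h2
    rw [R.grHom_symb hp hϖ hn hzn, R.grHom_symb hp hϖ hn h2, hz',
      R.symv_conj hp hϖ hn ((hm n).2 le_rfl)]

end ChevalleyRep

theorem mainTheorem3 {p : ℕ} [Fact p.Prime]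
    {K : Type u} [Field K] [CharZero K] [Algebra ℚ_[p] K] [FiniteDimensional ℚ_[p] K]
    [Algebra ℤ_[p] K] [IsScalarTower ℤ_[p] ℚ_[p] K]
    {A : Type u} [CommRing A] [HopfAlgebra K A] (hG : IsAlmostSimple K A)
    {X Y ι : Type*} [AddCommGroup X] [Module.Free ℤ X] [Module.Finite ℤ X] [AddCommGroup Y]
    [Fintype ι] (P : RootPairing ι ℤ X Y) [P.IsReduced] (b : P.Base)
    (hsc : Submodule.span ℤ (Set.range P.coroot) = ⊤)
    (π : A →ₐc[K] AddMonoidAlgebra K X) (S : ChevalleySystem P b π)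
    (hp : coxeterNum b * ramDeg p K < p - 1)
    (ϖ lam : RingInt p K) (hϖ : Irreducible ϖ)
    (hlam : (p : RingInt p K) = lam * ϖ ^ ramDeg p K) :
    (∀ z : S.proPIwahori p, z ≠ 1 →
      ∃ n : ℕ, IsGreatest {n : ℕ | (z : Pts K A K) ∈ S.mp p n} n) ∧
    ∃ F : PFiltration p (S.proPIwahori p),
      F.toFun = S.omega p ∧ F.IsPValuation ∧ F.IsSaturated ∧
      (∀ g ∈ S.iwahori p, ∀ z : S.proPIwahori p,
        ∃ z' : S.proPIwahori p, (z' : Pts K A K) = g * z * g⁻¹ ∧ F.toFun z' = F.toFun z) ∧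
      ∃ _ : LieAlgebra (ResK p K)[X] F.Gr,
        (∀ z, (Polynomial.X : (ResK p K)[X]) • F.symb z = F.symb (z ^ p)) ∧
        (∀ (a : (RingInt p K)ˣ) (i : ι) (c : K) (z z' : S.proPIwahori p),
          (z : Pts K A K) = S.rootPt i c → (z' : Pts K A K) = S.rootPt i ((a : RingInt p K) * c) →
          Polynomial.C (IsLocalRing.residue (RingInt p K) a) • F.symb z = F.symb z') ∧
        (∀ (a : (RingInt p K)ˣ) (i : ι) (c : RingInt p K) (w w' : Kˣ) (z z' : S.proPIwahori p),
          c ∈ IsLocalRing.maximalIdeal (RingInt p K) →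
          (w : K) = 1 + c → (w' : K) = 1 + (a : RingInt p K) * c →
          (z : Pts K A K) = torusPt π (cocharPt P (P.coroot i) w) →
          (z' : Pts K A K) = torusPt π (cocharPt P (P.coroot i) w') →
          Polynomial.C (IsLocalRing.residue (RingInt p K) a) • F.symb z = F.symb z') ∧
        ∃ f : F.Gr ≃+ S.gTilde (ResK p K),
          (∀ x y, f ⁅x, y⁆ = ⁅f x, f y⁆) ∧
          (∀ (q : (ResK p K)[X]) (x : F.Gr), f (q • x) =
            q.comp (Polynomial.C (IsLocalRing.residue (RingInt p K) lam) *
              Polynomial.X ^ ramDeg p K) • f x) ∧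
          (∀ (r : ℝ) (x : F.Gr), x ∈ F.grDeg r ↔
            (f x : (ResK p K)[X] ⊗[ResK p K] S.gk (ResK p K)) ∈
              S.loopDeg (ResK p K) (coxeterNum b) (ramDeg p K) r) ∧
          (∀ (τ : Multiplicative X →* (RingInt p K)ˣ) (z z' : S.proPIwahori p),
            (z' : Pts K A K) =
              torusPt π ((Units.map (algebraMap (RingInt p K) K).toMonoidHom).comp τ) * z *
              (torusPt π ((Units.map (algebraMap (RingInt p K) K).toMonoidHom).comp τ))⁻¹ →
            (f (F.symb z') : (ResK p K)[X] ⊗[ResK p K] S.gk (ResK p K)) =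
              S.adkv (ResK p K)
                ((Units.map (IsLocalRing.residue (RingInt p K)).toMonoidHom).comp τ)
                (f (F.symb z))) := by
  have := hG.finiteType
  obtain ⟨J, _, _, ⟨R⟩⟩ := S.exists_chevalleyRep (p := p) hsc
  refine ⟨fun z hz => R.exists_isGreatest hp hz, R.filtration hp, rfl,
    R.filtration_isPValuation hp, R.filtration_isSaturated hp,
    fun g hg z => R.filtration_conj hp hg z, ?_⟩
  -- Here the variable of `k[X]` on `gr` is `ε`, and on `𝔤̃` it is `v`; `θ` is the substitution `ε ↦
  -- λ v^e`.
  set θ : (ResK p K)[X] →+* (ResK p K)[X] := Polynomial.compRingHom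
    (Polynomial.C (IsLocalRing.residue (RingInt p K) lam) * Polynomial.X ^ ramDeg p K) with hθ
  have hlie : ∀ x y, R.grEquiv hp hϖ ⁅x, y⁆ = ⁅R.grEquiv hp hϖ x, R.grEquiv hp hϖ y⁆ :=
    fun x y => Subtype.ext (R.grHom_lie hp hϖ x y)
  obtain ⟨inst, hsmul⟩ := exists_lieAlgebra_of_addEquiv θ (R.grEquiv hp hϖ) hlie
  -- The structure on `gr` is defined by transport, so each prescribed formula for scalars reduces,
  -- by injectivity, to the corresponding identity of leading terms in `𝔤[v]`.
  have hsmul' : ∀ (q : (ResK p K)[X]) (x y : (R.filtration hp).Gr),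
      R.grHom hp hϖ y = θ q • R.grHom hp hϖ x → q • x = y := fun q x y h =>
    (R.grEquiv hp hϖ).injective ((hsmul q x).trans (Subtype.ext h.symm))
  refine ⟨inst, fun z => hsmul' _ _ _ ?_, fun a i c z z' hz hz' => hsmul' _ _ _ ?_,
    fun a i c w w' z z' hc hw hw' hz hz' => hsmul' _ _ _ ?_, R.grEquiv hp hϖ, hlie, hsmul,
    fun r x => R.mem_grDeg_iff hp hϖ r x, fun τ z z' h => R.grHom_symb_conj hp hϖ τ h⟩
  · rw [R.grHom_symb_pow hp hϖ hlam, hθ, Polynomial.coe_compRingHom_apply, Polynomial.X_comp]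
  · rw [R.grHom_symb_rootPt hp hϖ a hz hz', hθ, Polynomial.coe_compRingHom_apply,
      Polynomial.C_comp]
  · rw [R.grHom_symb_corootPt hp hϖ a hc hw hw' hz hz', hθ, Polynomial.coe_compRingHom_apply,
      Polynomial.C_comp]
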